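/- **Theorem (norm inflation with infinite loss of regularity).** Consider the Cauchy problem, with datum $\psi|_{t=0}=\varphi$, for one of the following equations: * (NLS) $\; i\partial_t\psi+\tfrac12\Delta\psi=\mu|\psi|^{2\nu}\psi$ on $\mathbf R^d$, where $d\ge 2$, $\nu\in\mathbf N$, $\nu\ge1$, $\mu\in\mathbf R$ and $\mu\neq0$; * (DS) $\; i\partial_t\psi+\tfrac12(\eta\,\partial_{x_1}^2+\partial_{x_2}^2)\psi=(\partial_{x_1}\chi+\mu|\psi|^2)\psi$, $\;(\partial_{x_1}^2+\partial_{x_2}^2)\chi=\lambda\,\partial_{x_1}|\psi|^2$ on $\mathbf R^2$, where $\eta\in\{1,-1\}$, $\lambda,\mu\in\mathbf R$, $\lambda+2\mu\neq0$, and $\chi$ is real valued with $\nabla\chi(t)\in L^2(\mathbf R^2)$, so that $\partial_{x_1}\chi=\lambda E(|\psi|^2)$ with $\widehat{Ef}(\xi)=\frac{\xi_1^2}{|\xi|^2}\widehat f(\xi)$; here $d=2$ and $\nu=1$; * (DGP) $\; i\partial_t\psi+\tfrac12\Delta\psi=\mu|\psi|^2\psi+\lambda(K*|\psi|^2)\psi$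 on $\mathbf R^3$, where $\lambda,\mu\in\mathbf R$, $(\lambda,\mu)\neq(0,0)$, $K(x)=\dfrac{1-3\cos^2\theta}{|x|^3}$ with $\cos\theta=n\cdot x/|x|$ for a fixed unit vector $n\in\mathbf R^3$, and the convolution with $K$ is understood as a principal value; here $d=3$ and $\nu=1$. Then there are Schwartz functions $\varphi_n\in\mathcal S(\mathbf R^d)$, $n\in\mathbf N$, with $$\|\varphi_n\|_{H^{-1/(2\nu)}(\mathbf R^d)}\to0\quad(n\to\infty),$$ and times $t_n>0$ with $t_n\to0$, such that for every $n$ the Cauchy problem with datum $\varphi_n$ has a unique smooth solution $\psi_n\in\bigcap_{s\in\mathbf R}C([0,t_n];H^s(\mathbf R^d))$ on $[0,t_n]$, and $$\|\psi_n(t_n)\|_{H^\sigma(\mathbf R^d)}\to+\infty\quad(n\to\infty)\qquad\text{for every }\sigma\in\mathbf R.$$ Here $\|f\|_{H^\sigma}^2=\int_{\mathbf R^d}(1+|\xi|^2)^{\sigma}|\widehat f(\xi)|^2\,d\xi$ with $\widehat f(\xi)=(2\pi)^{-d/2}\int_{\mathbf R^d} f(x)e^{-ix\cdot\xi}\,dx$.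 The sequences $(\varphi_n)$ and $(t_n)$ do not depend on $\sigma$. -/

import Mathlib

open MeasureTheory Filter Topology Set
open scoped ENNReal FourierTransform SchwartzMap Laplacian ContDiff RealInnerProductSpace

namespace NormInflation

/-- The space `ℝ^d` with its Euclidean norm. -/
abbrev Space (d : ℕ) : Type := EuclideanSpace ℝ (Fin d)

noncomputable section

/-- The norm of `H^σ(ℝ^d)`, `σ ∈ ℝ`, of a square integrable function `f`:
`‖f‖_{H^σ}² = ∫ (1 + |ξ|²)^σ |f̂(ξ)|² dξ` with `f̂` the (Plancherel) Fourier transform normalized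
as `(2π)^{-d/2} ∫ f(x) e^{-i x·ξ} dx`.  Mathlib's transform `𝓕` is normalized with
`e^{-2π i x·ζ}`; the change of variables `ξ = 2π ζ` turns the weight into `(1 + |2π ζ|²)^σ` and
leaves no other constant.  The value is `∞` if `f` is not square integrable (the right
convention for `σ ≥ 0`; all functions whose norm is taken in negative order below are square
integrable). -/
def sobolevNorm {d : ℕ} (σ : ℝ) (f : Space d → ℂ) : ℝ≥0∞ :=
  open Classical in
  if hf : MemLp f 2 (volume : Measure (Space d)) then
    (∫⁻ ζ : Space d,
      ENNReal.ofReal ((1 + (2 * Real.pi * ‖ζ‖) ^ 2) ^ σ) * ‖(𝓕 (hf.toLp f)) ζ‖ₑ ^ 2)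
        ^ (1 / 2 : ℝ)
  else ⊤

/-- The `i`-th partial derivative of a function on `ℝ^d`. -/
def partialDeriv {d : ℕ} {F : Type*} [NormedAddCommGroup F] [NormedSpace ℝ F]
    (i : Fin d) (f : Space d → F) (x : Space d) : F :=
  fderiv ℝ f x (EuclideanSpace.single i 1)

/-- `ψ` is a smooth (`H^∞`) solution on the time interval `[0, T]` of
`i ∂ₜψ + ½ L ψ = V ψ`, `ψ(0) = φ`: it belongs to `C([0, T]; H^s(ℝ^d))` for every `s`, each
`ψ(t)` is the smooth representative, and the equation holds at every point of `[0, T] × ℝ^d`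
(with one-sided time derivatives at the end points).  In the three models below the real
potential `V` is a function of `ψ`. -/
structure SolvesSchrodinger {d : ℕ} (L : (Space d → ℂ) → Space d → ℂ)
    (V : ℝ → Space d → ℝ) (T : ℝ) (φ : Space d → ℂ) (ψ : ℝ → Space d → ℂ) : Prop where
  smooth : ∀ t ∈ Icc 0 T, ContDiff ℝ ∞ (ψ t)
  mem_sobolev : ∀ s : ℝ, ∀ t ∈ Icc 0 T, sobolevNorm s (ψ t) < ⊤
  continuous_sobolev : ∀ s : ℝ, ∀ t ∈ Icc 0 T,
    Tendsto (fun τ => sobolevNorm s (ψ τ - ψ t)) (𝓝[Icc 0 T] t) (𝓝 0)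
  initial : ψ 0 = φ
  equation : ∀ t ∈ Icc 0 T, ∀ x,
    HasDerivWithinAt (fun τ => ψ τ x)
      (Complex.I * ((1 / 2) * L (ψ t) x - (V t x : ℂ) * ψ t x)) (Icc 0 T) t

/-- Solutions on `[0, T]` of `i ∂ₜψ + ½ Δψ = μ |ψ|^{2ν} ψ`, `ψ(0) = φ`, on `ℝ^d`. -/
def IsNLSSolution {d : ℕ} (ν : ℕ) (μ : ℝ) (T : ℝ) (φ : Space d → ℂ)
    (ψ : ℝ → Space d → ℂ) : Prop :=
  SolvesSchrodinger (fun f => Δ f) (fun t x => μ * ‖ψ t x‖ ^ (2 * ν)) T φ ψ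

/-- Solutions on `[0, T]` of the Davey-Stewartson system on `ℝ²`
`i ∂ₜψ + ½ (η ∂₁² + ∂₂²) ψ = (∂₁χ + μ |ψ|²) ψ`, `(∂₁² + ∂₂²) χ = λ ∂₁ |ψ|²`, `ψ(0) = φ`.
The mean field `χ` is real; the condition `∇χ(t) ∈ L²` selects the solution of the Poisson
equation for which `∂₁χ` is `λ` times the Fourier multiplier `ξ₁² / |ξ|²` applied to `|ψ|²`
(otherwise an arbitrary harmonic function could be added to `χ(t)`). -/
def IsDSSolution (η lam μ : ℝ) (T : ℝ) (φ : Space 2 → ℂ) (ψ : ℝ → Space 2 → ℂ) : Prop :=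
  ∃ χ : ℝ → Space 2 → ℝ,
    (∀ t ∈ Icc 0 T, ContDiff ℝ 2 (χ t)) ∧
    (∀ t ∈ Icc 0 T, ∀ i, MemLp (partialDeriv i (χ t)) 2 volume) ∧
    (∀ t ∈ Icc 0 T, ∀ x,
      partialDeriv 0 (partialDeriv 0 (χ t)) x + partialDeriv 1 (partialDeriv 1 (χ t)) x =
        lam * partialDeriv 0 (fun y => ‖ψ t y‖ ^ 2) x) ∧
    SolvesSchrodinger
      (fun f x => (η : ℂ) * partialDeriv 0 (partialDeriv 0 f) x +
        partialDeriv 1 (partialDeriv 1 f) x)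
      (fun t x => partialDeriv 0 (χ t) x + μ * ‖ψ t x‖ ^ 2) T φ ψ

/-- The dipolar kernel `K(x) = (1 - 3 cos² θ) / |x|³` on `ℝ³`, with `cos θ = n · x / |x|`. -/
def dipoleKernel (n x : Space 3) : ℝ := (1 - 3 * (⟪n, x⟫ / ‖x‖) ^ 2) / ‖x‖ ^ 3

/-- `W` is the convolution `K ∗ f` with the dipolar kernel, which is not locally integrable at
the origin and acts as a principal value. -/
def IsDipoleConvolution (n : Space 3) (f W : Space 3 → ℝ) : Prop :=
  ∀ x, Tendsto (fun r : ℝ => ∫ y in {y : Space 3 | r < ‖y‖}, dipoleKernel n y * f (x - y))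
    (𝓝[>] 0) (𝓝 (W x))

/-- Solutions on `[0, T]` of the dipolar Gross-Pitaevskii equation on `ℝ³`
`i ∂ₜψ + ½ Δψ = μ |ψ|² ψ + λ (K ∗ |ψ|²) ψ`, `ψ(0) = φ`, with dipole axis `n`. -/
def IsDGPSolution (n : Space 3) (lam μ : ℝ) (T : ℝ) (φ : Space 3 → ℂ)
    (ψ : ℝ → Space 3 → ℂ) : Prop :=
  ∃ W : ℝ → Space 3 → ℝ,
    (∀ t ∈ Icc 0 T, IsDipoleConvolution n (fun y => ‖ψ t y‖ ^ 2) (W t)) ∧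
    SolvesSchrodinger (fun f => Δ f) (fun t x => μ * ‖ψ t x‖ ^ 2 + lam * W t x) T φ ψ

/-- Norm inflation from `H^s(ℝ^d)` with infinite loss of regularity, for the Cauchy problem
whose solutions on `[0, T]` with initial datum `φ` are the `ψ` with `IsSol T φ ψ`: there are
Schwartz data `φ n → 0` in `H^s`, and times `t n → 0`, `t n > 0`, such that the solution `ψ n`
with datum `φ n` exists on `[0, t n]`, is unique there, and `‖ψ n (t n)‖_{H^σ} → ∞` for every
`σ ∈ ℝ`. -/
def HasNormInflation (d : ℕ) (s : ℝ)
    (IsSol : ℝ → (Space d → ℂ) → (ℝ → Space d → ℂ) → Prop) : Prop :=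
  ∃ (φ : ℕ → 𝓢(Space d, ℂ)) (t : ℕ → ℝ) (ψ : ℕ → ℝ → Space d → ℂ),
    Tendsto (fun n => sobolevNorm s (φ n)) atTop (𝓝 0) ∧
    (∀ n, 0 < t n) ∧ Tendsto t atTop (𝓝 0) ∧
    (∀ n, IsSol (t n) (φ n) (ψ n) ∧
      ∀ ψ', IsSol (t n) (φ n) ψ' → ∀ τ ∈ Icc 0 (t n), ψ' τ = ψ n τ) ∧
    ∀ σ : ℝ, Tendsto (fun n => sobolevNorm σ (ψ n (t n))) atTop (𝓝 ⊤)

end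

end NormInflation

/-!
All three equations have the form `i ∂ₜψ + ½ Lψ = (m(D)|ψ|²) |ψ|^{2j} ψ`, where `L` has a real
quadratic symbol and `m` is a bounded even symbol that is asymptotically constant along rays: the
constant `μ`, with `j = ν - 1`, for the nonlinear Schrödinger equation; `μ + λ ξ₁² / |ξ|²` for the
Davey-Stewartson system; and `μ + λ κ(ξ)` with `κ(ξ) = (4π/3)(3 (n·ξ)² / |ξ|² - 1)` for the dipolar
Gross-Pitaevskii equation (`j = 0` in the last two).

**Mechanism.** The Fourier transform of the datum consists of three bumps of height `A R^d` and
width `R⁻¹` at the frequencies `N e`, `N f` and `N (e + f)`, where `e` and `f` are orthonormal and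
the symbol of `L` is additive along them (`IsResonant`). The interaction `N e + N f - N (e + f) = 0`
has a stationary phase and creates the frequency zero, which the datum does not contain. On the time
scale `τ R / N` the free evolution merely rotates the phases of the three bumps, so that for
`A^{2j+2} = N / R` the solution acquires low frequencies of the size `A R^d`, that of the datum
itself (`exists_solution_lower_bound`).  The norm of the datum in `H^{-1/(2j+2)}` does not depend on
`N`; it is of the order `R^{(d - 1/(j+1))/2}`, which is small with `R` because `d ≥ 2`.  For fixed
`R` the low frequencies tend to infinity with `N`, and they bound every Sobolev norm from below
(`le_sobolevNorm`), whatever its order.  A diagonal choice of `R → 0` and `N → ∞` gives sequences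
independent of `σ` (`hasNormInflation_of_resonant`).  It remains that the resonant interactions do
not cancel.  This is plain for a constant `m`; for a cubic nonlinearity with `m` homogeneous of
degree zero it is the condition `m e + m f ≠ 0` (`hasNormInflation_cubic`), which amounts to
`λ + 2 μ ≠ 0` for the Davey-Stewartson system and holds for a suitable pair `e`, `f` for the dipolar
equation.

**Existence and uniqueness.** A weight `W` with `W ∗ W ≤ W` (`IsWeight`) makes the functions of
frequency that are bounded by multiples of `W` a Banach algebra under convolution, in which the
Duhamel equation is solved by contraction (`exists_fixed_profile`,
`solvesSchrodinger_of_profile`).  For weights concentrated near the lattice generated by `N e` and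
`N f` the constants are uniform in `N` and `R` (`exists_isWeight_combWeight`), so that the solution
lives for the time `τ R / N` and is described by its first Duhamel iterate.  An additional factor
`e^{-δ|ξ|}` in the weight makes the solutions smooth.  Uniqueness in the class of all smooth
solutions is proved by the energy method in `L²` (`SolvesSchrodinger.unique`).

**The nonlocal terms.** For the Davey-Stewartson system, `∂₁χ` is determined by `|ψ|²` because a
harmonic function on the plane with square integrable gradient has zero gradient
(`partialDeriv_eq_zero_of_harmonic`).  For the dipolar equation, the symbol of the principal value
convolution is computed by writing the kernel as a superposition of second derivatives of Gaussians,
for which the multiplier is explicit, and by comparing this regularization with the truncation near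
the origin: as the kernel has mean zero on spheres, all radial regularizations have the same limit
(`tendsto_integral_dipoleKernel`, `isDipoleConvolution_of_fastDecay`).
-/

open scoped Convolution BoundedContinuousFunction

namespace NormInflation

variable {d : ℕ}

/-! ### Plancherel's theorem for continuous representatives -/

theorem continuous_fourier {f : Space d → ℂ} (h1 : Integrable f) : Continuous (𝓕 f) := by
  rw [← Real.fourierTransform_toLp (memLp_one_iff_integrable.2 h1)]
  exact (Real.Lp.fourierTransform _).continuous

theorem continuous_fourierInv {f : Space d → ℂ} (h1 : Integrable f) : Continuous (𝓕⁻ f) := by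
  have : (𝓕⁻ f) = fun x => 𝓕 f (-x) := funext fun x => Real.fourierInv_eq_fourier_neg f x
  rw [this]
  exact (continuous_fourier h1).comp continuous_neg

/-- The Fourier transform on `L²`, defined by density, is given by the Fourier integral when the
latter converges: both define the same tempered distribution. -/
theorem fourier_toLp_ae {f : Space d → ℂ} (h1 : Integrable f) (h2 : MemLp f 2) :
    (𝓕 (h2.toLp f) : Lp ℂ 2 (volume : Measure (Space d))) =ᵐ[volume] 𝓕 f := by
  have hc : Continuous (𝓕 f) := continuous_fourier h1
  have hl : LocallyIntegrable (𝓕 f) (volume : Measure (Space d)) := hc.locallyIntegrable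
  generalize hF : (𝓕 (h2.toLp f) : Lp ℂ 2 (volume : Measure (Space d))) = F
  have hl' : LocallyIntegrable F (volume : Measure (Space d)) :=
    (Lp.memLp F).locallyIntegrable one_le_two
  suffices H : ∀ (g : Space d → ℝ), ContDiff ℝ ∞ g → HasCompactSupport g →
      ∫ x, g x • F x = ∫ x, g x • 𝓕 f x from
    ae_eq_of_integral_contDiff_smul_eq hl' hl H
  · intro g hg hgs
    have hgs' : HasCompactSupport (fun x => (g x : ℂ)) := hgs.comp_left
        (g := ((↑) : ℝ → ℂ)) Complex.ofReal_zero
    have hg' : ContDiff ℝ ∞ (fun x => (g x : ℂ)) := Complex.ofRealCLM.contDiff.comp hg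
    let θ : 𝓢(Space d, ℂ) := hgs'.toSchwartzMap hg'
    have key := congrArg (fun T => T θ) (Lp.fourier_toTemperedDistribution_eq (h2.toLp f))
    simp only [TemperedDistribution.fourier_apply, Lp.toTemperedDistribution_apply] at key
    have hθ : ∀ x, θ x = (g x : ℂ) := fun x => rfl
    rw [hF] at key
    have e1 : ∫ x, g x • F x = ∫ x, θ x • F x := by
      simp [hθ]
    rw [e1, ← key]
    have e2 : ∫ x, (𝓕 θ) x • (h2.toLp f) x = ∫ x, (𝓕 (θ : Space d → ℂ)) x • f x := by
      refine integral_congr_ae ?_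
      filter_upwards [h2.coeFn_toLp] with x hx
      rw [hx, SchwartzMap.fourier_coe]
    rw [e2]
    have := VectorFourier.integral_fourierIntegral_smul_eq_flip (f := (θ : Space d → ℂ)) (g := f)
      (μ := volume) (ν := volume) (L := innerₗ (Space d)) (e := Real.fourierChar)
      Real.continuous_fourierChar (by exact continuous_inner) θ.integrable h1
    rw [flip_innerₗ] at this
    simp only [smul_eq_mul, Complex.real_smul, hθ] at this ⊢
    exact this

theorem fourierInv_toLp_ae {f : Space d → ℂ} (h1 : Integrable f) (h2 : MemLp f 2) :
    (𝓕⁻ (h2.toLp f) : Lp ℂ 2 (volume : Measure (Space d))) =ᵐ[volume] 𝓕⁻ f := by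
  have hc : Continuous (𝓕⁻ f) := continuous_fourierInv h1
  have hl : LocallyIntegrable (𝓕⁻ f) (volume : Measure (Space d)) := hc.locallyIntegrable
  generalize hF : (𝓕⁻ (h2.toLp f) : Lp ℂ 2 (volume : Measure (Space d))) = F
  have hl' : LocallyIntegrable F (volume : Measure (Space d)) :=
    (Lp.memLp F).locallyIntegrable one_le_two
  suffices H : ∀ (g : Space d → ℝ), ContDiff ℝ ∞ g → HasCompactSupport g →
      ∫ x, g x • F x = ∫ x, g x • 𝓕⁻ f x from
    ae_eq_of_integral_contDiff_smul_eq hl' hl H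
  intro g hg hgs
  have hgs' : HasCompactSupport (fun x => (g x : ℂ)) :=
    hgs.comp_left (g := ((↑) : ℝ → ℂ)) Complex.ofReal_zero
  have hg' : ContDiff ℝ ∞ (fun x => (g x : ℂ)) := Complex.ofRealCLM.contDiff.comp hg
  let θ : 𝓢(Space d, ℂ) := hgs'.toSchwartzMap hg'
  have key := congrArg (fun T => T θ) (Lp.fourierInv_toTemperedDistribution_eq (h2.toLp f))
  simp only [TemperedDistribution.fourierInv_apply, Lp.toTemperedDistribution_apply] at key
  have hθ : ∀ x, θ x = (g x : ℂ) := fun x => rfl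
  rw [hF] at key
  have e1 : ∫ x, g x • F x = ∫ x, θ x • F x := by
    simp [hθ]
  rw [e1, ← key]
  have e2 : ∫ x, (𝓕⁻ θ) x • (h2.toLp f) x = ∫ x, (𝓕⁻ (θ : Space d → ℂ)) x • f x := by
    refine integral_congr_ae ?_
    filter_upwards [h2.coeFn_toLp] with x hx
    rw [hx, SchwartzMap.fourierInv_coe]
  rw [e2]
  have := VectorFourier.integral_fourierIntegral_smul_eq_flip (f := (θ : Space d → ℂ)) (g := f)
    (μ := volume) (ν := volume) (L := -innerₗ (Space d)) (e := Real.fourierChar)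
    Real.continuous_fourierChar (by exact continuous_inner.neg) θ.integrable h1
  have e3 : (-innerₗ (Space d)).flip = -innerₗ (Space d) := by
    ext x y; simp [real_inner_comm]
  rw [e3] at this
  simp only [smul_eq_mul, Complex.real_smul, hθ] at this ⊢
  exact this

theorem memLp_fourierInv {g : Space d → ℂ} (h1 : Integrable g) (h2 : MemLp g 2) :
    MemLp (𝓕⁻ g) 2 volume :=
  (memLp_congr_ae (fourierInv_toLp_ae h1 h2)).1 (Lp.memLp _)

theorem toLp_fourierInv {g : Space d → ℂ} (h1 : Integrable g) (h2 : MemLp g 2)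
    (h : MemLp (𝓕⁻ g) 2 volume) : h.toLp (𝓕⁻ g) = 𝓕⁻ (h2.toLp g) := by
  rw [← Lp.toLp_coeFn (𝓕⁻ (h2.toLp g)) (Lp.memLp _)]
  exact (MemLp.toLp_eq_toLp_iff _ _).2 (fourierInv_toLp_ae h1 h2).symm

/-- The Fourier transform of the (square integrable) function `𝓕⁻ g` is `g`. -/
theorem fourier_toLp_fourierInv {g : Space d → ℂ} (h1 : Integrable g) (h2 : MemLp g 2)
    (h : MemLp (𝓕⁻ g) 2 volume) :
    (𝓕 (h.toLp (𝓕⁻ g)) : Lp ℂ 2 (volume : Measure (Space d))) =ᵐ[volume] g := by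
  rw [toLp_fourierInv h1 h2 h, FourierTransform.fourier_fourierInv_eq]
  exact h2.coeFn_toLp

theorem sobolevNorm_of_memLp (σ : ℝ) {f : Space d → ℂ} (h : MemLp f 2 volume) {g : Space d → ℂ}
    (hg : (𝓕 (h.toLp f) : Lp ℂ 2 (volume : Measure (Space d))) =ᵐ[volume] g) :
    sobolevNorm σ f = (∫⁻ ζ : Space d,
      ENNReal.ofReal ((1 + (2 * Real.pi * ‖ζ‖) ^ 2) ^ σ) * ‖g ζ‖ₑ ^ 2) ^ (1 / 2 : ℝ) := by
  rw [sobolevNorm, dif_pos h]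
  congr 1
  refine lintegral_congr_ae ?_
  filter_upwards [hg] with x hx
  rw [hx]

theorem sobolevNorm_fourierInv (σ : ℝ) {g : Space d → ℂ} (h1 : Integrable g) (h2 : MemLp g 2) :
    sobolevNorm σ (𝓕⁻ g) = (∫⁻ ζ : Space d,
      ENNReal.ofReal ((1 + (2 * Real.pi * ‖ζ‖) ^ 2) ^ σ) * ‖g ζ‖ₑ ^ 2) ^ (1 / 2 : ℝ) :=
  sobolevNorm_of_memLp σ (memLp_fourierInv h1 h2) (fourier_toLp_fourierInv h1 h2 _)

/-- Plancherel's identity in the form of lower integrals. -/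
theorem lintegral_enorm_sq_fourierInv {g : Space d → ℂ} (h1 : Integrable g) (h2 : MemLp g 2) :
    ∫⁻ x, ‖𝓕⁻ g x‖ₑ ^ 2 = ∫⁻ ξ, ‖g ξ‖ₑ ^ 2 := by
  have h := memLp_fourierInv h1 h2
  have e : ‖h.toLp (𝓕⁻ g)‖ₑ = ‖h2.toLp g‖ₑ := by
    rw [toLp_fourierInv h1 h2 h]
    have := Lp.norm_fourier_eq (𝓕⁻ (h2.toLp g))
    rw [FourierTransform.fourier_fourierInv_eq] at this
    rw [enorm_eq_nnnorm, enorm_eq_nnnorm]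
    congr 1
    exact NNReal.eq this.symm
  have key : ∀ {f : Space d → ℂ} (hf : MemLp f 2 volume),
      ‖hf.toLp f‖ₑ ^ (2 : ℕ) = ∫⁻ x, ‖f x‖ₑ ^ 2 := by
    intro f hf
    rw [Lp.enorm_toLp, eLpNorm_eq_lintegral_rpow_enorm_toReal (by norm_num) (by norm_num)]
    rw [← ENNReal.rpow_natCast, ← ENNReal.rpow_mul]
    simp
  rw [← key h, ← key h2, e]

/-! ### Rapidly decreasing functions of the frequency -/

/-- `g` is rapidly decreasing in the mean square: all its polynomial moments are square integrable.
These are the Fourier transforms of the functions of class `H^∞`. -/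
structure FastDecay (g : Space d → ℂ) : Prop where
  aesm : AEStronglyMeasurable g volume
  memLp : ∀ k : ℕ, MemLp (fun ξ => (1 + ‖ξ‖) ^ k * ‖g ξ‖) 2 (volume : Measure (Space d))

theorem memLp_two_one_add_norm_inv :
    MemLp (fun ξ : Space d => ((1 + ‖ξ‖) ^ (d + 1))⁻¹) 2 (volume : Measure (Space d)) := by
  have hc : Continuous (fun ξ : Space d => ((1 + ‖ξ‖) ^ (d + 1))⁻¹) :=
    Continuous.inv₀ (by fun_prop) (fun ξ => by positivity)
  rw [memLp_two_iff_integrable_sq hc.aestronglyMeasurable]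
  have h := integrable_one_add_norm (E := Space d) (μ := volume) (r := (2 * (d + 1) : ℕ))
    (by simp; linarith)
  refine h.congr (Eventually.of_forall fun ξ => ?_)
  have : 0 ≤ 1 + ‖ξ‖ := by positivity
  simp only
  rw [Real.rpow_neg this, Real.rpow_natCast, inv_pow, ← pow_mul, mul_comm 2]

theorem integrable_one_add_norm_inv :
    Integrable (fun ξ : Space d => ((1 + ‖ξ‖) ^ (d + 1))⁻¹) (volume : Measure (Space d)) := by
  have h := integrable_one_add_norm (E := Space d) (μ := volume) (r := (d + 1 : ℕ))
    (by simp)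
  refine h.congr (Eventually.of_forall fun ξ => ?_)
  have : 0 ≤ 1 + ‖ξ‖ := by positivity
  simp only
  rw [Real.rpow_neg this, Real.rpow_natCast]

theorem aesm_weight_mul {g : Space d → ℂ} (h : AEStronglyMeasurable g volume) (k : ℕ) :
    AEStronglyMeasurable (fun ξ => (1 + ‖ξ‖) ^ k * ‖g ξ‖) (volume : Measure (Space d)) :=
  (Continuous.aestronglyMeasurable (by fun_prop)).mul h.norm

namespace FastDecay

variable {f g : Space d → ℂ}

theorem memLp_two (hg : FastDecay g) : MemLp g 2 volume := by
  have := hg.memLp 0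
  simp only [pow_zero, one_mul] at this
  exact (memLp_norm_iff hg.aesm).1 this

theorem integrable_weight (hg : FastDecay g) (k : ℕ) :
    Integrable (fun ξ => (1 + ‖ξ‖) ^ k * ‖g ξ‖) (volume : Measure (Space d)) := by
  have := (memLp_two_one_add_norm_inv (d := d)).integrable_mul (hg.memLp (k + (d + 1)))
  refine this.congr (Eventually.of_forall fun ξ => ?_)
  have : (1 + ‖ξ‖) ≠ 0 := by positivity
  simp only [Pi.mul_apply]
  rw [pow_add]
  field_simp
  ring

theorem integrable (hg : FastDecay g) : Integrable g volume := by
  have := hg.integrable_weight 0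
  simp only [pow_zero, one_mul] at this
  exact (integrable_norm_iff hg.aesm).1 this

theorem integrable_pow (hg : FastDecay g) (k : ℕ) :
    Integrable (fun ξ => ‖ξ‖ ^ k * ‖g ξ‖) (volume : Measure (Space d)) := by
  refine (hg.integrable_weight k).mono'
    ((Continuous.aestronglyMeasurable (by fun_prop)).mul hg.aesm.norm)
    (Eventually.of_forall fun ξ => ?_)
  rw [Real.norm_of_nonneg (by positivity)]
  gcongr
  linarith

theorem mono (hg : FastDecay g) (hf : AEStronglyMeasurable f volume) (C : ℝ) (n : ℕ)
    (h : ∀ᵐ ξ, ‖f ξ‖ ≤ C * ((1 + ‖ξ‖) ^ n * ‖g ξ‖)) : FastDecay f := by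
  refine ⟨hf, fun k => ?_⟩
  refine MemLp.of_le_mul (c := C) (hg.memLp (k + n)) (aesm_weight_mul hf k) ?_
  filter_upwards [h] with ξ hξ
  rw [Real.norm_of_nonneg (by positivity), Real.norm_of_nonneg (by positivity)]
  calc (1 + ‖ξ‖) ^ k * ‖f ξ‖ ≤ (1 + ‖ξ‖) ^ k * (C * ((1 + ‖ξ‖) ^ n * ‖g ξ‖)) := by gcongr
    _ = _ := by rw [pow_add]; ring

theorem of_bound (hf : AEStronglyMeasurable f volume)
    (h : ∀ k : ℕ, ∃ C : ℝ, ∀ ξ, (1 + ‖ξ‖) ^ k * ‖f ξ‖ ≤ C) : FastDecay f := by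
  refine ⟨hf, fun k => ?_⟩
  obtain ⟨C, hC⟩ := h (k + (d + 1))
  refine MemLp.of_le_mul (c := C) (memLp_two_one_add_norm_inv (d := d)) (aesm_weight_mul hf k)
    (Eventually.of_forall fun ξ => ?_)
  rw [Real.norm_of_nonneg (by positivity), Real.norm_of_nonneg (by positivity)]
  have := hC ξ
  rw [pow_add] at this
  rw [← div_eq_mul_inv, le_div_iff₀ (by positivity)]
  linarith

theorem congr (hg : FastDecay g) (h : f =ᵐ[volume] g) : FastDecay f := by
  refine hg.mono (hg.aesm.congr h.symm) 1 0 ?_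
  filter_upwards [h] with ξ hξ
  simp [hξ]

theorem mul_bdd (hg : FastDecay g) {m : Space d → ℂ} (hm : AEStronglyMeasurable m volume)
    {C : ℝ} {n : ℕ} (h : ∀ ξ, ‖m ξ‖ ≤ C * (1 + ‖ξ‖) ^ n) : FastDecay (fun ξ => m ξ * g ξ) := by
  refine hg.mono (hm.mul hg.aesm) C n (Eventually.of_forall fun ξ => ?_)
  rw [norm_mul, ← mul_assoc]
  gcongr
  exact h ξ

theorem add (hf : FastDecay f) (hg : FastDecay g) : FastDecay (fun ξ => f ξ + g ξ) := by
  refine ⟨hf.aesm.add hg.aesm, fun k => ?_⟩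
  refine MemLp.of_le ((hf.memLp k).add (hg.memLp k)) (aesm_weight_mul (hf.aesm.add hg.aesm) k)
    (Eventually.of_forall fun ξ => ?_)
  simp only [Pi.add_apply]
  rw [Real.norm_of_nonneg (by positivity), Real.norm_of_nonneg (by positivity), ← mul_add]
  gcongr
  exact norm_add_le _ _

theorem neg (hf : FastDecay f) : FastDecay (fun ξ => - f ξ) :=
  hf.mono hf.aesm.neg 1 0 (Eventually.of_forall fun ξ => by simp)

theorem sub (hf : FastDecay f) (hg : FastDecay g) : FastDecay (fun ξ => f ξ - g ξ) := by
  simpa only [sub_eq_add_neg] using hf.add hg.neg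

theorem comp_neg (hf : FastDecay f) : FastDecay (fun ξ => f (-ξ)) := by
  refine ⟨hf.aesm.comp_measurePreserving (Measure.measurePreserving_neg _), fun k => ?_⟩
  have := (hf.memLp k).comp_measurePreserving (Measure.measurePreserving_neg volume)
  simpa [Function.comp_def] using this

theorem star (hf : FastDecay f) : FastDecay (fun ξ => starRingEnd ℂ (f ξ)) :=
  hf.mono (Complex.continuous_conj.comp_aestronglyMeasurable hf.aesm) 1 0
    (Eventually.of_forall fun ξ => by simp)

end FastDecay

/-- The Fourier transform of the complex conjugate of `𝓕⁻ g`. -/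
def conjReflect (g : Space d → ℂ) (ξ : Space d) : ℂ := starRingEnd ℂ (g (-ξ))

theorem FastDecay.conjReflect {g : Space d → ℂ} (hg : FastDecay g) :
    FastDecay (conjReflect g) := hg.comp_neg.star

theorem fourierInv_conjReflect (g : Space d → ℂ) (x : Space d) :
    𝓕⁻ (conjReflect g) x = starRingEnd ℂ (𝓕⁻ g x) := by
  rw [Real.fourierInv_eq', Real.fourierInv_eq', ← integral_conj,
    ← integral_neg_eq_self (fun v : Space d => starRingEnd ℂ _)]
  refine integral_congr_ae (Eventually.of_forall fun v => ?_)
  simp [conjReflect, ← Complex.exp_conj, Complex.conj_ofNat]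

theorem one_add_norm_pow_le (k : ℕ) (ξ η : Space d) :
    (1 + ‖ξ‖) ^ k ≤ (1 + ‖η‖) ^ k * (1 + ‖ξ - η‖) ^ k := by
  rw [← mul_pow]
  have : ‖ξ‖ ≤ ‖η‖ + ‖ξ - η‖ := by simpa using norm_add_le η (ξ - η)
  have h2 : 0 ≤ ‖η‖ * ‖ξ - η‖ := by positivity
  gcongr
  nlinarith

theorem integral_mul_le_of_memLp_two {f g : Space d → ℝ} (hf : MemLp f 2 volume)
    (hg : MemLp g 2 volume) :
    ∫ η, |f η| * |g η| ≤ (∫ η, f η ^ 2) ^ (1 / 2 : ℝ) * (∫ η, g η ^ 2) ^ (1 / 2 : ℝ) := by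
  have := integral_mul_norm_le_Lp_mul_Lq (p := 2) (q := 2) (f := f) (g := g) (μ := volume)
    Real.HolderConjugate.two_two (by simpa using hf) (by simpa using hg)
  simpa using this

/-- The polynomial weights are submultiplicative, so the Cauchy-Schwarz inequality bounds the
convolution pointwise with any weight. -/
theorem FastDecay.conv {f g : Space d → ℂ} (hf : FastDecay f) (hg : FastDecay g) :
    FastDecay (f ⋆[ContinuousLinearMap.mul ℂ ℂ] g) := by
  refine FastDecay.of_bound (hf.integrable.integrable_convolution _ hg.integrable).1 fun k => ?_
  refine ⟨(∫ η, ((1 + ‖η‖) ^ k * ‖f η‖) ^ 2) ^ (1 / 2 : ℝ) *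
    (∫ η, ((1 + ‖η‖) ^ k * ‖g η‖) ^ 2) ^ (1 / 2 : ℝ), fun ξ => ?_⟩
  have hg' : MemLp (fun η => (1 + ‖ξ - η‖) ^ k * ‖g (ξ - η)‖) 2 (volume : Measure (Space d)) :=
    (hg.memLp k).comp_measurePreserving (Measure.measurePreserving_sub_left volume ξ)
  have h1 := integral_mul_le_of_memLp_two (hf.memLp k) hg'
  rw [integral_sub_left_eq_self (fun η => ((1 + ‖η‖) ^ k * ‖g η‖) ^ 2) volume ξ] at h1
  refine le_trans ?_ h1
  rw [convolution_def]
  calc (1 + ‖ξ‖) ^ k * ‖∫ t, (ContinuousLinearMap.mul ℂ ℂ) (f t) (g (ξ - t))‖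
      ≤ (1 + ‖ξ‖) ^ k * ∫ t, ‖f t‖ * ‖g (ξ - t)‖ := by
        gcongr
        refine (norm_integral_le_integral_norm _).trans (le_of_eq ?_)
        simp
    _ = ∫ t, (1 + ‖ξ‖) ^ k * (‖f t‖ * ‖g (ξ - t)‖) := by rw [integral_const_mul]
    _ ≤ _ := by
        refine integral_mono_of_nonneg (Eventually.of_forall fun t => by positivity)
          ((hf.memLp k).abs.integrable_mul hg'.abs) (Eventually.of_forall fun t => ?_)
        simp only [abs_mul, abs_pow, abs_norm]
        rw [abs_of_nonneg (by positivity : 0 ≤ 1 + ‖t‖),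
          abs_of_nonneg (by positivity : 0 ≤ 1 + ‖ξ - t‖)]
        have := one_add_norm_pow_le k ξ t
        calc (1 + ‖ξ‖) ^ k * (‖f t‖ * ‖g (ξ - t)‖)
            ≤ ((1 + ‖t‖) ^ k * (1 + ‖ξ - t‖) ^ k) * (‖f t‖ * ‖g (ξ - t)‖) := by gcongr
          _ = _ := by ring

theorem fourierInv_conv {f g : Space d → ℂ} (hf : Integrable f) (hg : Integrable g)
    (x : Space d) :
    𝓕⁻ (f ⋆[ContinuousLinearMap.mul ℂ ℂ] g) x = 𝓕⁻ f x * 𝓕⁻ g x := by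
  rw [Real.fourierInv_eq_fourier_neg, Real.fourierInv_eq_fourier_neg,
    Real.fourierInv_eq_fourier_neg, Real.fourier_mul_convolution_eq hf hg]

/-! ### Derivatives and Sobolev norms of inverse Fourier transforms -/

theorem fourierInv_add_apply {f g : Space d → ℂ} (hf : Integrable f) (hg : Integrable g)
    (x : Space d) : 𝓕⁻ (fun ξ => f ξ + g ξ) x = 𝓕⁻ f x + 𝓕⁻ g x := by
  simp only [Real.fourierInv_eq_fourier_neg, Real.fourier_eq, smul_add]
  exact integral_add ((Real.fourierIntegral_convergent_iff _).2 hf)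
    ((Real.fourierIntegral_convergent_iff _).2 hg)

theorem fourierInv_sub_apply {f g : Space d → ℂ} (hf : Integrable f) (hg : Integrable g)
    (x : Space d) : 𝓕⁻ (fun ξ => f ξ - g ξ) x = 𝓕⁻ f x - 𝓕⁻ g x := by
  simp only [Real.fourierInv_eq_fourier_neg, Real.fourier_eq, smul_sub]
  exact integral_sub ((Real.fourierIntegral_convergent_iff _).2 hf)
    ((Real.fourierIntegral_convergent_iff _).2 hg)

theorem fourierInv_const_mul_apply (c : ℂ) (f : Space d → ℂ) (x : Space d) :
    𝓕⁻ (fun ξ => c * f ξ) x = c * 𝓕⁻ f x := by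
  simp only [Real.fourierInv_eq', smul_eq_mul]
  rw [← integral_const_mul]
  congr 1; ext v; ring

theorem norm_fourierInv_le (f : Space d → ℂ) (x : Space d) : ‖𝓕⁻ f x‖ ≤ ∫ ξ, ‖f ξ‖ := by
  rw [Real.fourierInv_eq']
  refine (norm_integral_le_integral_norm _).trans (le_of_eq ?_)
  congr 1; ext v
  rw [norm_smul, Complex.norm_exp_ofReal_mul_I, one_mul]

theorem contDiff_fourierInv {g : Space d → ℂ} (hg : FastDecay g) : ContDiff ℝ ∞ (𝓕⁻ g) := by
  have h : ContDiff ℝ ∞ (𝓕 g) := Real.contDiff_fourier (N := ⊤) fun n _ => hg.integrable_pow n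
  have : (𝓕⁻ g) = fun x => 𝓕 g (-x) := funext fun x => Real.fourierInv_eq_fourier_neg g x
  rw [this]
  exact h.comp contDiff_neg

theorem norm_apply_le (ξ : Space d) (i : Fin d) : |ξ i| ≤ ‖ξ‖ := by
  simpa using PiLp.norm_apply_le ξ i

theorem inner_single_right (ξ : Space d) (i : Fin d) :
    ⟪ξ, EuclideanSpace.single i (1 : ℝ)⟫ = ξ i := by
  simp [EuclideanSpace.inner_single_right]

theorem partialDeriv_fourierInv {g : Space d → ℂ} (h1 : Integrable g)
    (h2 : Integrable (fun ξ => ‖ξ‖ * ‖g ξ‖)) (i : Fin d) (x : Space d) :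
    partialDeriv i (𝓕⁻ g) x = 𝓕⁻ (fun ξ => (2 * Real.pi * ξ i * Complex.I) * g ξ) x := by
  have hd := Real.hasFDerivAt_fourier h1 h2 (-x)
  have : (𝓕⁻ g) = fun x => 𝓕 g (-x) := funext fun x => Real.fourierInv_eq_fourier_neg g x
  have h3 : HasFDerivAt (fun x => 𝓕 g (-x))
    ((𝓕 (VectorFourier.fourierSMulRight (innerSL ℝ) g) (-x)).comp
      (-(ContinuousLinearMap.id ℝ (Space d)))) x :=
    HasFDerivAt.comp x hd (hasFDerivAt_id x).neg
  rw [partialDeriv, this, h3.fderiv]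
  have h4 : Integrable (VectorFourier.fourierSMulRight (innerSL ℝ) g) volume := by
    refine (h2.const_mul (2 * Real.pi * ‖innerSL ℝ (E := Space d)‖)).mono'
      h1.aestronglyMeasurable.fourierSMulRight (Eventually.of_forall fun ξ => ?_)
    refine (VectorFourier.norm_fourierSMulRight_le _ _ _).trans (le_of_eq ?_)
    ring
  simp only [ContinuousLinearMap.comp_apply, _root_.neg_apply,
    ContinuousLinearMap.id_apply, map_neg]
  rw [Real.fourier_continuousLinearMap_apply h4, Real.fourierInv_eq_fourier_neg,
    Real.fourier_eq, Real.fourier_eq, ← integral_neg]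
  refine integral_congr_ae (Eventually.of_forall fun ξ => ?_)
  have hi : (innerSL ℝ ξ) (EuclideanSpace.single i 1) = ξ i := inner_single_right ξ i
  beta_reduce
  rw [VectorFourier.fourierSMulRight_apply, hi, ← smul_neg]
  congr 1
  rw [Complex.real_smul, smul_eq_mul]
  ring

theorem FastDecay.mul_coord {g : Space d → ℂ} (hg : FastDecay g) (c : ℂ) (i : Fin d) :
    FastDecay (fun ξ => (c * ξ i) * g ξ) := by
  refine hg.mul_bdd (C := ‖c‖) (n := 1) (Continuous.aestronglyMeasurable (by fun_prop)) fun ξ => ?_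
  rw [norm_mul, Complex.norm_real, Real.norm_eq_abs]
  gcongr
  have := norm_apply_le ξ i
  rw [pow_one]; linarith

theorem FastDecay.partialDeriv_fourierInv {g : Space d → ℂ} (hg : FastDecay g) (i : Fin d) :
    partialDeriv i (𝓕⁻ g) = 𝓕⁻ (fun ξ => ((2 * Real.pi * Complex.I) * ξ i) * g ξ) := by
  funext x
  rw [NormInflation.partialDeriv_fourierInv hg.integrable (by simpa using hg.integrable_pow 1)]
  refine congrArg (fun h : Space d → ℂ => 𝓕⁻ h x) (funext fun ξ => ?_)
  ring

theorem FastDecay.partialDeriv_partialDeriv_fourierInv {g : Space d → ℂ} (hg : FastDecay g)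
    (i : Fin d) :
    partialDeriv i (partialDeriv i (𝓕⁻ g)) =
      𝓕⁻ (fun ξ => (-(4 * Real.pi ^ 2 * (ξ i) ^ 2 : ℝ) : ℂ) * g ξ) := by
  rw [hg.partialDeriv_fourierInv, (hg.mul_coord _ i).partialDeriv_fourierInv]
  congr 1; funext ξ
  push_cast
  linear_combination (4 * Real.pi ^ 2 * (ξ i : ℂ) ^ 2 * g ξ) * Complex.I_sq

theorem laplacian_eq_sum_partialDeriv {f : Space d → ℂ} (hf : ContDiff ℝ 2 f) (x : Space d) :
    (Δ f) x = ∑ i, partialDeriv i (partialDeriv i f) x := by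
  rw [InnerProductSpace.laplacian_eq_iteratedFDeriv_orthonormalBasis f
    (EuclideanSpace.basisFun (Fin d) ℝ)]
  refine Finset.sum_congr rfl fun i _ => ?_
  rw [iteratedFDeriv_two_apply]
  have hd : DifferentiableAt ℝ (fderiv ℝ f) x :=
    ((hf.fderiv_right (m := 1) (by norm_num)).differentiable (by norm_num)) x
  have : partialDeriv i (partialDeriv i f) x =
      fderiv ℝ (fun y => fderiv ℝ f y (EuclideanSpace.single i 1)) x
        (EuclideanSpace.single i 1) := rfl
  rw [this, fderiv_clm_apply hd (differentiableAt_const _)]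
  simp

theorem fourierInv_finset_sum {ι : Type*} (s : Finset ι) {g : ι → Space d → ℂ}
    (hg : ∀ i ∈ s, Integrable (g i)) (x : Space d) :
    𝓕⁻ (fun ξ => ∑ i ∈ s, g i ξ) x = ∑ i ∈ s, 𝓕⁻ (g i) x := by
  simp only [Real.fourierInv_eq_fourier_neg, Real.fourier_eq, Finset.smul_sum]
  exact integral_finsetSum _ fun i hi => (Real.fourierIntegral_convergent_iff _).2 (hg i hi)

theorem FastDecay.mul_coord_sq {g : Space d → ℂ} (hg : FastDecay g) (c : ℝ) (i : Fin d) :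
    FastDecay (fun ξ => (-(c * (ξ i) ^ 2 : ℝ) : ℂ) * g ξ) := by
  have := (hg.mul_coord (-c) i).mul_coord 1 i
  refine this.congr (Eventually.of_forall fun ξ => ?_)
  simp only; push_cast; ring

theorem FastDecay.laplacian_fourierInv {g : Space d → ℂ} (hg : FastDecay g) :
    Δ (𝓕⁻ g) = 𝓕⁻ (fun ξ => (-(4 * Real.pi ^ 2 * ‖ξ‖ ^ 2 : ℝ) : ℂ) * g ξ) := by
  funext x
  rw [laplacian_eq_sum_partialDeriv ((contDiff_fourierInv hg).of_le (by norm_cast))]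
  simp only [hg.partialDeriv_partialDeriv_fourierInv]
  rw [← fourierInv_finset_sum]
  · refine congrArg (fun h : Space d → ℂ => 𝓕⁻ h x) (funext fun ξ => ?_)
    rw [← Finset.sum_mul, EuclideanSpace.norm_sq_eq]
    congr 1
    simp [Finset.mul_sum]
  · intro i _
    exact (hg.mul_coord_sq _ i).integrable

theorem one_add_sq_le_sobolev (ξ : Space d) (k : ℕ) :
    ((1 + ‖ξ‖) ^ k) ^ 2 ≤ 2 ^ k * (1 + (2 * Real.pi * ‖ξ‖) ^ 2) ^ (k : ℝ) := by
  rw [Real.rpow_natCast, ← mul_pow, ← pow_mul, mul_comm k 2, pow_mul]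
  have hpi : 1 ≤ 2 * Real.pi := by linarith [Real.pi_gt_three]
  have : ‖ξ‖ ^ 2 ≤ (2 * Real.pi * ‖ξ‖) ^ 2 := by
    rw [mul_pow]
    exact le_mul_of_one_le_left (sq_nonneg _) (one_le_pow₀ hpi)
  gcongr
  nlinarith [sq_nonneg (1 - ‖ξ‖)]

/-- Weighted square integrals of the frequency function are controlled by the Sobolev norms. -/
theorem lintegral_weight_sq_le (k : ℕ) (g : Space d → ℂ) :
    ∫⁻ ξ, ‖(1 + ‖ξ‖) ^ k * ‖g ξ‖‖ₑ ^ 2 ≤ 2 ^ k * ∫⁻ ζ : Space d,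
      ENNReal.ofReal ((1 + (2 * Real.pi * ‖ζ‖) ^ 2) ^ (k : ℝ)) * ‖g ζ‖ₑ ^ 2 := by
  rw [← lintegral_const_mul' _ _ (by simp)]
  refine lintegral_mono fun ξ => ?_
  have h := one_add_sq_le_sobolev ξ k
  rw [← ofReal_norm, ← ofReal_norm, ← ENNReal.ofReal_pow (by positivity),
    ← ENNReal.ofReal_pow (by positivity), ← ENNReal.ofReal_mul (by positivity),
    show (2 : ℝ≥0∞) ^ k = ENNReal.ofReal (2 ^ k) by
      rw [ENNReal.ofReal_pow (by norm_num)]; norm_num,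
    ← ENNReal.ofReal_mul (by positivity)]
  refine ENNReal.ofReal_le_ofReal ?_
  rw [Real.norm_of_nonneg (by positivity), mul_pow, ← mul_assoc]
  gcongr

theorem memLp_of_sobolevNorm_lt_top {σ : ℝ} {f : Space d → ℂ} (h : sobolevNorm σ f < ⊤) :
    MemLp f 2 volume := by
  by_contra hf
  rw [sobolevNorm, dif_neg hf] at h
  exact lt_irrefl _ h

/-- A continuous function of class `H^∞` is the inverse Fourier transform of a rapidly decreasing
function. -/
theorem exists_fourierInv_of_sobolevNorm {f : Space d → ℂ} (hc : Continuous f)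
    (h : ∀ s : ℝ, sobolevNorm s f < ⊤) :
    ∃ g, FastDecay g ∧ f = 𝓕⁻ g := by
  have hf := memLp_of_sobolevNorm_lt_top (h 0)
  generalize hG : (𝓕 (hf.toLp f) : Lp ℂ 2 (volume : Measure (Space d))) = G
  have hfd : FastDecay (G : Space d → ℂ) := by
    refine ⟨(Lp.memLp G).1, fun k => ?_⟩
    refine ⟨aesm_weight_mul (Lp.memLp G).1 k, ?_⟩
    rw [eLpNorm_lt_top_iff_lintegral_rpow_enorm_lt_top (by norm_num) (by norm_num)]
    have h1 := h k
    rw [sobolevNorm_of_memLp (k : ℝ) hf (g := G) (by rw [hG])] at h1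
    have h2 := (ENNReal.rpow_lt_top_iff_of_pos (by norm_num : (0 : ℝ) < 1 / 2)).1 h1
    have h3 := lintegral_weight_sq_le k (G : Space d → ℂ)
    have h4 : ((2 : ℝ≥0∞) ^ k) ≠ ⊤ := by simp
    refine lt_of_le_of_lt ?_ (ENNReal.mul_lt_top h4.lt_top h2)
    refine le_trans (le_of_eq ?_) h3
    simp
  refine ⟨G, hfd, ?_⟩
  have h1 := fourierInv_toLp_ae hfd.integrable (Lp.memLp G)
  rw [Lp.toLp_coeFn, ← hG, FourierTransform.fourierInv_fourier_eq] at h1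
  have h2 : f =ᵐ[volume] 𝓕⁻ (G : Space d → ℂ) := by
    rw [← hG]
    exact hf.coeFn_toLp.symm.trans h1
  exact (hc.ae_eq_iff_eq _ (continuous_fourierInv hfd.integrable)).1 h2

/-- Weighted `L¹` norms of the frequency function are controlled by Sobolev norms of a higher order,
by the Cauchy-Schwarz inequality. -/
theorem exists_lintegral_weight_le (d k : ℕ) : ∃ C : ℝ≥0∞, C ≠ ⊤ ∧ ∀ g : Space d → ℂ,
    FastDecay g → ∫⁻ ξ, ‖(1 + ‖ξ‖) ^ k * ‖g ξ‖‖ₑ ≤ C * sobolevNorm (k + (d + 1) : ℕ) (𝓕⁻ g) := by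
  have h0 := memLp_two_one_add_norm_inv (d := d)
  refine ⟨(∫⁻ ξ : Space d, ‖((1 + ‖ξ‖) ^ (d + 1))⁻¹‖ₑ ^ (2 : ℝ)) ^ (1 / 2 : ℝ) *
    (2 ^ (k + (d + 1))) ^ (1 / 2 : ℝ), ?_, fun g hg => ?_⟩
  · refine ENNReal.mul_ne_top ?_ (by simp)
    have := h0.2
    rw [eLpNorm_lt_top_iff_lintegral_rpow_enorm_lt_top (by norm_num) (by norm_num)] at this
    exact ENNReal.rpow_ne_top_of_nonneg (by norm_num) (by simpa using this.ne)
  · rw [sobolevNorm_fourierInv _ hg.integrable hg.memLp_two, mul_assoc,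
      ← ENNReal.mul_rpow_of_nonneg _ _
      (by norm_num)]
    calc ∫⁻ ξ, ‖(1 + ‖ξ‖) ^ k * ‖g ξ‖‖ₑ
        = ∫⁻ ξ, ((fun ξ : Space d => ‖((1 + ‖ξ‖) ^ (d + 1))⁻¹‖ₑ) *
            (fun ξ => ‖(1 + ‖ξ‖) ^ (k + (d + 1)) * ‖g ξ‖‖ₑ)) ξ := by
          refine lintegral_congr fun ξ => ?_
          have : (1 + ‖ξ‖) ≠ 0 := by positivity
          rw [Pi.mul_apply, ← enorm_mul, pow_add]
          congr 1
          field_simp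
          ring
      _ ≤ _ := ENNReal.lintegral_mul_le_Lp_mul_Lq volume Real.HolderConjugate.two_two
            h0.1.enorm (aesm_weight_mul hg.aesm _).enorm
      _ ≤ _ := by
          gcongr
          refine le_trans (le_of_eq ?_) (lintegral_weight_sq_le (k + (d + 1)) g)
          simp

/-! ### The nonlinearity on the Fourier side -/

/-- Convolution of complex functions. -/
noncomputable def cconv (f g : Space d → ℂ) : Space d → ℂ := f ⋆[ContinuousLinearMap.mul ℂ ℂ] g

theorem cconv_apply (f g : Space d → ℂ) (ξ : Space d) :
    cconv f g ξ = ∫ η, f η * g (ξ - η) := by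
  simp [cconv, convolution_def]

theorem FastDecay.cconv {f g : Space d → ℂ} (hf : FastDecay f) (hg : FastDecay g) :
    FastDecay (cconv f g) := hf.conv hg

theorem FastDecay.fourierInv_cconv {f g : Space d → ℂ} (hf : FastDecay f) (hg : FastDecay g)
    (x : Space d) : 𝓕⁻ (NormInflation.cconv f g) x = 𝓕⁻ f x * 𝓕⁻ g x :=
  fourierInv_conv hf.integrable hg.integrable x

/-- The Fourier transform of `|𝓕⁻ g|²`. -/
noncomputable def autoConv (g : Space d → ℂ) : Space d → ℂ := cconv g (conjReflect g)

theorem FastDecay.autoConv {g : Space d → ℂ} (hg : FastDecay g) : FastDecay (autoConv g) :=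
  hg.cconv hg.conjReflect

theorem FastDecay.fourierInv_autoConv {g : Space d → ℂ} (hg : FastDecay g) (x : Space d) :
    𝓕⁻ (NormInflation.autoConv g) x = ((‖𝓕⁻ g x‖ ^ 2 : ℝ) : ℂ) := by
  rw [NormInflation.autoConv, hg.fourierInv_cconv hg.conjReflect, fourierInv_conjReflect,
    Complex.mul_conj']
  push_cast; rfl

/-- As `|𝓕⁻ g|²` is real, its Fourier transform is Hermitian symmetric. -/
theorem conjReflect_autoConv (g : Space d → ℂ) : conjReflect (autoConv g) = autoConv g := by
  funext ξ
  rw [conjReflect, autoConv, cconv_apply, cconv_apply, ← integral_conj]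
  rw [← integral_add_right_eq_self _ (-ξ)]
  refine integral_congr_ae (Eventually.of_forall fun η => ?_)
  simp only [conjReflect, map_mul, Complex.conj_conj]
  rw [mul_comm]
  congr 2 <;> abel_nf

/-- The Fourier transform of `|𝓕⁻ g|^{2j} 𝓕⁻ g`. -/
noncomputable def oddPower (j : ℕ) (g : Space d → ℂ) : Space d → ℂ :=
  (cconv (autoConv g))^[j] g

theorem oddPower_zero (g : Space d → ℂ) : oddPower 0 g = g := rfl

/-- The recursion `|ψ|^{2j+2} ψ = |ψ|² · |ψ|^{2j} ψ` on the Fourier side. -/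
theorem oddPower_succ (j : ℕ) (g : Space d → ℂ) :
    oddPower (j + 1) g = cconv (autoConv g) (oddPower j g) :=
  Function.iterate_succ_apply' _ _ _

theorem FastDecay.oddPower {g : Space d → ℂ} (hg : FastDecay g) (j : ℕ) :
    FastDecay (oddPower j g) := by
  induction j with
  | zero => exact hg
  | succ j ih => rw [oddPower_succ]; exact hg.autoConv.cconv ih

theorem FastDecay.fourierInv_oddPower {g : Space d → ℂ} (hg : FastDecay g) (j : ℕ) (x : Space d) :
    𝓕⁻ (NormInflation.oddPower j g) x = ((‖𝓕⁻ g x‖ ^ (2 * j) : ℝ) : ℂ) * 𝓕⁻ g x := by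
  induction j with
  | zero => simp [oddPower_zero]
  | succ j ih =>
    rw [oddPower_succ, hg.autoConv.fourierInv_cconv (hg.oddPower j), ih, hg.fourierInv_autoConv]
    push_cast; ring

/-- Bounded even measurable real symbols.  Evenness makes `m(D)|ψ|²` a real function, so that it can
serve as a potential. -/
structure IsMultiplier (m : Space d → ℝ) (C : ℝ) : Prop where
  measurable : Measurable m
  bound : ∀ ξ, |m ξ| ≤ C
  even : ∀ ξ, m (-ξ) = m ξ

theorem IsMultiplier.nonneg {m : Space d → ℝ} {C : ℝ} (hm : IsMultiplier m C) : 0 ≤ C :=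
  (abs_nonneg _).trans (hm.bound 0)

theorem IsMultiplier.fastDecay {m : Space d → ℝ} {C : ℝ} (hm : IsMultiplier m C)
    {g : Space d → ℂ} (hg : FastDecay g) : FastDecay (fun ξ => (m ξ : ℂ) * g ξ) :=
  hg.mul_bdd (C := C) (n := 0)
    (Complex.measurable_ofReal.comp hm.measurable).aestronglyMeasurable
    (fun ξ => by simpa using hm.bound ξ)

/-- The Fourier multiplier with symbol `m` applied to `|f|²`.  For symbols `m` with `IsMultiplier m
C` the inverse Fourier transform is real, and taking the real part only changes its type. -/
noncomputable def meanField (m : Space d → ℝ) (f : Space d → ℂ) (x : Space d) : ℝ :=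
  (𝓕⁻ (fun ξ => (m ξ : ℂ) * 𝓕 (fun y => ((‖f y‖ ^ 2 : ℝ) : ℂ)) ξ) x).re

theorem FastDecay.fourier_norm_sq {g : Space d → ℂ} (hg : FastDecay g) :
    𝓕 (fun y => ((‖𝓕⁻ g y‖ ^ 2 : ℝ) : ℂ)) =ᵐ[volume] NormInflation.autoConv g := by
  have e : (fun y => ((‖𝓕⁻ g y‖ ^ 2 : ℝ) : ℂ)) = 𝓕⁻ (NormInflation.autoConv g) :=
    funext fun x => (hg.fourierInv_autoConv x).symm
  have h2 : MemLp (𝓕⁻ (NormInflation.autoConv g)) 2 volume :=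
    memLp_fourierInv hg.autoConv.integrable hg.autoConv.memLp_two
  have h1 : Integrable (𝓕⁻ (NormInflation.autoConv g)) volume := by
    rw [← e]
    have h3 := memLp_fourierInv hg.integrable hg.memLp_two
    have h4 := (memLp_two_iff_integrable_sq_norm h3.1).1 h3
    exact h4.ofReal
  rw [e]
  exact (fourier_toLp_ae h1 h2).symm.trans
    (fourier_toLp_fourierInv hg.autoConv.integrable hg.autoConv.memLp_two h2)

theorem IsMultiplier.meanField_eq {m : Space d → ℝ} {C : ℝ} (hm : IsMultiplier m C)
    {g : Space d → ℂ} (hg : FastDecay g) (x : Space d) :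
    (meanField m (𝓕⁻ g) x : ℂ) = 𝓕⁻ (fun ξ => (m ξ : ℂ) * autoConv g ξ) x := by
  have e : 𝓕⁻ (fun ξ => (m ξ : ℂ) * 𝓕 (fun y => ((‖𝓕⁻ g y‖ ^ 2 : ℝ) : ℂ)) ξ) x =
      𝓕⁻ (fun ξ => (m ξ : ℂ) * autoConv g ξ) x := by
    refine Real.fourierInv_congr_ae ?_ x
    filter_upwards [hg.fourier_norm_sq] with ξ hξ
    rw [hξ]
  rw [meanField, e]
  have h := fourierInv_conjReflect (fun ξ => (m ξ : ℂ) * autoConv g ξ) x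
  have e2 : conjReflect (fun ξ => (m ξ : ℂ) * autoConv g ξ) =
      (fun ξ => (m ξ : ℂ) * autoConv g ξ) := by
    funext ξ
    have := congrFun (conjReflect_autoConv g) ξ
    simp only [conjReflect] at this ⊢
    rw [map_mul, Complex.conj_ofReal, hm.even, this]
  rw [e2] at h
  exact (Complex.conj_eq_iff_re.1 h.symm)

/-- The Fourier transform of the nonlinearity `(m(D)|ψ|²) |ψ|^{2j} ψ` at `ψ = 𝓕⁻ g`. -/
noncomputable def nonlin (m : Space d → ℝ) (j : ℕ) (g : Space d → ℂ) : Space d → ℂ :=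
  cconv (fun ξ => (m ξ : ℂ) * autoConv g ξ) (oddPower j g)

/-- The potential `(m(D)|f|²) |f|^{2j}`.  The power nonlinearity `μ |f|^{2ν}` is the case of the
constant symbol `μ` and `j = ν - 1`. -/
noncomputable def potential (m : Space d → ℝ) (j : ℕ) (f : Space d → ℂ) (x : Space d) : ℝ :=
  meanField m f x * ‖f x‖ ^ (2 * j)

theorem IsMultiplier.fastDecay_nonlin {m : Space d → ℝ} {C : ℝ} (hm : IsMultiplier m C) (j : ℕ)
    {g : Space d → ℂ} (hg : FastDecay g) : FastDecay (nonlin m j g) :=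
  (hm.fastDecay hg.autoConv).cconv (hg.oddPower j)

theorem IsMultiplier.fourierInv_nonlin {m : Space d → ℝ} {C : ℝ} (hm : IsMultiplier m C) (j : ℕ)
    {g : Space d → ℂ} (hg : FastDecay g) (x : Space d) :
    𝓕⁻ (nonlin m j g) x = (potential m j (𝓕⁻ g) x : ℂ) * 𝓕⁻ g x := by
  rw [nonlin, (hm.fastDecay hg.autoConv).fourierInv_cconv (hg.oddPower j),
    hg.fourierInv_oddPower, ← hm.meanField_eq hg, potential]
  push_cast; ring

theorem isMultiplier_const (μ : ℝ) : IsMultiplier (fun _ : Space d => μ) |μ| :=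
  ⟨measurable_const, fun _ => le_rfl, fun _ => rfl⟩

theorem meanField_const (μ : ℝ) {g : Space d → ℂ} (hg : FastDecay g) (x : Space d) :
    meanField (fun _ => μ) (𝓕⁻ g) x = μ * ‖𝓕⁻ g x‖ ^ 2 := by
  have := (isMultiplier_const (d := d) μ).meanField_eq hg x
  rw [fourierInv_const_mul_apply, hg.fourierInv_autoConv] at this
  exact_mod_cast this

/-! ### Bounds in the Wiener algebra and in `L²` -/

theorem aemeasurable_conv_integrand {f g : Space d → ℂ} (hf : AEStronglyMeasurable f volume)
    (hg : AEStronglyMeasurable g volume) :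
    AEMeasurable (fun p : Space d × Space d => ‖f p.2‖ₑ * ‖g (p.1 - p.2)‖ₑ)
      (volume.prod volume) := by
  have := (hf.convolution_integrand (ContinuousLinearMap.mul ℂ ℂ) (μ := volume) (ν := volume) hg)
  simpa [enorm_mul] using this.enorm

/-- Young's inequality in `L¹`. -/
theorem lintegral_enorm_cconv_le {f g : Space d → ℂ} (hf : AEStronglyMeasurable f volume)
    (hg : AEStronglyMeasurable g volume) :
    ∫⁻ ξ, ‖cconv f g ξ‖ₑ ≤ (∫⁻ ξ, ‖f ξ‖ₑ) * ∫⁻ ξ, ‖g ξ‖ₑ := by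
  calc ∫⁻ ξ, ‖cconv f g ξ‖ₑ ≤ ∫⁻ ξ, ∫⁻ η, ‖f η‖ₑ * ‖g (ξ - η)‖ₑ := by
        refine lintegral_mono fun ξ => ?_
        rw [cconv_apply]
        refine (enorm_integral_le_lintegral_enorm _).trans (le_of_eq ?_)
        simp [enorm_mul]
    _ = ∫⁻ η, ∫⁻ ξ, ‖f η‖ₑ * ‖g (ξ - η)‖ₑ :=
        lintegral_lintegral_swap (aemeasurable_conv_integrand hf hg)
    _ = ∫⁻ η, ‖f η‖ₑ * ∫⁻ ξ, ‖g ξ‖ₑ := by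
        refine lintegral_congr fun η => ?_
        rw [lintegral_const_mul' _ _ enorm_ne_top, lintegral_sub_right_eq_self (fun ξ => ‖g ξ‖ₑ)]
    _ = _ := by
        rw [lintegral_mul_const'' _ hf.enorm]

theorem integral_norm_cconv_le {f g : Space d → ℂ} (hf : Integrable f) (hg : Integrable g) :
    ∫ ξ, ‖cconv f g ξ‖ ≤ (∫ ξ, ‖f ξ‖) * ∫ ξ, ‖g ξ‖ := by
  have h := lintegral_enorm_cconv_le hf.1 hg.1
  rw [integral_norm_eq_lintegral_enorm hf.1, integral_norm_eq_lintegral_enorm hg.1,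
    integral_norm_eq_lintegral_enorm (f := cconv f g) (hf.integrable_convolution _ hg).1,
    ← ENNReal.toReal_mul]
  exact ENNReal.toReal_mono (ENNReal.mul_ne_top hf.2.ne hg.2.ne) h

theorem integral_norm_conjReflect (g : Space d → ℂ) :
    ∫ ξ, ‖conjReflect g ξ‖ = ∫ ξ, ‖g ξ‖ := by
  simp only [conjReflect, RCLike.norm_conj]
  exact integral_neg_eq_self (fun ξ => ‖g ξ‖) volume

theorem IsMultiplier.abs_meanField_le {m : Space d → ℝ} {C : ℝ} (hm : IsMultiplier m C)
    {g : Space d → ℂ} (hg : FastDecay g) (x : Space d) :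
    |meanField m (𝓕⁻ g) x| ≤ C * (∫ ξ, ‖g ξ‖) ^ 2 := by
  have h := norm_fourierInv_le (fun ξ => (m ξ : ℂ) * autoConv g ξ) x
  rw [← hm.meanField_eq hg, Complex.norm_real, Real.norm_eq_abs] at h
  refine h.trans ?_
  calc ∫ ξ, ‖(m ξ : ℂ) * autoConv g ξ‖ ≤ ∫ ξ, C * ‖autoConv g ξ‖ := by
        refine integral_mono (hm.fastDecay hg.autoConv).integrable.norm
          (hg.autoConv.integrable.norm.const_mul C) fun ξ => ?_
        simp only [norm_mul, Complex.norm_real, Real.norm_eq_abs]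
        gcongr
        exact hm.bound ξ
    _ = C * ∫ ξ, ‖autoConv g ξ‖ := integral_const_mul _ _
    _ ≤ C * ((∫ ξ, ‖g ξ‖) * ∫ ξ, ‖conjReflect g ξ‖) := by
        have := hm.nonneg
        gcongr
        exact integral_norm_cconv_le hg.integrable hg.conjReflect.integrable
    _ = _ := by rw [integral_norm_conjReflect, sq]

theorem FastDecay.integral_norm_sq_fourierInv {g : Space d → ℂ} (hg : FastDecay g) :
    ∫ x, ‖𝓕⁻ g x‖ ^ 2 = ∫ ξ, ‖g ξ‖ ^ 2 := by
  have h := lintegral_enorm_sq_fourierInv hg.integrable hg.memLp_two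
  have key : ∀ {f : Space d → ℂ}, AEStronglyMeasurable f volume →
      ∫ x, ‖f x‖ ^ 2 = (∫⁻ x, ‖f x‖ₑ ^ 2).toReal := by
    intro f hf
    rw [integral_eq_lintegral_of_nonneg_ae (f := fun x => ‖f x‖ ^ 2)
      (Eventually.of_forall fun x => by positivity) (hf.norm.pow 2)]
    congr 1
    refine lintegral_congr fun x => ?_
    rw [← ofReal_norm, ENNReal.ofReal_pow (norm_nonneg _)]
  rw [key hg.aesm, key (continuous_fourierInv hg.integrable).aestronglyMeasurable, h]

theorem FastDecay.integrable_norm_sq {g : Space d → ℂ} (hg : FastDecay g) :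
    Integrable (fun x => ‖𝓕⁻ g x‖ ^ 2) volume := by
  have h3 := memLp_fourierInv hg.integrable hg.memLp_two
  exact (memLp_two_iff_integrable_sq_norm h3.1).1 h3

theorem FastDecay.integral_inner_fourierInv {f g : Space d → ℂ} (hf : FastDecay f)
    (hg : FastDecay g) :
    ∫ x, inner ℂ (𝓕⁻ f x) (𝓕⁻ g x) = ∫ ξ, inner ℂ (f ξ) (g ξ) := by
  have key : ∀ {a b : Space d → ℂ} (ha : MemLp a 2 volume) (hb : MemLp b 2 volume),
      inner ℂ (ha.toLp a) (hb.toLp b) = ∫ x, inner ℂ (a x) (b x) := by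
    intro a b ha hb
    rw [L2.inner_def]
    refine integral_congr_ae ?_
    filter_upwards [ha.coeFn_toLp, hb.coeFn_toLp] with x h1 h2
    rw [h1, h2]
  have h1 := memLp_fourierInv hf.integrable hf.memLp_two
  have h2 := memLp_fourierInv hg.integrable hg.memLp_two
  rw [← key h1 h2, ← key hf.memLp_two hg.memLp_two,
    toLp_fourierInv hf.integrable hf.memLp_two h1, toLp_fourierInv hg.integrable hg.memLp_two h2,
    ← Lp.inner_fourier_eq, FourierTransform.fourier_fourierInv_eq,
    FourierTransform.fourier_fourierInv_eq]

theorem norm_pow_mul_sub_le (j : ℕ) {B : ℝ} (a b : ℂ) (ha : ‖a‖ ≤ B) (hb : ‖b‖ ≤ B) :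
    ‖((‖a‖ ^ (2 * j) : ℝ) : ℂ) * a - ((‖b‖ ^ (2 * j) : ℝ) : ℂ) * b‖
      ≤ (2 * j + 1) * B ^ (2 * j) * ‖a - b‖ := by
  have hB : 0 ≤ B := (norm_nonneg a).trans ha
  induction j with
  | zero => simp
  | succ j ih =>
    have e : ((‖a‖ ^ (2 * (j + 1)) : ℝ) : ℂ) * a - ((‖b‖ ^ (2 * (j + 1)) : ℝ) : ℂ) * b =
        ((‖a‖ ^ 2 : ℝ) : ℂ) * (((‖a‖ ^ (2 * j) : ℝ) : ℂ) * a - ((‖b‖ ^ (2 * j) : ℝ) : ℂ) * b) +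
        ((‖a‖ ^ 2 - ‖b‖ ^ 2 : ℝ) : ℂ) * (((‖b‖ ^ (2 * j) : ℝ) : ℂ) * b) := by
      push_cast; ring
    have h1 : |‖a‖ ^ 2 - ‖b‖ ^ 2| ≤ 2 * B * ‖a - b‖ := by
      rw [sq_sub_sq, abs_mul, abs_of_nonneg (by positivity)]
      have := abs_norm_sub_norm_le a b
      gcongr
      linarith
    have h2 : ‖((‖b‖ ^ (2 * j) : ℝ) : ℂ) * b‖ ≤ B ^ (2 * j) * B := by
      rw [norm_mul, Complex.norm_real, Real.norm_of_nonneg (by positivity)]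
      gcongr
    rw [e]
    calc _ ≤ ‖a‖ ^ 2 * ((2 * j + 1) * B ^ (2 * j) * ‖a - b‖) +
          (2 * B * ‖a - b‖) * (B ^ (2 * j) * B) := by
          refine (norm_add_le _ _).trans (add_le_add ?_ ?_)
          · rw [norm_mul, Complex.norm_real, Real.norm_of_nonneg (by positivity)]
            gcongr
          · rw [norm_mul, Complex.norm_real, Real.norm_eq_abs]
            gcongr
      _ ≤ B ^ 2 * ((2 * j + 1) * B ^ (2 * j) * ‖a - b‖) +
          (2 * B * ‖a - b‖) * (B ^ (2 * j) * B) := by gcongr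
      _ = _ := by push_cast; ring

/-- The nonlinearity is Lipschitz in `L²` on sets bounded in the Wiener algebra, in which functions
are bounded by the `L¹` norm of their Fourier transform.  No bound of `m(D)` on `L^∞` is needed, as
the differences of mean fields are estimated by Plancherel's theorem. -/
theorem IsMultiplier.integral_norm_sq_nonlin_sub_le {m : Space d → ℝ} {C : ℝ}
    (hm : IsMultiplier m C) (j : ℕ) {B : ℝ} {f g : Space d → ℂ} (hf : FastDecay f)
    (hg : FastDecay g) (hfB : ∫ ξ, ‖f ξ‖ ≤ B) (hgB : ∫ ξ, ‖g ξ‖ ≤ B) :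
    ∫ x, ‖𝓕⁻ (fun ξ => nonlin m j f ξ - nonlin m j g ξ) x‖ ^ 2 ≤
      (2 * (C * B ^ 2 * ((2 * j + 1) * B ^ (2 * j))) ^ 2 +
        2 * (B ^ (2 * j + 1)) ^ 2 * (C ^ 2 * (2 * B) ^ 2)) *
      ∫ x, ‖𝓕⁻ (fun ξ => f ξ - g ξ) x‖ ^ 2 := by
  have hC := hm.nonneg
  have hB : 0 ≤ B := le_trans (integral_nonneg fun _ => norm_nonneg _) hfB
  have sf : ∀ x, ‖𝓕⁻ f x‖ ≤ B := fun x => (norm_fourierInv_le f x).trans hfB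
  have sg : ∀ x, ‖𝓕⁻ g x‖ ≤ B := fun x => (norm_fourierInv_le g x).trans hgB
  have hk := (hm.fastDecay hf.autoConv).sub (hm.fastDecay hg.autoConv)
  set M : Space d → ℂ := 𝓕⁻ (fun ξ => (m ξ : ℂ) * autoConv f ξ - (m ξ : ℂ) * autoConv g ξ) with hM
  have hMeq : ∀ x, M x = (meanField m (𝓕⁻ f) x : ℂ) - meanField m (𝓕⁻ g) x := by
    intro x
    rw [hM, hm.meanField_eq hf, hm.meanField_eq hg]
    exact fourierInv_sub_apply (hm.fastDecay hf.autoConv).integrable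
      (hm.fastDecay hg.autoConv).integrable x
  set w : Space d → ℂ := 𝓕⁻ (fun ξ => f ξ - g ξ) with hw
  have hweq : ∀ x, w x = 𝓕⁻ f x - 𝓕⁻ g x := fun x =>
    fourierInv_sub_apply hf.integrable hg.integrable x
  have iw : Integrable (fun x => ‖w x‖ ^ 2) volume := (hf.sub hg).integrable_norm_sq
  have iM : Integrable (fun x => ‖M x‖ ^ 2) volume := hk.integrable_norm_sq
  -- the mean fields differ by at most a multiple of `w` in `L²`, by Plancherel
  have h1 : ∫ x, ‖M x‖ ^ 2 ≤ C ^ 2 * (2 * B) ^ 2 * ∫ x, ‖w x‖ ^ 2 := by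
    have hdiff := hf.autoConv.sub hg.autoConv
    calc ∫ x, ‖M x‖ ^ 2
        = ∫ ξ, ‖(m ξ : ℂ) * autoConv f ξ - (m ξ : ℂ) * autoConv g ξ‖ ^ 2 :=
          hk.integral_norm_sq_fourierInv
      _ ≤ ∫ ξ, C ^ 2 * ‖autoConv f ξ - autoConv g ξ‖ ^ 2 := by
          refine integral_mono_of_nonneg (Eventually.of_forall fun ξ => by positivity)
            (((memLp_two_iff_integrable_sq_norm hdiff.aesm).1 hdiff.memLp_two).const_mul _)
            (Eventually.of_forall fun ξ => ?_)
          simp only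
          rw [← mul_sub, norm_mul, mul_pow, Complex.norm_real, Real.norm_eq_abs]
          have := hm.bound ξ
          gcongr
      _ = C ^ 2 * ∫ x, ‖𝓕⁻ (fun ξ => autoConv f ξ - autoConv g ξ) x‖ ^ 2 := by
          rw [integral_const_mul, hdiff.integral_norm_sq_fourierInv]
      _ ≤ C ^ 2 * ∫ x, (2 * B) ^ 2 * ‖w x‖ ^ 2 := by
          gcongr ?_ * ?_
          refine integral_mono_of_nonneg (Eventually.of_forall fun ξ => by positivity)
            (iw.const_mul _) (Eventually.of_forall fun x => ?_)
          simp only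
          rw [fourierInv_sub_apply hf.autoConv.integrable hg.autoConv.integrable,
            hf.fourierInv_autoConv, hg.fourierInv_autoConv, ← mul_pow, ← Complex.ofReal_sub,
            Complex.norm_real, Real.norm_eq_abs]
          gcongr
          rw [sq_sub_sq, abs_mul, abs_of_nonneg (by positivity), hweq]
          have := abs_norm_sub_norm_le (𝓕⁻ f x) (𝓕⁻ g x)
          have := sf x
          have := sg x
          gcongr
          linarith
      _ = _ := by rw [integral_const_mul]; ring
  have h2 : ∀ x, ‖𝓕⁻ (fun ξ => nonlin m j f ξ - nonlin m j g ξ) x‖ ^ 2 ≤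
      2 * (C * B ^ 2 * ((2 * j + 1) * B ^ (2 * j))) ^ 2 * ‖w x‖ ^ 2 +
        2 * (B ^ (2 * j + 1)) ^ 2 * ‖M x‖ ^ 2 := by
    intro x
    rw [fourierInv_sub_apply (hm.fastDecay_nonlin j hf).integrable
      (hm.fastDecay_nonlin j hg).integrable, hm.fourierInv_nonlin j hf, hm.fourierInv_nonlin j hg]
    have e : (potential m j (𝓕⁻ f) x : ℂ) * 𝓕⁻ f x - (potential m j (𝓕⁻ g) x : ℂ) * 𝓕⁻ g x =
        (meanField m (𝓕⁻ f) x : ℂ) * (((‖𝓕⁻ f x‖ ^ (2 * j) : ℝ) : ℂ) * 𝓕⁻ f x -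
          ((‖𝓕⁻ g x‖ ^ (2 * j) : ℝ) : ℂ) * 𝓕⁻ g x) +
        M x * (((‖𝓕⁻ g x‖ ^ (2 * j) : ℝ) : ℂ) * 𝓕⁻ g x) := by
      rw [hMeq, potential, potential]; push_cast; ring
    have a1 : ‖(potential m j (𝓕⁻ f) x : ℂ) * 𝓕⁻ f x - (potential m j (𝓕⁻ g) x : ℂ) * 𝓕⁻ g x‖ ≤
        (C * B ^ 2 * ((2 * j + 1) * B ^ (2 * j))) * ‖w x‖ + B ^ (2 * j + 1) * ‖M x‖ := by
      rw [e]
      refine (norm_add_le _ _).trans (add_le_add ?_ ?_)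
      · rw [norm_mul, Complex.norm_real, Real.norm_eq_abs, mul_assoc (C * B ^ 2)]
        gcongr
        · refine (hm.abs_meanField_le hf x).trans ?_
          have : 0 ≤ ∫ ξ, ‖f ξ‖ := integral_nonneg fun _ => norm_nonneg _
          gcongr
        · rw [hweq]
          exact norm_pow_mul_sub_le j _ _ (sf x) (sg x)
      · rw [norm_mul, mul_comm]
        gcongr
        rw [norm_mul, Complex.norm_real, Real.norm_of_nonneg (by positivity), pow_succ]
        have := sg x
        gcongr
    calc _ ≤ ((C * B ^ 2 * ((2 * j + 1) * B ^ (2 * j))) * ‖w x‖ + B ^ (2 * j + 1) * ‖M x‖) ^ 2 := by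
          gcongr
      _ ≤ _ := by
          nlinarith [sq_nonneg ((C * B ^ 2 * ((2 * j + 1) * B ^ (2 * j))) * ‖w x‖ -
            B ^ (2 * j + 1) * ‖M x‖)]
  calc _ ≤ ∫ x, (2 * (C * B ^ 2 * ((2 * j + 1) * B ^ (2 * j))) ^ 2 * ‖w x‖ ^ 2 +
        2 * (B ^ (2 * j + 1)) ^ 2 * ‖M x‖ ^ 2) :=
        integral_mono_of_nonneg (Eventually.of_forall fun ξ => by positivity)
          ((iw.const_mul _).add (iM.const_mul _)) (Eventually.of_forall h2)
    _ = 2 * (C * B ^ 2 * ((2 * j + 1) * B ^ (2 * j))) ^ 2 * (∫ x, ‖w x‖ ^ 2) +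
        2 * (B ^ (2 * j + 1)) ^ 2 * ∫ x, ‖M x‖ ^ 2 := by
        rw [integral_add (iw.const_mul _) (iM.const_mul _), integral_const_mul, integral_const_mul]
    _ ≤ 2 * (C * B ^ 2 * ((2 * j + 1) * B ^ (2 * j))) ^ 2 * (∫ x, ‖w x‖ ^ 2) +
        2 * (B ^ (2 * j + 1)) ^ 2 * (C ^ 2 * (2 * B) ^ 2 * ∫ x, ‖w x‖ ^ 2) := by gcongr
    _ = _ := by ring

/-! ### The energy estimate -/

/-- `½ L` acts as the Fourier multiplier with the real symbol `-P`, in the variable `ξ` of Mathlib's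
transform: `P ξ = 2π²|ξ|²` for the Laplace operator. -/
structure HasSymbol (L : (Space d → ℂ) → Space d → ℂ) (P : Space d → ℝ) : Prop where
  cont : Continuous P
  bound : ∃ C : ℝ, ∀ ξ, |P ξ| ≤ C * (1 + ‖ξ‖) ^ 2
  apply : ∀ g, FastDecay g → ∀ x,
    (1 / 2 : ℂ) * L (𝓕⁻ g) x = 𝓕⁻ (fun ξ => -(P ξ : ℂ) * g ξ) x

theorem HasSymbol.fastDecay {L : (Space d → ℂ) → Space d → ℂ} {P : Space d → ℝ}
    (hL : HasSymbol L P) {g : Space d → ℂ} (hg : FastDecay g) :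
    FastDecay (fun ξ => -(P ξ : ℂ) * g ξ) := by
  obtain ⟨C, hC⟩ := hL.bound
  refine hg.mul_bdd (C := C) (n := 2) (Continuous.aestronglyMeasurable ?_) (fun ξ => ?_)
  · have := hL.cont
    fun_prop
  · simpa using hC ξ

/-- The weighted square norm `‖(1 + |ξ|)^k g‖_{L²}`. -/
noncomputable def wnorm (k : ℕ) (g : Space d → ℂ) : ℝ≥0∞ :=
  eLpNorm (fun ξ => (1 + ‖ξ‖) ^ k * ‖g ξ‖) 2 volume

theorem wnorm_sq (k : ℕ) (g : Space d → ℂ) :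
    wnorm k g = (∫⁻ ξ, ‖(1 + ‖ξ‖) ^ k * ‖g ξ‖‖ₑ ^ 2) ^ (1 / 2 : ℝ) := by
  rw [wnorm, eLpNorm_eq_lintegral_rpow_enorm_toReal (by norm_num) (by norm_num)]
  simp

theorem wnorm_add_le (k : ℕ) {f g : Space d → ℂ} (hf : FastDecay f) (hg : FastDecay g) :
    wnorm k (fun ξ => f ξ + g ξ) ≤ wnorm k f + wnorm k g := by
  refine le_trans (eLpNorm_mono_real (g := fun ξ => (1 + ‖ξ‖) ^ k * ‖f ξ‖ + (1 + ‖ξ‖) ^ k * ‖g ξ‖)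
    fun ξ => ?_) (eLpNorm_add_le (aesm_weight_mul hf.aesm k) (aesm_weight_mul hg.aesm k)
      one_le_two)
  rw [Real.norm_of_nonneg (by positivity), ← mul_add]
  gcongr
  exact norm_add_le _ _

theorem wnorm_le_sobolevNorm (k : ℕ) {g : Space d → ℂ} (hg : FastDecay g) :
    wnorm k g ≤ (2 ^ k) ^ (1 / 2 : ℝ) * sobolevNorm k (𝓕⁻ g) := by
  rw [wnorm_sq, sobolevNorm_fourierInv _ hg.integrable hg.memLp_two,
    ← ENNReal.mul_rpow_of_nonneg _ _ (by norm_num)]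
  gcongr
  exact lintegral_weight_sq_le k g

/-- Compactness of the interval: local boundedness implies boundedness. -/
theorem exists_bound_on_Icc {T : ℝ} {N : ℝ → ℝ≥0∞}
    (h : ∀ t ∈ Icc 0 T, ∃ B : ℝ≥0∞, B ≠ ⊤ ∧ ∀ᶠ τ in 𝓝[Icc 0 T] t, N τ ≤ B) :
    ∃ B : ℝ≥0∞, B ≠ ⊤ ∧ ∀ t ∈ Icc 0 T, N t ≤ B := by
  refine isCompact_Icc.induction_on (p := fun s => ∃ B : ℝ≥0∞, B ≠ ⊤ ∧ ∀ t ∈ s, N t ≤ B)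
    ⟨0, by simp, by simp⟩ ?_ ?_ ?_
  · rintro s t hst ⟨B, hB, h⟩
    exact ⟨B, hB, fun x hx => h x (hst hx)⟩
  · rintro s t ⟨B, hB, h⟩ ⟨B', hB', h'⟩
    refine ⟨max B B', by simp [hB, hB'], ?_⟩
    rintro x (hx | hx)
    · exact (h x hx).trans (le_max_left _ _)
    · exact (h' x hx).trans (le_max_right _ _)
  · intro t ht
    obtain ⟨B, hB, h'⟩ := h t ht
    exact ⟨_, h', B, hB, fun x hx => hx⟩

section Representation

variable {L : (Space d → ℂ) → Space d → ℂ} {V : ℝ → Space d → ℝ} {T : ℝ} {φ : Space d → ℂ}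
  {ψ : ℝ → Space d → ℂ}

/-- Solutions are of class `H^∞` at each time, hence inverse Fourier transforms of rapidly
decreasing functions. -/
theorem SolvesSchrodinger.exists_fourier (h : SolvesSchrodinger L V T φ ψ) :
    ∃ g : ℝ → Space d → ℂ, ∀ t ∈ Icc 0 T, FastDecay (g t) ∧ ψ t = 𝓕⁻ (g t) := by
  have : ∀ t, ∃ g, t ∈ Icc 0 T → FastDecay g ∧ ψ t = 𝓕⁻ g := by
    intro t
    by_cases ht : t ∈ Icc 0 T
    · obtain ⟨g, hg⟩ := exists_fourierInv_of_sobolevNorm (h.smooth t ht).continuous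
        (fun s => h.mem_sobolev s t ht)
      exact ⟨g, fun _ => hg⟩
    · exact ⟨0, fun h => absurd h ht⟩
  choose g hg using this
  exact ⟨g, hg⟩

theorem sub_eq_fourierInv {g : ℝ → Space d → ℂ}
    (hg : ∀ t ∈ Icc 0 T, FastDecay (g t) ∧ ψ t = 𝓕⁻ (g t)) {τ t : ℝ} (hτ : τ ∈ Icc 0 T)
    (ht : t ∈ Icc 0 T) : ψ τ - ψ t = 𝓕⁻ (fun ξ => g τ ξ - g t ξ) := by
  funext x
  rw [fourierInv_sub_apply (hg τ hτ).1.integrable (hg t ht).1.integrable, Pi.sub_apply,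
    (hg τ hτ).2, (hg t ht).2]

/-- A seminorm controlled by a Sobolev norm is bounded along a solution, by the continuity of the
solution with values in the Sobolev space. -/
theorem SolvesSchrodinger.exists_bound (h : SolvesSchrodinger L V T φ ψ) {g : ℝ → Space d → ℂ}
    (hg : ∀ t ∈ Icc 0 T, FastDecay (g t) ∧ ψ t = 𝓕⁻ (g t)) (N : (Space d → ℂ) → ℝ≥0∞)
    (hN : ∀ f g, FastDecay f → FastDecay g → N (fun ξ => f ξ + g ξ) ≤ N f + N g)
    {C : ℝ≥0∞} (hC : C ≠ ⊤) (s : ℝ) (hs : ∀ f, FastDecay f → N f ≤ C * sobolevNorm s (𝓕⁻ f)) :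
    ∃ B : ℝ≥0∞, B ≠ ⊤ ∧ ∀ t ∈ Icc 0 T, N (g t) ≤ B := by
  refine exists_bound_on_Icc fun t ht => ⟨C * sobolevNorm s (ψ t) + C * 1, ?_, ?_⟩
  · exact ENNReal.add_ne_top.2 ⟨ENNReal.mul_ne_top hC (h.mem_sobolev s t ht).ne, by simpa⟩
  · have h1 := (h.continuous_sobolev s t ht).eventually (eventually_le_nhds zero_lt_one)
    filter_upwards [h1, self_mem_nhdsWithin] with τ h2 hτ
    have e : g τ = fun ξ => g t ξ + (g τ ξ - g t ξ) := by funext ξ; ring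
    have h3 := (hg τ hτ).1.sub (hg t ht).1
    rw [e]
    refine (hN _ _ (hg t ht).1 h3).trans (add_le_add ?_ ?_)
    · rw [(hg t ht).2]; exact hs _ (hg t ht).1
    · refine (hs _ h3).trans ?_
      rw [← sub_eq_fourierInv hg hτ ht]
      gcongr

theorem SolvesSchrodinger.exists_bound_integral (h : SolvesSchrodinger L V T φ ψ)
    {g : ℝ → Space d → ℂ} (hg : ∀ t ∈ Icc 0 T, FastDecay (g t) ∧ ψ t = 𝓕⁻ (g t)) :
    ∃ B : ℝ, ∀ t ∈ Icc 0 T, ∫ ξ, ‖g t ξ‖ ≤ B := by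
  obtain ⟨C, hC, hC'⟩ := exists_lintegral_weight_le d 0
  simp only [pow_zero, one_mul, enorm_norm] at hC'
  obtain ⟨B, hB, hB'⟩ := h.exists_bound hg (fun f => ∫⁻ ξ, ‖f ξ‖ₑ) (fun f g hf hg => by
    simp only
    rw [← lintegral_add_left' hf.aesm.enorm]
    exact lintegral_mono fun ξ => enorm_add_le _ _) hC _ hC'
  refine ⟨B.toReal, fun t ht => ?_⟩
  rw [integral_norm_eq_lintegral_enorm (hg t ht).1.aesm]
  exact ENNReal.toReal_mono hB (hB' t ht)

theorem SolvesSchrodinger.exists_bound_wnorm (h : SolvesSchrodinger L V T φ ψ)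
    {g : ℝ → Space d → ℂ} (hg : ∀ t ∈ Icc 0 T, FastDecay (g t) ∧ ψ t = 𝓕⁻ (g t)) (k : ℕ) :
    ∃ B : ℝ≥0∞, B ≠ ⊤ ∧ ∀ t ∈ Icc 0 T, wnorm k (g t) ≤ B :=
  h.exists_bound hg (wnorm k) (fun _ _ hf hg => wnorm_add_le k hf hg)
    (ENNReal.rpow_ne_top_of_nonneg (by norm_num) (by simp)) _ fun _ hf => wnorm_le_sobolevNorm k hf

/-- A solution, extended in time by its boundary values, is jointly continuous. -/
theorem SolvesSchrodinger.continuous_clamp (h : SolvesSchrodinger L V T φ ψ) (hT : 0 ≤ T) :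
    Continuous (fun p : ℝ × Space d => ψ (projIcc 0 T hT p.1) p.2) := by
  obtain ⟨g, hg⟩ := h.exists_fourier
  obtain ⟨C, hC, hC'⟩ := exists_lintegral_weight_le d 0
  simp only [pow_zero, one_mul, enorm_norm] at hC'
  have hsup : ∀ τ ∈ Icc 0 T, ∀ t ∈ Icc 0 T, ∀ x,
      ‖ψ τ x - ψ t x‖ₑ ≤ C * sobolevNorm (0 + (d + 1) : ℕ) (ψ τ - ψ t) := by
    intro τ hτ t ht x
    have h3 := (hg τ hτ).1.sub (hg t ht).1
    have h4 := norm_fourierInv_le (fun ξ => g τ ξ - g t ξ) x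
    rw [integral_norm_eq_lintegral_enorm h3.aesm] at h4
    have h5 : ‖𝓕⁻ (fun ξ => g τ ξ - g t ξ) x‖ₑ ≤ ∫⁻ ξ, ‖g τ ξ - g t ξ‖ₑ := by
      rw [← ofReal_norm]
      exact ENNReal.ofReal_le_of_le_toReal h4
    rw [← sub_eq_fourierInv hg hτ ht] at h5
    refine h5.trans ((hC' _ h3).trans ?_)
    rw [← sub_eq_fourierInv hg hτ ht]
  rw [continuous_iff_continuousAt]
  rintro ⟨t, x⟩
  have ht := (projIcc 0 T hT t).2
  have e : (fun p : ℝ × Space d => ψ (projIcc 0 T hT p.1) p.2) = fun p =>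
      (ψ (projIcc 0 T hT p.1) p.2 - ψ (projIcc 0 T hT t) p.2) + ψ (projIcc 0 T hT t) p.2 := by
    funext p; ring
  have h1 : ContinuousAt (fun p : ℝ × Space d => ψ (projIcc 0 T hT t) p.2) (t, x) :=
    ((h.smooth _ ht).continuous.comp continuous_snd).continuousAt
  have h2 : Tendsto (fun p : ℝ × Space d =>
      ψ (projIcc 0 T hT p.1) p.2 - ψ (projIcc 0 T hT t) p.2) (𝓝 (t, x)) (𝓝 0) := by
    rw [tendsto_zero_iff_enorm_tendsto_zero]
    have h3 : Tendsto (fun p : ℝ × Space d => ((projIcc 0 T hT p.1 : Icc 0 T) : ℝ)) (𝓝 (t, x))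
        (𝓝[Icc 0 T] (projIcc 0 T hT t : ℝ)) := by
      refine tendsto_nhdsWithin_iff.2 ⟨?_, Eventually.of_forall fun p => (projIcc 0 T hT p.1).2⟩
      exact ((continuous_subtype_val.comp continuous_projIcc).comp continuous_fst).tendsto (t, x)
    have h4 := ((h.continuous_sobolev (0 + (d + 1) : ℕ) _ ht).comp h3)
    have h5 := ENNReal.Tendsto.const_mul (a := C) h4 (Or.inr hC)
    rw [mul_zero] at h5
    refine tendsto_of_tendsto_of_tendsto_of_le_of_le tendsto_const_nhds h5 (fun _ => zero_le)
      fun p => ?_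
    exact hsup _ (projIcc 0 T hT p.1).2 _ ht p.2
  rw [ContinuousAt, e]
  simpa using h2.add h1

end Representation

/-- Grönwall's inequality in integral form. -/
theorem eq_zero_of_le_integral {T K S : ℝ} (hK : 0 ≤ K) {y : ℝ → ℝ} (hy0 : ∀ t, 0 ≤ y t)
    (hyS : ∀ t, y t ≤ S) (hym : Measurable y)
    (h : ∀ t ∈ Icc 0 T, y t ≤ K * ∫ s in (0 : ℝ)..t, y s) :
    ∀ t ∈ Icc 0 T, y t = 0 := by
  have hint : ∀ t, IntervalIntegrable y volume 0 t := fun t =>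
    (intervalIntegrable_const (c := S)).mono_fun' hym.aestronglyMeasurable
      (Eventually.of_forall fun s => by simpa [abs_of_nonneg (hy0 s)] using hyS s)
  have key : ∀ n : ℕ, ∀ t ∈ Icc 0 T, y t ≤ S * ((K * t) ^ n / n.factorial) := by
    intro n
    induction n with
    | zero => intro t _; simpa using hyS t
    | succ n ih =>
      intro t ht
      have h1 : ∫ s in (0 : ℝ)..t, y s ≤ ∫ s in (0 : ℝ)..t, S * ((K * s) ^ n / n.factorial) := by
        refine intervalIntegral.integral_mono_on ht.1 (hint t)
          (Continuous.intervalIntegrable (by fun_prop) _ _) fun s hs => ?_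
        exact ih s ⟨hs.1, hs.2.trans ht.2⟩
      refine (h t ht).trans ((mul_le_mul_of_nonneg_left h1 hK).trans (le_of_eq ?_))
      simp only [mul_pow, intervalIntegral.integral_const_mul, intervalIntegral.integral_div,
        integral_pow]
      rw [Nat.factorial_succ]
      push_cast
      field_simp
      simp
      ring
  intro t ht
  have h1 : Tendsto (fun n : ℕ => S * ((K * t) ^ n / n.factorial)) atTop (𝓝 (S * 0)) :=
    (FloorSemiring.tendsto_pow_div_factorial_atTop (K * t)).const_mul S
  rw [mul_zero] at h1
  exact le_antisymm (ge_of_tendsto' h1 fun n => key n t ht) (hy0 t)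

/-- The energy estimate: the dispersive part of the equation is skew adjoint. -/
theorem integral_re_inner_le {P : Space d → ℝ} {a n : Space d → ℂ} (ha : FastDecay a)
    (hn : FastDecay n) (hG : FastDecay (fun ξ => Complex.I * (-(P ξ : ℂ) * a ξ - n ξ))) :
    ∫ x, 2 * (inner ℂ (𝓕⁻ a x)
        (𝓕⁻ (fun ξ => Complex.I * (-(P ξ : ℂ) * a ξ - n ξ)) x)).re ≤
      (∫ x, ‖𝓕⁻ a x‖ ^ 2) + ∫ x, ‖𝓕⁻ n x‖ ^ 2 := by
  have hint : ∀ {f g : Space d → ℂ}, MemLp f 2 volume → MemLp g 2 volume →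
      Integrable (fun x => inner ℂ (f x) (g x)) volume := by
    intro f g hf hg
    have := L2.integrable_inner (𝕜 := ℂ) (hf.toLp f) (hg.toLp g)
    refine this.congr ?_
    filter_upwards [hf.coeFn_toLp, hg.coeFn_toLp] with x h1 h2
    rw [h1, h2]
  have h1 := memLp_fourierInv ha.integrable ha.memLp_two
  have h2 := memLp_fourierInv hG.integrable hG.memLp_two
  have e := ha.integral_inner_fourierInv hG
  have e1 : ∫ x, 2 * (inner ℂ (𝓕⁻ a x)
        (𝓕⁻ (fun ξ => Complex.I * (-(P ξ : ℂ) * a ξ - n ξ)) x)).re =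
      ∫ ξ, 2 * (inner ℂ (a ξ) (Complex.I * (-(P ξ : ℂ) * a ξ - n ξ))).re := by
    rw [integral_const_mul, integral_const_mul]
    congr 1
    have e2 := integral_re (𝕜 := ℂ) (hint h1 h2)
    have e3 := integral_re (𝕜 := ℂ) (hint ha.memLp_two hG.memLp_two)
    simp only [RCLike.re_to_complex] at e2 e3
    rw [e2, e3, e]
  rw [e1, ha.integral_norm_sq_fourierInv, hn.integral_norm_sq_fourierInv, ← integral_add
    ((memLp_two_iff_integrable_sq_norm ha.aesm).1 ha.memLp_two)
    ((memLp_two_iff_integrable_sq_norm hn.aesm).1 hn.memLp_two)]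
  refine integral_mono ?_ (((memLp_two_iff_integrable_sq_norm ha.aesm).1 ha.memLp_two).add
    ((memLp_two_iff_integrable_sq_norm hn.aesm).1 hn.memLp_two)) fun ξ => ?_
  · exact (hint ha.memLp_two hG.memLp_two).re.const_mul 2
  · simp only [RCLike.inner_apply, ← Complex.normSq_eq_norm_sq, Complex.normSq_apply,
      Complex.mul_re, Complex.mul_im, Complex.sub_re, Complex.sub_im, Complex.neg_re,
      Complex.neg_im, Complex.I_re, Complex.I_im, Complex.ofReal_re, Complex.ofReal_im,
      Complex.conj_re, Complex.conj_im]
    nlinarith [sq_nonneg ((a ξ).re - (n ξ).im), sq_nonneg ((a ξ).im + (n ξ).re)]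

/-! ### Uniqueness of smooth solutions -/

theorem lintegral_enorm_sq_eq_wnorm (g : Space d → ℂ) :
    ∫⁻ ξ, ‖g ξ‖ₑ ^ 2 = wnorm 0 g ^ 2 := by
  rw [wnorm_sq, ← ENNReal.rpow_natCast, ← ENNReal.rpow_mul]
  simp

theorem lintegral_symbol_mul_sq_le {P : Space d → ℝ} {C : ℝ} (h : ∀ ξ, |P ξ| ≤ C * (1 + ‖ξ‖) ^ 2)
    (g : Space d → ℂ) :
    ∫⁻ ξ, ‖-(P ξ : ℂ) * g ξ‖ₑ ^ 2 ≤ ENNReal.ofReal C ^ 2 * wnorm 2 g ^ 2 := by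
  have hC : 0 ≤ C := by
    have := (abs_nonneg _).trans (h 0)
    simpa using this
  have e : wnorm 2 g ^ 2 = ∫⁻ ξ, ‖(1 + ‖ξ‖) ^ 2 * ‖g ξ‖‖ₑ ^ 2 := by
    rw [wnorm_sq, ← ENNReal.rpow_natCast, ← ENNReal.rpow_mul]
    simp
  rw [e, ← lintegral_const_mul' _ _ (by simp)]
  refine lintegral_mono fun ξ => ?_
  rw [← mul_pow]
  gcongr
  rw [← ofReal_norm, ← ofReal_norm, ← ENNReal.ofReal_mul hC]
  refine ENNReal.ofReal_le_ofReal ?_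
  rw [norm_mul, norm_neg, Complex.norm_real,
      Real.norm_of_nonneg (by positivity : (0:ℝ) ≤ (1 + ‖ξ‖) ^ 2 * ‖g ξ‖),
    ← mul_assoc, Real.norm_eq_abs]
  gcongr
  exact h ξ

theorem enorm_add_sq_le (a b : ℂ) : ‖a + b‖ₑ ^ 2 ≤ 2 * ‖a‖ₑ ^ 2 + 2 * ‖b‖ₑ ^ 2 := by
  have h : ‖a + b‖ ^ 2 ≤ 2 * ‖a‖ ^ 2 + 2 * ‖b‖ ^ 2 := by
    have := norm_add_le a b
    nlinarith [sq_nonneg (‖a‖ - ‖b‖), norm_nonneg (a + b)]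
  have := ENNReal.ofReal_le_ofReal h
  rw [ENNReal.ofReal_add (by positivity) (by positivity), ENNReal.ofReal_mul (by norm_num),
    ENNReal.ofReal_mul (by norm_num), ENNReal.ofReal_pow (by positivity),
    ENNReal.ofReal_pow (by positivity), ENNReal.ofReal_pow (by positivity), ofReal_norm,
    ofReal_norm, ofReal_norm] at this
  simpa using this

/-- Uniqueness of smooth solutions, by the energy method: the `L²` norm of the difference of two
solutions obeys Grönwall's inequality, as the nonlinearity is Lipschitz in `L²` on bounded sets of
the Wiener algebra. -/
theorem SolvesSchrodinger.unique {L : (Space d → ℂ) → Space d → ℂ} {P : Space d → ℝ}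
    (hL : HasSymbol L P) {m : Space d → ℝ} {C : ℝ} (hm : IsMultiplier m C) {j : ℕ} {T : ℝ}
    (hT : 0 ≤ T) {φ : Space d → ℂ} {ψ₁ ψ₂ : ℝ → Space d → ℂ}
    (h₁ : SolvesSchrodinger L (fun t => potential m j (ψ₁ t)) T φ ψ₁)
    (h₂ : SolvesSchrodinger L (fun t => potential m j (ψ₂ t)) T φ ψ₂) :
    ∀ t ∈ Icc 0 T, ψ₁ t = ψ₂ t := by
  obtain ⟨g₁, hg₁⟩ := h₁.exists_fourier
  obtain ⟨g₂, hg₂⟩ := h₂.exists_fourier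
  obtain ⟨B₁, hB₁⟩ := h₁.exists_bound_integral hg₁
  obtain ⟨B₂, hB₂⟩ := h₂.exists_bound_integral hg₂
  set B := max B₁ B₂
  obtain ⟨CP, hCP⟩ := hL.bound
  obtain ⟨S₁, hS₁, hS₁'⟩ := h₁.exists_bound_wnorm hg₁ 2
  obtain ⟨S₂, hS₂, hS₂'⟩ := h₂.exists_bound_wnorm hg₂ 2
  obtain ⟨R₁, hR₁, hR₁'⟩ := h₁.exists_bound_wnorm hg₁ 0
  obtain ⟨R₂, hR₂, hR₂'⟩ := h₂.exists_bound_wnorm hg₂ 0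
  set K : ℝ := 2 * (C * B ^ 2 * ((2 * j + 1) * B ^ (2 * j))) ^ 2 +
        2 * (B ^ (2 * j + 1)) ^ 2 * (C ^ 2 * (2 * B) ^ 2) with hKdef
  have hK : 0 ≤ K := by positivity
  let a : ℝ → Space d → ℂ := fun t ξ => g₁ t ξ - g₂ t ξ
  let n : ℝ → Space d → ℂ := fun t ξ => nonlin m j (g₁ t) ξ - nonlin m j (g₂ t) ξ
  let G : ℝ → Space d → ℂ := fun t ξ => Complex.I * (-(P ξ : ℂ) * a t ξ - n t ξ)
  have ha : ∀ t ∈ Icc 0 T, FastDecay (a t) := fun t ht => (hg₁ t ht).1.sub (hg₂ t ht).1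
  have hn : ∀ t ∈ Icc 0 T, FastDecay (n t) := fun t ht =>
    (hm.fastDecay_nonlin j (hg₁ t ht).1).sub (hm.fastDecay_nonlin j (hg₂ t ht).1)
  have hPa : ∀ t ∈ Icc 0 T, FastDecay (fun ξ => -(P ξ : ℂ) * a t ξ) := fun t ht =>
    hL.fastDecay (ha t ht)
  have hG : ∀ t ∈ Icc 0 T, FastDecay (G t) := fun t ht =>
    ((hPa t ht).sub (hn t ht)).mul_bdd (m := fun _ => Complex.I) (C := 1) (n := 0)
      aestronglyMeasurable_const (by simp)
  have hn2 : ∀ t ∈ Icc 0 T, ∫ x, ‖𝓕⁻ (n t) x‖ ^ 2 ≤ K * ∫ x, ‖𝓕⁻ (a t) x‖ ^ 2 := fun t ht =>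
    hm.integral_norm_sq_nonlin_sub_le j (hg₁ t ht).1 (hg₂ t ht).1
      ((hB₁ t ht).trans (le_max_left _ _)) ((hB₂ t ht).trans (le_max_right _ _))
  let w : ℝ → Space d → ℂ := fun t x => ψ₁ (projIcc 0 T hT t) x - ψ₂ (projIcc 0 T hT t) x
  have hw : ∀ t ∈ Icc 0 T, w t = 𝓕⁻ (a t) := by
    intro t ht
    funext x
    simp only [w, projIcc_of_mem hT ht, a]
    rw [fourierInv_sub_apply (hg₁ t ht).1.integrable (hg₂ t ht).1.integrable, (hg₁ t ht).2,
      (hg₂ t ht).2]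
  have hwc : Continuous (fun p : ℝ × Space d => w p.1 p.2) :=
    (h₁.continuous_clamp hT).sub (h₂.continuous_clamp hT)
  -- the equation for the difference
  have hder : ∀ t ∈ Ioo 0 T, ∀ x, HasDerivAt (fun τ => w τ x) (𝓕⁻ (G t) x) t := by
    intro t ht x
    have ht' : t ∈ Icc 0 T := Ioo_subset_Icc_self ht
    have e1 := ((h₁.equation t ht' x).hasDerivAt (Icc_mem_nhds ht.1 ht.2))
    have e2 := ((h₂.equation t ht' x).hasDerivAt (Icc_mem_nhds ht.1 ht.2))
    have e3 := e1.sub e2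
    have e4 : Complex.I * ((1 / 2) * L (ψ₁ t) x - (potential m j (ψ₁ t) x : ℂ) * ψ₁ t x) -
        Complex.I * ((1 / 2) * L (ψ₂ t) x - (potential m j (ψ₂ t) x : ℂ) * ψ₂ t x) =
        𝓕⁻ (G t) x := by
      rw [(hg₁ t ht').2, (hg₂ t ht').2, hL.apply _ (hg₁ t ht').1, hL.apply _ (hg₂ t ht').1,
        ← hm.fourierInv_nonlin j (hg₁ t ht').1, ← hm.fourierInv_nonlin j (hg₂ t ht').1]
      simp only [G]
      rw [fourierInv_const_mul_apply, fourierInv_sub_apply (hPa t ht').integrable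
        (hn t ht').integrable]
      have e5 : 𝓕⁻ (fun ξ => -(P ξ : ℂ) * a t ξ) x =
          𝓕⁻ (fun ξ => -(P ξ : ℂ) * g₁ t ξ) x - 𝓕⁻ (fun ξ => -(P ξ : ℂ) * g₂ t ξ) x := by
        rw [← fourierInv_sub_apply (hL.fastDecay (hg₁ t ht').1).integrable
          (hL.fastDecay (hg₂ t ht').1).integrable]
        refine congrArg (fun h : Space d → ℂ => 𝓕⁻ h x) (funext fun ξ => ?_)
        simp only [a]; ring
      have e6 : 𝓕⁻ (n t) x = 𝓕⁻ (nonlin m j (g₁ t)) x - 𝓕⁻ (nonlin m j (g₂ t)) x :=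
        fourierInv_sub_apply (hm.fastDecay_nonlin j (hg₁ t ht').1).integrable
          (hm.fastDecay_nonlin j (hg₂ t ht').1).integrable x
      rw [e5, e6]; ring
    rw [e4] at e3
    refine e3.congr_of_eventuallyEq ?_
    filter_upwards [Icc_mem_nhds ht.1 ht.2] with τ hτ
    simp only [w, projIcc_of_mem hT hτ, Pi.sub_apply]
  let D : Space d × ℝ → ℝ := fun p => deriv (fun τ => ‖w τ p.1‖ ^ 2) p.2
  have hDm : Measurable D := by
    refine measurable_deriv_with_param (f := fun (x : Space d) (τ : ℝ) => ‖w τ x‖ ^ 2) ?_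
    exact ((hwc.comp continuous_swap).norm.pow 2)
  have hDd : ∀ t ∈ Ioo 0 T, ∀ x, HasDerivAt (fun τ => ‖w τ x‖ ^ 2)
      (2 * (inner ℂ (𝓕⁻ (a t) x) (𝓕⁻ (G t) x)).re) t := by
    intro t ht x
    have := (hder t ht x).norm_sq
    rw [hw t (Ioo_subset_Icc_self ht)] at this
    exact this
  have hDeq : ∀ t ∈ Ioo 0 T, ∀ x, D (x, t) = 2 * (inner ℂ (𝓕⁻ (a t) x) (𝓕⁻ (G t) x)).re :=
    fun t ht x => (hDd t ht x).deriv
  -- bounds that are uniform in time, for the interchange of the integrals in `x` and in time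
  have hA : ∀ t ∈ Icc 0 T, ∫⁻ x, ‖𝓕⁻ (a t) x‖ₑ ^ 2 ≤ (R₁ + R₂) ^ 2 := by
    intro t ht
    rw [lintegral_enorm_sq_fourierInv (ha t ht).integrable (ha t ht).memLp_two,
      lintegral_enorm_sq_eq_wnorm]
    gcongr
    have h := wnorm_add_le 0 (hg₁ t ht).1 (hg₂ t ht).1.neg
    have e : wnorm 0 (fun ξ => -g₂ t ξ) = wnorm 0 (g₂ t) := by simp [wnorm]
    rw [e] at h
    simp only [a, sub_eq_add_neg]
    exact h.trans (add_le_add (hR₁' t ht) (hR₂' t ht))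
  have hn3 : ∀ t ∈ Icc 0 T, ∫⁻ x, ‖n t x‖ₑ ^ 2 ≤ ENNReal.ofReal K * (R₁ + R₂) ^ 2 := by
    intro t ht
    have conv : ∀ {f : Space d → ℂ}, FastDecay f →
        ENNReal.ofReal (∫ x, ‖𝓕⁻ f x‖ ^ 2) = ∫⁻ x, ‖𝓕⁻ f x‖ₑ ^ 2 := by
      intro f hf
      rw [ofReal_integral_eq_lintegral_ofReal hf.integrable_norm_sq
        (Eventually.of_forall fun x => by positivity)]
      refine lintegral_congr fun x => ?_
      rw [ENNReal.ofReal_pow (norm_nonneg _), ofReal_norm]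
    rw [← lintegral_enorm_sq_fourierInv (hn t ht).integrable (hn t ht).memLp_two,
      ← conv (hn t ht)]
    refine (ENNReal.ofReal_le_ofReal (hn2 t ht)).trans ?_
    rw [ENNReal.ofReal_mul hK, conv (ha t ht)]
    gcongr
    exact hA t ht
  set BG : ℝ≥0∞ := 2 * (ENNReal.ofReal CP ^ 2 * (S₁ + S₂) ^ 2) +
    2 * (ENNReal.ofReal K * (R₁ + R₂) ^ 2) with hBG
  have hGb : ∀ t ∈ Icc 0 T, ∫⁻ x, ‖𝓕⁻ (G t) x‖ₑ ^ 2 ≤ BG := by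
    intro t ht
    rw [lintegral_enorm_sq_fourierInv (hG t ht).integrable (hG t ht).memLp_two]
    calc ∫⁻ ξ, ‖G t ξ‖ₑ ^ 2
        ≤ ∫⁻ ξ, (2 * ‖-(P ξ : ℂ) * a t ξ‖ₑ ^ 2 + 2 * ‖n t ξ‖ₑ ^ 2) := by
          refine lintegral_mono fun ξ => ?_
          have := enorm_add_sq_le (-(P ξ : ℂ) * a t ξ) (- n t ξ)
          rw [enorm_neg] at this
          simp only [G, enorm_mul]
          rw [← enorm_mul, sub_eq_add_neg]
          simpa [← ofReal_norm] using this
      _ = 2 * (∫⁻ ξ, ‖-(P ξ : ℂ) * a t ξ‖ₑ ^ 2) + 2 * ∫⁻ ξ, ‖n t ξ‖ₑ ^ 2 := by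
          rw [lintegral_add_left' (((hPa t ht).aesm.enorm.pow_const 2).const_mul 2),
            lintegral_const_mul' _ _ (by simp), lintegral_const_mul' _ _ (by simp)]
      _ ≤ _ := by
          rw [hBG]
          gcongr
          · refine (lintegral_symbol_mul_sq_le hCP _).trans ?_
            gcongr
            have h := wnorm_add_le 2 (hg₁ t ht).1 (hg₂ t ht).1.neg
            have e : wnorm 2 (fun ξ => -g₂ t ξ) = wnorm 2 (g₂ t) := by simp [wnorm]
            rw [e] at h
            simp only [a, sub_eq_add_neg]
            exact h.trans (add_le_add (hS₁' t ht) (hS₂' t ht))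
          · exact hn3 t ht
  have hBGtop : (R₁ + R₂) ^ 2 + BG ≠ ⊤ := by
    have h1 : R₁ + R₂ ≠ ⊤ := ENNReal.add_ne_top.2 ⟨hR₁, hR₂⟩
    have h2 : S₁ + S₂ ≠ ⊤ := ENNReal.add_ne_top.2 ⟨hS₁, hS₂⟩
    rw [hBG]
    finiteness
  have hIoo : ∀ t ∈ Icc 0 T, ∀ᵐ s ∂(volume.restrict (Ioc 0 t)), s ∈ Ioo 0 T := by
    intro t ht
    rw [ae_restrict_iff' measurableSet_Ioc]
    have : ∀ᵐ s : ℝ, s ≠ t := by simp [ae_iff]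
    filter_upwards [this] with s hs hs'
    exact ⟨hs'.1, (lt_of_le_of_ne hs'.2 hs).trans_le ht.2⟩
  have hInt : ∀ t ∈ Icc 0 T, Integrable D (volume.prod (volume.restrict (Ioc 0 t))) := by
    intro t ht
    refine ⟨hDm.aestronglyMeasurable, ?_⟩
    rw [HasFiniteIntegral, lintegral_prod_symm _ hDm.enorm.aemeasurable]
    calc _ ≤ ∫⁻ s in Ioc 0 t, ((R₁ + R₂) ^ 2 + BG) := by
          refine lintegral_mono_ae ?_
          filter_upwards [hIoo t ht] with s hs
          have hs' := Ioo_subset_Icc_self hs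
          calc ∫⁻ x, ‖D (x, s)‖ₑ ≤ ∫⁻ x, (‖𝓕⁻ (a s) x‖ₑ ^ 2 + ‖𝓕⁻ (G s) x‖ₑ ^ 2) := by
                refine lintegral_mono fun x => ?_
                rw [hDeq s hs x]
                have h1 : ‖2 * (inner ℂ (𝓕⁻ (a s) x) (𝓕⁻ (G s) x)).re‖ ≤
                    ‖𝓕⁻ (a s) x‖ ^ 2 + ‖𝓕⁻ (G s) x‖ ^ 2 := by
                  have h2 := Complex.abs_re_le_norm (inner ℂ (𝓕⁻ (a s) x) (𝓕⁻ (G s) x))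
                  have h3 := norm_inner_le_norm (𝕜 := ℂ) (𝓕⁻ (a s) x) (𝓕⁻ (G s) x)
                  rw [Real.norm_eq_abs, abs_mul, abs_of_pos (by norm_num : (0 : ℝ) < 2)]
                  nlinarith [sq_nonneg (‖𝓕⁻ (a s) x‖ - ‖𝓕⁻ (G s) x‖)]
                have := ENNReal.ofReal_le_ofReal h1
                rwa [ENNReal.ofReal_add (by positivity) (by positivity),
                  ENNReal.ofReal_pow (norm_nonneg _), ENNReal.ofReal_pow (norm_nonneg _),
                  ofReal_norm, ofReal_norm, ofReal_norm] at this
            _ = (∫⁻ x, ‖𝓕⁻ (a s) x‖ₑ ^ 2) + ∫⁻ x, ‖𝓕⁻ (G s) x‖ₑ ^ 2 :=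
                lintegral_add_left' ((continuous_fourierInv
                  (ha s hs').integrable).aestronglyMeasurable.enorm.pow_const 2) _
            _ ≤ _ := add_le_add (hA s hs') (hGb s hs')
      _ < ⊤ := by
          rw [setLIntegral_const]
          refine ENNReal.mul_lt_top hBGtop.lt_top ?_
          simp
  let y : ℝ → ℝ := fun t => ∫ x, ‖w t x‖ ^ 2
  have hproj : ∀ t, ∃ s ∈ Icc 0 T, w t = w s := by
    intro t
    refine ⟨projIcc 0 T hT t, (projIcc 0 T hT t).2, ?_⟩
    funext x
    simp [w, projIcc_val]
  have hyS : ∀ t, y t ≤ ((R₁ + R₂) ^ 2).toReal := by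
    intro t
    obtain ⟨s, hs, e⟩ := hproj t
    simp only [y]
    rw [e, hw s hs, integral_eq_lintegral_of_nonneg_ae (Eventually.of_forall fun x => by positivity)
      (ha s hs).integrable_norm_sq.1]
    refine ENNReal.toReal_mono ?_ (le_trans (le_of_eq ?_) (hA s hs))
    · have h1 : R₁ + R₂ ≠ ⊤ := ENNReal.add_ne_top.2 ⟨hR₁, hR₂⟩
      finiteness
    · refine lintegral_congr fun x => ?_
      rw [ENNReal.ofReal_pow (norm_nonneg _), ofReal_norm]
  have hym : Measurable y := by
    have : StronglyMeasurable (fun p : ℝ × Space d => ‖w p.1 p.2‖ ^ 2) :=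
      (hwc.norm.pow 2).stronglyMeasurable
    exact this.integral_prod_right.measurable
  have hyle : ∀ t ∈ Icc 0 T, y t ≤ (1 + K) * ∫ s in (0 : ℝ)..t, y s := by
    intro t ht
    have h0 : ∀ x, w 0 x = 0 := by
      intro x
      simp [w, h₁.initial, h₂.initial]
    have e1 : y t = ∫ x, ∫ s in Ioc 0 t, D (x, s) := by
      refine integral_congr_ae ?_
      filter_upwards [(hInt t ht).prod_right_ae] with x hx
      rw [← intervalIntegral.integral_of_le ht.1,
        intervalIntegral.integral_eq_sub_of_hasDerivAt_of_le (f := fun τ => ‖w τ x‖ ^ 2) ht.1]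
      · simp [h0]
      · exact (((hwc.comp (continuous_id.prodMk continuous_const)).norm.pow 2)).continuousOn
      · intro s hs
        have hs' : s ∈ Ioo 0 T := ⟨hs.1, hs.2.trans_le ht.2⟩
        rw [hDeq s hs' x]
        exact hDd s hs' x
      · exact (intervalIntegrable_iff_integrableOn_Ioc_of_le ht.1).2 hx
    rw [e1, integral_integral_swap (hInt t ht), intervalIntegral.integral_of_le ht.1,
      ← integral_const_mul]
    have hyi : IntegrableOn y (Ioc 0 t) volume := by
      refine Measure.integrableOn_of_bounded (M := ((R₁ + R₂) ^ 2).toReal) (by simp)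
        hym.aestronglyMeasurable (Eventually.of_forall fun s => ?_)
      rw [Real.norm_of_nonneg (integral_nonneg fun x => by positivity)]
      exact hyS s
    refine integral_mono_ae (hInt t ht).integral_prod_right (hyi.const_mul _) ?_
    filter_upwards [hIoo t ht] with s hs
    have hs' := Ioo_subset_Icc_self hs
    simp only [hDeq s hs, y]
    refine (integral_re_inner_le (ha s hs') (hn s hs') (hG s hs')).trans ?_
    rw [hw s hs', add_mul, one_mul]
    gcongr
    exact hn2 s hs'
  have hy := eq_zero_of_le_integral (by positivity : 0 ≤ 1 + K)
    (fun t => integral_nonneg fun x => by positivity) hyS hym hyle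
  intro t ht
  have h1 := hy t ht
  have h2 : Integrable (fun x => ‖w t x‖ ^ 2) volume := by
    rw [hw t ht]; exact (ha t ht).integrable_norm_sq
  have h3 := (integral_eq_zero_iff_of_nonneg (fun x => by positivity) h2).1 h1
  have hc : Continuous (w t) := hwc.comp (continuous_const.prodMk continuous_id)
  have h4 : (fun x => ‖w t x‖ ^ 2) = 0 :=
    ((hc.norm.pow 2).ae_eq_iff_eq (μ := volume) continuous_zero).1 h3
  funext x
  have h5 := congrFun h4 x
  simp only [Pi.zero_apply, ne_eq, OfNat.ofNat_ne_zero, not_false_eq_true, pow_eq_zero_iff,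
    norm_eq_zero, w, projIcc_of_mem hT ht] at h5
  exact sub_eq_zero.1 h5

/-! ### Convolution algebras with a weight -/

/-- Exponentially decreasing weights `W` with `W ∗ W ≤ W`.  For such a weight the functions bounded
by a multiple of `W` form a Banach algebra under convolution. -/
structure IsWeight (W : Space d → ℝ) : Prop where
  cont : Continuous W
  pos : ∀ ξ, 0 < W ξ
  even : ∀ ξ, W (-ξ) = W ξ
  conv_le : ∀ ξ, ∫ η, W η * W (ξ - η) ≤ W ξ
  decay : ∃ C δ : ℝ, 0 < δ ∧ ∀ ξ, W ξ ≤ C * Real.exp (-(δ * ‖ξ‖))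

theorem exists_pow_mul_exp_le (k : ℕ) {δ : ℝ} (hδ : 0 < δ) :
    ∃ C : ℝ, ∀ x : ℝ, 0 ≤ x → (1 + x) ^ k * Real.exp (-(δ * x)) ≤ C := by
  have h1 : Tendsto (fun x : ℝ => x ^ k * Real.exp (-δ * x)) atTop (𝓝 0) := by
    have := Real.tendsto_pow_mul_exp_neg_atTop_nhds_zero k
    have h2 := (this.comp (tendsto_id.const_mul_atTop hδ)).const_mul ((δ ^ k)⁻¹)
    rw [mul_zero] at h2
    refine h2.congr fun x => ?_
    simp only [Function.comp, id, mul_pow]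
    have : δ ^ k ≠ 0 := by positivity
    field_simp
  refine ⟨(k.factorial / δ ^ k) * Real.exp δ, fun x hx => ?_⟩
  have h3 : (δ * (1 + x)) ^ k / k.factorial ≤ Real.exp (δ * (1 + x)) :=
    Real.pow_div_factorial_le_exp _ (by positivity) k
  have h4 : Real.exp (δ * (1 + x)) * Real.exp (-(δ * x)) = Real.exp δ := by
    rw [← Real.exp_add]; ring_nf
  have h5 : (1 + x) ^ k = (k.factorial / δ ^ k) * ((δ * (1 + x)) ^ k / k.factorial) := by
    rw [mul_pow]; field_simp
  rw [h5, mul_assoc]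
  refine mul_le_mul_of_nonneg_left ?_ (by positivity)
  rw [← h4]
  gcongr

namespace IsWeight

variable {W : Space d → ℝ}

theorem exists_pow_mul_le (hW : IsWeight W) (k : ℕ) :
    ∃ C : ℝ, ∀ ξ, (1 + ‖ξ‖) ^ k * W ξ ≤ C := by
  obtain ⟨C, δ, hδ, h⟩ := hW.decay
  obtain ⟨C', h'⟩ := exists_pow_mul_exp_le k hδ
  have hC : 0 ≤ C := by
    have := (hW.pos 0).le.trans (h 0)
    simpa using this
  refine ⟨C * C', fun ξ => ?_⟩
  calc (1 + ‖ξ‖) ^ k * W ξ ≤ (1 + ‖ξ‖) ^ k * (C * Real.exp (-(δ * ‖ξ‖))) := by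
        gcongr; exact h ξ
    _ = C * ((1 + ‖ξ‖) ^ k * Real.exp (-(δ * ‖ξ‖))) := by ring
    _ ≤ _ := by gcongr; exact h' _ (norm_nonneg _)

theorem fastDecay_of_le (hW : IsWeight W) {g : Space d → ℂ} (hg : AEStronglyMeasurable g volume)
    {M : ℝ} (h : ∀ ξ, ‖g ξ‖ ≤ M * W ξ) : FastDecay g := by
  refine FastDecay.of_bound hg fun k => ?_
  obtain ⟨C, hC⟩ := hW.exists_pow_mul_le k
  have hM : 0 ≤ M := by
    have := (norm_nonneg _).trans (h 0)
    exact nonneg_of_mul_nonneg_left this (hW.pos 0)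
  refine ⟨M * C, fun ξ => ?_⟩
  calc (1 + ‖ξ‖) ^ k * ‖g ξ‖ ≤ (1 + ‖ξ‖) ^ k * (M * W ξ) := by gcongr; exact h ξ
    _ = M * ((1 + ‖ξ‖) ^ k * W ξ) := by ring
    _ ≤ _ := by gcongr; exact hC ξ

theorem fastDecay (hW : IsWeight W) : FastDecay (fun ξ => (W ξ : ℂ)) :=
  hW.fastDecay_of_le (M := 1)
    (Complex.continuous_ofReal.comp hW.cont).aestronglyMeasurable
    fun ξ => by simp [abs_of_pos (hW.pos ξ)]

theorem integrable (hW : IsWeight W) : Integrable W volume := by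
  have := hW.fastDecay.integrable.norm
  refine this.congr (Eventually.of_forall fun ξ => ?_)
  simp [abs_of_pos (hW.pos ξ)]

theorem integrable_mul (hW : IsWeight W) (ξ : Space d) :
    Integrable (fun η => W η * W (ξ - η)) volume := by
  obtain ⟨C, hC⟩ := hW.exists_pow_mul_le 0
  refine (hW.integrable.mul_const C).mono'
    (hW.cont.mul (hW.cont.comp (continuous_const.sub continuous_id))).aestronglyMeasurable
    (Eventually.of_forall fun η => ?_)
  rw [Real.norm_of_nonneg (mul_nonneg (hW.pos _).le (hW.pos _).le)]
  have := hC (ξ - η)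
  rw [pow_zero, one_mul] at this
  have := (hW.pos η).le
  gcongr

end IsWeight

/-- The functions of time and frequency, measured in units of the weight: the profile `h` stands for
the function `W(ξ) h(t, ξ)`.  Bounded continuous functions form a complete space, in which a
contraction can be iterated. -/
abbrev Profile (d : ℕ) : Type := (ℝ × Space d) →ᵇ ℂ

/-- The function of frequency that a profile represents at time `t`. -/
noncomputable def slice (W : Space d → ℝ) (h : Profile d) (t : ℝ) (ξ : Space d) : ℂ :=
    W ξ * h (t, ξ)

theorem norm_slice_le {W : Space d → ℝ} (hW : IsWeight W) (h : Profile d) (t : ℝ) (ξ : Space d) :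
    ‖slice W h t ξ‖ ≤ ‖h‖ * W ξ := by
  rw [slice, norm_mul, Complex.norm_real, Real.norm_of_nonneg (hW.pos ξ).le, mul_comm]
  have := (hW.pos ξ).le
  gcongr
  exact h.norm_coe_le_norm _

theorem continuous_slice {W : Space d → ℝ} (hW : IsWeight W) (h : Profile d) :
    Continuous (fun p : ℝ × Space d => slice W h p.1 p.2) := by
  have := hW.cont
  unfold slice
  fun_prop

theorem fastDecay_slice {W : Space d → ℝ} (hW : IsWeight W) (h : Profile d) (t : ℝ) :
    FastDecay (slice W h t) :=
  hW.fastDecay_of_le (((continuous_slice hW h).comp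
    (continuous_const.prodMk continuous_id)).aestronglyMeasurable) (norm_slice_le hW h t)

theorem norm_conv_integrand_le {W : Space d → ℝ} (hW : IsWeight W) {m : Space d → ℝ} {C : ℝ}
    (hm : IsMultiplier m C) (h k : Profile d) (t : ℝ) (ξ η : Space d) :
    ‖(m η : ℂ) * slice W h t η * slice W k t (ξ - η)‖ ≤
      (C * ‖h‖ * ‖k‖) * (W η * W (ξ - η)) := by
  rw [norm_mul, norm_mul, Complex.norm_real, Real.norm_eq_abs]
  calc _ ≤ C * (‖h‖ * W η) * (‖k‖ * W (ξ - η)) := by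
        have := hm.nonneg
        have := (hW.pos η).le
        gcongr
        · exact hm.bound η
        · exact norm_slice_le hW h t η
        · exact norm_slice_le hW k t _
    _ = _ := by ring

/-- The inequality `W ∗ W ≤ W` makes the bounded profiles an algebra. -/
theorem norm_cconv_slice_le {W : Space d → ℝ} (hW : IsWeight W) {m : Space d → ℝ} {C : ℝ}
    (hm : IsMultiplier m C) (h k : Profile d) (t : ℝ) (ξ : Space d) :
    ‖cconv (fun η => (m η : ℂ) * slice W h t η) (slice W k t) ξ‖ ≤ (C * ‖h‖ * ‖k‖) * W ξ := by
  rw [cconv_apply]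
  calc _ ≤ ∫ η, (C * ‖h‖ * ‖k‖) * (W η * W (ξ - η)) :=
        norm_integral_le_of_norm_le ((hW.integrable_mul ξ).const_mul _)
          (Eventually.of_forall fun η => norm_conv_integrand_le hW hm h k t ξ η)
    _ ≤ _ := by
        have := hm.nonneg
        rw [integral_const_mul]
        gcongr
        exact hW.conv_le ξ

theorem continuous_cconv_slice {W : Space d → ℝ} (hW : IsWeight W) {m : Space d → ℝ} {C : ℝ}
    (hm : IsMultiplier m C) (h k : Profile d) :
    Continuous (fun p : ℝ × Space d =>
      cconv (fun η => (m η : ℂ) * slice W h p.1 η) (slice W k p.1) p.2) := by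
  simp only [cconv_apply]
  obtain ⟨S, hS⟩ := hW.exists_pow_mul_le 0
  simp only [pow_zero, one_mul] at hS
  refine continuous_of_dominated (bound := fun η => (C * ‖h‖ * ‖k‖) * (W η * S)) ?_ ?_ ?_ ?_
  · intro p
    refine ((Complex.measurable_ofReal.comp hm.measurable).aestronglyMeasurable.mul
      (fastDecay_slice hW h p.1).aesm).mul ?_
    exact (((continuous_slice hW k).comp (continuous_const.prodMk
      (continuous_const.sub continuous_id)))).aestronglyMeasurable
  · intro p
    refine Eventually.of_forall fun η => (norm_conv_integrand_le hW hm h k p.1 p.2 η).trans ?_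
    have := hm.nonneg
    have := (hW.pos η).le
    gcongr
    exact hS _
  · exact (hW.integrable.mul_const S).const_mul _
  · refine Eventually.of_forall fun η => ?_
    have h1 : Continuous fun p : ℝ × Space d => slice W h p.1 η :=
      (continuous_slice hW h).comp (continuous_fst.prodMk continuous_const)
    have h2 : Continuous fun p : ℝ × Space d => slice W k p.1 (p.2 - η) :=
      (continuous_slice hW k).comp (continuous_fst.prodMk (continuous_snd.sub continuous_const))
    fun_prop

/-- The product of profiles that corresponds to the convolution of `m h` and `k`. -/
noncomputable def profileMul {W : Space d → ℝ} (hW : IsWeight W) {m : Space d → ℝ} {C : ℝ}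
    (hm : IsMultiplier m C) (h k : Profile d) : Profile d :=
  BoundedContinuousFunction.ofNormedAddCommGroup
    (fun p : ℝ × Space d => (W p.2 : ℂ)⁻¹ *
      cconv (fun η => (m η : ℂ) * slice W h p.1 η) (slice W k p.1) p.2)
    (by
      have h1 := continuous_cconv_slice hW hm h k
      have h2 : Continuous fun p : ℝ × Space d => (W p.2 : ℂ)⁻¹ :=
        Continuous.inv₀ (Complex.continuous_ofReal.comp (hW.cont.comp continuous_snd))
          (fun p => by exact_mod_cast (hW.pos p.2).ne')
      exact h2.mul h1)
    (C * ‖h‖ * ‖k‖) (by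
      rintro ⟨t, ξ⟩
      have := norm_cconv_slice_le hW hm h k t ξ
      have hp := hW.pos ξ
      rw [norm_mul, norm_inv, Complex.norm_real, Real.norm_of_nonneg hp.le, inv_mul_le_iff₀ hp,
        mul_comm]
      exact this)

section Algebra

variable {W : Space d → ℝ} (hW : IsWeight W) {m : Space d → ℝ} {C : ℝ} (hm : IsMultiplier m C)

theorem slice_profileMul (h k : Profile d) (t : ℝ) :
    slice W (profileMul hW hm h k) t =
      cconv (fun η => (m η : ℂ) * slice W h t η) (slice W k t) := by
  funext ξ
  have : (W ξ : ℂ) ≠ 0 := by exact_mod_cast (hW.pos ξ).ne'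
  simp only [slice, profileMul, BoundedContinuousFunction.coe_ofNormedAddCommGroup]
  rw [mul_inv_cancel_left₀ this]

theorem profile_ext {W : Space d → ℝ} (hW : IsWeight W) {h k : Profile d}
    (e : ∀ t ξ, slice W h t ξ = slice W k t ξ) : h = k := by
  ext ⟨t, ξ⟩
  have : (W ξ : ℂ) ≠ 0 := by exact_mod_cast (hW.pos ξ).ne'
  exact mul_left_cancel₀ this (e t ξ)

theorem norm_profileMul_le (h k : Profile d) : ‖profileMul hW hm h k‖ ≤ C * ‖h‖ * ‖k‖ := by
  have := hm.nonneg
  exact BoundedContinuousFunction.norm_ofNormedAddCommGroup_le _ (by positivity) _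

theorem slice_sub (h k : Profile d) (t : ℝ) (ξ : Space d) :
    slice W (h - k) t ξ = slice W h t ξ - slice W k t ξ := by
  simp [slice, mul_sub]

theorem slice_add (h k : Profile d) (t : ℝ) (ξ : Space d) :
    slice W (h + k) t ξ = slice W h t ξ + slice W k t ξ := by
  simp [slice, mul_add]

theorem integrable_conv_integrand {W : Space d → ℝ} (hW : IsWeight W) {m : Space d → ℝ} {C : ℝ}
    (hm : IsMultiplier m C) (h k : Profile d) (t : ℝ) (ξ : Space d) :
    Integrable (fun η => (m η : ℂ) * slice W h t η * slice W k t (ξ - η)) volume := by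
  refine ((hW.integrable_mul ξ).const_mul (C * ‖h‖ * ‖k‖)).mono' ?_
    (Eventually.of_forall fun η => norm_conv_integrand_le hW hm h k t ξ η)
  refine ((Complex.measurable_ofReal.comp hm.measurable).aestronglyMeasurable.mul
    (fastDecay_slice hW h t).aesm).mul ?_
  exact (((continuous_slice hW k).comp (continuous_const.prodMk
    (continuous_const.sub continuous_id)))).aestronglyMeasurable

theorem profileMul_sub_profileMul (h k h' k' : Profile d) :
    profileMul hW hm h k - profileMul hW hm h' k' =
      profileMul hW hm (h - h') k + profileMul hW hm h' (k - k') := by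
  refine profile_ext hW fun t ξ => ?_
  simp only [slice_sub, slice_add, slice_profileMul, cconv_apply]
  rw [← integral_sub (integrable_conv_integrand hW hm h k t ξ)
      (integrable_conv_integrand hW hm h' k' t ξ)]
  have e1 := integrable_conv_integrand hW hm (h - h') k t ξ
  have e2 := integrable_conv_integrand hW hm h' (k - k') t ξ
  simp only [slice_sub] at e1 e2
  rw [← integral_add e1 e2]
  refine integral_congr_ae (Eventually.of_forall fun η => ?_)
  simp only; ring

theorem norm_profileMul_sub_le (h k h' k' : Profile d) :
    ‖profileMul hW hm h k - profileMul hW hm h' k'‖ ≤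
      C * ‖h - h'‖ * ‖k‖ + C * ‖h'‖ * ‖k - k'‖ := by
  rw [profileMul_sub_profileMul]
  exact (norm_add_le _ _).trans
    (add_le_add (norm_profileMul_le hW hm _ _) (norm_profileMul_le hW hm _ _))

/-- The profile of the conjugate reflection. -/
noncomputable def profileStar (h : Profile d) : Profile d :=
  BoundedContinuousFunction.ofNormedAddCommGroup
    (fun p : ℝ × Space d => starRingEnd ℂ (h (p.1, -p.2)))
    (Complex.continuous_conj.comp (h.continuous.comp
      (continuous_fst.prodMk continuous_snd.neg))) ‖h‖
    (fun p => by
      rw [RCLike.norm_conj]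
      exact h.norm_coe_le_norm _)

theorem norm_profileStar_le (h : Profile d) : ‖profileStar h‖ ≤ ‖h‖ :=
  BoundedContinuousFunction.norm_ofNormedAddCommGroup_le _ (norm_nonneg _) _

theorem profileStar_sub (h k : Profile d) :
    profileStar h - profileStar k = profileStar (h - k) := by
  ext p
  simp [profileStar]

theorem slice_profileStar {W : Space d → ℝ} (hW : IsWeight W) (h : Profile d) (t : ℝ) :
    slice W (profileStar h) t = conjReflect (slice W h t) := by
  funext ξ
  simp [slice, profileStar, conjReflect, hW.even]

/-- The unit multiplier. -/
theorem isMultiplier_one : IsMultiplier (fun _ : Space d => (1 : ℝ)) 1 := by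
  simpa using isMultiplier_const (d := d) 1

/-- The profile of `autoConv`. -/
noncomputable def profileAuto (h : Profile d) : Profile d :=
  profileMul hW isMultiplier_one h (profileStar h)

theorem slice_profileAuto (h : Profile d) (t : ℝ) :
    slice W (profileAuto hW h) t = autoConv (slice W h t) := by
  rw [profileAuto, slice_profileMul, slice_profileStar hW, autoConv]
  simp

/-- The profile of `oddPower`. -/
noncomputable def profilePow (j : ℕ) (h : Profile d) : Profile d :=
  (profileMul hW isMultiplier_one (profileAuto hW h))^[j] h

theorem profilePow_succ (j : ℕ) (h : Profile d) : profilePow hW (j + 1) h =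
    profileMul hW isMultiplier_one (profileAuto hW h) (profilePow hW j h) :=
  Function.iterate_succ_apply' _ _ _

theorem slice_profilePow (j : ℕ) (h : Profile d) (t : ℝ) :
    slice W (profilePow hW j h) t = oddPower j (slice W h t) := by
  induction j with
  | zero => rfl
  | succ j ih =>
    rw [profilePow_succ, slice_profileMul, ih, slice_profileAuto, oddPower_succ]
    simp

/-- The profile of the nonlinearity. -/
noncomputable def profileNonlin (j : ℕ) (h : Profile d) : Profile d :=
  profileMul hW hm (profileAuto hW h) (profilePow hW j h)

theorem slice_profileNonlin (j : ℕ) (h : Profile d) (t : ℝ) :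
    slice W (profileNonlin hW hm j h) t = nonlin m j (slice W h t) := by
  rw [profileNonlin, slice_profileMul, slice_profileAuto, slice_profilePow, nonlin]

theorem norm_profileAuto_le {M : ℝ} {h : Profile d} (hh : ‖h‖ ≤ M) :
    ‖profileAuto hW h‖ ≤ M ^ 2 := by
  have hM := (norm_nonneg h).trans hh
  calc _ ≤ 1 * ‖h‖ * ‖profileStar h‖ := norm_profileMul_le _ _ _ _
    _ ≤ 1 * M * M := by gcongr; exact (norm_profileStar_le h).trans hh
    _ = _ := by ring

theorem norm_profilePow_le (j : ℕ) {M : ℝ} {h : Profile d} (hh : ‖h‖ ≤ M) :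
    ‖profilePow hW j h‖ ≤ M ^ (2 * j + 1) := by
  have hM := (norm_nonneg h).trans hh
  induction j with
  | zero => simpa [profilePow] using hh
  | succ j ih =>
    rw [profilePow_succ]
    calc _ ≤ 1 * ‖profileAuto hW h‖ * ‖profilePow hW j h‖ := norm_profileMul_le _ _ _ _
      _ ≤ 1 * M ^ 2 * M ^ (2 * j + 1) := by gcongr; exact norm_profileAuto_le hW hh
      _ = _ := by ring

theorem norm_profileAuto_sub_le {M : ℝ} {h k : Profile d} (hh : ‖h‖ ≤ M) (hk : ‖k‖ ≤ M) :
    ‖profileAuto hW h - profileAuto hW k‖ ≤ 2 * M * ‖h - k‖ := by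
  have hM := (norm_nonneg h).trans hh
  calc _ ≤ 1 * ‖h - k‖ * ‖profileStar h‖ + 1 * ‖k‖ * ‖profileStar h - profileStar k‖ :=
        norm_profileMul_sub_le _ _ _ _ _ _
    _ ≤ 1 * ‖h - k‖ * M + 1 * M * ‖h - k‖ := by
        rw [profileStar_sub]
        gcongr
        · exact (norm_profileStar_le h).trans hh
        · exact norm_profileStar_le _
    _ = _ := by ring

theorem norm_profilePow_sub_le (j : ℕ) {M : ℝ} {h k : Profile d} (hh : ‖h‖ ≤ M) (hk : ‖k‖ ≤ M) :
    ‖profilePow hW j h - profilePow hW j k‖ ≤ (2 * j + 1) * M ^ (2 * j) * ‖h - k‖ := by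
  have hM := (norm_nonneg h).trans hh
  induction j with
  | zero => simp [profilePow]
  | succ j ih =>
    rw [profilePow_succ, profilePow_succ]
    calc _ ≤ 1 * ‖profileAuto hW h - profileAuto hW k‖ * ‖profilePow hW j h‖ +
          1 * ‖profileAuto hW k‖ * ‖profilePow hW j h - profilePow hW j k‖ :=
          norm_profileMul_sub_le _ _ _ _ _ _
      _ ≤ 1 * (2 * M * ‖h - k‖) * M ^ (2 * j + 1) +
          1 * M ^ 2 * ((2 * j + 1) * M ^ (2 * j) * ‖h - k‖) := by
          gcongr
          · exact norm_profileAuto_sub_le hW hh hk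
          · exact norm_profilePow_le hW j hh
          · exact norm_profileAuto_le hW hk
      _ = _ := by push_cast; ring

theorem norm_profileNonlin_le (j : ℕ) {M : ℝ} {h : Profile d} (hh : ‖h‖ ≤ M) :
    ‖profileNonlin hW hm j h‖ ≤ C * M ^ (2 * j + 3) := by
  have hM := (norm_nonneg h).trans hh
  have hC := hm.nonneg
  calc _ ≤ C * ‖profileAuto hW h‖ * ‖profilePow hW j h‖ := norm_profileMul_le _ _ _ _
    _ ≤ C * M ^ 2 * M ^ (2 * j + 1) := by
        gcongr
        · exact norm_profileAuto_le hW hh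
        · exact norm_profilePow_le hW j hh
    _ = _ := by ring

theorem norm_profileNonlin_sub_le (j : ℕ) {M : ℝ} {h k : Profile d} (hh : ‖h‖ ≤ M)
    (hk : ‖k‖ ≤ M) :
    ‖profileNonlin hW hm j h - profileNonlin hW hm j k‖ ≤
      C * (2 * j + 3) * M ^ (2 * j + 2) * ‖h - k‖ := by
  have hM := (norm_nonneg h).trans hh
  have hC := hm.nonneg
  calc _ ≤ C * ‖profileAuto hW h - profileAuto hW k‖ * ‖profilePow hW j h‖ +
          C * ‖profileAuto hW k‖ * ‖profilePow hW j h - profilePow hW j k‖ :=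
          norm_profileMul_sub_le _ _ _ _ _ _
    _ ≤ C * (2 * M * ‖h - k‖) * M ^ (2 * j + 1) +
          C * M ^ 2 * ((2 * j + 1) * M ^ (2 * j) * ‖h - k‖) := by
          gcongr
          · exact norm_profileAuto_sub_le hW hh hk
          · exact norm_profilePow_le hW j hh
          · exact norm_profileAuto_le hW hk
          · exact norm_profilePow_sub_le hW j hh hk
    _ = _ := by ring

end Algebra

/-! ### Existence of solutions in a weighted algebra -/

/-- Multiplication of a profile by `e^{i σ t P(ξ)}`. -/
noncomputable def phase {P : Space d → ℝ} (hP : Continuous P) (σ : ℝ) (h : Profile d) : Profile d :=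
  BoundedContinuousFunction.ofNormedAddCommGroup
    (fun p : ℝ × Space d => Complex.exp ((σ * p.1 * P p.2 : ℝ) * Complex.I) * h p)
    (by fun_prop) ‖h‖
    (fun p => by
      rw [norm_mul, Complex.norm_exp_ofReal_mul_I, one_mul]
      exact h.norm_coe_le_norm _)

theorem phase_apply {P : Space d → ℝ} (hP : Continuous P) (σ : ℝ) (h : Profile d) (t : ℝ)
    (ξ : Space d) :
    phase hP σ h (t, ξ) = Complex.exp ((σ * t * P ξ : ℝ) * Complex.I) * h (t, ξ) := rfl

theorem norm_phase_le {P : Space d → ℝ} (hP : Continuous P) (σ : ℝ) (h : Profile d) :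
    ‖phase hP σ h‖ ≤ ‖h‖ :=
  BoundedContinuousFunction.norm_ofNormedAddCommGroup_le _ (norm_nonneg _) _

theorem phase_sub {P : Space d → ℝ} (hP : Continuous P) (σ : ℝ) (h k : Profile d) :
    phase hP σ h - phase hP σ k = phase hP σ (h - k) := by
  ext ⟨t, ξ⟩
  simp [phase_apply, mul_sub]

theorem abs_clamp_le {T : ℝ} (hT : 0 ≤ T) (t : ℝ) : |max (-T) (min T t)| ≤ T := by
  rw [abs_le]
  exact ⟨le_max_left _ _, max_le (by linarith) (min_le_left _ _)⟩

/-- Integration in time from `0`.  The time variable is truncated to `[-T, T]` to make the result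
bounded on all of `ℝ`; the two-sided interval makes `0` an interior point, where the equation is
differentiated. -/
noncomputable def timeInt {T : ℝ} (hT : 0 ≤ T) (h : Profile d) : Profile d :=
  BoundedContinuousFunction.ofNormedAddCommGroup
    (fun p : ℝ × Space d => ∫ s in (0 : ℝ)..(max (-T) (min T p.1)), h (s, p.2))
    (by
      refine intervalIntegral.continuous_parametric_intervalIntegral_of_continuous
        (f := fun (p : ℝ × Space d) s => h (s, p.2)) ?_ ?_
      · have := h.continuous
        fun_prop
      · fun_prop)
    (‖h‖ * T)
    (fun p => by
      refine (intervalIntegral.norm_integral_le_of_norm_le_const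
        (fun s _ => h.norm_coe_le_norm _)).trans ?_
      rw [sub_zero]
      gcongr
      exact abs_clamp_le hT _)

theorem timeInt_apply {T : ℝ} (hT : 0 ≤ T) (h : Profile d) {t : ℝ} (ht : t ∈ Icc (-T) T)
    (ξ : Space d) : timeInt hT h (t, ξ) = ∫ s in (0 : ℝ)..t, h (s, ξ) := by
  have : max (-T) (min T t) = t := by rw [min_eq_right ht.2, max_eq_right ht.1]
  simp [timeInt, this]

theorem norm_timeInt_le {T : ℝ} (hT : 0 ≤ T) (h : Profile d) : ‖timeInt hT h‖ ≤ ‖h‖ * T :=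
  BoundedContinuousFunction.norm_ofNormedAddCommGroup_le _ (by positivity) _

theorem timeInt_sub {T : ℝ} (hT : 0 ≤ T) (h k : Profile d) :
    timeInt hT h - timeInt hT k = timeInt hT (h - k) := by
  ext ⟨t, ξ⟩
  simp only [timeInt, BoundedContinuousFunction.coe_sub, Pi.sub_apply,
    BoundedContinuousFunction.coe_ofNormedAddCommGroup]
  rw [intervalIntegral.integral_sub]
  · exact Continuous.intervalIntegrable (by have := h.continuous; fun_prop) _ _
  · exact Continuous.intervalIntegrable (by have := k.continuous; fun_prop) _ _

/-- The profile, constant in time, of a function of frequency. -/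
noncomputable def constProfile {W : Space d → ℝ} (hW : IsWeight W) {g : Space d → ℂ}
    (hg : Continuous g) {M : ℝ} (h : ∀ ξ, ‖g ξ‖ ≤ M * W ξ) : Profile d :=
  BoundedContinuousFunction.ofNormedAddCommGroup
    (fun p : ℝ × Space d => (W p.2 : ℂ)⁻¹ * g p.2)
    (by
      have h2 : Continuous fun p : ℝ × Space d => (W p.2 : ℂ)⁻¹ :=
        Continuous.inv₀ (Complex.continuous_ofReal.comp (hW.cont.comp continuous_snd))
          (fun p => by exact_mod_cast (hW.pos p.2).ne')
      fun_prop) M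
    (fun p => by
      have hp := hW.pos p.2
      rw [norm_mul, norm_inv, Complex.norm_real, Real.norm_of_nonneg hp.le, inv_mul_le_iff₀ hp,
        mul_comm]
      exact h p.2)

theorem slice_constProfile {W : Space d → ℝ} (hW : IsWeight W) {g : Space d → ℂ}
    (hg : Continuous g) {M : ℝ} (h : ∀ ξ, ‖g ξ‖ ≤ M * W ξ) (t : ℝ) :
    slice W (constProfile hW hg h) t = g := by
  funext ξ
  have : (W ξ : ℂ) ≠ 0 := by exact_mod_cast (hW.pos ξ).ne'
  simp only [slice, constProfile, BoundedContinuousFunction.coe_ofNormedAddCommGroup]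
  rw [mul_inv_cancel_left₀ this]

theorem norm_constProfile_le {W : Space d → ℝ} (hW : IsWeight W) {g : Space d → ℂ}
    (hg : Continuous g) {M : ℝ} (hM : 0 ≤ M) (h : ∀ ξ, ‖g ξ‖ ≤ M * W ξ) :
    ‖constProfile hW hg h‖ ≤ M :=
  BoundedContinuousFunction.norm_ofNormedAddCommGroup_le _ hM _

/-- The nonlinearity in the interaction picture, `e^{itP} 𝒩(e^{-itP} h)` with `𝒩` the nonlinearity
on the Fourier side. -/
noncomputable def interaction {W : Space d → ℝ} (hW : IsWeight W) {m : Space d → ℝ} {C : ℝ}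
    (hm : IsMultiplier m C) {P : Space d → ℝ} (hP : Continuous P) (j : ℕ) (h : Profile d) :
    Profile d :=
  phase hP 1 (profileNonlin hW hm j (phase hP (-1) h))

section FixedPoint

variable {W : Space d → ℝ} (hW : IsWeight W) {m : Space d → ℝ} {C : ℝ} (hm : IsMultiplier m C)
  {P : Space d → ℝ} (hP : Continuous P) (j : ℕ)

theorem norm_interaction_le {M : ℝ} {h : Profile d} (hh : ‖h‖ ≤ M) :
    ‖interaction hW hm hP j h‖ ≤ C * M ^ (2 * j + 3) :=
  (norm_phase_le _ _ _).trans (norm_profileNonlin_le hW hm j ((norm_phase_le _ _ _).trans hh))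

theorem norm_interaction_sub_le {M : ℝ} {h k : Profile d} (hh : ‖h‖ ≤ M) (hk : ‖k‖ ≤ M) :
    ‖interaction hW hm hP j h - interaction hW hm hP j k‖ ≤
      C * (2 * j + 3) * M ^ (2 * j + 2) * ‖h - k‖ := by
  have hM := (norm_nonneg h).trans hh
  have hC := hm.nonneg
  rw [interaction, interaction, phase_sub]
  refine (norm_phase_le _ _ _).trans ((norm_profileNonlin_sub_le hW hm j
    ((norm_phase_le _ _ _).trans hh) ((norm_phase_le _ _ _).trans hk)).trans ?_)
  rw [phase_sub]
  gcongr
  exact norm_phase_le _ _ _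

/-- Solution of the integrated equation in the interaction picture by contraction, on a time
interval whose length is inverse to the power `2j + 2` of the size of the datum in the weighted
algebra. -/
theorem exists_fixed_profile (H₀ : Profile d) {M T : ℝ} (hM : 0 < M) (hT : 0 ≤ T)
    (hH : ‖H₀‖ ≤ M) (hsmall : T * (C * (2 * j + 3) * (2 * M) ^ (2 * j + 2)) ≤ 1 / 2) :
    ∃ h : Profile d, ‖h‖ ≤ 2 * M ∧
      h = H₀ - Complex.I • timeInt hT (interaction hW hm hP j h) := by
  have hC := hm.nonneg
  let Φ : Profile d → Profile d := fun h => H₀ - Complex.I • timeInt hT (interaction hW hm hP j h)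
  have hmaps : MapsTo Φ (Metric.closedBall 0 (2 * M)) (Metric.closedBall 0 (2 * M)) := by
    intro h hh
    rw [mem_closedBall_zero_iff] at hh ⊢
    have h1 : ‖timeInt hT (interaction hW hm hP j h)‖ ≤ C * (2 * M) ^ (2 * j + 3) * T :=
      (norm_timeInt_le hT _).trans (by gcongr; exact norm_interaction_le hW hm hP j hh)
    have h2 : C * (2 * M) ^ (2 * j + 3) * T ≤ M := by
      have h3 : T * (C * (2 * M) ^ (2 * j + 2)) ≤ 1 / 2 := by
        refine le_trans ?_ hsmall
        have : (0 : ℝ) ≤ 2 * j := by positivity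
        have h5 : 0 ≤ T * (C * (2 * M) ^ (2 * j + 2)) := by positivity
        nlinarith
      calc C * (2 * M) ^ (2 * j + 3) * T = (T * (C * (2 * M) ^ (2 * j + 2))) * (2 * M) := by ring
        _ ≤ 1 / 2 * (2 * M) := by gcongr
        _ = M := by ring
    calc ‖Φ h‖ ≤ ‖H₀‖ + ‖Complex.I • timeInt hT (interaction hW hm hP j h)‖ := norm_sub_le _ _
      _ ≤ M + M := by
          rw [norm_smul, Complex.norm_I, one_mul]
          exact add_le_add hH (h1.trans h2)
      _ = 2 * M := by ring
  have hcontr : ContractingWith (1 / 2) (hmaps.restrict Φ _ _) := by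
    refine ⟨by rw [← NNReal.coe_lt_coe]; norm_num, LipschitzWith.of_dist_le_mul ?_⟩
    rintro ⟨h, hh⟩ ⟨k, hk⟩
    rw [mem_closedBall_zero_iff] at hh hk
    simp only [Subtype.dist_eq, MapsTo.val_restrict_apply, dist_eq_norm]
    have e : Φ h - Φ k = -(Complex.I • timeInt hT (interaction hW hm hP j h -
        interaction hW hm hP j k)) := by
      simp only [Φ]
      rw [← timeInt_sub, smul_sub]
      abel
    rw [e, norm_neg, norm_smul, Complex.norm_I, one_mul]
    refine (norm_timeInt_le hT _).trans ?_
    calc _ ≤ C * (2 * j + 3) * (2 * M) ^ (2 * j + 2) * ‖h - k‖ * T := by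
          gcongr; exact norm_interaction_sub_le hW hm hP j hh hk
      _ = (T * (C * (2 * j + 3) * (2 * M) ^ (2 * j + 2))) * ‖h - k‖ := by ring
      _ ≤ 1 / 2 * ‖h - k‖ := by gcongr
      _ = _ := by norm_num
  obtain ⟨h, hh, hfix, -⟩ := hcontr.exists_fixedPoint' Metric.isClosed_closedBall.isComplete hmaps
    (x := 0) (by simp [hM.le]) (edist_ne_top _ _)
  exact ⟨h, by simpa using hh, hfix.symm⟩

end FixedPoint

theorem sobolevNorm_lt_top {g : Space d → ℂ} (hg : FastDecay g) (s : ℝ) :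
    sobolevNorm s (𝓕⁻ g) < ⊤ := by
  obtain ⟨k, hk⟩ := exists_nat_ge s
  rw [sobolevNorm_fourierInv s hg.integrable hg.memLp_two]
  refine ENNReal.rpow_lt_top_of_nonneg (by norm_num) (ne_of_lt ?_)
  have h1 : wnorm k g < ⊤ := (hg.memLp k).2
  have h2 : ∫⁻ ξ, ‖(1 + ‖ξ‖) ^ k * ‖g ξ‖‖ₑ ^ 2 < ⊤ := by
    rw [wnorm_sq] at h1
    exact (ENNReal.rpow_lt_top_iff_of_pos (by norm_num)).1 h1
  have h3 : ENNReal.ofReal (((2 * Real.pi) ^ 2) ^ k) ≠ ⊤ := ENNReal.ofReal_ne_top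
  refine lt_of_le_of_lt ?_ (ENNReal.mul_lt_top h3.lt_top h2)
  rw [← lintegral_const_mul' _ _ h3]
  refine lintegral_mono fun ξ => ?_
  rw [← ofReal_norm, ← ofReal_norm, ← ENNReal.ofReal_pow (by positivity),
    ← ENNReal.ofReal_pow (by positivity), ← ENNReal.ofReal_mul (by positivity),
    ← ENNReal.ofReal_mul (by positivity)]
  refine ENNReal.ofReal_le_ofReal ?_
  rw [Real.norm_of_nonneg (by positivity : (0 : ℝ) ≤ (1 + ‖ξ‖) ^ k * ‖g ξ‖),
    mul_pow ((1 + ‖ξ‖) ^ k), ← mul_assoc]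
  gcongr
  have hpi : 1 ≤ 2 * Real.pi := by linarith [Real.pi_gt_three]
  calc (1 + (2 * Real.pi * ‖ξ‖) ^ 2) ^ s ≤ (1 + (2 * Real.pi * ‖ξ‖) ^ 2) ^ (k : ℝ) :=
        Real.rpow_le_rpow_of_exponent_le (by nlinarith [sq_nonneg (2 * Real.pi * ‖ξ‖)]) hk
    _ = (1 + (2 * Real.pi * ‖ξ‖) ^ 2) ^ k := Real.rpow_natCast _ _
    _ ≤ ((2 * Real.pi) ^ 2 * (1 + ‖ξ‖) ^ 2) ^ k := by
        gcongr
        rw [mul_pow]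
        have h5 : 1 ≤ (2 * Real.pi) ^ 2 := one_le_pow₀ hpi
        nlinarith [norm_nonneg ξ, mul_nonneg (sq_nonneg (2 * Real.pi)) (norm_nonneg ξ)]
    _ = _ := by
        rw [mul_pow ((2 * Real.pi) ^ 2), ← pow_mul (1 + ‖ξ‖) 2 k, ← pow_mul (1 + ‖ξ‖) k 2,
          mul_comm 2 k]

section Solution

variable {W : Space d → ℝ} (hW : IsWeight W) {m : Space d → ℝ} {C : ℝ} (hm : IsMultiplier m C)
  {P : Space d → ℝ} (hP : Continuous P) (j : ℕ)

theorem hasDerivAt_phase_profile {H₀ : Profile d} {g₀ : Space d → ℂ}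
    (hg₀ : ∀ t, slice W H₀ t = g₀) {T : ℝ} (hT : 0 ≤ T) {h : Profile d}
    (hh : h = H₀ - Complex.I • timeInt hT (interaction hW hm hP j h)) {t : ℝ}
    (ht : t ∈ Ioo (-T) T) (ξ : Space d) :
    HasDerivAt (fun τ => slice W (phase hP (-1) h) τ ξ)
      (Complex.I * (-(P ξ : ℂ) * slice W (phase hP (-1) h) t ξ -
        nonlin m j (slice W (phase hP (-1) h) t) ξ)) t := by
  have hc : Continuous fun s => interaction hW hm hP j h (s, ξ) := by
    have := (interaction hW hm hP j h).continuous
    fun_prop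
  have h1 : HasDerivAt (fun τ => h (τ, ξ)) (-(Complex.I * interaction hW hm hP j h (t, ξ))) t := by
    have e : ∀ τ ∈ Ioo (-T) T, h (τ, ξ) = H₀ (0, ξ) -
        Complex.I * ∫ s in (0 : ℝ)..τ, interaction hW hm hP j h (s, ξ) := by
      intro τ hτ
      have hW0 : (W ξ : ℂ) ≠ 0 := by exact_mod_cast (hW.pos ξ).ne'
      have h0 : H₀ (τ, ξ) = H₀ (0, ξ) :=
        mul_left_cancel₀ hW0 (congrFun ((hg₀ τ).trans (hg₀ 0).symm) ξ)
      conv_lhs => rw [hh]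
      rw [BoundedContinuousFunction.coe_sub, Pi.sub_apply, BoundedContinuousFunction.coe_smul]
      beta_reduce
      rw [timeInt_apply hT _ (Ioo_subset_Icc_self hτ), h0, smul_eq_mul]
    have h2 : HasDerivAt (fun τ => H₀ (0, ξ) -
        Complex.I * ∫ s in (0 : ℝ)..τ, interaction hW hm hP j h (s, ξ))
        (-(Complex.I * interaction hW hm hP j h (t, ξ))) t :=
      ((hc.integral_hasStrictDerivAt 0 t).hasDerivAt.const_mul Complex.I).const_sub _
    refine h2.congr_of_eventuallyEq ?_
    filter_upwards [Ioo_mem_nhds ht.1 ht.2] with τ hτ using e τ hτ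
  have h3 : HasDerivAt (fun τ : ℝ => Complex.exp (((-1) * τ * P ξ : ℝ) * Complex.I))
      (Complex.exp (((-1) * t * P ξ : ℝ) * Complex.I) * (-(P ξ : ℂ) * Complex.I)) t := by
    have h4 : HasDerivAt (fun τ : ℝ => ((((-1) * τ * P ξ : ℝ) : ℂ)) * Complex.I)
        (-(P ξ : ℂ) * Complex.I) t := by
      have := (((hasDerivAt_id t).const_mul (-1)).mul_const (P ξ)).ofReal_comp.mul_const Complex.I
      simpa using this
    exact h4.cexp
  have h5 := (h3.mul h1).const_mul (W ξ : ℂ)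
  have e2 : nonlin m j (slice W (phase hP (-1) h) t) ξ =
      W ξ * profileNonlin hW hm j (phase hP (-1) h) (t, ξ) := by
    rw [← slice_profileNonlin hW hm]; rfl
  refine h5.congr_deriv ?_
  rw [e2, interaction, phase_apply, slice, phase_apply]
  have e3 : Complex.exp (((-1) * t * P ξ : ℝ) * Complex.I) *
      Complex.exp ((1 * t * P ξ : ℝ) * Complex.I) = 1 := by
    rw [← Complex.exp_add]; push_cast; ring_nf; simp
  linear_combination (-(Complex.I * W ξ * profileNonlin hW hm j (phase hP (-1) h) (t, ξ))) * e3

/-- The inverse Fourier transform of a solution in the interaction picture is a smooth solution of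
the equation, because weighted profiles are rapidly decreasing. -/
theorem solvesSchrodinger_of_profile {L : (Space d → ℂ) → Space d → ℂ} (hL : HasSymbol L P)
    {H₀ : Profile d} {g₀ : Space d → ℂ}
    (hg₀ : ∀ t, slice W H₀ t = g₀) {T T' : ℝ} (hT : 0 ≤ T) (hT' : T' < T) {h : Profile d}
    (hh : h = H₀ - Complex.I • timeInt hT (interaction hW hm hL.cont j h)) :
    SolvesSchrodinger L
      (fun t => potential m j ((fun t => 𝓕⁻ (slice W (phase hL.cont (-1) h) t)) t)) T' (𝓕⁻ g₀)
      (fun t => 𝓕⁻ (slice W (phase hL.cont (-1) h) t)) := by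
  set k := phase hL.cont (-1) h with hk
  have hfd : ∀ t, FastDecay (slice W k t) := fastDecay_slice hW k
  refine ⟨fun t _ => contDiff_fourierInv (hfd t), fun s t _ => sobolevNorm_lt_top (hfd t) s,
    fun s t _ => ?_, ?_, fun t ht x => ?_⟩
  · have e : ∀ τ, 𝓕⁻ (slice W k τ) - 𝓕⁻ (slice W k t) =
        𝓕⁻ (fun ξ => slice W k τ ξ - slice W k t ξ) := by
      intro τ; funext x
      rw [fourierInv_sub_apply (hfd τ).integrable (hfd t).integrable]; rfl
    have hsub : ∀ τ, FastDecay (fun ξ => slice W k τ ξ - slice W k t ξ) := fun τ =>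
      (hfd τ).sub (hfd t)
    simp only [e, sobolevNorm_fourierInv s (hsub _).integrable (hsub _).memLp_two]
    refine Tendsto.mono_left ?_ nhdsWithin_le_nhds
    have hW2 : FastDecay (fun ξ => ((2 * ‖k‖ : ℝ) : ℂ) * (W ξ : ℂ)) :=
      hW.fastDecay.mul_bdd (m := fun _ => ((2 * ‖k‖ : ℝ) : ℂ)) (C := 2 * ‖k‖) (n := 0)
        aestronglyMeasurable_const (fun ξ => by simp)
    have hfin := sobolevNorm_lt_top hW2 s
    rw [sobolevNorm_fourierInv s hW2.integrable hW2.memLp_two] at hfin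
    have hfin' := (ENNReal.rpow_lt_top_iff_of_pos (by norm_num : (0 : ℝ) < 1 / 2)).1 hfin
    have hlim : Tendsto (fun τ => ∫⁻ ζ : Space d,
        ENNReal.ofReal ((1 + (2 * Real.pi * ‖ζ‖) ^ 2) ^ s) *
          ‖slice W k τ ζ - slice W k t ζ‖ₑ ^ 2) (𝓝 t) (𝓝 (∫⁻ _ : Space d, 0)) := by
      refine tendsto_lintegral_filter_of_dominated_convergence' _ (Eventually.of_forall fun τ => ?_)
        (Eventually.of_forall fun τ => Eventually.of_forall fun ξ => ?_) hfin'.ne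
        (Eventually.of_forall fun ξ => ?_)
      · refine AEMeasurable.mul (Measurable.aemeasurable ?_) ((hsub τ).aesm.enorm.pow_const 2)
        exact ENNReal.measurable_ofReal.comp (by fun_prop)
      · gcongr
        rw [← ofReal_norm, ← ofReal_norm]
        refine ENNReal.ofReal_le_ofReal ((norm_sub_le _ _).trans ?_)
        have h1 := norm_slice_le hW k τ ξ
        have h2 := norm_slice_le hW k t ξ
        rw [norm_mul, Complex.norm_real, Complex.norm_real, Real.norm_of_nonneg (by positivity),
          Real.norm_of_nonneg (hW.pos ξ).le]
        linarith
      · have hc : Continuous fun τ => slice W k τ ξ :=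
          (continuous_slice hW k).comp (continuous_id.prodMk continuous_const)
        have h3 : Tendsto (fun τ => ‖slice W k τ ξ - slice W k t ξ‖ₑ ^ 2) (𝓝 t) (𝓝 0) := by
          have : Continuous fun τ => ‖slice W k τ ξ - slice W k t ξ‖ₑ ^ 2 := by fun_prop
          simpa using this.tendsto t
        have h4 := ENNReal.Tendsto.const_mul
          (a := ENNReal.ofReal ((1 + (2 * Real.pi * ‖ξ‖) ^ 2) ^ s)) h3
          (Or.inr ENNReal.ofReal_ne_top)
        simpa using h4
    have h5 := (ENNReal.continuous_rpow_const (y := (1 / 2 : ℝ))).continuousAt.tendsto.comp hlim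
    simpa [Function.comp_def] using h5
  · have : slice W k 0 = g₀ := by
      rw [← hg₀ 0]
      funext ξ
      have h0 : h (0, ξ) = H₀ (0, ξ) := by
        conv_lhs => rw [hh]
        rw [BoundedContinuousFunction.coe_sub, Pi.sub_apply, BoundedContinuousFunction.coe_smul]
        beta_reduce
        rw [timeInt_apply hT _ ⟨by linarith, hT⟩]
        simp
      simp [slice, hk, phase_apply, h0]
    simp only [this]
  · have htI : t ∈ Ioo (-T) T := ⟨by linarith [ht.1, ht.2], ht.2.trans_lt hT'⟩
    refine HasDerivAt.hasDerivWithinAt ?_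
    rw [hL.apply _ (hfd t), ← hm.fourierInv_nonlin j (hfd t),
      ← fourierInv_sub_apply (hL.fastDecay (hfd t)).integrable
        (hm.fastDecay_nonlin j (hfd t)).integrable, ← fourierInv_const_mul_apply]
    simp only [Real.fourierInv_eq', smul_eq_mul]
    obtain ⟨CP, hCP⟩ := hL.bound
    have hnl : ∀ τ ξ, ‖nonlin m j (slice W k τ) ξ‖ ≤ (C * ‖k‖ ^ (2 * j + 3)) * W ξ := by
      intro τ ξ
      rw [← slice_profileNonlin hW hm]
      refine (norm_slice_le hW _ τ ξ).trans ?_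
      have := (hW.pos ξ).le
      gcongr
      exact norm_profileNonlin_le hW hm j le_rfl
    have hmeas : ∀ (f : Space d → ℂ), AEStronglyMeasurable f volume → AEStronglyMeasurable
        (fun ξ => Complex.exp ((2 * Real.pi * ⟪ξ, x⟫ : ℝ) * Complex.I) * f ξ) volume := by
      intro f hf
      exact (Continuous.aestronglyMeasurable (by fun_prop)).mul hf
    have hGfd : FastDecay (fun ξ => Complex.I * (-(P ξ : ℂ) * slice W k t ξ -
        nonlin m j (slice W k t) ξ)) :=
      ((hL.fastDecay (hfd t)).sub (hm.fastDecay_nonlin j (hfd t))).mul_bdd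
        (m := fun _ => Complex.I) (C := 1) (n := 0) aestronglyMeasurable_const (by simp)
    refine (hasDerivAt_integral_of_dominated_loc_of_deriv_le
      (F := fun τ ξ => Complex.exp ((2 * Real.pi * ⟪ξ, x⟫ : ℝ) * Complex.I) * slice W k τ ξ)
      (F' := fun τ ξ => Complex.exp ((2 * Real.pi * ⟪ξ, x⟫ : ℝ) * Complex.I) *
        (Complex.I * (-(P ξ : ℂ) * slice W k τ ξ - nonlin m j (slice W k τ) ξ)))
      (bound := fun ξ => CP * ((1 + ‖ξ‖) ^ 2 * (‖k‖ * W ξ)) + (C * ‖k‖ ^ (2 * j + 3)) * W ξ)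
      (Ioo_mem_nhds htI.1 htI.2) (Eventually.of_forall fun τ => hmeas _ (hfd τ).aesm) ?_
      (hmeas _ hGfd.aesm) (Eventually.of_forall fun ξ τ hτ => ?_) ?_
      (Eventually.of_forall fun ξ τ hτ => ?_)).2
    · refine (hfd t).integrable.norm.mono' (hmeas _ (hfd t).aesm) (Eventually.of_forall fun ξ => ?_)
      rw [norm_mul, Complex.norm_exp_ofReal_mul_I, one_mul]
    · rw [norm_mul, Complex.norm_exp_ofReal_mul_I, one_mul, norm_mul, Complex.norm_I, one_mul]
      refine (norm_sub_le _ _).trans (add_le_add ?_ (hnl τ ξ))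
      rw [norm_mul, norm_neg, Complex.norm_real, Real.norm_eq_abs, ← mul_assoc]
      gcongr
      · exact (abs_nonneg _).trans (hCP ξ)
      · exact hCP ξ
      · exact norm_slice_le hW k τ ξ
    · have h1 := hW.fastDecay.integrable_weight 2
      have h2 : Integrable (fun ξ => (1 + ‖ξ‖) ^ 2 * (‖k‖ * W ξ)) volume := by
        refine (h1.const_mul ‖k‖).congr (Eventually.of_forall fun ξ => ?_)
        simp only [Complex.norm_real, Real.norm_of_nonneg (hW.pos ξ).le]
        ring
      exact (h2.const_mul CP).add (hW.integrable.const_mul _)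
    · exact (hasDerivAt_phase_profile hW hm hL.cont j hg₀ hT hh hτ ξ).const_mul _

end Solution

/-! ### Weights adapted to lattices of frequencies -/

/-- The polynomial weight `(1 + r)⁻ⁿ` is, up to a constant, stable under convolution, because
`(1 + r + s)ⁿ ≤ 2ⁿ ((1 + r)ⁿ + (1 + s)ⁿ)`. -/
theorem inv_pow_mul_inv_pow_le (n : ℕ) {r s t : ℝ} (hr : 0 ≤ r) (hs : 0 ≤ s) (ht : 0 ≤ t)
    (h : t ≤ r + s) :
    ((1 + r) ^ n)⁻¹ * ((1 + s) ^ n)⁻¹ ≤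
      2 ^ n * ((1 + t) ^ n)⁻¹ * (((1 + r) ^ n)⁻¹ + ((1 + s) ^ n)⁻¹) := by
  have h1 : (1 + t) ^ n ≤ 2 ^ n * ((1 + r) ^ n + (1 + s) ^ n) := by
    rcases le_total r s with hrs | hrs
    · calc (1 + t) ^ n ≤ (2 * (1 + s)) ^ n := by gcongr; linarith
        _ = 2 ^ n * (1 + s) ^ n := mul_pow _ _ _
        _ ≤ _ := by gcongr; linarith [pow_nonneg (by positivity : 0 ≤ 1 + r) n]
    · calc (1 + t) ^ n ≤ (2 * (1 + r)) ^ n := by gcongr; linarith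
        _ = 2 ^ n * (1 + r) ^ n := mul_pow _ _ _
        _ ≤ _ := by gcongr; linarith [pow_nonneg (by positivity : 0 ≤ 1 + s) n]
  have e : 2 ^ n * ((1 + t) ^ n)⁻¹ * (((1 + r) ^ n)⁻¹ + ((1 + s) ^ n)⁻¹) =
      (2 ^ n * ((1 + r) ^ n + (1 + s) ^ n)) * ((1 + t) ^ n)⁻¹ *
        (((1 + r) ^ n)⁻¹ * ((1 + s) ^ n)⁻¹) := by
    have hr' : 1 + r ≠ 0 := by positivity
    have hs' : 1 + s ≠ 0 := by positivity
    field_simp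
    ring
  rw [e]
  refine le_mul_of_one_le_left (by positivity) ?_
  rw [← div_eq_mul_inv, one_le_div (by positivity)]
  exact h1

/-- A summable weight on the lattice `ℤ²` that is stable under convolution up to a constant. -/
noncomputable def latticeWeight (k : ℤ × ℤ) : ℝ := ((1 + ‖k‖) ^ 4)⁻¹

theorem latticeWeight_pos (k : ℤ × ℤ) : 0 < latticeWeight k := by
  unfold latticeWeight; positivity

theorem summable_latticeWeight : Summable latticeWeight := by
  have h1 : Summable (fun n : ℤ => ((1 + ‖n‖) ^ 2)⁻¹) := by
    have h2 : Summable (fun n : ℤ => 1 / |(n : ℝ)| ^ (2 : ℝ)) := by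
      simpa using Real.summable_one_div_int_pow.2 one_lt_two
    refine Summable.of_nonneg_of_le (fun n => by positivity) (fun n => ?_)
      ((h2.add (summable_of_hasFiniteSupport (f := fun n : ℤ => if n = 0 then (1 : ℝ) else 0)
        ((Set.finite_singleton 0).subset (by intro n; simp)))))
    by_cases hn : n = 0
    · simp [hn]
    · have : 0 < |(n : ℝ)| := by positivity
      simp only [hn, if_false, add_zero, one_div, Int.norm_eq_abs, Real.rpow_two]
      gcongr
      linarith
  have h3 := h1.mul_of_nonneg h1 (fun n => by positivity) (fun n => by positivity)
  refine Summable.of_nonneg_of_le (fun k => (latticeWeight_pos k).le) (fun k => ?_) h3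
  rw [latticeWeight, ← mul_inv, show 4 = 2 + 2 from rfl, pow_add]
  gcongr
  · exact norm_fst_le k
  · exact norm_snd_le k

theorem exists_latticeWeight_conv_le : ∃ C : ℝ, 0 < C ∧ ∀ n,
    ∑' k, ENNReal.ofReal (latticeWeight k * latticeWeight (n - k)) ≤
      ENNReal.ofReal (C * latticeWeight n) := by
  refine ⟨2 ^ 5 * ∑' k, latticeWeight k, ?_, fun n => ?_⟩
  · have := summable_latticeWeight.tsum_pos (fun k => (latticeWeight_pos k).le) 0
      (latticeWeight_pos 0)
    positivity
  · have hs : Summable fun k => latticeWeight (n - k) :=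
      (Equiv.subLeft n).summable_iff.2 summable_latticeWeight
    have hs2 := (summable_latticeWeight.add hs).mul_left (2 ^ 4 * latticeWeight n)
    have hle : ∀ k, latticeWeight k * latticeWeight (n - k) ≤
        2 ^ 4 * latticeWeight n * (latticeWeight k + latticeWeight (n - k)) := fun k =>
      inv_pow_mul_inv_pow_le 4 (norm_nonneg _) (norm_nonneg _) (norm_nonneg _) (by
        simpa using norm_add_le k (n - k))
    have hs1 : Summable fun k => latticeWeight k * latticeWeight (n - k) :=
      Summable.of_nonneg_of_le (fun k => mul_nonneg (latticeWeight_pos _).le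
        (latticeWeight_pos _).le) hle hs2
    rw [← ENNReal.ofReal_tsum_of_nonneg (fun k => mul_nonneg (latticeWeight_pos _).le
        (latticeWeight_pos _).le) hs1]
    refine ENNReal.ofReal_le_ofReal ((hs1.tsum_le_tsum hle hs2).trans (le_of_eq ?_))
    have e : ∑' k, latticeWeight (n - k) = ∑' k, latticeWeight k :=
      (Equiv.subLeft n).tsum_eq latticeWeight
    rw [tsum_mul_left, summable_latticeWeight.tsum_add hs, e]
    ring

/-- An integrable polynomial weight on `ℝ^d`. -/
noncomputable def polyWeight (z : Space d) : ℝ := ((1 + ‖z‖) ^ (d + 1))⁻¹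

theorem polyWeight_pos (z : Space d) : 0 < polyWeight z := by
  unfold polyWeight; positivity

theorem polyWeight_le_one (z : Space d) : polyWeight z ≤ 1 :=
  inv_le_one_of_one_le₀ (one_le_pow₀ (by linarith [norm_nonneg z]))

theorem continuous_polyWeight : Continuous (polyWeight (d := d)) := by
  unfold polyWeight
  exact Continuous.inv₀ (by fun_prop) fun z => by positivity

theorem lintegral_polyWeight_smul {R : ℝ} (hR : 0 < R) (c : Space d) :
    ∫⁻ η : Space d, ENNReal.ofReal (polyWeight (R • (η - c))) =
      ENNReal.ofReal ((R ^ d)⁻¹ * ∫ z : Space d, polyWeight z) := by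
  rw [lintegral_sub_right_eq_self (fun η : Space d => ENNReal.ofReal (polyWeight (R • η))) c]
  have hi : Integrable (polyWeight (d := d)) volume := integrable_one_add_norm_inv
  rw [← ofReal_integral_eq_lintegral_ofReal (hi.comp_smul hR.ne')
    (Eventually.of_forall fun z => (polyWeight_pos _).le), Measure.integral_comp_smul]
  simp [abs_of_pos hR]

theorem exists_polyWeight_conv_le (d : ℕ) : ∃ C : ℝ, 0 < C ∧ ∀ R : ℝ, 0 < R → ∀ ξ a b : Space d,
    ∫⁻ η : Space d, ENNReal.ofReal (polyWeight (R • (η - a)) * polyWeight (R • (ξ - η - b))) ≤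
      ENNReal.ofReal (C * (R ^ d)⁻¹ * polyWeight (R • (ξ - (a + b)))) := by
  have hi : Integrable (polyWeight (d := d)) volume := integrable_one_add_norm_inv
  have hpos : 0 ≤ ∫ z : Space d, polyWeight z := integral_nonneg fun z => (polyWeight_pos z).le
  refine ⟨2 ^ (d + 1) * (2 * (∫ z : Space d, polyWeight z) + 1), by positivity,
    fun R hR ξ a b => ?_⟩
  have hle : ∀ η : Space d, polyWeight (R • (η - a)) * polyWeight (R • (ξ - η - b)) ≤
      2 ^ (d + 1) * polyWeight (R • (ξ - (a + b))) *
        (polyWeight (R • (η - a)) + polyWeight (R • (η - (ξ - b)))) := by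
    intro η
    have e : polyWeight (R • (η - (ξ - b))) = polyWeight (R • (ξ - η - b)) := by
      unfold polyWeight
      rw [← norm_neg (R • (ξ - η - b)), ← smul_neg]
      congr 5; abel
    rw [e]
    refine inv_pow_mul_inv_pow_le (d + 1) (norm_nonneg _) (norm_nonneg _) (norm_nonneg _) ?_
    have e2 : R • (ξ - (a + b)) = R • (η - a) + R • (ξ - η - b) := by
      rw [← smul_add]; congr 1; abel
    rw [e2]; exact norm_add_le _ _
  calc _ ≤ ∫⁻ η : Space d, ENNReal.ofReal (2 ^ (d + 1) * polyWeight (R • (ξ - (a + b)))) *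
        (ENNReal.ofReal (polyWeight (R • (η - a))) +
          ENNReal.ofReal (polyWeight (R • (η - (ξ - b))))) := by
        refine lintegral_mono fun η => ?_
        rw [← ENNReal.ofReal_add (polyWeight_pos _).le (polyWeight_pos _).le,
          ← ENNReal.ofReal_mul (mul_nonneg (by positivity) (polyWeight_pos _).le)]
        exact ENNReal.ofReal_le_ofReal (hle η)
    _ = ENNReal.ofReal (2 ^ (d + 1) * polyWeight (R • (ξ - (a + b)))) *
        (ENNReal.ofReal ((R ^ d)⁻¹ * ∫ z : Space d, polyWeight z) +
          ENNReal.ofReal ((R ^ d)⁻¹ * ∫ z : Space d, polyWeight z)) := by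
        rw [lintegral_const_mul' _ _ ENNReal.ofReal_ne_top, lintegral_add_left,
          lintegral_polyWeight_smul hR, lintegral_polyWeight_smul hR]
        exact ENNReal.measurable_ofReal.comp
          (continuous_polyWeight.comp (by fun_prop)).measurable
    _ ≤ _ := by
        rw [← ENNReal.ofReal_add (by positivity) (by positivity), ← ENNReal.ofReal_mul
          (mul_nonneg (by positivity) (polyWeight_pos _).le)]
        refine ENNReal.ofReal_le_ofReal ?_
        have h1 := (polyWeight_pos (R • (ξ - (a + b)))).le
        have h2 : 0 ≤ (R ^ d)⁻¹ := by positivity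
        have h3 : 0 ≤ (2 : ℝ) ^ (d + 1) * ((R ^ d)⁻¹ * polyWeight (R • (ξ - (a + b)))) := by
          positivity
        nlinarith

section Comb

variable (R : ℝ) (x : ℤ × ℤ →+ Space d)

/-- A sum of polynomially decreasing bumps of width `R⁻¹`, placed at the points of the group
generated by two frequencies.  As the points form a group, the convolution of two such sums is again
of this form. -/
noncomputable def combSum (ξ : Space d) : ℝ :=
  ∑' k, latticeWeight k * polyWeight (R • (ξ - x k))

theorem combSum_term_nonneg (ξ : Space d) (k : ℤ × ℤ) :
    0 ≤ latticeWeight k * polyWeight (R • (ξ - x k)) :=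
  mul_nonneg (latticeWeight_pos _).le (polyWeight_pos _).le

theorem combSum_term_le (ξ : Space d) (k : ℤ × ℤ) :
    latticeWeight k * polyWeight (R • (ξ - x k)) ≤ latticeWeight k :=
  mul_le_of_le_one_right (latticeWeight_pos _).le (polyWeight_le_one _)

theorem summable_combSum (ξ : Space d) :
    Summable fun k => latticeWeight k * polyWeight (R • (ξ - x k)) :=
  Summable.of_nonneg_of_le (combSum_term_nonneg R x ξ) (combSum_term_le R x ξ)
    summable_latticeWeight

theorem le_combSum (ξ : Space d) (k : ℤ × ℤ) :
    latticeWeight k * polyWeight (R • (ξ - x k)) ≤ combSum R x ξ :=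
  (summable_combSum R x ξ).le_tsum k fun l _ => combSum_term_nonneg R x ξ l

theorem combSum_pos (ξ : Space d) : 0 < combSum R x ξ :=
  lt_of_lt_of_le (mul_pos (latticeWeight_pos _) (polyWeight_pos _)) (le_combSum R x ξ 0)

theorem combSum_le (ξ : Space d) : combSum R x ξ ≤ ∑' k, latticeWeight k :=
  (summable_combSum R x ξ).tsum_le_tsum (combSum_term_le R x ξ) summable_latticeWeight

theorem continuous_combSum : Continuous (combSum R x) := by
  refine continuous_tsum (fun k => ?_) summable_latticeWeight (fun k ξ => ?_)
  · exact continuous_const.mul (continuous_polyWeight.comp (by fun_prop))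
  · rw [Real.norm_of_nonneg (combSum_term_nonneg R x ξ k)]
    exact combSum_term_le R x ξ k

theorem combSum_neg (ξ : Space d) : combSum R x (-ξ) = combSum R x ξ := by
  unfold combSum
  rw [← (Equiv.neg (ℤ × ℤ)).tsum_eq]
  refine tsum_congr fun k => ?_
  simp only [Equiv.neg_apply, latticeWeight, polyWeight, norm_neg, map_neg]
  rw [← norm_neg (R • (ξ - x k)), ← smul_neg]
  congr 6; abel

theorem ofReal_combSum (ξ : Space d) : ENNReal.ofReal (combSum R x ξ) =
    ∑' k, ENNReal.ofReal (latticeWeight k * polyWeight (R • (ξ - x k))) :=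
  ENNReal.ofReal_tsum_of_nonneg (combSum_term_nonneg R x ξ) (summable_combSum R x ξ)

end Comb

theorem exists_combSum_conv_le (d : ℕ) : ∃ C : ℝ, 0 < C ∧ ∀ R : ℝ, 0 < R →
    ∀ (x : ℤ × ℤ →+ Space d) (ξ : Space d),
    ∫⁻ η : Space d, ENNReal.ofReal (combSum R x η * combSum R x (ξ - η)) ≤
      ENNReal.ofReal (C * (R ^ d)⁻¹ * combSum R x ξ) := by
  obtain ⟨C₁, hC₁, h₁⟩ := exists_latticeWeight_conv_le
  obtain ⟨C₂, hC₂, h₂⟩ := exists_polyWeight_conv_le d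
  refine ⟨C₁ * C₂, by positivity, fun R hR x ξ => ?_⟩
  have hmeas : ∀ (k l : ℤ × ℤ), Measurable fun η : Space d =>
      ENNReal.ofReal (latticeWeight k * latticeWeight l) *
        ENNReal.ofReal (polyWeight (R • (η - x k)) * polyWeight (R • (ξ - η - x l))) := by
    intro k l
    refine (ENNReal.measurable_ofReal.comp (Continuous.measurable ?_)).const_mul _
    exact (continuous_polyWeight.comp (by fun_prop)).mul (continuous_polyWeight.comp (by fun_prop))
  calc ∫⁻ η : Space d, ENNReal.ofReal (combSum R x η * combSum R x (ξ - η))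
      = ∫⁻ η : Space d, ∑' k, ∑' l, ENNReal.ofReal (latticeWeight k * latticeWeight l) *
        ENNReal.ofReal (polyWeight (R • (η - x k)) * polyWeight (R • (ξ - η - x l))) := by
        refine lintegral_congr fun η => ?_
        rw [ENNReal.ofReal_mul (combSum_pos R x η).le, ofReal_combSum, ofReal_combSum,
          ← ENNReal.tsum_mul_right]
        refine tsum_congr fun k => ?_
        rw [← ENNReal.tsum_mul_left]
        refine tsum_congr fun l => ?_
        have p1 := (latticeWeight_pos k).le
        have p2 := (latticeWeight_pos l).le
        have p3 := (polyWeight_pos (R • (η - x k))).le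
        rw [← ENNReal.ofReal_mul (by positivity), ← ENNReal.ofReal_mul (by positivity)]
        congr 1; ring
    _ = ∑' k, ∑' l, ENNReal.ofReal (latticeWeight k * latticeWeight l) *
        ∫⁻ η : Space d, ENNReal.ofReal (polyWeight (R • (η - x k)) *
          polyWeight (R • (ξ - η - x l))) := by
        rw [lintegral_tsum fun k => (Measurable.tsum fun l => hmeas k l).aemeasurable]
        refine tsum_congr fun k => ?_
        rw [lintegral_tsum fun l => (hmeas k l).aemeasurable]
        refine tsum_congr fun l => ?_
        rw [lintegral_const_mul' _ _ ENNReal.ofReal_ne_top]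
    _ ≤ ∑' k, ∑' l, ENNReal.ofReal (latticeWeight k * latticeWeight l) *
        ENNReal.ofReal (C₂ * (R ^ d)⁻¹ * polyWeight (R • (ξ - x (k + l)))) := by
        refine ENNReal.tsum_le_tsum fun k => ENNReal.tsum_le_tsum fun l => ?_
        gcongr
        rw [map_add]
        exact h₂ R hR ξ (x k) (x l)
    _ = ∑' n, (∑' k, ENNReal.ofReal (latticeWeight k * latticeWeight (n - k))) *
        ENNReal.ofReal (C₂ * (R ^ d)⁻¹ * polyWeight (R • (ξ - x n))) := by
        simp_rw [← ENNReal.tsum_mul_right]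
        rw [ENNReal.tsum_comm]
        rw [ENNReal.tsum_comm]
        conv_rhs => rw [ENNReal.tsum_comm]
        refine tsum_congr fun k => ?_
        rw [← (Equiv.addLeft k).tsum_eq (fun n => ENNReal.ofReal (latticeWeight k *
          latticeWeight (n - k)) * ENNReal.ofReal (C₂ * (R ^ d)⁻¹ * polyWeight (R • (ξ - x n))))]
        refine tsum_congr fun l => ?_
        simp
    _ ≤ ∑' n, ENNReal.ofReal (C₁ * latticeWeight n) *
        ENNReal.ofReal (C₂ * (R ^ d)⁻¹ * polyWeight (R • (ξ - x n))) := by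
        refine ENNReal.tsum_le_tsum fun n => ?_
        gcongr
        exact h₁ n
    _ = ENNReal.ofReal (C₁ * C₂ * (R ^ d)⁻¹ * combSum R x ξ) := by
        rw [ENNReal.ofReal_mul (by positivity), ofReal_combSum, ← ENNReal.tsum_mul_left]
        refine tsum_congr fun n => ?_
        have p1 := (latticeWeight_pos n).le
        rw [← ENNReal.ofReal_mul (by positivity), ← ENNReal.ofReal_mul (by positivity)]
        congr 1; ring

/-- The weight for data that oscillate at the frequencies `x k` with profiles of width `R⁻¹`. The
exponential factor, which is submultiplicative, provides the decay that a weight must have; the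
constant is independent of it. -/
noncomputable def combWeight (C R δ : ℝ) (x : ℤ × ℤ →+ Space d) (ξ : Space d) : ℝ :=
  C⁻¹ * R ^ d * Real.exp (-(δ * ‖ξ‖)) * combSum R x ξ

/-- The normalizing constant `C` of the weight depends neither on the width `R⁻¹` nor on the
frequencies.  This uniformity makes the existence time of the solutions explicit in these
parameters. -/
theorem exists_isWeight_combWeight (d : ℕ) : ∃ C : ℝ, 0 < C ∧ ∀ R δ : ℝ, 0 < R → 0 < δ →
    ∀ x : ℤ × ℤ →+ Space d, IsWeight (combWeight C R δ x) := by
  obtain ⟨C, hC, h⟩ := exists_combSum_conv_le d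
  refine ⟨C, hC, fun R δ hR hδ x => ?_⟩
  have hpos : ∀ ξ, 0 < combWeight C R δ x ξ := fun ξ => by
    have := combSum_pos R x ξ
    unfold combWeight; positivity
  have hcont : Continuous (combWeight C R δ x) := by
    have := continuous_combSum R x
    unfold combWeight; fun_prop
  refine ⟨hcont, hpos, fun ξ => ?_, fun ξ => ?_, ?_⟩
  · simp [combWeight, combSum_neg]
  · rw [integral_eq_lintegral_of_nonneg_ae
      (f := fun η => combWeight C R δ x η * combWeight C R δ x (ξ - η))
      (Eventually.of_forall fun η => (mul_pos (hpos _) (hpos _)).le)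
      (hcont.mul (hcont.comp (continuous_const.sub continuous_id))).aestronglyMeasurable]
    refine ENNReal.toReal_le_of_le_ofReal (hpos ξ).le ?_
    calc ∫⁻ η, ENNReal.ofReal (combWeight C R δ x η * combWeight C R δ x (ξ - η))
        ≤ ∫⁻ η, ENNReal.ofReal ((C⁻¹ * R ^ d) ^ 2 * Real.exp (-(δ * ‖ξ‖))) *
            ENNReal.ofReal (combSum R x η * combSum R x (ξ - η)) := by
          refine lintegral_mono fun η => ?_
          rw [← ENNReal.ofReal_mul (by positivity)]
          refine ENNReal.ofReal_le_ofReal ?_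
          have p1 := combSum_pos R x η
          have p2 := combSum_pos R x (ξ - η)
          have h3 : Real.exp (-(δ * ‖η‖)) * Real.exp (-(δ * ‖ξ - η‖)) ≤
              Real.exp (-(δ * ‖ξ‖)) := by
            rw [← Real.exp_add]
            refine Real.exp_le_exp.2 ?_
            have : ‖ξ‖ ≤ ‖η‖ + ‖ξ - η‖ := by simpa using norm_add_le η (ξ - η)
            nlinarith
          calc combWeight C R δ x η * combWeight C R δ x (ξ - η)
              = (C⁻¹ * R ^ d) ^ 2 * (Real.exp (-(δ * ‖η‖)) * Real.exp (-(δ * ‖ξ - η‖))) *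
                (combSum R x η * combSum R x (ξ - η)) := by unfold combWeight; ring
            _ ≤ _ := by gcongr
      _ = ENNReal.ofReal ((C⁻¹ * R ^ d) ^ 2 * Real.exp (-(δ * ‖ξ‖))) *
            ∫⁻ η, ENNReal.ofReal (combSum R x η * combSum R x (ξ - η)) :=
          lintegral_const_mul' _ _ ENNReal.ofReal_ne_top
      _ ≤ ENNReal.ofReal ((C⁻¹ * R ^ d) ^ 2 * Real.exp (-(δ * ‖ξ‖))) *
            ENNReal.ofReal (C * (R ^ d)⁻¹ * combSum R x ξ) := by
          gcongr; exact h R hR x ξ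
      _ = ENNReal.ofReal (combWeight C R δ x ξ) := by
          rw [← ENNReal.ofReal_mul (by positivity)]
          congr 1
          unfold combWeight
          field_simp
  · refine ⟨C⁻¹ * R ^ d * ∑' k, latticeWeight k, δ, hδ, fun ξ => ?_⟩
    unfold combWeight
    rw [mul_right_comm]
    gcongr
    exact combSum_le R x ξ

/-! ### Superpositions of translated profiles -/

/-- The superposition `∑ χ(k) f(ξ - x k)`, `k ∈ L`, of translates of the profile `f`.  The
coefficients are the values of a character `χ` of the lattice `ℤ²`, so that products of combs are
combs; the list `L` counts frequencies with multiplicity. -/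
noncomputable def comb (x : ℤ × ℤ →+ Space d) (χ : AddChar (ℤ × ℤ) Circle) (L : List (ℤ × ℤ))
    (f : Space d → ℂ) (ξ : Space d) : ℂ :=
  (L.map fun k => (χ k : ℂ) * f (ξ - x k)).sum

/-- All the sums of an element of `L` and an element of `L'`, with multiplicity. -/
def sumList (L L' : List (ℤ × ℤ)) : List (ℤ × ℤ) := L.flatMap fun k => L'.map fun l => k + l

/-- The frequencies of `autoConv` of a comb with frequencies `L`: conjugation changes their sign. -/
def autoList (L : List (ℤ × ℤ)) : List (ℤ × ℤ) := sumList (L.map fun k => -k) L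

/-- The frequencies of `oddPower j` of a comb with frequencies `L`. -/
def oddList : ℕ → List (ℤ × ℤ) → List (ℤ × ℤ)
  | 0, L => L
  | j + 1, L => sumList (oddList j L) (autoList L)

section Comb

variable (x : ℤ × ℤ →+ Space d) (χ : AddChar (ℤ × ℤ) Circle)

theorem comb_cons (k : ℤ × ℤ) (L : List (ℤ × ℤ)) (f : Space d → ℂ) (ξ : Space d) :
    comb x χ (k :: L) f ξ = (χ k : ℂ) * f (ξ - x k) + comb x χ L f ξ := by
  simp [comb]

theorem comb_append (L L' : List (ℤ × ℤ)) (f : Space d → ℂ) (ξ : Space d) :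
    comb x χ (L ++ L') f ξ = comb x χ L f ξ + comb x χ L' f ξ := by
  simp [comb]

theorem comb_map_add (k : ℤ × ℤ) (L : List (ℤ × ℤ)) (f : Space d → ℂ) (ξ : Space d) :
    comb x χ (L.map fun l => k + l) f ξ = (χ k : ℂ) * comb x χ L f (ξ - x k) := by
  induction L with
  | nil => simp [comb]
  | cons l L ih =>
    rw [List.map_cons, comb_cons, ih, comb_cons, AddChar.map_add_eq_mul, Circle.coe_mul, map_add,
      ← sub_sub]
    ring

theorem comb_comb (L L' : List (ℤ × ℤ)) (f : Space d → ℂ) :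
    comb x χ L (comb x χ L' f) = comb x χ (sumList L L') f := by
  funext ξ
  induction L with
  | nil => simp [comb, sumList]
  | cons k L ih =>
    rw [comb_cons, ih]
    simp only [sumList, List.flatMap_cons]
    rw [comb_append, comb_map_add]

theorem conjReflect_comb (L : List (ℤ × ℤ)) (f : Space d → ℂ) :
    conjReflect (comb x χ L f) = comb x χ (L.map fun k => -k) (conjReflect f) := by
  funext ξ
  induction L with
  | nil => simp [comb, conjReflect]
  | cons k L ih =>
    rw [List.map_cons, comb_cons, ← ih]
    simp only [conjReflect, comb_cons, map_add, map_mul, map_neg, AddChar.map_neg_eq_inv,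
      Circle.coe_inv_eq_conj]
    congr 4
    abel

theorem continuous_comb (L : List (ℤ × ℤ)) {f : Space d → ℂ} (hf : Continuous f) :
    Continuous (comb x χ L f) := by
  induction L with
  | nil => exact (continuous_const (y := (0 : ℂ))).congr fun ξ => by simp [comb]
  | cons k L ih =>
    have e : comb x χ (k :: L) f = fun ξ => (χ k : ℂ) * f (ξ - x k) + comb x χ L f ξ :=
      funext fun ξ => comb_cons x χ k L f ξ
    rw [e]
    fun_prop

theorem hasCompactSupport_comb (L : List (ℤ × ℤ)) {f : Space d → ℂ} (hf : HasCompactSupport f) :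
    HasCompactSupport (comb x χ L f) := by
  induction L with
  | nil =>
    have : comb x χ [] f = 0 := by funext ξ; simp [comb]
    rw [this]; exact HasCompactSupport.zero
  | cons k L ih =>
    have e : comb x χ (k :: L) f = fun ξ => (χ k : ℂ) * f (ξ - x k) + comb x χ L f ξ :=
      funext fun ξ => comb_cons x χ k L f ξ
    rw [e]
    have h1 : HasCompactSupport fun ξ => f (ξ - x k) :=
      hf.comp_homeomorph (Homeomorph.subRight (x k))
    exact (h1.mul_left (f := fun _ => (χ k : ℂ))).add ih

end Comb

theorem cconv_add_right {F g h : Space d → ℂ} {ξ : Space d}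
    (hg : Integrable fun η => F η * g (ξ - η)) (hh : Integrable fun η => F η * h (ξ - η)) :
    cconv F (fun η => g η + h η) ξ = cconv F g ξ + cconv F h ξ := by
  simp only [cconv_apply, mul_add]
  exact integral_add hg hh

theorem cconv_const_mul_right (F g : Space d → ℂ) (c : ℂ) :
    cconv F (fun η => c * g η) = fun ξ => c * cconv F g ξ := by
  funext ξ
  simp only [cconv_apply]
  rw [← integral_const_mul]
  refine integral_congr_ae (Eventually.of_forall fun η => ?_)
  simp only; ring

theorem cconv_const_mul_left (F g : Space d → ℂ) (c : ℂ) :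
    cconv (fun η => c * F η) g = fun ξ => c * cconv F g ξ := by
  funext ξ
  simp only [cconv_apply]
  rw [← integral_const_mul]
  refine integral_congr_ae (Eventually.of_forall fun η => ?_)
  simp only; ring

theorem cconv_translate_right (F g : Space d → ℂ) (a ξ : Space d) :
    cconv F (fun η => g (η - a)) ξ = cconv F g (ξ - a) := by
  simp only [cconv_apply, sub_right_comm]

/-- The continuous functions with compact support. -/
def IsTest (f : Space d → ℂ) : Prop := Continuous f ∧ HasCompactSupport f

namespace IsTest

variable {f g : Space d → ℂ}

theorem fastDecay (hf : IsTest f) : FastDecay f := by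
  refine FastDecay.of_bound hf.1.aestronglyMeasurable fun k => ?_
  have h1 : Continuous fun ξ => (((1 + ‖ξ‖) ^ k : ℝ) : ℂ) * f ξ := by have := hf.1; fun_prop
  have h2 : HasCompactSupport fun ξ => (((1 + ‖ξ‖) ^ k : ℝ) : ℂ) * f ξ := hf.2.mul_left
  obtain ⟨C, hC⟩ := h1.bounded_above_of_compact_support h2
  refine ⟨C, fun ξ => ?_⟩
  have := hC ξ
  rwa [norm_mul, Complex.norm_real, Real.norm_of_nonneg (by positivity)] at this

theorem integrable_mul {F : Space d → ℂ} (hg : IsTest g) (hF : Integrable F) (ξ : Space d) :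
    Integrable fun η => F η * g (ξ - η) := by
  obtain ⟨C, hC⟩ := hg.1.bounded_above_of_compact_support hg.2
  exact hF.mul_bdd (c := C) (hg.1.comp (continuous_const.sub continuous_id)).aestronglyMeasurable
    (Eventually.of_forall fun η => hC _)

theorem cconv (hf : IsTest f) (hg : IsTest g) : IsTest (cconv f g) :=
  ⟨hg.2.continuous_convolution_right _ (hf.1.locallyIntegrable) hg.1, hf.2.convolution _ hg.2⟩

theorem conjReflect (hf : IsTest f) : IsTest (conjReflect f) :=
  ⟨Complex.continuous_conj.comp (hf.1.comp continuous_neg),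
    (hf.2.comp_homeomorph (Homeomorph.neg _)).comp_left (map_zero _)⟩

theorem autoConv (hf : IsTest f) : IsTest (autoConv f) := hf.cconv hf.conjReflect

theorem oddPower (hf : IsTest f) (j : ℕ) : IsTest (oddPower j f) := by
  induction j with
  | zero => exact hf
  | succ j ih => rw [oddPower_succ]; exact hf.autoConv.cconv ih

theorem translate (hf : IsTest f) (a : Space d) : IsTest (fun ξ => f (ξ - a)) :=
  ⟨hf.1.comp (continuous_id.sub continuous_const),
    hf.2.comp_homeomorph (Homeomorph.subRight a)⟩

theorem comb (hf : IsTest f) (x : ℤ × ℤ →+ Space d) (χ : AddChar (ℤ × ℤ) Circle)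
    (L : List (ℤ × ℤ)) : IsTest (comb x χ L f) :=
  ⟨continuous_comb x χ L hf.1, hasCompactSupport_comb x χ L hf.2⟩

end IsTest

section CombAlgebra

variable (x : ℤ × ℤ →+ Space d) (χ : AddChar (ℤ × ℤ) Circle)

theorem cconv_comb_right {F g : Space d → ℂ} (hF : Integrable F) (hg : IsTest g)
    (L : List (ℤ × ℤ)) : cconv F (comb x χ L g) = comb x χ L (cconv F g) := by
  funext ξ
  induction L with
  | nil => simp [comb, cconv_apply]
  | cons k L ih =>
    rw [comb_cons, ← ih]
    have e : comb x χ (k :: L) g = fun ξ => (χ k : ℂ) * g (ξ - x k) + comb x χ L g ξ :=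
      funext fun ξ => comb_cons x χ k L g ξ
    rw [e, cconv_add_right, congrFun (cconv_const_mul_right F _ _) ξ, cconv_translate_right]
    · have := ((hg.translate (x k)).integrable_mul hF ξ).const_mul (χ k : ℂ)
      refine this.congr (Eventually.of_forall fun η => ?_)
      simp only; ring
    · exact (hg.comb x χ L).integrable_mul hF ξ

theorem cconv_mul_comb_left {m : Space d → ℝ} {C : ℝ} (hm : IsMultiplier m C) {f g : Space d → ℂ}
    (hf : IsTest f) (hg : IsTest g) (L : List (ℤ × ℤ)) (ξ : Space d) :
    cconv (fun η => (m η : ℂ) * comb x χ L f η) g ξ =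
      (L.map fun k => (χ k : ℂ) * ∫ η, (m (η + x k) : ℂ) * f η * g (ξ - x k - η)).sum := by
  induction L with
  | nil => simp [comb, cconv_apply]
  | cons k L ih =>
    rw [List.map_cons, List.sum_cons, ← ih]
    have e1 : ∫ η, (m (η + x k) : ℂ) * f η * g (ξ - x k - η) =
        ∫ η, (m η : ℂ) * f (η - x k) * g (ξ - η) := by
      rw [← integral_add_right_eq_self (fun η => (m η : ℂ) * f (η - x k) * g (ξ - η)) (x k)]
      simp only [add_sub_cancel_right, sub_sub, add_comm (x k)]
    rw [e1, ← integral_const_mul, cconv_apply, cconv_apply, ← integral_add]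
    · refine integral_congr_ae (Eventually.of_forall fun η => ?_)
      simp only [comb_cons]; ring
    · exact (hg.integrable_mul (hm.fastDecay (hf.translate (x k)).fastDecay).integrable
        ξ).const_mul _
    · exact hg.integrable_mul (hm.fastDecay (hf.comb x χ L).fastDecay).integrable ξ

theorem cconv_comb_comb {f g : Space d → ℂ} (hf : IsTest f) (hg : IsTest g)
    (L L' : List (ℤ × ℤ)) :
    cconv (comb x χ L f) (comb x χ L' g) = comb x χ (sumList L' L) (cconv f g) := by
  rw [cconv_comb_right x χ (hf.comb x χ L).fastDecay.integrable hg, ← comb_comb]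
  congr 1
  funext ξ
  have := cconv_mul_comb_left x χ isMultiplier_one hf hg L ξ
  simp only [Complex.ofReal_one, one_mul] at this
  rw [this]
  simp only [comb, cconv_apply]

theorem autoConv_comb {f : Space d → ℂ} (hf : IsTest f) (L : List (ℤ × ℤ)) :
    autoConv (comb x χ L f) = comb x χ (autoList L) (autoConv f) := by
  rw [autoConv, conjReflect_comb, cconv_comb_comb x χ hf hf.conjReflect]
  rfl

theorem oddPower_comb {f : Space d → ℂ} (hf : IsTest f) (L : List (ℤ × ℤ)) (j : ℕ) :
    oddPower j (comb x χ L f) = comb x χ (oddList j L) (oddPower j f) := by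
  induction j with
  | zero => rfl
  | succ j ih =>
    rw [oddPower_succ, ih, autoConv_comb x χ hf, oddPower_succ,
      cconv_comb_comb x χ hf.autoConv (hf.oddPower j)]
    rfl

/-- The nonlinearity of a comb is a sum over pairs of a frequency `k` of `|ψ|²`, at which the
multiplier acts, and a frequency `l` of `|ψ|^{2j} ψ`. -/
theorem nonlin_comb {m : Space d → ℝ} {C : ℝ} (hm : IsMultiplier m C) {f : Space d → ℂ}
    (hf : IsTest f) (L : List (ℤ × ℤ)) (j : ℕ) (ξ : Space d) :
    nonlin m j (comb x χ L f) ξ = ((oddList j L).map fun l => ((autoList L).map fun k =>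
      (χ (l + k) : ℂ) * ∫ η, (m (η + x k) : ℂ) * autoConv f η *
        oddPower j f (ξ - x (l + k) - η)).sum).sum := by
  rw [nonlin, autoConv_comb x χ hf, oddPower_comb x χ hf,
    cconv_comb_right x χ (hm.fastDecay (hf.autoConv.comb x χ _).fastDecay).integrable
      (hf.oddPower j), comb]
  congr 1
  refine List.map_congr_left fun l _ => ?_
  rw [cconv_mul_comb_left x χ hm hf.autoConv (hf.oddPower j), ← List.sum_map_mul_left]
  congr 1
  refine List.map_congr_left fun k _ => ?_
  rw [AddChar.map_add_eq_mul, Circle.coe_mul, map_add, mul_assoc]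
  simp only [sub_sub]

end CombAlgebra

theorem autoConv_const_mul (A : ℝ) (g : Space d → ℂ) :
    autoConv (fun ξ => (A : ℂ) * g ξ) = fun ξ => ((A ^ 2 : ℝ) : ℂ) * autoConv g ξ := by
  have e : conjReflect (fun ξ => (A : ℂ) * g ξ) = fun ξ => (A : ℂ) * conjReflect g ξ := by
    funext ξ; simp [conjReflect]
  rw [autoConv, e, cconv_const_mul_left, cconv_const_mul_right]
  funext ξ
  rw [autoConv]; push_cast; ring

theorem oddPower_const_mul (A : ℝ) (j : ℕ) (g : Space d → ℂ) :
    oddPower j (fun ξ => (A : ℂ) * g ξ) = fun ξ =>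
        ((A ^ (2 * j + 1) : ℝ) : ℂ) * oddPower j g ξ := by
  induction j with
  | zero => simp [oddPower_zero]
  | succ j ih =>
    rw [oddPower_succ, ih, autoConv_const_mul, cconv_const_mul_left, cconv_const_mul_right]
    funext ξ
    rw [oddPower_succ]; push_cast; ring

theorem nonlin_const_mul (m : Space d → ℝ) (A : ℝ) (j : ℕ) (g : Space d → ℂ) (ξ : Space d) :
    nonlin m j (fun ξ => (A : ℂ) * g ξ) ξ = ((A ^ (2 * j + 3) : ℝ) : ℂ) * nonlin m j g ξ := by
  have e : (fun ξ => (m ξ : ℂ) * (((A ^ 2 : ℝ) : ℂ) * autoConv g ξ)) =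
      fun ξ => ((A ^ 2 : ℝ) : ℂ) * ((m ξ : ℂ) * autoConv g ξ) := by
    funext ξ; ring
  rw [nonlin, oddPower_const_mul, autoConv_const_mul, e, cconv_const_mul_left,
    cconv_const_mul_right, nonlin]
  push_cast; ring

/-! ### Resonant interactions -/

/-- The lattice of frequencies generated by `N e` and `N f`. -/
noncomputable def freq (e f : Space d) (N : ℝ) : ℤ × ℤ →+ Space d where
  toFun k := N • ((k.1 : ℝ) • e + (k.2 : ℝ) • f)
  map_zero' := by simp
  map_add' k l := by
    simp only [Prod.fst_add, Prod.snd_add, Int.cast_add, add_smul, ← smul_add]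
    congr 1; abel

theorem freq_apply (e f : Space d) (N : ℝ) (k : ℤ × ℤ) :
    freq e f N k = N • ((k.1 : ℝ) • e + (k.2 : ℝ) • f) := rfl

theorem le_norm_freq {e f : Space d} (he : ‖e‖ = 1) (hf : ‖f‖ = 1) (hef : ⟪e, f⟫ = 0) {N : ℝ}
    (hN : 0 ≤ N) {k : ℤ × ℤ} (hk : k ≠ 0) : N ≤ ‖freq e f N k‖ := by
  rw [freq_apply, norm_smul, Real.norm_of_nonneg hN]
  refine le_mul_of_one_le_right hN ?_
  have h1 : ‖(k.1 : ℝ) • e + (k.2 : ℝ) • f‖ ^ 2 = (k.1 : ℝ) ^ 2 + (k.2 : ℝ) ^ 2 := by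
    rw [norm_add_sq_real, inner_smul_left, inner_smul_right, hef, norm_smul, norm_smul, he, hf]
    simp
  have h2 : (1 : ℤ) ≤ k.1 ^ 2 + k.2 ^ 2 := by
    by_contra h
    have h3 : k.1 ^ 2 + k.2 ^ 2 = 0 := by
      have := sq_nonneg k.1; have := sq_nonneg k.2; omega
    have h4 : k.1 = 0 := by nlinarith [sq_nonneg k.1, sq_nonneg k.2]
    have h5 : k.2 = 0 := by nlinarith [sq_nonneg k.1, sq_nonneg k.2]
    exact hk (Prod.ext h4 h5)
  have h3 : (1 : ℝ) ≤ (k.1 : ℝ) ^ 2 + (k.2 : ℝ) ^ 2 := by exact_mod_cast h2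
  rw [← h1] at h3
  nlinarith [norm_nonneg ((k.1 : ℝ) • e + (k.2 : ℝ) • f)]

/-- The total value of `a` over the pairs of frequencies with sum zero, the interactions that create
the frequency zero. -/
def resonantSum (a : ℤ × ℤ → ℝ) (L : List (ℤ × ℤ)) (j : ℕ) : ℝ :=
  ((oddList j L).map fun l => ((autoList L).map fun k => if l + k = 0 then a k else 0).sum).sum

theorem tendstoUniformly_list_sum {ι κ : Type*} (L : List κ) {F : κ → ℝ → ι → ℂ} {G : κ → ι → ℂ}
    (h : ∀ k ∈ L, TendstoUniformly (F k) (G k) atTop) :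
    TendstoUniformly (fun N p => (L.map fun k => F k N p).sum)
      (fun p => (L.map fun k => G k p).sum) atTop := by
  induction L with
  | nil =>
    simp only [List.map_nil, List.sum_nil]
    exact Metric.tendstoUniformly_iff.2 fun ε hε => Eventually.of_forall fun N p =>
        by simpa using hε
  | cons k L ih =>
    simp only [List.map_cons, List.sum_cons]
    exact (h k (by simp)).add (ih fun l hl => h l (by simp [hl]))

theorem IsTest.exists_radius {f : Space d → ℂ} (hf : IsTest f) :
    ∃ B : ℝ, ∀ ξ, B < ‖ξ‖ → f ξ = 0 := by
  obtain ⟨B, hB⟩ := hf.2.isCompact.isBounded.subset_closedBall 0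
  refine ⟨B, fun ξ hξ => ?_⟩
  by_contra h
  have := hB (subset_closure h)
  rw [mem_closedBall_zero_iff] at this
  linarith

section Limit

variable {m : Space d → ℝ} {C : ℝ} (hm : IsMultiplier m C) {e f : Space d} {b o : Space d → ℂ}
  (hb : IsTest b) (ho : IsTest o)
include hm hb ho

/-- A multiplier that converges along the translates by `freq e f N k` acts in the limit as a
constant. -/
theorem tendsto_integral_multiplier {a : ℝ} {k : ℤ × ℤ}
    (ha : ∀ ζ, Tendsto (fun N => m (ζ + freq e f N k)) atTop (𝓝 a)) :
    TendstoUniformly (fun N (ξ : Space d) => ∫ η, (m (η + freq e f N k) : ℂ) * b η * o (ξ - η))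
      (fun ξ => (a : ℂ) * cconv b o ξ) atTop := by
  obtain ⟨S, hS⟩ := ho.1.bounded_above_of_compact_support ho.2
  have hS0 : 0 ≤ S := (norm_nonneg _).trans (hS 0)
  have hmeas : ∀ N, AEStronglyMeasurable (fun η : Space d => (m (η + freq e f N k) : ℂ)) volume :=
    fun N => (Complex.measurable_ofReal.comp
      (hm.measurable.comp (measurable_id.add_const _))).aestronglyMeasurable
  have hint : ∀ N, Integrable fun η : Space d => (m (η + freq e f N k) : ℂ) * b η := fun N =>
    (hb.fastDecay.mul_bdd (hmeas N) (C := C) (n := 0) fun ξ => by simpa using hm.bound _).integrable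
  have h1 : Tendsto (fun N => ∫ η, S * ‖(m (η + freq e f N k) : ℂ) * b η - (a : ℂ) * b η‖) atTop
      (𝓝 0) := by
    have : (0 : ℝ) = ∫ _ : Space d, (0 : ℝ) := by simp
    rw [this]
    refine tendsto_integral_filter_of_dominated_convergence
      (fun η => S * (C * ‖b η‖ + |a| * ‖b η‖)) (Eventually.of_forall fun N => ?_)
      (Eventually.of_forall fun N => Eventually.of_forall fun η => ?_) ?_
      (Eventually.of_forall fun η => ?_)
    · exact (((hint N).sub (hb.fastDecay.integrable.const_mul _)).norm.const_mul S).1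
    · rw [Real.norm_of_nonneg (by positivity)]
      gcongr
      refine (norm_sub_le _ _).trans (add_le_add ?_ ?_)
      · rw [norm_mul, Complex.norm_real]
        gcongr
        exact hm.bound _
      · rw [norm_mul, Complex.norm_real, Real.norm_eq_abs]
    · exact ((hb.fastDecay.integrable.norm.const_mul C).add
        (hb.fastDecay.integrable.norm.const_mul |a|)).const_mul S
    · have h2 : Tendsto (fun N => (m (η + freq e f N k) : ℂ)) atTop (𝓝 (a : ℂ)) :=
        (Complex.continuous_ofReal.tendsto a).comp (ha η)
      have h3 := (((h2.mul_const (b η)).sub_const ((a : ℂ) * b η)).norm).const_mul S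
      simpa using h3
  refine Metric.tendstoUniformly_iff.2 fun ε hε => ?_
  filter_upwards [h1.eventually (gt_mem_nhds hε)] with N hN ξ
  refine lt_of_le_of_lt ?_ hN
  rw [dist_comm, dist_eq_norm, cconv_apply, ← integral_const_mul, ← integral_sub]
  · refine norm_integral_le_of_norm_le
      (((hint N).sub (hb.fastDecay.integrable.const_mul (a : ℂ))).norm.const_mul S)
      (Eventually.of_forall fun η => ?_)
    rw [← mul_assoc, ← sub_mul, norm_mul, mul_comm]
    gcongr
    exact hS _
  · exact ho.integrable_mul (hint N) ξ
  · exact (ho.integrable_mul hb.fastDecay.integrable ξ).const_mul _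

omit hm in
/-- The other interactions take place at frequencies of size at least `N`, out of reach of the ball
of radius one. -/
theorem eventually_integral_eq_zero (he : ‖e‖ = 1) (hf : ‖f‖ = 1) (hef : ⟪e, f⟫ = 0) {k : ℤ × ℤ}
    (hk : k ≠ 0) : ∀ᶠ N in atTop, ∀ ξ : Space d, ‖ξ‖ ≤ 1 → ∀ n : Space d → ℂ,
      ∫ η, n η * b η * o (ξ - freq e f N k - η) = 0 := by
  obtain ⟨B, hB⟩ := hb.exists_radius
  obtain ⟨B', hB'⟩ := ho.exists_radius
  filter_upwards [eventually_gt_atTop (1 + B + B'), eventually_ge_atTop 0] with N hN hN0 ξ hξ n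
  refine integral_eq_zero_of_ae (Eventually.of_forall fun η => ?_)
  simp only [Pi.zero_apply]
  by_cases h : B < ‖η‖
  · rw [hB η h]; simp
  · rw [hB' (ξ - freq e f N k - η), mul_zero]
    have h1 := le_norm_freq he hf hef hN0 hk
    have h2 : ‖freq e f N k‖ ≤ ‖ξ‖ + ‖η‖ + ‖ξ - freq e f N k - η‖ := by
      have : freq e f N k = ξ - η - (ξ - freq e f N k - η) := by abel
      calc _ = ‖ξ - η - (ξ - freq e f N k - η)‖ := by rw [← this]
        _ ≤ ‖ξ - η‖ + _ := norm_sub_le _ _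
        _ ≤ _ := by gcongr; exact norm_sub_le _ _
    linarith

end Limit

/-- As the frequencies tend to infinity, the nonlinearity of a comb is determined near the frequency
zero by the resonant interactions.  The estimate is uniform in the character `χ`, which will carry
the time dependence. -/
theorem eventually_nonlin_comb {m : Space d → ℝ} {C : ℝ} (hm : IsMultiplier m C) {e f : Space d}
    (he : ‖e‖ = 1) (hf : ‖f‖ = 1) (hef : ⟪e, f⟫ = 0) {g : Space d → ℂ} (hg : IsTest g)
    (L : List (ℤ × ℤ)) (j : ℕ) {a : ℤ × ℤ → ℝ}
    (ha : ∀ k ∈ autoList L, -k ∈ oddList j L → ∀ ζ,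
      Tendsto (fun N => m (ζ + freq e f N k)) atTop (𝓝 (a k))) {ε : ℝ} (hε : 0 < ε) :
    ∀ᶠ N in atTop, ∀ (χ : AddChar (ℤ × ℤ) Circle) (ξ : Space d), ‖ξ‖ ≤ 1 →
      ‖nonlin m j (comb (freq e f N) χ L g) ξ -
        (resonantSum a L j : ℂ) * cconv (autoConv g) (oddPower j g) ξ‖ ≤ ε := by
  let ι := AddChar (ℤ × ℤ) Circle × {ξ : Space d // ‖ξ‖ ≤ 1}
  have key : TendstoUniformly (fun N (p : ι) => nonlin m j (comb (freq e f N) p.1 L g) p.2)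
      (fun p => ((oddList j L).map fun l => ((autoList L).map fun k =>
        ((if l + k = 0 then a k else 0 : ℝ) : ℂ) *
          cconv (autoConv g) (oddPower j g) p.2).sum).sum) atTop := by
    simp only [nonlin_comb _ _ hm hg]
    refine tendstoUniformly_list_sum _ fun l hl => tendstoUniformly_list_sum _ fun k hk => ?_
    by_cases h : l + k = 0
    · have hl' : l = -k := eq_neg_of_add_eq_zero_left h
      have h1 := (tendsto_integral_multiplier hm hg.autoConv (hg.oddPower j)
        (ha k hk (hl' ▸ hl))).comp (fun p : ι => (p.2 : Space d))
      simp only [h, AddChar.map_zero_eq_one, Circle.coe_one, one_mul, map_zero, sub_zero, if_true]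
      exact h1
    · refine Metric.tendstoUniformly_iff.2 fun ε hε => ?_
      filter_upwards [eventually_integral_eq_zero hg.autoConv (hg.oddPower j) he hf hef h]
        with N hN p
      rw [hN p.2 p.2.2 fun η => (m (η + freq e f N k) : ℂ)]
      simpa [h] using hε
  filter_upwards [Metric.tendstoUniformly_iff.1 key ε hε] with N hN χ ξ hξ
  have h2 := hN (χ, ⟨ξ, hξ⟩)
  rw [dist_comm, dist_eq_norm] at h2
  refine le_trans (le_of_eq ?_) h2.le
  congr 2
  simp only [List.sum_map_mul_right, resonantSum]
  congr 1
  rw [← Complex.ofRealHom_eq_coe, map_list_sum, List.map_map]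
  congr 1
  refine List.map_congr_left fun l _ => ?_
  rw [Function.comp_apply, map_list_sum, List.map_map]
  rfl

/-- The nonnegative functions with compact support that are at least `α` on the ball of radius
`ρ`. -/
def IsBump (ρ α : ℝ) (f : Space d → ℂ) : Prop :=
  ∃ r : Space d → ℝ, Continuous r ∧ HasCompactSupport r ∧ (∀ ξ, 0 ≤ r ξ) ∧
    (∀ ξ, ‖ξ‖ ≤ ρ → α ≤ r ξ) ∧ f = fun ξ => (r ξ : ℂ)

theorem IsBump.isTest {ρ α : ℝ} {f : Space d → ℂ} (hf : IsBump ρ α f) : IsTest f := by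
  obtain ⟨r, h1, h2, -, -, rfl⟩ := hf
  exact ⟨Complex.continuous_ofReal.comp h1, h2.comp_left Complex.ofReal_zero⟩

theorem IsBump.conjReflect {ρ α : ℝ} {f : Space d → ℂ} (hf : IsBump ρ α f) :
    IsBump ρ α (conjReflect f) := by
  obtain ⟨r, h1, h2, h3, h4, rfl⟩ := hf
  refine ⟨fun ξ => r (-ξ), h1.comp continuous_neg, h2.comp_homeomorph (Homeomorph.neg _),
    fun ξ => h3 _, fun ξ hξ => h4 _ (by simpa using hξ), ?_⟩
  funext ξ
  simp [NormInflation.conjReflect]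

/-- The volume of the ball of radius one half. -/
noncomputable def halfBallVolume (d : ℕ) : ℝ := volume.real (Metric.ball (0 : Space d) (1 / 2))

theorem halfBallVolume_pos (d : ℕ) : 0 < halfBallVolume d :=
  ENNReal.toReal_pos (Metric.measure_ball_pos _ _ (by norm_num)).ne' measure_ball_lt_top.ne

/-- For `‖ξ‖ ≤ ρ` both factors of the convolution integral are bounded below on the ball of radius
`ρ / 2` around `ξ / 2`. -/
theorem IsBump.cconv {ρ α β : ℝ} (hρ : 0 < ρ) (hβ : 0 ≤ β) {f g : Space d → ℂ}
    (hf : IsBump ρ α f) (hg : IsBump ρ β g) :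
    IsBump ρ (α * β * (halfBallVolume d * ρ ^ d)) (cconv f g) := by
  have ht := hf.isTest.cconv hg.isTest
  have hint := fun ξ => hg.isTest.integrable_mul hf.isTest.fastDecay.integrable ξ
  obtain ⟨r, h1, h2, h3, h4, rfl⟩ := hf
  obtain ⟨s, k1, k2, k3, k4, rfl⟩ := hg
  have e : NormInflation.cconv (fun ξ => (r ξ : ℂ)) (fun ξ => (s ξ : ℂ)) =
      fun ξ => ((∫ η, r η * s (ξ - η) : ℝ) : ℂ) := by
    funext ξ
    rw [cconv_apply, ← integral_complex_ofReal]
    push_cast; rfl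
  have e' : (fun ξ => ∫ η, r η * s (ξ - η)) =
      fun ξ => (NormInflation.cconv (fun ξ => (r ξ : ℂ)) (fun ξ => (s ξ : ℂ)) ξ).re := by
    rw [e]; simp
  refine ⟨fun ξ => ∫ η, r η * s (ξ - η), ?_, ?_, fun ξ => integral_nonneg fun η =>
    mul_nonneg (h3 _) (k3 _), fun ξ hξ => ?_, e⟩
  · rw [e']; exact Complex.continuous_re.comp ht.1
  · rw [e']; exact ht.2.comp_left (g := Complex.re) Complex.zero_re
  · have hint' : Integrable fun η => r η * s (ξ - η) := by
      have := (hint ξ).re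
      simpa using this
    have hsub : ∀ η ∈ Metric.ball ((1 / 2 : ℝ) • ξ) (ρ / 2), α * β ≤ r η * s (ξ - η) := by
      intro η hη
      rw [Metric.mem_ball, dist_eq_norm] at hη
      have hh : ‖(1 / 2 : ℝ) • ξ‖ ≤ ρ / 2 := by
        rw [norm_smul]; norm_num; linarith
      have n1 : ‖η‖ ≤ ρ := by
        have : η = (η - (1 / 2 : ℝ) • ξ) + (1 / 2 : ℝ) • ξ := by abel
        rw [this]
        exact (norm_add_le _ _).trans (by linarith)
      have n2 : ‖ξ - η‖ ≤ ρ := by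
        have : ξ - η = (1 / 2 : ℝ) • ξ - (η - (1 / 2 : ℝ) • ξ) := by module
        rw [this]
        exact (norm_sub_le _ _).trans (by linarith)
      exact mul_le_mul (h4 _ n1) (k4 _ n2) hβ (h3 _)
    have hvol : volume.real (Metric.ball ((1 / 2 : ℝ) • ξ) (ρ / 2)) = halfBallVolume d * ρ ^ d := by
      have := Measure.addHaar_ball_mul_of_pos (volume : Measure (Space d)) ((1 / 2 : ℝ) • ξ) hρ
        (1 / 2)
      rw [halfBallVolume, ← mul_one_div ρ, measureReal_def, this, finrank_euclideanSpace,
        Fintype.card_fin, ENNReal.toReal_mul, ENNReal.toReal_ofReal (by positivity), mul_comm]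
      rfl
    calc α * β * (halfBallVolume d * ρ ^ d)
        = ∫ η in Metric.ball ((1 / 2 : ℝ) • ξ) (ρ / 2), α * β := by
          rw [setIntegral_const, hvol, smul_eq_mul, mul_comm]
      _ ≤ ∫ η in Metric.ball ((1 / 2 : ℝ) • ξ) (ρ / 2), r η * s (ξ - η) :=
          setIntegral_mono_on (integrableOn_const measure_ball_lt_top.ne) hint'.integrableOn
            measurableSet_ball hsub
      _ ≤ _ := setIntegral_le_integral hint' (Eventually.of_forall fun η =>
          mul_nonneg (h3 _) (k3 _))

/-- For bumps of height `R^d` and width `R⁻¹`, the height is preserved by convolutions. -/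
theorem IsBump.nonlin {R : ℝ} (hR : 0 < R) {f : Space d → ℂ} (hf : IsBump R⁻¹ (R ^ d) f) (j : ℕ) :
    IsBump R⁻¹ (halfBallVolume d ^ (2 * j + 2) * R ^ d)
      (NormInflation.cconv (autoConv f) (oddPower j f)) := by
  have hv := (halfBallVolume_pos d).le
  have hR' : R⁻¹ ^ d * R ^ d = 1 := by rw [← mul_pow, inv_mul_cancel₀ hR.ne', one_pow]
  have h1 : IsBump R⁻¹ (halfBallVolume d * R ^ d) (autoConv f) := by
    have := hf.cconv (inv_pos.2 hR) (by positivity) hf.conjReflect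
    rwa [show R ^ d * R ^ d * (halfBallVolume d * R⁻¹ ^ d) =
      halfBallVolume d * R ^ d * (R⁻¹ ^ d * R ^ d) by ring, hR', mul_one] at this
  have h2 : ∀ j, IsBump R⁻¹ (halfBallVolume d ^ (2 * j) * R ^ d) (oddPower j f) := by
    intro j
    induction j with
    | zero => simpa [oddPower_zero] using hf
    | succ j ih =>
      have := h1.cconv (inv_pos.2 hR) (by positivity) ih
      rw [← oddPower_succ] at this
      convert this using 1
      linear_combination (-(halfBallVolume d ^ (2 * j + 2) * R ^ d)) * hR'
  have := h1.cconv (inv_pos.2 hR) (by positivity) (h2 j)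
  convert this using 1
  linear_combination (-(halfBallVolume d ^ (2 * j + 2) * R ^ d)) * hR'

/-! ### The initial data -/

/-- A smooth bump of height `R^d`, constant on the ball of radius `R⁻¹` and supported in the ball
of radius `2 R⁻¹`. -/
noncomputable def bump (R : ℝ) (ξ : Space d) : ℂ :=
  ((R ^ d * (⟨1, 2, one_pos, one_lt_two⟩ : ContDiffBump (0 : Space d)) (R • ξ) : ℝ) : ℂ)

theorem contDiff_bump (R : ℝ) : ContDiff ℝ ∞ (bump R : Space d → ℂ) := by
  refine Complex.ofRealCLM.contDiff.comp (contDiff_const.mul ?_)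
  exact (ContDiffBump.contDiff _).comp (contDiff_id.const_smul R)

theorem norm_bump_le {R : ℝ} (hR : 0 < R) (ξ : Space d) : ‖bump R ξ‖ ≤ R ^ d := by
  rw [bump, Complex.norm_real, Real.norm_of_nonneg (mul_nonneg (by positivity)
    (ContDiffBump.nonneg _))]
  exact mul_le_of_le_one_right (by positivity) (ContDiffBump.le_one _)

theorem bump_eq_zero {R : ℝ} (hR : 0 < R) {ξ : Space d} (hξ : 2 / R ≤ ‖ξ‖) : bump R ξ = 0 := by
  rw [bump, ContDiffBump.zero_of_le_dist]
  · simp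
  · rw [dist_zero_right, norm_smul, Real.norm_of_nonneg hR.le]
    rwa [div_le_iff₀' hR] at hξ

theorem isBump_bump {R : ℝ} (hR : 0 < R) : IsBump R⁻¹ (R ^ d) (bump R : Space d → ℂ) := by
  refine ⟨fun ξ => R ^ d * (⟨1, 2, one_pos, one_lt_two⟩ : ContDiffBump (0 : Space d)) (R • ξ),
    ?_, ?_, fun ξ => mul_nonneg (by positivity) (ContDiffBump.nonneg _), fun ξ hξ => ?_, rfl⟩
  · exact continuous_const.mul ((ContDiffBump.continuous _).comp (continuous_id.const_smul R))
  · exact ((ContDiffBump.hasCompactSupport _).comp_homeomorph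
      (Homeomorph.smulOfNeZero R hR.ne')).mul_left
  · beta_reduce
    rw [ContDiffBump.one_of_mem_closedBall, mul_one]
    rw [mem_closedBall_zero_iff, norm_smul, Real.norm_of_nonneg hR.le]
    rwa [← one_div, le_div_iff₀' hR] at hξ

/-- The frequencies `e`, `f` and `e + f` of the initial data.  Two opposite corners of a square
balance the third: `(1, 0) + (0, 1) - (1, 1) = 0`, and this interaction creates the frequency zero.
-/
def dataList : List (ℤ × ℤ) := [(1, 0), (0, 1), (1, 1)]

theorem norm_of_mem_dataList {k : ℤ × ℤ} (hk : k ∈ dataList) : ‖k‖ = 1 := by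
  simp only [dataList, List.mem_cons, List.not_mem_nil, or_false] at hk
  rcases hk with rfl | rfl | rfl <;> simp [Prod.norm_def]

theorem ne_zero_of_mem_dataList {k : ℤ × ℤ} (hk : k ∈ dataList) : k ≠ 0 := by
  rintro rfl
  have := norm_of_mem_dataList hk
  simp at this

theorem norm_freq_le {e f : Space d} (he : ‖e‖ = 1) (hf : ‖f‖ = 1) {N : ℝ} (hN : 0 ≤ N)
    {k : ℤ × ℤ} (hk : k ∈ dataList) : ‖freq e f N k‖ ≤ 2 * N := by
  have h := norm_of_mem_dataList hk
  have h1 : ‖k.1‖ ≤ 1 := h ▸ norm_fst_le k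
  have h2 : ‖k.2‖ ≤ 1 := h ▸ norm_snd_le k
  rw [freq_apply, norm_smul, Real.norm_of_nonneg hN, mul_comm 2]
  gcongr
  refine (norm_add_le _ _).trans ?_
  rw [norm_smul, norm_smul, he, hf, mul_one, mul_one, Int.norm_cast_real, Int.norm_cast_real]
  linarith

theorem norm_comb_dataList_le (x : ℤ × ℤ →+ Space d) (χ : AddChar (ℤ × ℤ) Circle)
    (g : Space d → ℂ) (ξ : Space d) {b : ℝ} (hb : ∀ k ∈ dataList, ‖g (ξ - x k)‖ ≤ b) :
    ‖comb x χ dataList g ξ‖ ≤ 3 * b := by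
  have h1 := hb (1, 0) (by simp [dataList])
  have h2 := hb (0, 1) (by simp [dataList])
  have h3 := hb (1, 1) (by simp [dataList])
  simp only [dataList, comb, List.map_cons, List.map_nil, List.sum_cons, List.sum_nil, add_zero]
  refine (norm_add_le _ _).trans ?_
  have h4 := norm_add_le ((χ (0, 1) : ℂ) * g (ξ - x (0, 1))) ((χ (1, 1) : ℂ) * g (ξ - x (1, 1)))
  simp only [norm_mul, Circle.norm_coe, one_mul] at h4 ⊢
  linarith

/-- The weight of the combs with frequencies of size `N` and profiles of width `R⁻¹`: it is bounded
by a multiple of `R^d`, and it is at least a multiple of `R^d` where the data live. -/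
theorem exists_weight (d : ℕ) : ∃ Cw K S : ℝ, 0 < K ∧ 0 < S ∧ ∀ (e f : Space d), ‖e‖ = 1 →
    ‖f‖ = 1 → ∀ R N : ℝ, 0 < R → 0 < N → 1 ≤ N * R →
      IsWeight (combWeight Cw R N⁻¹ (freq e f N)) ∧
      (∀ ξ, combWeight Cw R N⁻¹ (freq e f N) ξ ≤ S * R ^ d) ∧
      ∀ k ∈ dataList, ∀ ξ, ‖ξ - freq e f N k‖ ≤ 2 / R →
        R ^ d ≤ K * combWeight Cw R N⁻¹ (freq e f N) ξ := by
  obtain ⟨C, hC, hw⟩ := exists_isWeight_combWeight d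
  have hs : 0 < ∑' k, latticeWeight k := summable_latticeWeight.tsum_pos
    (fun k => (latticeWeight_pos k).le) 0 (latticeWeight_pos 0)
  refine ⟨C, C * Real.exp 4 * 2 ^ 4 * 3 ^ (d + 1), C⁻¹ * ∑' k, latticeWeight k, by positivity,
    by positivity, fun e f he hf R N hR hN hNR => ⟨hw R N⁻¹ hR (inv_pos.2 hN) _, fun ξ => ?_,
      fun k hk ξ hξ => ?_⟩⟩
  · have h1 : Real.exp (-(N⁻¹ * ‖ξ‖)) ≤ 1 := by
      rw [Real.exp_le_one_iff]
      have : 0 ≤ N⁻¹ * ‖ξ‖ := by positivity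
      linarith
    have h2 := combSum_le R (freq e f N) ξ
    have h3 := (combSum_pos R (freq e f N) ξ).le
    calc combWeight C R N⁻¹ (freq e f N) ξ ≤ C⁻¹ * R ^ d * 1 * ∑' k, latticeWeight k := by
          unfold combWeight; gcongr
      _ = _ := by ring
  · have hRN : 1 / R ≤ N := by rwa [div_le_iff₀ hR]
    have h1 : ‖ξ‖ ≤ 4 * N := by
      have e1 : ξ = (ξ - freq e f N k) + freq e f N k := by abel
      have e2 := norm_freq_le he hf hN.le hk
      have e3 : 2 / R ≤ 2 * N := by rw [← mul_one_div]; gcongr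
      calc ‖ξ‖ ≤ ‖ξ - freq e f N k‖ + ‖freq e f N k‖ := by
            conv_lhs => rw [e1]
            exact norm_add_le _ _
        _ ≤ _ := by linarith
    have h2 : Real.exp (-4) ≤ Real.exp (-(N⁻¹ * ‖ξ‖)) := by
      rw [Real.exp_le_exp, neg_le_neg_iff, inv_mul_le_iff₀ hN]
      linarith
    have h3 : (2 ^ 4 : ℝ)⁻¹ * (3 ^ (d + 1))⁻¹ ≤ combSum R (freq e f N) ξ := by
      refine le_trans ?_ (le_combSum R (freq e f N) ξ k)
      have e1 : latticeWeight k = (2 ^ 4 : ℝ)⁻¹ := by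
        rw [latticeWeight, norm_of_mem_dataList hk]; norm_num
      rw [e1, polyWeight]
      gcongr
      rw [norm_smul, Real.norm_of_nonneg hR.le]
      rw [le_div_iff₀' hR] at hξ
      linarith
    calc R ^ d = (C * Real.exp 4 * 2 ^ 4 * 3 ^ (d + 1)) * (C⁻¹ * R ^ d * Real.exp (-4) *
          ((2 ^ 4 : ℝ)⁻¹ * (3 ^ (d + 1))⁻¹)) := by
          rw [Real.exp_neg]
          field_simp
      _ ≤ _ := by
          unfold combWeight
          gcongr

/-- A quadratic symbol that is additive along the orthonormal pair `e`, `f`.  The phase of the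
interaction `N e + N f - N (e + f) = 0` is then stationary: `P (N e) + P (N f) = P (N (e + f)) + P
0`. -/
structure IsResonant (P : Space d → ℝ) (e f : Space d) (B : ℝ) : Prop where
  norm_fst : ‖e‖ = 1
  norm_snd : ‖f‖ = 1
  inner_eq_zero : ⟪e, f⟫ = 0
  abs_sub_le : ∀ ξ η, |P (ξ + η) - P ξ| ≤ B * ‖η‖ * (2 * ‖ξ‖ + ‖η‖)
  apply_add : ∀ r s : ℝ, P (r • e + s • f) = r ^ 2 * P e + s ^ 2 * P f

namespace IsResonant

variable {P : Space d → ℝ} {e f : Space d} {B : ℝ} (hP : IsResonant P e f B)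
include hP

theorem nonneg : 0 ≤ B := by
  have h := (abs_nonneg _).trans (hP.abs_sub_le 0 e)
  rw [hP.norm_fst, norm_zero] at h
  linarith

theorem abs_le {ξ : Space d} (hξ : ‖ξ‖ ≤ 1) : |P ξ| ≤ B := by
  have h0 : P 0 = 0 := by simpa using hP.apply_add 0 0
  have h := hP.abs_sub_le 0 ξ
  rw [h0, zero_add, sub_zero, norm_zero] at h
  have hB := hP.nonneg
  calc |P ξ| ≤ B * ‖ξ‖ * (2 * 0 + ‖ξ‖) := h
    _ ≤ B * 1 * (2 * 0 + 1) := by gcongr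
    _ = B := by ring

end IsResonant

/-- The phases of the frequencies `freq e f N k` under the free evolution at time `s`.  For a
resonant symbol they form a character of the lattice on the frequencies of the data. -/
noncomputable def phaseChar (P : Space d → ℝ) (e f : Space d) (N s : ℝ) :
    AddChar (ℤ × ℤ) Circle where
  toFun k := Circle.exp (-(s * N ^ 2) * (k.1 * P e + k.2 * P f))
  map_zero_eq_one' := by simp
  map_add_eq_mul' k l := by
    rw [← Circle.exp_add]
    congr 1
    push_cast [Prod.fst_add, Prod.snd_add]
    ring

theorem phaseChar_eq {P : Space d → ℝ} {e f : Space d} {B : ℝ} (hP : IsResonant P e f B)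
    (N s : ℝ) {k : ℤ × ℤ} (hk : k ∈ dataList) :
    (phaseChar P e f N s k : ℂ) = Complex.exp (((-1) * s * P (freq e f N k) : ℝ) * Complex.I) := by
  have e1 : P (freq e f N k) = N ^ 2 * (k.1 * P e + k.2 * P f) := by
    rw [freq_apply, smul_add, smul_smul, smul_smul, hP.apply_add]
    simp only [dataList, List.mem_cons, List.not_mem_nil, or_false] at hk
    rcases hk with rfl | rfl | rfl <;> push_cast <;> ring
  change ((Circle.exp (-(s * N ^ 2) * (k.1 * P e + k.2 * P f)) : Circle) : ℂ) = _
  rw [Circle.coe_exp, e1]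
  congr 3
  ring

theorem norm_exp_sub_exp_le (a b : ℝ) :
    ‖Complex.exp (a * Complex.I) - Complex.exp (b * Complex.I)‖ ≤ |a - b| := by
  have e : Complex.exp (a * Complex.I) - Complex.exp (b * Complex.I) =
      Complex.exp (b * Complex.I) * (Complex.exp (Complex.I * ((a - b : ℝ) : ℂ)) - 1) := by
    rw [mul_sub, ← Complex.exp_add]; push_cast; ring_nf
  rw [e, norm_mul, Complex.norm_exp_ofReal_mul_I, one_mul]
  exact Real.norm_exp_I_mul_ofReal_sub_one_le

/-- On the time scale `R / N` the free evolution only rotates the phases of the data: on a bump of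
width `R⁻¹` at frequency `N` the symbol varies by `O(N / R)`, so the error is of the order of `τ`.
-/
theorem norm_free_sub_comb_le {P : Space d → ℝ} {e f : Space d} {B : ℝ}
    (hP : IsResonant P e f B) {R N τ s b : ℝ} (hR : 0 < R) (hN : 0 < N) (hNR : 1 ≤ N * R)
    (hs : |s| ≤ τ * R / N) (ξ : Space d)
    (hb : ∀ k ∈ dataList, ‖ξ - freq e f N k‖ ≤ 2 / R → R ^ d ≤ b) (hb0 : 0 ≤ b) :
    ‖Complex.exp (((-1) * s * P ξ : ℝ) * Complex.I) * comb (freq e f N) 1 dataList (bump R) ξ -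
      comb (freq e f N) (phaseChar P e f N s) dataList (bump R) ξ‖ ≤ 36 * B * τ * b := by
  have hRN : 1 / R ≤ N := by rwa [div_le_iff₀ hR]
  have hB := hP.nonneg
  have hτ : 0 ≤ τ * R / N := (abs_nonneg _).trans hs
  have hτ0 : 0 ≤ τ := by
    by_contra h
    have : τ * R / N < 0 := div_neg_of_neg_of_pos (mul_neg_of_neg_of_pos (not_le.1 h) hR) hN
    linarith
  have key : ∀ k ∈ dataList, ‖(Complex.exp (((-1) * s * P ξ : ℝ) * Complex.I) -
      phaseChar P e f N s k) * bump R (ξ - freq e f N k)‖ ≤ 12 * B * τ * b := by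
    intro k hk
    rcases le_total (2 / R) ‖ξ - freq e f N k‖ with h | h
    · rw [bump_eq_zero hR h, mul_zero, norm_zero]; positivity
    · rw [norm_mul, phaseChar_eq hP N s hk]
      have h1 := hP.abs_sub_le (freq e f N k) (ξ - freq e f N k)
      rw [add_sub_cancel] at h1
      have h2 := norm_freq_le hP.norm_fst hP.norm_snd hN.le hk
      have h3 : 2 / R ≤ 2 * N := by rw [← mul_one_div]; gcongr
      have h4 : |P ξ - P (freq e f N k)| ≤ B * (2 / R) * (6 * N) := by
        refine h1.trans ?_
        gcongr
        linarith
      have h5 : |(-1) * s * P ξ - (-1) * s * P (freq e f N k)| ≤ 12 * B * τ := by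
        rw [← mul_sub, abs_mul, abs_mul, abs_neg, abs_one, one_mul]
        calc |s| * |P ξ - P (freq e f N k)| ≤ (τ * R / N) * (B * (2 / R) * (6 * N)) := by gcongr
          _ = 12 * B * τ := by field_simp; ring
      exact mul_le_mul ((norm_exp_sub_exp_le _ _).trans h5)
        ((norm_bump_le hR _).trans (hb k hk h)) (norm_nonneg _) (by positivity)
  have h1 := key (1, 0) (by simp [dataList])
  have h2 := key (0, 1) (by simp [dataList])
  have h3 := key (1, 1) (by simp [dataList])
  set E := Complex.exp (((-1) * s * P ξ : ℝ) * Complex.I)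
  have e1 : E * comb (freq e f N) 1 dataList (bump R) ξ -
      comb (freq e f N) (phaseChar P e f N s) dataList (bump R) ξ =
      (E - phaseChar P e f N s (1, 0)) * bump R (ξ - freq e f N (1, 0)) +
      ((E - phaseChar P e f N s (0, 1)) * bump R (ξ - freq e f N (0, 1)) +
      (E - phaseChar P e f N s (1, 1)) * bump R (ξ - freq e f N (1, 1))) := by
    simp only [dataList, comb, List.map_cons, List.map_nil, List.sum_cons, List.sum_nil, add_zero,
      AddChar.one_apply, Circle.coe_one, one_mul]
    ring
  rw [e1]
  refine (norm_add_le _ _).trans ?_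
  have h4 := norm_add_le ((E - phaseChar P e f N s (0, 1)) * bump R (ξ - freq e f N (0, 1)))
    ((E - phaseChar P e f N s (1, 1)) * bump R (ξ - freq e f N (1, 1)))
  linarith

/-- A Duhamel integral is bounded below by its length as long as its integrand is close to a
constant and the phase does not turn by more than half a radian. -/
theorem le_norm_integral_exp_mul {z : ℝ → ℂ} (hz : Continuous z) {c₀ : ℂ} {T E θ : ℝ}
    (hT : 0 ≤ T) (h : ∀ s ∈ Icc 0 T, ‖z s - c₀‖ ≤ E) (hθ : T * |θ| ≤ 1 / 2) :
    T * (‖c₀‖ / 2 - E) ≤ ‖∫ s in (0 : ℝ)..T, Complex.exp ((1 * s * θ : ℝ) * Complex.I) * z s‖ := by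
  have h1 : ‖∫ s in (0 : ℝ)..T, (Complex.exp ((1 * s * θ : ℝ) * Complex.I) * z s - c₀)‖ ≤
      (E + ‖c₀‖ / 2) * |T - 0| := by
    refine intervalIntegral.norm_integral_le_of_norm_le_const fun s hs => ?_
    rw [uIoc_of_le hT] at hs
    have e : Complex.exp ((1 * s * θ : ℝ) * Complex.I) * z s - c₀ =
        Complex.exp ((1 * s * θ : ℝ) * Complex.I) * (z s - c₀) +
        (Complex.exp ((1 * s * θ : ℝ) * Complex.I) - Complex.exp ((0 : ℝ) * Complex.I)) * c₀ := by
      simp; ring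
    rw [e]
    refine (norm_add_le _ _).trans (add_le_add ?_ ?_)
    · rw [norm_mul, Complex.norm_exp_ofReal_mul_I, one_mul]
      exact h s ⟨hs.1.le, hs.2⟩
    · rw [norm_mul]
      have h2 : |1 * s * θ - 0| ≤ 1 / 2 := by
        rw [sub_zero, one_mul, abs_mul, abs_of_pos hs.1]
        exact (mul_le_mul_of_nonneg_right hs.2 (abs_nonneg _)).trans hθ
      have := (norm_exp_sub_exp_le (1 * s * θ) 0).trans h2
      calc _ ≤ 1 / 2 * ‖c₀‖ := by gcongr
        _ = _ := by ring
  rw [intervalIntegral.integral_sub (Continuous.intervalIntegrable (by fun_prop) _ _)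
    (by simp), intervalIntegral.integral_const, sub_zero, abs_of_nonneg hT] at h1
  have h2 := norm_sub_norm_le (T • c₀)
    (∫ s in (0 : ℝ)..T, Complex.exp ((1 * s * θ : ℝ) * Complex.I) * z s)
  rw [norm_sub_rev, norm_smul, Real.norm_of_nonneg hT] at h2
  linarith

/-! ### Low frequencies of the solution -/

theorem norm_nonlin_sub_le {W : Space d → ℝ} (hW : IsWeight W) {m : Space d → ℝ} {C : ℝ}
    (hm : IsMultiplier m C) (j : ℕ) {u v : Space d → ℂ} (hu : Continuous u) (hv : Continuous v)
    {M D : ℝ} (hM : 0 ≤ M) (hD : 0 ≤ D) (h1 : ∀ ξ, ‖u ξ‖ ≤ M * W ξ) (h2 : ∀ ξ, ‖v ξ‖ ≤ M * W ξ)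
    (h3 : ∀ ξ, ‖u ξ - v ξ‖ ≤ D * W ξ) (ξ : Space d) :
    ‖nonlin m j u ξ - nonlin m j v ξ‖ ≤ C * (2 * j + 3) * M ^ (2 * j + 2) * D * W ξ := by
  have hC := hm.nonneg
  have hsub : ‖constProfile hW hu h1 - constProfile hW hv h2‖ ≤ D := by
    refine (BoundedContinuousFunction.norm_le hD).2 fun p => ?_
    have hp := hW.pos p.2
    have : (constProfile hW hu h1 - constProfile hW hv h2) p =
        (W p.2 : ℂ)⁻¹ * (u p.2 - v p.2) := by
      rw [mul_sub]; rfl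
    rw [this, norm_mul, norm_inv, Complex.norm_real, Real.norm_of_nonneg hp.le,
      inv_mul_le_iff₀ hp, mul_comm]
    exact h3 _
  have e : nonlin m j u ξ - nonlin m j v ξ =
      slice W (profileNonlin hW hm j (constProfile hW hu h1) -
        profileNonlin hW hm j (constProfile hW hv h2)) 0 ξ := by
    rw [slice_sub, slice_profileNonlin, slice_profileNonlin, slice_constProfile,
      slice_constProfile]
  rw [e]
  refine (norm_slice_le hW _ _ _).trans ?_
  have := (hW.pos ξ).le
  gcongr
  refine (norm_profileNonlin_sub_le hW hm j (norm_constProfile_le hW hu hM h1)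
    (norm_constProfile_le hW hv hM h2)).trans ?_
  gcongr

/-- Over times `T` the solution in the interaction picture stays `O(T)`-close to its datum. -/
theorem norm_duhamel_le {W : Space d → ℝ} (hW : IsWeight W) {m : Space d → ℝ} {C : ℝ}
    (hm : IsMultiplier m C) {P : Space d → ℝ} (hP : Continuous P) (j : ℕ) {H₀ h : Profile d}
    {T M : ℝ} (hT : 0 ≤ T) (hM : ‖h‖ ≤ M)
    (hh : h = H₀ - Complex.I • timeInt hT (interaction hW hm hP j h)) :
    ‖h - H₀‖ ≤ C * M ^ (2 * j + 3) * T := by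
  have e : h - H₀ = -(Complex.I • timeInt hT (interaction hW hm hP j h)) := by
    conv_lhs => rw [hh]
    abel
  rw [e, norm_neg, norm_smul, Complex.norm_I, one_mul]
  refine (norm_timeInt_le hT _).trans ?_
  gcongr
  exact norm_interaction_le hW hm hP j hM

/-- Where the datum vanishes, the solution is given by the Duhamel integral. -/
theorem norm_slice_eq_norm_integral {W : Space d → ℝ} (hW : IsWeight W) {m : Space d → ℝ} {C : ℝ}
    (hm : IsMultiplier m C) {P : Space d → ℝ} (hP : Continuous P) (j : ℕ) {H₀ h : Profile d}
    {T t : ℝ} (hT : 0 ≤ T) (ht : t ∈ Icc 0 T)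
    (hh : h = H₀ - Complex.I • timeInt hT (interaction hW hm hP j h)) {ξ : Space d}
    (h0 : slice W H₀ t ξ = 0) :
    ‖slice W (phase hP (-1) h) t ξ‖ = ‖∫ s in (0 : ℝ)..t,
        Complex.exp ((1 * s * P ξ : ℝ) * Complex.I) *
      nonlin m j (slice W (phase hP (-1) h) s) ξ‖ := by
  have hW0 : (W ξ : ℂ) ≠ 0 := by exact_mod_cast (hW.pos ξ).ne'
  have h1 : H₀ (t, ξ) = 0 := (mul_eq_zero.1 h0).resolve_left hW0
  have h2 : h (t, ξ) = -(Complex.I * ∫ s in (0 : ℝ)..t, interaction hW hm hP j h (s, ξ)) := by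
    conv_lhs => rw [hh]
    rw [BoundedContinuousFunction.coe_sub, Pi.sub_apply, BoundedContinuousFunction.coe_smul]
    beta_reduce
    rw [timeInt_apply hT _ ⟨by linarith [ht.1], ht.2⟩, h1, smul_eq_mul, zero_sub]
  have h3 : ∀ s, Complex.exp ((1 * s * P ξ : ℝ) * Complex.I) *
      nonlin m j (slice W (phase hP (-1) h) s) ξ = W ξ * interaction hW hm hP j h (s, ξ) := by
    intro s
    rw [← slice_profileNonlin hW hm, interaction, phase_apply, slice]
    ring
  simp only [h3]
  rw [intervalIntegral.integral_const_mul, slice, phase_apply, h2]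
  simp only [norm_mul, norm_neg, Complex.norm_I, Complex.norm_exp_ofReal_mul_I, one_mul]

/-- A short-time solution and a lower bound for its low frequencies, when the datum has none, the
free evolution of the datum is close to `q`, and the nonlinearity at `q` is close at low frequencies
to the function `c₀`, constant in time. -/
theorem exists_solution_of_approx {W : Space d → ℝ} (hW : IsWeight W) {m : Space d → ℝ} {C : ℝ}
    (hm : IsMultiplier m C) {L : (Space d → ℂ) → Space d → ℂ} {P : Space d → ℝ}
    (hL : HasSymbol L P) (j : ℕ) {g₀ : Space d → ℂ} (hg₀ : Continuous g₀)
    {q : ℝ → Space d → ℂ} (hq : ∀ s, Continuous (q s)) {c₀ : Space d → ℂ} {M D E T : ℝ}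
    (hM : 0 < M) (hD : 0 ≤ D) (hT : 0 < T) (hg₀M : ∀ ξ, ‖g₀ ξ‖ ≤ M * W ξ)
    (hqM : ∀ s ξ, ‖q s ξ‖ ≤ M * W ξ)
    (hsmall : 2 * T * (C * (2 * j + 3) * (2 * M) ^ (2 * j + 2)) ≤ 1 / 2)
    (hfree : ∀ s ∈ Icc 0 T, ∀ ξ,
      ‖Complex.exp (((-1) * s * P ξ : ℝ) * Complex.I) * g₀ ξ - q s ξ‖ ≤ D * W ξ)
    (hnl : ∀ s, ∀ ξ, ‖ξ‖ ≤ 1 → ‖nonlin m j (q s) ξ - c₀ ξ‖ ≤ E)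
    (hzero : ∀ ξ, ‖ξ‖ ≤ 1 → g₀ ξ = 0) (hTP : ∀ ξ, ‖ξ‖ ≤ 1 → T * |P ξ| ≤ 1 / 2) :
    ∃ (ψ : ℝ → Space d → ℂ) (g : Space d → ℂ),
      SolvesSchrodinger L (fun t => potential m j (ψ t)) T (𝓕⁻ g₀) ψ ∧
      FastDecay g ∧ ψ T = 𝓕⁻ g ∧ ∀ ξ, ‖ξ‖ ≤ 1 →
        T * (‖c₀ ξ‖ / 2 - (C * (2 * j + 3) * (2 * M) ^ (2 * j + 2) *
          (C * (2 * M) ^ (2 * j + 3) * (2 * T) + D) * W ξ + E)) ≤ ‖g ξ‖ := by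
  have hC := hm.nonneg
  set H₀ := constProfile hW hg₀ hg₀M with hH₀
  have hH₀s : ∀ t, slice W H₀ t = g₀ := fun t => slice_constProfile hW hg₀ hg₀M t
  have hT2 : 0 ≤ 2 * T := by positivity
  obtain ⟨h, hhM, hh⟩ := exists_fixed_profile hW hm hL.cont j H₀ hM hT2
    (norm_constProfile_le hW hg₀ hM.le hg₀M) hsmall
  refine ⟨fun t => 𝓕⁻ (slice W (phase hL.cont (-1) h) t), slice W (phase hL.cont (-1) h) T,
    solvesSchrodinger_of_profile hW hm j hL hH₀s hT2 (by linarith) hh, fastDecay_slice hW _ _, rfl,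
    fun ξ hξ => ?_⟩
  set u : ℝ → Space d → ℂ := fun s => slice W (phase hL.cont (-1) h) s with hu
  have hdiff : ∀ s ∈ Icc 0 T, ∀ η,
      ‖u s η - q s η‖ ≤ (C * (2 * M) ^ (2 * j + 3) * (2 * T) + D) * W η := by
    intro s hs η
    have e1 : u s η - q s η = Complex.exp (((-1) * s * P η : ℝ) * Complex.I) *
        slice W (h - H₀) s η +
          (Complex.exp (((-1) * s * P η : ℝ) * Complex.I) * g₀ η - q s η) := by
      rw [slice_sub, hH₀s s]
      simp only [hu, slice, phase_apply]
      ring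
    have h1 := norm_duhamel_le hW hm hL.cont j hT2 hhM hh
    have hWη := hW.pos η
    rw [e1, add_mul]
    refine (norm_add_le _ _).trans (add_le_add ?_ (hfree s hs η))
    rw [norm_mul, Complex.norm_exp_ofReal_mul_I, one_mul]
    refine (norm_slice_le hW _ _ _).trans ?_
    gcongr
  have hucont : ∀ s, Continuous (u s) := fun s =>
    (continuous_slice hW (phase hL.cont (-1) h)).comp (continuous_const.prodMk continuous_id)
  have huM : ∀ s η, ‖u s η‖ ≤ (2 * M) * W η := fun s η => by
    refine (norm_slice_le hW _ _ _).trans ?_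
    have := (hW.pos η).le
    gcongr
    exact (norm_phase_le _ _ _).trans hhM
  have hqM' : ∀ s η, ‖q s η‖ ≤ (2 * M) * W η := fun s η => by
    refine (hqM s η).trans ?_
    have := (hW.pos η).le
    gcongr
    linarith
  have hmain : ∀ s ∈ Icc 0 T, ‖nonlin m j (u s) ξ - c₀ ξ‖ ≤
      C * (2 * j + 3) * (2 * M) ^ (2 * j + 2) *
        (C * (2 * M) ^ (2 * j + 3) * (2 * T) + D) * W ξ + E := fun s hs =>
    (norm_sub_le_norm_sub_add_norm_sub _ (nonlin m j (q s) ξ) _).trans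
      (add_le_add (norm_nonlin_sub_le hW hm j (hucont s) (hq s) (by positivity) (by positivity)
        (huM s) (hqM' s) (hdiff s hs) ξ) (hnl s ξ hξ))
  have hzc : Continuous fun s => nonlin m j (u s) ξ := by
    have e1 : ∀ s, nonlin m j (u s) ξ =
        slice W (profileNonlin hW hm j (phase hL.cont (-1) h)) s ξ := fun s => by
      rw [slice_profileNonlin]
    simp only [e1]
    exact (continuous_slice hW _).comp (continuous_id.prodMk continuous_const)
  have hint := le_norm_integral_exp_mul hzc hT.le hmain (hTP ξ hξ)
  rwa [← norm_slice_eq_norm_integral hW hm hL.cont j hT2 ⟨hT.le, by linarith⟩ hh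
    (by rw [hH₀s]; exact hzero ξ hξ)] at hint

/-- For data of amplitude `A` the nonlinearity has the size `A^{2j+3} R^d` at low frequencies, where
the resonant interactions are coherent.  Over the time `τ R / N` with `A^{2j+2} = N / R` it creates
low frequencies of the size `A R^d`, that of the data themselves. -/
theorem exists_solution_lower_bound {m : Space d → ℝ} {C : ℝ} (hm : IsMultiplier m C)
    {L : (Space d → ℂ) → Space d → ℂ} {P : Space d → ℝ} (hL : HasSymbol L P) {e f : Space d}
    {B : ℝ} (hP : IsResonant P e f B) (j : ℕ) {a : ℤ × ℤ → ℝ}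
    (ha : ∀ k ∈ autoList dataList, -k ∈ oddList j dataList → ∀ ζ,
      Tendsto (fun N => m (ζ + freq e f N k)) atTop (𝓝 (a k)))
    (hc : resonantSum a dataList j ≠ 0) :
    ∃ τ : ℝ, 0 < τ ∧ ∃ c : ℝ, 0 < c ∧ ∀ R : ℝ, 0 < R → R ≤ 1 → ∀ᶠ N : ℝ in atTop,
      ∀ A : ℝ, 0 < A → A ^ (2 * j + 2) = N / R →
      ∃ (ψ : ℝ → Space d → ℂ) (g : Space d → ℂ),
        SolvesSchrodinger L (fun t => potential m j (ψ t)) (τ * R / N)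
          (𝓕⁻ (fun ξ => (A : ℂ) * comb (freq e f N) 1 dataList (bump R) ξ)) ψ ∧
        FastDecay g ∧ ψ (τ * R / N) = 𝓕⁻ g ∧ ∀ ξ, ‖ξ‖ ≤ 1 → c * (A * R ^ d) ≤ ‖g ξ‖ := by
  obtain ⟨Cw, K, S, hK, hS, hwt⟩ := exists_weight d
  have hC := hm.nonneg
  have hB := hP.nonneg
  generalize hr : resonantSum a dataList j = r at hc
  have hr0 : 0 < |r| := abs_pos.2 hc
  obtain ⟨v, hv⟩ : ∃ v, v = halfBallVolume d ^ (2 * j + 2) := ⟨_, rfl⟩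
  have hv0 : 0 < v := hv ▸ pow_pos (halfBallVolume_pos d) _
  -- `Q A^{2j+2}` is the Lipschitz constant of the nonlinearity, and `τ A D₀` the distance of the
  -- solution from the comb with rotating phases
  obtain ⟨Q, hQ⟩ : ∃ Q, Q = C * (2 * j + 3) * (6 * K) ^ (2 * j + 2) := ⟨_, rfl⟩
  have hQ0 : 0 ≤ Q := by rw [hQ]; positivity
  obtain ⟨D₀, hD₀⟩ : ∃ D₀, D₀ = 2 * C * (6 * K) ^ (2 * j + 3) + 36 * B * K := ⟨_, rfl⟩
  have hD₀0 : 0 ≤ D₀ := by rw [hD₀]; positivity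
  -- the first condition on `τ` is for the contraction, the second makes the errors smaller than
  -- the contribution of the resonances
  obtain ⟨τ, hτ0, hτ1, hτ2⟩ : ∃ τ : ℝ, 0 < τ ∧ 2 * τ * Q ≤ 1 / 2 ∧
      τ * (Q * D₀ * S + 1) ≤ |r| * v / 4 := by
    have h1 : Tendsto (fun τ : ℝ => 2 * τ * Q) (𝓝[>] 0) (𝓝 0) := by
      refine (Continuous.tendsto' (by fun_prop) 0 0 (by simp)).mono_left nhdsWithin_le_nhds
    have h2 : Tendsto (fun τ : ℝ => τ * (Q * D₀ * S + 1)) (𝓝[>] 0) (𝓝 0) := by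
      refine (Continuous.tendsto' (by fun_prop) 0 0 (by simp)).mono_left nhdsWithin_le_nhds
    have h3 : 0 < |r| * v / 4 := by positivity
    obtain ⟨τ, h4, h5, h6⟩ := ((h1.eventually (ge_mem_nhds one_half_pos)).and
      ((h2.eventually (ge_mem_nhds h3)).and self_mem_nhdsWithin)).exists
    exact ⟨τ, h6, h4, h5⟩
  refine ⟨τ, hτ0, τ * (|r| * v / 4), by positivity, fun R hR hR1 => ?_⟩
  have hbump : IsTest (bump R : Space d → ℂ) := (isBump_bump hR).isTest
  filter_upwards [eventually_nonlin_comb hm hP.norm_fst hP.norm_snd hP.inner_eq_zero hbump dataList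
    j ha (mul_pos hτ0 (pow_pos hR d)), eventually_gt_atTop 0, eventually_ge_atTop (1 / R),
    eventually_ge_atTop (2 * τ * R * B), eventually_ge_atTop (1 + 2 / R)] with
    N hlim hN hN1 hN2 hN3 A hA hAN
  rw [hr] at hlim
  have hNR : 1 ≤ N * R := by rwa [div_le_iff₀ hR] at hN1
  obtain ⟨hW, hWS, hWK⟩ := hwt e f hP.norm_fst hP.norm_snd R N hR hN hNR
  generalize combWeight Cw R N⁻¹ (freq e f N) = W at hW hWS hWK
  have hA0 := hA.le
  have hWb : ∀ k ∈ dataList, ∀ ξ, ‖bump R (ξ - freq e f N k)‖ ≤ K * W ξ := by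
    intro k hk ξ
    rcases le_total (2 / R) ‖ξ - freq e f N k‖ with h | h
    · rw [bump_eq_zero hR h, norm_zero]
      exact (mul_pos hK (hW.pos ξ)).le
    · exact (norm_bump_le hR _).trans (hWK k hk ξ h)
  have hcomb : ∀ χ ξ, ‖(A : ℂ) * comb (freq e f N) χ dataList (bump R) ξ‖ ≤ 3 * K * A * W ξ := by
    intro χ ξ
    rw [norm_mul, Complex.norm_real, Real.norm_of_nonneg hA.le]
    calc A * ‖comb (freq e f N) χ dataList (bump R) ξ‖ ≤ A * (3 * (K * W ξ)) := by
          gcongr; exact norm_comb_dataList_le _ χ _ ξ fun k hk => hWb k hk ξ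
      _ = _ := by ring
  have hcont : ∀ χ, Continuous fun ξ => (A : ℂ) * comb (freq e f N) χ dataList (bump R) ξ :=
    fun χ => continuous_const.mul (continuous_comb _ χ _ hbump.1)
  obtain ⟨T, hTdef⟩ : ∃ T, T = τ * R / N := ⟨_, rfl⟩
  have hT : 0 < T := by rw [hTdef]; positivity
  have hTA : T * A ^ (2 * j + 2) = τ := by rw [hAN, hTdef]; field_simp
  have hpow : ∀ n, (2 * (3 * K * A)) ^ n = (6 * K) ^ n * A ^ n := fun n => by
    rw [← mul_pow]; ring
  have hsmall : 2 * T * (C * (2 * j + 3) * (2 * (3 * K * A)) ^ (2 * j + 2)) ≤ 1 / 2 := by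
    calc 2 * T * (C * (2 * j + 3) * (2 * (3 * K * A)) ^ (2 * j + 2))
        = 2 * (T * A ^ (2 * j + 2)) * Q := by rw [hpow, hQ]; ring
      _ ≤ 1 / 2 := by rw [hTA]; exact hτ1
  have hfree : ∀ s ∈ Icc 0 T, ∀ ξ, ‖Complex.exp (((-1) * s * P ξ : ℝ) * Complex.I) *
      ((A : ℂ) * comb (freq e f N) 1 dataList (bump R) ξ) -
      (A : ℂ) * comb (freq e f N) (phaseChar P e f N s) dataList (bump R) ξ‖ ≤
      A * (36 * B * τ * K) * W ξ := by
    intro s hs ξ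
    have h5 := norm_free_sub_comb_le hP (τ := τ) hR hN hNR (s := s)
      (by rw [abs_of_nonneg hs.1, ← hTdef]; exact hs.2) ξ (b := K * W ξ)
      (fun k hk hη => hWK k hk ξ hη) (mul_pos hK (hW.pos ξ)).le
    rw [mul_left_comm, ← mul_sub, norm_mul, Complex.norm_real, Real.norm_of_nonneg hA.le]
    calc _ ≤ A * (36 * B * τ * (K * W ξ)) := by gcongr
      _ = _ := by ring
  have hnl : ∀ s ξ, ‖ξ‖ ≤ 1 →
      ‖nonlin m j (fun ξ => (A : ℂ) * comb (freq e f N) (phaseChar P e f N s)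
          dataList (bump R) ξ) ξ -
        ((A ^ (2 * j + 3) : ℝ) : ℂ) * ((r : ℂ) *
            cconv (autoConv (bump R)) (oddPower j (bump R)) ξ)‖ ≤
      A ^ (2 * j + 3) * (τ * R ^ d) := by
    intro s ξ hξ
    rw [nonlin_const_mul, ← mul_sub, norm_mul, Complex.norm_real,
      Real.norm_of_nonneg (by positivity)]
    gcongr
    exact hlim _ ξ hξ
  have hzero : ∀ ξ : Space d, ‖ξ‖ ≤ 1 → (A : ℂ) * comb (freq e f N) 1 dataList (bump R) ξ = 0 := by
    intro ξ hξ
    have h0 : ∀ k ∈ dataList, ‖bump R (ξ - freq e f N k)‖ ≤ 0 := by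
      intro k hk
      rw [bump_eq_zero hR, norm_zero]
      have h1 := le_norm_freq hP.norm_fst hP.norm_snd hP.inner_eq_zero hN.le
        (ne_zero_of_mem_dataList hk)
      have h2 : ‖freq e f N k‖ - ‖ξ‖ ≤ ‖ξ - freq e f N k‖ := by
        rw [norm_sub_rev]; exact norm_sub_norm_le _ _
      linarith
    have := norm_comb_dataList_le (freq e f N) 1 (bump R) ξ h0
    rw [mul_zero] at this
    rw [norm_le_zero_iff.1 this, mul_zero]
  have hTP : ∀ ξ, ‖ξ‖ ≤ 1 → T * |P ξ| ≤ 1 / 2 := by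
    intro ξ hξ
    calc T * |P ξ| ≤ T * B := by gcongr; exact hP.abs_le hξ
      _ ≤ 1 / 2 := by
        rw [hTdef, div_mul_eq_mul_div, div_le_iff₀ hN]
        linarith
  obtain ⟨ψ, g, h1, h2, h3, h4⟩ := exists_solution_of_approx hW hm hL j (hcont 1)
    (q := fun s ξ => (A : ℂ) * comb (freq e f N) (phaseChar P e f N s) dataList (bump R) ξ)
    (fun s => hcont _) (c₀ := fun ξ => ((A ^ (2 * j + 3) : ℝ) : ℂ) *
      ((r : ℂ) * cconv (autoConv (bump R)) (oddPower j (bump R)) ξ))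
    (M := 3 * K * A) (D := A * (36 * B * τ * K)) (E := A ^ (2 * j + 3) * (τ * R ^ d)) (T := T)
    (by positivity) (by positivity) hT (hcomb 1) (fun s => hcomb _)
    hsmall hfree hnl hzero hTP
  rw [← hTdef]
  refine ⟨ψ, g, h1, h2, h3, fun ξ hξ => le_trans ?_ (h4 ξ hξ)⟩
  have hlow : v * R ^ d ≤ ‖cconv (autoConv (bump R)) (oddPower j (bump R)) ξ‖ := by
    obtain ⟨p, -, -, hp0, hp, hFp⟩ := (isBump_bump (d := d) hR).nonlin hR j
    rw [hFp, Complex.norm_real, Real.norm_of_nonneg (hp0 ξ), hv]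
    exact hp ξ (hξ.trans ((one_le_inv₀ hR).2 hR1))
  have hc₀ : A ^ (2 * j + 3) * (|r| * (v * R ^ d)) ≤ ‖((A ^ (2 * j + 3) : ℝ) : ℂ) *
      ((r : ℂ) * cconv (autoConv (bump R)) (oddPower j (bump R)) ξ)‖ := by
    rw [norm_mul, norm_mul, Complex.norm_real, Complex.norm_real,
      Real.norm_of_nonneg (by positivity), Real.norm_eq_abs]
    gcongr
  have herr : C * (2 * j + 3) * (2 * (3 * K * A)) ^ (2 * j + 2) *
      (C * (2 * (3 * K * A)) ^ (2 * j + 3) * (2 * T) + A * (36 * B * τ * K)) * W ξ ≤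
      τ * A ^ (2 * j + 3) * R ^ d * (Q * D₀ * S) := by
    have e1 : C * (2 * (3 * K * A)) ^ (2 * j + 3) * (2 * T) + A * (36 * B * τ * K) =
        τ * A * D₀ := by
      rw [hpow, hD₀, ← hTA]; ring
    rw [e1, hpow]
    calc C * (2 * j + 3) * ((6 * K) ^ (2 * j + 2) * A ^ (2 * j + 2)) * (τ * A * D₀) * W ξ
        ≤ C * (2 * j + 3) * ((6 * K) ^ (2 * j + 2) * A ^ (2 * j + 2)) * (τ * A * D₀) *
          (S * R ^ d) := by gcongr; exact hWS ξ
      _ = _ := by rw [hQ]; ring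
  calc τ * (|r| * v / 4) * (A * R ^ d)
      = T * (A ^ (2 * j + 3) * R ^ d * (|r| * v / 4)) := by rw [← hTA]; ring
    _ ≤ T * (A ^ (2 * j + 3) * R ^ d * (|r| * v / 2 - τ * (Q * D₀ * S + 1))) := by
        gcongr
        linarith
    _ = T * (A ^ (2 * j + 3) * (|r| * (v * R ^ d)) / 2 -
          (τ * A ^ (2 * j + 3) * R ^ d * (Q * D₀ * S) + A ^ (2 * j + 3) * (τ * R ^ d))) := by
        ring
    _ ≤ _ := by gcongr

/-! ### Norm inflation for resonant symbols -/

theorem contDiff_comb (x : ℤ × ℤ →+ Space d) (χ : AddChar (ℤ × ℤ) Circle) (L : List (ℤ × ℤ))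
    {f : Space d → ℂ} (hf : ContDiff ℝ ∞ f) : ContDiff ℝ ∞ (comb x χ L f) := by
  induction L with
  | nil =>
    have e : comb x χ [] f = fun _ => 0 := funext fun ξ => by simp [comb]
    rw [e]; exact contDiff_const
  | cons k L ih =>
    have e : comb x χ (k :: L) f = fun ξ => (χ k : ℂ) * f (ξ - x k) + comb x χ L f ξ :=
      funext fun ξ => comb_cons x χ k L f ξ
    rw [e]
    exact (contDiff_const.mul (hf.comp (contDiff_id.sub contDiff_const))).add ih

/-- The data are three bumps of height `A R^d` and width `R⁻¹` at frequencies of size `N`, where the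
weight of the Sobolev norm of order `s ≤ 0` is at most `(N²)^s`. -/
theorem sobolevNorm_data_le {e f : Space d} (he : ‖e‖ = 1) (hf : ‖f‖ = 1) (hef : ⟪e, f⟫ = 0)
    {R N A s : ℝ} (hR : 0 < R) (hN : 0 < N) (hNR : 4 / R ≤ N) (hs : s ≤ 0) :
    sobolevNorm s (𝓕⁻ (fun ξ => (A : ℂ) * comb (freq e f N) 1 dataList (bump R) ξ)) ≤
      (ENNReal.ofReal ((N ^ 2) ^ s * (27 * A ^ 2 * R ^ (2 * d))) *
        volume (Metric.closedBall (0 : Space d) (2 / R))) ^ (1 / 2 : ℝ) := by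
  have htest : IsTest (bump R : Space d → ℂ) := (isBump_bump hR).isTest
  have hfd : FastDecay fun ξ => (A : ℂ) * comb (freq e f N) 1 dataList (bump R) ξ :=
    (htest.comb _ 1 dataList).fastDecay.mul_bdd (m := fun _ => (A : ℂ)) (C := ‖(A : ℂ)‖) (n := 0)
      aestronglyMeasurable_const (fun ξ => by simp)
  rw [sobolevNorm_fourierInv s hfd.integrable hfd.memLp_two]
  refine ENNReal.rpow_le_rpow ?_ (by norm_num)
  set K := (N ^ 2) ^ s * (9 * A ^ 2 * R ^ (2 * d)) with hK
  have hK0 : 0 ≤ K := by positivity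
  set b : ℤ × ℤ → Set (Space d) := fun k => Metric.closedBall (freq e f N k) (2 / R)
  have hpt : ∀ ζ : Space d, ENNReal.ofReal ((1 + (2 * Real.pi * ‖ζ‖) ^ 2) ^ s) *
      ‖(A : ℂ) * comb (freq e f N) 1 dataList (bump R) ζ‖ₑ ^ 2 ≤
      ((b (1, 0)).indicator (fun _ => ENNReal.ofReal K) ζ +
        (b (0, 1)).indicator (fun _ => ENNReal.ofReal K) ζ) +
        (b (1, 1)).indicator (fun _ => ENNReal.ofReal K) ζ := by
    intro ζ
    by_cases h : ∃ k ∈ dataList, ζ ∈ b k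
    · obtain ⟨k, hk, hζ⟩ := h
      have h1 : ENNReal.ofReal ((1 + (2 * Real.pi * ‖ζ‖) ^ 2) ^ s) *
          ‖(A : ℂ) * comb (freq e f N) 1 dataList (bump R) ζ‖ₑ ^ 2 ≤ ENNReal.ofReal K := by
        rw [← ofReal_norm, ← ENNReal.ofReal_pow (norm_nonneg _),
          ← ENNReal.ofReal_mul (by positivity)]
        refine ENNReal.ofReal_le_ofReal ?_
        have h2 := norm_comb_dataList_le (freq e f N) 1 (bump R) ζ
          fun k _ => norm_bump_le hR (ζ - freq e f N k)
        rw [norm_mul, Complex.norm_real, Real.norm_eq_abs, mul_pow |A|, sq_abs]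
        have h3 : N / 2 ≤ ‖ζ‖ := by
          have e1 := le_norm_freq he hf hef hN.le (ne_zero_of_mem_dataList hk)
          have e2 : ‖freq e f N k‖ - ‖ζ‖ ≤ ‖ζ - freq e f N k‖ := by
            rw [norm_sub_rev]; exact norm_sub_norm_le _ _
          have e3 : ‖ζ - freq e f N k‖ ≤ 2 / R := by
            rw [← dist_eq_norm]; exact hζ
          have e4 : 4 / R = 2 * (2 / R) := by ring
          linarith
        have h4 : N ^ 2 ≤ 1 + (2 * Real.pi * ‖ζ‖) ^ 2 := by
          have : N ≤ 2 * Real.pi * ‖ζ‖ := by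
            nlinarith [Real.pi_gt_three, norm_nonneg ζ]
          nlinarith
        have h5 : (1 + (2 * Real.pi * ‖ζ‖) ^ 2) ^ s ≤ (N ^ 2) ^ s :=
          Real.rpow_le_rpow_of_nonpos (by positivity) h4 hs
        calc _ ≤ (N ^ 2) ^ s * (A ^ 2 * (3 * R ^ d) ^ 2) := by gcongr
          _ = K := by rw [hK]; ring
      have h6 : ENNReal.ofReal K = (b k).indicator (fun _ => ENNReal.ofReal K) ζ :=
        (indicator_of_mem hζ (fun _ => ENNReal.ofReal K)).symm
      refine (h1.trans h6.le).trans ?_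
      simp only [dataList, List.mem_cons, List.not_mem_nil, or_false] at hk
      rcases hk with rfl | rfl | rfl
      · exact le_add_right le_self_add
      · exact le_add_right le_add_self
      · exact le_add_self
    · push Not at h
      have h0 := norm_comb_dataList_le (freq e f N) 1 (bump R) ζ (b := 0) fun k hk => by
        have := h k hk
        rw [bump_eq_zero hR, norm_zero]
        rw [Metric.mem_closedBall, not_le, dist_eq_norm] at this
        exact this.le
      rw [mul_zero] at h0
      rw [norm_le_zero_iff.1 h0]
      simp
  refine (lintegral_mono hpt).trans ?_
  have hb : ∀ k, ∫⁻ ζ, (b k).indicator (fun _ => ENNReal.ofReal K) ζ =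
      ENNReal.ofReal K * volume (Metric.closedBall (0 : Space d) (2 / R)) := fun k => by
    rw [lintegral_indicator measurableSet_closedBall, setLIntegral_const,
      Measure.addHaar_closedBall_center]
  have hmeas : ∀ k, Measurable ((b k).indicator fun _ => ENNReal.ofReal K) := fun k =>
    measurable_const.indicator measurableSet_closedBall
  rw [lintegral_add_right _ (hmeas _), lintegral_add_left (hmeas _), hb, hb, hb]
  have e1 : (N ^ 2) ^ s * (27 * A ^ 2 * R ^ (2 * d)) = K + K + K := by rw [hK]; ring
  rw [e1, ENNReal.ofReal_add (by positivity) hK0, ENNReal.ofReal_add hK0 hK0, add_mul, add_mul]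

/-- A lower bound on the low frequencies bounds all Sobolev norms from below, including those of
negative order. -/
theorem le_sobolevNorm {g : Space d → ℂ} (hg : FastDecay g) {c : ℝ} (hc : 0 ≤ c)
    (h : ∀ ξ, ‖ξ‖ ≤ 1 → c ≤ ‖g ξ‖) (σ : ℝ) :
    (ENNReal.ofReal ((1 + (2 * Real.pi) ^ 2) ^ (-|σ|) * c ^ 2) *
      volume (Metric.closedBall (0 : Space d) 1)) ^ (1 / 2 : ℝ) ≤ sobolevNorm σ (𝓕⁻ g) := by
  rw [sobolevNorm_fourierInv σ hg.integrable hg.memLp_two]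
  refine ENNReal.rpow_le_rpow ?_ (by norm_num)
  rw [← setLIntegral_const]
  refine (setLIntegral_mono' measurableSet_closedBall fun ζ hζ => ?_).trans
    (setLIntegral_le_lintegral (Metric.closedBall (0 : Space d) 1) _)
  rw [mem_closedBall_zero_iff] at hζ
  rw [← ofReal_norm, ← ENNReal.ofReal_pow (norm_nonneg _), ← ENNReal.ofReal_mul (by positivity)]
  refine ENNReal.ofReal_le_ofReal ?_
  have h1 : 1 + (2 * Real.pi * ‖ζ‖) ^ 2 ≤ 1 + (2 * Real.pi) ^ 2 := by
    have : 2 * Real.pi * ‖ζ‖ ≤ 2 * Real.pi * 1 := by gcongr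
    rw [mul_one] at this
    gcongr
  have h2 : 1 ≤ 1 + (2 * Real.pi * ‖ζ‖) ^ 2 := by
    have := sq_nonneg (2 * Real.pi * ‖ζ‖)
    linarith
  have h3 : (1 + (2 * Real.pi) ^ 2) ^ (-|σ|) ≤ (1 + (2 * Real.pi * ‖ζ‖) ^ 2) ^ σ :=
    (Real.rpow_le_rpow_of_nonpos (by positivity) h1 (by simp)).trans
      (Real.rpow_le_rpow_of_exponent_le h2 (neg_abs_le σ))
  have h4 := h ζ hζ
  gcongr

/-- Norm inflation for an equation with resonant symbol, as soon as the resonant interactions of the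
data do not cancel.  With the amplitude `A = (N / R)^{1/(2j+2)}` the `H^s` norm of the data at the
exponent `s = -1/(2j+2)` is independent of `N`, and of the order `R^{(d - 1/(j+1))/2}`. It is small
with `R`, as `d ≥ 2`, whereas the low frequencies of the solution, of the size `A R^d`, grow without
bound with `N`. -/
theorem hasNormInflation_of_resonant (hd : 2 ≤ d) {m : Space d → ℝ} {C : ℝ}
    (hm : IsMultiplier m C)
    {L : (Space d → ℂ) → Space d → ℂ} {P : Space d → ℝ} (hL : HasSymbol L P) {e f : Space d}
    {B : ℝ} (hP : IsResonant P e f B) (j : ℕ) {a : ℤ × ℤ → ℝ}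
    (ha : ∀ k ∈ autoList dataList, -k ∈ oddList j dataList → ∀ ζ,
      Tendsto (fun N => m (ζ + freq e f N k)) atTop (𝓝 (a k)))
    (hc : resonantSum a dataList j ≠ 0)
    {IsSol : ℝ → (Space d → ℂ) → (ℝ → Space d → ℂ) → Prop}
    (hsol : ∀ T, 0 ≤ T → ∀ φ ψ, IsSol T φ ψ ↔
      SolvesSchrodinger L (fun t => potential m j (ψ t)) T φ ψ) :
    HasNormInflation d (-1 / (2 * ((j + 1 : ℕ) : ℝ))) IsSol := by
  obtain ⟨τ, hτ, c, hc0, hmain⟩ := exists_solution_lower_bound hm hL hP j ha hc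
  have hν : (0 : ℝ) < 2 * j + 2 := by positivity
  set R : ℕ → ℝ := fun n => 1 / ((n : ℝ) + 1) with hRdef
  have hR : ∀ n, 0 < R n := fun n => by simp only [hRdef]; positivity
  have hR1 : ∀ n, R n ≤ 1 := fun n => by
    simp only [hRdef]
    rw [div_le_one (by positivity)]
    linarith [(Nat.cast_nonneg n : (0 : ℝ) ≤ n)]
  have hRlim : Tendsto R atTop (𝓝 0) := tendsto_one_div_add_atTop_nhds_zero_nat
  -- for each width, a frequency so large that the low frequencies of the solution exceed `c n`
  have hex : ∀ n : ℕ, ∃ N : ℝ, 0 < N ∧ 4 / R n ≤ N ∧ τ * R n / N ≤ R n ∧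
      (n : ℝ) ≤ (N / R n) ^ (1 / (2 * (j : ℝ) + 2)) * R n ^ d ∧
      ∀ A : ℝ, 0 < A → A ^ (2 * j + 2) = N / R n →
      ∃ (ψ : ℝ → Space d → ℂ) (g : Space d → ℂ),
        SolvesSchrodinger L (fun t => potential m j (ψ t)) (τ * R n / N)
          (𝓕⁻ (fun ξ => (A : ℂ) * comb (freq e f N) 1 dataList (bump (R n)) ξ)) ψ ∧
        FastDecay g ∧ ψ (τ * R n / N) = 𝓕⁻ g ∧ ∀ ξ, ‖ξ‖ ≤ 1 → c * (A * R n ^ d) ≤ ‖g ξ‖ := by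
    intro n
    have h1 : Tendsto (fun N : ℝ => (N / R n) ^ (1 / (2 * (j : ℝ) + 2)) * R n ^ d) atTop atTop :=
      ((tendsto_rpow_atTop (by positivity)).comp
        (tendsto_id.atTop_div_const (hR n))).atTop_mul_const (pow_pos (hR n) d)
    obtain ⟨N, h2, h3, h4, h5, h6⟩ := ((hmain (R n) (hR n) (hR1 n)).and
      ((h1.eventually_ge_atTop (n : ℝ)).and ((eventually_gt_atTop 0).and
      ((eventually_ge_atTop (4 / R n)).and (eventually_ge_atTop τ))))).exists
    refine ⟨N, h4, h5, ?_, h3, h2⟩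
    rw [div_le_iff₀ h4, mul_comm]
    have := (hR n).le
    gcongr
  choose N hN hN4 hNτ hNn hN' using hex
  set A : ℕ → ℝ := fun n => (N n / R n) ^ (1 / (2 * (j : ℝ) + 2)) with hA
  have hA0 : ∀ n, 0 < A n := fun n => Real.rpow_pos_of_pos (div_pos (hN n) (hR n)) _
  have hApow : ∀ n, A n ^ (2 * j + 2) = N n / R n := fun n => by
    simp only [hA]
    rw [← Real.rpow_natCast, ← Real.rpow_mul (div_pos (hN n) (hR n)).le]
    push_cast
    rw [one_div_mul_cancel hν.ne', Real.rpow_one]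
  choose ψ g hψ hg hψg hlow using fun n => hN' n (A n) (hA0 n) (hApow n)
  set g₀ : ℕ → Space d → ℂ := fun n ξ =>
    (A n : ℂ) * comb (freq e f (N n)) 1 dataList (bump (R n)) ξ with hg₀
  have hsmooth : ∀ n, ContDiff ℝ ∞ (g₀ n) := fun n =>
    contDiff_const.mul (contDiff_comb _ _ _ (contDiff_bump _))
  have hsupp : ∀ n, HasCompactSupport (g₀ n) := fun n =>
    (hasCompactSupport_comb (freq e f (N n)) 1 dataList
      (isBump_bump (d := d) (hR n)).isTest.2).mul_left (f := fun _ => (A n : ℂ))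
  let φ : ℕ → 𝓢(Space d, ℂ) := fun n => 𝓕⁻ ((hsupp n).toSchwartzMap (hsmooth n))
  have hφ : ∀ n, (φ n : Space d → ℂ) = 𝓕⁻ (g₀ n) := fun n => SchwartzMap.fourierInv_coe _
  have hT : ∀ n, 0 < τ * R n / N n := fun n => div_pos (mul_pos hτ (hR n)) (hN n)
  refine ⟨φ, fun n => τ * R n / N n, ψ, ?_, hT, ?_, fun n => ⟨?_, fun ψ' hψ' t ht => ?_⟩,
    fun σ => ?_⟩
  · set s : ℝ := -1 / (2 * ((j + 1 : ℕ) : ℝ)) with hs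
    have hs0 : s ≤ 0 := div_nonpos_of_nonpos_of_nonneg (by norm_num) (by positivity)
    set V := volume (Metric.closedBall (0 : Space d) 2) with hV
    have hVt : V ≠ ⊤ := measure_closedBall_lt_top.ne
    have hbound : ∀ n, sobolevNorm s (φ n) ≤
        (ENNReal.ofReal (27 * R n) * V) ^ (1 / 2 : ℝ) := by
      intro n
      rw [hφ]
      refine (sobolevNorm_data_le hP.norm_fst hP.norm_snd hP.inner_eq_zero (hR n) (hN n) (hN4 n)
        hs0).trans (ENNReal.rpow_le_rpow ?_ (by norm_num))
      have hRn := hR n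
      have e1 : volume (Metric.closedBall (0 : Space d) (2 / R n)) =
          ENNReal.ofReal ((R n)⁻¹ ^ d) * V := by
        have := Measure.addHaar_closedBall_mul (volume : Measure (Space d)) 0
          (inv_pos.2 hRn).le (by norm_num : (0 : ℝ) ≤ 2)
        rw [div_eq_inv_mul, this, finrank_euclideanSpace, Fintype.card_fin]
      rw [e1, ← mul_assoc, ← ENNReal.ofReal_mul (by have := hN n; positivity)]
      refine mul_le_mul_left (ENNReal.ofReal_le_ofReal ?_) V
      -- the powers of `N` cancel at the exponent `s`
      have e2 : (N n ^ 2) ^ s * A n ^ 2 = (R n) ^ (-(1 / ((j : ℝ) + 1))) := by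
        have hj : (j : ℝ) + 1 ≠ 0 := by positivity
        have hj' : 2 * (j : ℝ) + 2 ≠ 0 := by positivity
        simp only [hA]
        rw [← Real.rpow_natCast (N n), ← Real.rpow_natCast ((N n / R n) ^ _),
          ← Real.rpow_mul (hN n).le, ← Real.rpow_mul (div_pos (hN n) hRn).le,
          Real.div_rpow (hN n).le hRn.le, Real.rpow_neg hRn.le, ← mul_div_assoc,
          ← Real.rpow_add (hN n), hs]
        have e3 : ((2 : ℕ) : ℝ) * (-1 / (2 * ((j + 1 : ℕ) : ℝ))) +
            1 / (2 * (j : ℝ) + 2) * ((2 : ℕ) : ℝ) = 0 := by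
          push_cast; field_simp; ring
        have e4 : 1 / (2 * (j : ℝ) + 2) * ((2 : ℕ) : ℝ) = 1 / ((j : ℝ) + 1) := by
          push_cast; field_simp; try ring
        rw [e3, e4, Real.rpow_zero, one_div]
      have e5 : (R n) ^ (-(1 / ((j : ℝ) + 1))) ≤ (R n) ^ (-1 : ℝ) := by
        refine Real.rpow_le_rpow_of_exponent_ge hRn (hR1 n) ?_
        rw [neg_le_neg_iff, div_le_one (by positivity)]
        linarith [(Nat.cast_nonneg j : (0 : ℝ) ≤ j)]
      rw [Real.rpow_neg_one] at e5
      have e6 : R n ^ d ≤ R n ^ 2 := pow_le_pow_of_le_one hRn.le (hR1 n) hd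
      calc (N n ^ 2) ^ s * (27 * A n ^ 2 * R n ^ (2 * d)) * (R n)⁻¹ ^ d
          = 27 * ((N n ^ 2) ^ s * A n ^ 2) * R n ^ d := by
            rw [pow_mul', inv_pow]; field_simp
        _ ≤ 27 * (R n)⁻¹ * R n ^ 2 := by rw [e2]; gcongr
        _ = 27 * R n := by field_simp
    refine tendsto_of_tendsto_of_tendsto_of_le_of_le tendsto_const_nhds ?_ (fun n => zero_le)
      hbound
    have h1 : Tendsto (fun n => ENNReal.ofReal (27 * R n) * V) atTop (𝓝 0) := by
      have h2 := ENNReal.tendsto_ofReal (hRlim.const_mul 27)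
      have h3 := ENNReal.Tendsto.mul_const h2 (Or.inr hVt)
      simpa using h3
    have h4 := (ENNReal.continuous_rpow_const (y := (1 / 2 : ℝ))).continuousAt.tendsto.comp h1
    simpa [Function.comp_def] using h4
  · exact squeeze_zero (fun n => (hT n).le) hNτ hRlim
  · rw [hsol _ (hT n).le, hφ]
    exact hψ n
  · rw [hsol _ (hT n).le, hφ] at hψ'
    exact hψ'.unique hL hm (hT n).le (hψ n) t ht
  · have hV0 : volume (Metric.closedBall (0 : Space d) 1) ≠ 0 :=
      (Metric.measure_closedBall_pos _ _ one_pos).ne'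
    have hlim : Tendsto (fun n : ℕ =>
        (ENNReal.ofReal ((1 + (2 * Real.pi) ^ 2) ^ (-|σ|) * (c * n) ^ 2) *
          volume (Metric.closedBall (0 : Space d) 1)) ^ (1 / 2 : ℝ)) atTop (𝓝 ⊤) := by
      have h1 : Tendsto (fun n : ℕ => (1 + (2 * Real.pi) ^ 2) ^ (-|σ|) * (c * n) ^ 2) atTop
          atTop := by
        refine Tendsto.const_mul_atTop (by positivity) ?_
        exact (tendsto_pow_atTop two_ne_zero).comp
          (tendsto_natCast_atTop_atTop.const_mul_atTop hc0)
      have h2 := ENNReal.Tendsto.mul_const (ENNReal.tendsto_ofReal_atTop.comp h1)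
        (Or.inl ENNReal.top_ne_zero) (b := volume (Metric.closedBall (0 : Space d) 1))
      rw [ENNReal.top_mul hV0] at h2
      have h3 := (ENNReal.continuous_rpow_const (y := (1 / 2 : ℝ))).continuousAt.tendsto.comp h2
      rw [ENNReal.top_rpow_of_pos (by norm_num)] at h3
      exact h3
    refine tendsto_of_tendsto_of_tendsto_of_le_of_le hlim tendsto_const_nhds (fun n => ?_)
      fun n => le_top
    beta_reduce
    rw [hψg]
    refine le_sobolevNorm (hg n) (by positivity) (fun ξ hξ => le_trans ?_ (hlow n ξ hξ)) σ
    gcongr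
    exact hNn n

/-! ### The nonlinear Schrödinger equation and homogeneous cubic nonlinearities -/

theorem SolvesSchrodinger.congr {L : (Space d → ℂ) → Space d → ℂ} {V V' : ℝ → Space d → ℝ} {T : ℝ}
    {φ : Space d → ℂ} {ψ : ℝ → Space d → ℂ} (h : SolvesSchrodinger L V T φ ψ)
    (hV : ∀ t ∈ Icc 0 T, ∀ x, V t x = V' t x) : SolvesSchrodinger L V' T φ ψ :=
  ⟨h.smooth, h.mem_sobolev, h.continuous_sobolev, h.initial, fun t ht x => by
    rw [← hV t ht x]; exact h.equation t ht x⟩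

theorem hasSymbol_laplacian : HasSymbol (fun f : Space d → ℂ => Δ f)
    (fun ξ => 2 * Real.pi ^ 2 * ‖ξ‖ ^ 2) := by
  refine ⟨by fun_prop, ⟨2 * Real.pi ^ 2, fun ξ => ?_⟩, fun g hg x => ?_⟩
  · rw [abs_of_nonneg (by positivity)]
    gcongr
    linarith
  · rw [hg.laplacian_fourierInv, ← fourierInv_const_mul_apply]
    refine congrArg (fun h : Space d → ℂ => 𝓕⁻ h x) (funext fun ξ => ?_)
    push_cast; ring

theorem isResonant_norm_sq {e f : Space d} (he : ‖e‖ = 1) (hf : ‖f‖ = 1) (hef : ⟪e, f⟫ = 0) :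
    IsResonant (fun ξ => 2 * Real.pi ^ 2 * ‖ξ‖ ^ 2) e f (2 * Real.pi ^ 2) := by
  refine ⟨he, hf, hef, fun ξ η => ?_, fun r s => ?_⟩
  · rw [← mul_sub, abs_mul, abs_of_pos (by positivity), mul_assoc (2 * Real.pi ^ 2)]
    refine mul_le_mul_of_nonneg_left ?_ (by positivity)
    rw [norm_add_sq_real, abs_le]
    have h := abs_le.1 (abs_real_inner_le_norm ξ η)
    have := sq_nonneg ‖η‖
    constructor <;> nlinarith [h.1, h.2]
  · have : ‖r • e + s • f‖ ^ 2 = r ^ 2 + s ^ 2 := by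
      rw [norm_add_sq_real, inner_smul_left, inner_smul_right, hef, norm_smul, norm_smul, he, hf]
      simp
    rw [this, he, hf]
    ring

theorem mem_sumList {L L' : List (ℤ × ℤ)} {k l : ℤ × ℤ} (hk : k ∈ L) (hl : l ∈ L') :
    k + l ∈ sumList L L' :=
  List.mem_flatMap.2 ⟨k, hk, List.mem_map.2 ⟨l, hl, rfl⟩⟩

theorem mem_oddList {l : ℤ × ℤ} (hl : l ∈ dataList) (j : ℕ) : l ∈ oddList j dataList := by
  induction j with
  | zero => exact hl
  | succ j ih =>
    have h0 : (0 : ℤ × ℤ) ∈ autoList dataList := by decide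
    rw [← add_zero l]
    exact mem_sumList ih h0

/-- For a constant multiplier all resonant interactions have the same sign. -/
theorem resonantSum_const_ne_zero {μ : ℝ} (hμ : μ ≠ 0) (j : ℕ) :
    resonantSum (fun _ => μ) dataList j ≠ 0 := by
  have e : resonantSum (fun _ => μ) dataList j = resonantSum (fun _ => 1) dataList j * μ := by
    simp only [resonantSum, ← List.sum_map_mul_right, ite_mul, one_mul, zero_mul]
  have hinner : ∀ l : ℤ × ℤ,
      0 ≤ ((autoList dataList).map fun k => if l + k = 0 then (1 : ℝ) else 0).sum := fun l =>
    List.sum_nonneg fun y hy => by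
      obtain ⟨k, -, rfl⟩ := List.mem_map.1 hy
      split_ifs <;> norm_num
  have h1 : (1 : ℝ) ≤ ((autoList dataList).map fun k =>
      if (0, 1) + k = 0 then (1 : ℝ) else 0).sum := by
    refine List.single_le_sum (fun y hy => ?_) _ (List.mem_map.2 ⟨(0, -1), by decide, by simp⟩)
    obtain ⟨k, -, rfl⟩ := List.mem_map.1 hy
    split_ifs <;> norm_num
  have h2 : (1 : ℝ) ≤ resonantSum (fun _ => 1) dataList j := by
    refine h1.trans (List.single_le_sum (fun y hy => ?_) _
      (List.mem_map.2 ⟨(0, 1), mem_oddList (by decide) j, rfl⟩))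
    obtain ⟨l, -, rfl⟩ := List.mem_map.1 hy
    exact hinner l
  rw [e]
  exact mul_ne_zero (by linarith) hμ

theorem isNLSSolution_iff {j : ℕ} {μ T : ℝ} {φ : Space d → ℂ} {ψ : ℝ → Space d → ℂ} :
    IsNLSSolution (j + 1) μ T φ ψ ↔ SolvesSchrodinger (fun f => Δ f)
      (fun t => potential (fun _ => μ) j (ψ t)) T φ ψ := by
  have key : ∀ V, SolvesSchrodinger (fun f => Δ f) V T φ ψ → ∀ t ∈ Icc 0 T, ∀ x,
      μ * ‖ψ t x‖ ^ (2 * (j + 1)) = potential (fun _ => μ) j (ψ t) x := by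
    intro V h t ht x
    obtain ⟨g, hg⟩ := h.exists_fourier
    obtain ⟨hg1, hg2⟩ := hg t ht
    rw [potential, hg2, meanField_const μ hg1]
    ring
  exact ⟨fun h => SolvesSchrodinger.congr h (key _ h),
    fun h => h.congr fun t ht x => (key _ h t ht x).symm⟩

theorem hasNormInflation_nls (hd : 2 ≤ d) {ν : ℕ} (hν : 1 ≤ ν) {μ : ℝ} (hμ : μ ≠ 0) :
    HasNormInflation d (-1 / (2 * (ν : ℝ))) (IsNLSSolution ν μ) := by
  obtain ⟨j, rfl⟩ := Nat.exists_eq_add_of_le' hν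
  have hne : (⟨0, by omega⟩ : Fin d) ≠ ⟨1, by omega⟩ := by simp
  have hP := isResonant_norm_sq (e := EuclideanSpace.single (⟨0, by omega⟩ : Fin d) (1 : ℝ))
    (f := EuclideanSpace.single (⟨1, by omega⟩ : Fin d) (1 : ℝ)) (by simp) (by simp)
    (by simp [EuclideanSpace.inner_single_left, hne])
  exact hasNormInflation_of_resonant hd (isMultiplier_const μ) hasSymbol_laplacian hP j
    (a := fun _ => μ) (fun _ _ _ _ => tendsto_const_nhds) (resonantSum_const_ne_zero hμ j)
    fun T _ φ ψ => isNLSSolution_iff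

/-- A multiplier homogeneous of degree zero converges along a ray to its value at the direction. -/
theorem tendsto_multiplier_ray {m : Space d → ℝ} (hom : ∀ r : ℝ, 0 < r → ∀ ξ, m (r • ξ) = m ξ)
    {v : Space d} (hv : ContinuousAt m v) (ζ : Space d) :
    Tendsto (fun N : ℝ => m (ζ + N • v)) atTop (𝓝 (m v)) := by
  have h1 : Tendsto (fun N : ℝ => N⁻¹ • ζ + v) atTop (𝓝 v) := by
    have := (tendsto_inv_atTop_zero (𝕜 := ℝ)).smul_const ζ
    simpa using this.add_const v
  refine (hv.tendsto.comp h1).congr' ?_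
  filter_upwards [eventually_gt_atTop 0] with N hN
  rw [Function.comp_apply, ← hom N hN, smul_add, smul_inv_smul₀ hN.ne']

/-- The nonlinearity `(m(D)|ψ|²) ψ` with `m` homogeneous of degree zero.  The two resonant
interactions `N e + (N f - N (e + f))` and `N f + (N e - N (e + f))` apply the multiplier at the
frequencies `-N e` and `-N f`, whence the condition `m e + m f ≠ 0`. -/
theorem hasNormInflation_cubic (hd : 2 ≤ d) {m : Space d → ℝ} {C : ℝ} (hm : IsMultiplier m C)
    {L : (Space d → ℂ) → Space d → ℂ} {P : Space d → ℝ} (hL : HasSymbol L P) {e f : Space d}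
    {B : ℝ} (hP : IsResonant P e f B) (hom : ∀ r : ℝ, 0 < r → ∀ ξ, m (r • ξ) = m ξ)
    (he : ContinuousAt m (-e)) (hf : ContinuousAt m (-f)) (hef : m e + m f ≠ 0)
    {IsSol : ℝ → (Space d → ℂ) → (ℝ → Space d → ℂ) → Prop}
    (hsol : ∀ T, 0 ≤ T → ∀ φ ψ, IsSol T φ ψ ↔
      SolvesSchrodinger L (fun t => meanField m (ψ t)) T φ ψ) :
    HasNormInflation d (-1 / 2) IsSol := by
  have h := hasNormInflation_of_resonant (IsSol := IsSol) hd hm hL hP 0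
    (a := fun k => m ((k.1 : ℝ) • e + (k.2 : ℝ) • f)) (fun k hk hk' ζ => ?_) ?_ ?_
  · simpa using h
  · have hk2 : k = (-1, 0) ∨ k = (0, -1) := by
      revert k
      decide
    simp only [freq_apply]
    refine tendsto_multiplier_ray hom ?_ ζ
    rcases hk2 with rfl | rfl
    · simpa using he
    · simpa using hf
  · have e1 : resonantSum (fun k => m ((k.1 : ℝ) • e + (k.2 : ℝ) • f)) dataList 0 =
        m (-e) + m (-f) := by
      simp [resonantSum, oddList, autoList, sumList, dataList]
      try ring
    rw [e1, hm.even, hm.even]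
    exact hef
  · intro T hT φ ψ
    have e1 : ∀ f : Space d → ℂ, potential m 0 f = meanField m f := fun f => by
      funext x; simp [potential]
    simp only [hsol T hT, e1]

/-! ### Square integrable harmonic gradients on the plane -/

theorem setIntegral_circle {G : ℂ → ℂ} (hG : Differentiable ℂ G) (r : ℝ) :
    ∫ θ in Ioo (-Real.pi) Real.pi, G (Complex.polarCoord.symm (r, θ)) =
        (2 * Real.pi : ℝ) * G 0 := by
  have h1 := DiffContOnCl.circleAverage (f := G) (c := 0) (R := r) hG.diffContOnCl
  have hper : Function.Periodic (fun θ => G (circleMap 0 r θ)) (2 * Real.pi) := fun θ => by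
    simp only [periodic_circleMap 0 r θ]
  have h2 := hper.intervalIntegral_add_eq (-Real.pi) 0
  rw [Real.circleAverage_def, ← zero_add (2 * Real.pi), ← h2] at h1
  rw [show -Real.pi + 2 * Real.pi = Real.pi by ring,
    intervalIntegral.integral_of_le (by linarith [Real.pi_pos]), zero_add] at h1
  rw [← h1, integral_Ioc_eq_integral_Ioo, Complex.real_smul, ← mul_assoc, ← Complex.ofReal_mul,
    mul_inv_cancel₀ (by positivity), Complex.ofReal_one, one_mul]
  refine integral_congr_ae (Eventually.of_forall fun θ => ?_)
  simp only [Complex.polarCoord_symm_apply, circleMap, Complex.exp_mul_I, Complex.ofReal_cos,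
    Complex.ofReal_sin, zero_add]

/-- A square integrable entire function vanishes: by the mean value property its square would
not be integrable in polar coordinates. -/
theorem eq_zero_of_differentiable_of_memLp {f : ℂ → ℂ} (hf : Differentiable ℂ f)
    (h2 : MemLp f 2 volume) (c : ℂ) : f c = 0 := by
  set G : ℂ → ℂ := fun z => f (z + c) ^ 2 with hG
  have hGd : Differentiable ℂ G := (hf.comp (differentiable_id.add_const c)).pow 2
  have hGi : Integrable G volume := by
    have h3 : Integrable (fun z => f z ^ 2) volume := by
      have h4 := (memLp_two_iff_integrable_sq_norm h2.1).1 h2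
      refine h4.mono' (hf.continuous.pow 2).aestronglyMeasurable (Eventually.of_forall fun z => ?_)
      rw [norm_pow]
    exact h3.comp_add_right c
  have hcont : Continuous fun p : ℝ × ℝ => p.1 • G (Complex.polarCoord.symm p) := by
    have h5 : Continuous fun p : ℝ × ℝ => Complex.polarCoord.symm p := by
      simp only [Complex.polarCoord_symm_apply]; fun_prop
    exact continuous_fst.smul (hGd.continuous.comp h5)
  have hint : IntegrableOn (fun p : ℝ × ℝ => p.1 • G (Complex.polarCoord.symm p))
      (Ioi (0 : ℝ) ×ˢ Ioo (-Real.pi) Real.pi) volume := by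
    refine ⟨hcont.aestronglyMeasurable, ?_⟩
    have h6 := Complex.lintegral_comp_polarCoord_symm fun z => ‖G z‖ₑ
    rw [hasFiniteIntegral_iff_enorm]
    refine lt_of_le_of_lt (le_of_eq ?_) (h6.trans_lt hGi.2)
    refine setLIntegral_congr_fun (measurableSet_Ioi.prod measurableSet_Ioo) fun p hp => ?_
    simp only [enorm_smul, Real.enorm_eq_ofReal (le_of_lt hp.1), smul_eq_mul]
  rw [IntegrableOn, Measure.volume_eq_prod, ← Measure.prod_restrict] at hint
  have h7 := hint.integral_prod_left
  by_contra hne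
  have hG0 : G 0 ≠ 0 := by simpa [hG] using hne
  have h8 : IntegrableOn (fun r : ℝ => r * ‖((2 * Real.pi : ℝ) : ℂ) * G 0‖) (Ioi 0) volume := by
    refine h7.norm.congr ?_
    filter_upwards [ae_restrict_mem measurableSet_Ioi] with r hr
    rw [integral_smul, setIntegral_circle hGd r, norm_smul, Real.norm_of_nonneg (le_of_lt hr)]
  have hK : ‖((2 * Real.pi : ℝ) : ℂ) * G 0‖ ≠ 0 := by
    rw [norm_ne_zero_iff]
    refine mul_ne_zero ?_ hG0
    exact_mod_cast (by positivity : (2 * Real.pi : ℝ) ≠ 0)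
  have h9 : IntegrableOn (fun r : ℝ => r ^ (1 : ℝ)) (Ioi 1) volume := by
    have := (h8.mono_set (Ioi_subset_Ioi zero_le_one)).mul_const (‖((2 * Real.pi : ℝ) : ℂ) * G 0‖)⁻¹
    refine this.congr (Eventually.of_forall fun r => ?_)
    simp only [Real.rpow_one]
    field_simp
  rw [integrableOn_Ioi_rpow_iff one_pos] at h9
  linarith

theorem partialDeriv_sub {F : Type*} [NormedAddCommGroup F] [NormedSpace ℝ F] {f g : Space d → F}
    {x : Space d} (hf : DifferentiableAt ℝ f x) (hg : DifferentiableAt ℝ g x) (i : Fin d) :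
    partialDeriv i (fun y => f y - g y) x = partialDeriv i f x - partialDeriv i g x := by
  rw [partialDeriv, fderiv_fun_sub hf hg]; rfl

theorem partialDeriv_ofReal {f : Space d → ℝ} {x : Space d} (hf : DifferentiableAt ℝ f x)
    (i : Fin d) : partialDeriv i (fun y => (f y : ℂ)) x = ((partialDeriv i f x : ℝ) : ℂ) := by
  have := (Complex.ofRealCLM.hasFDerivAt.comp x hf.hasFDerivAt).fderiv
  rw [partialDeriv]
  change fderiv ℝ (Complex.ofRealCLM ∘ f) x _ = _
  rw [this]; rfl

theorem contDiff_partialDeriv {F : Type*} [NormedAddCommGroup F] [NormedSpace ℝ F]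
    {f : Space d → F} (hf : ContDiff ℝ 2 f) (i : Fin d) : ContDiff ℝ 1 (partialDeriv i f) := by
  have h1 : ContDiff ℝ 1 (fderiv ℝ f) := hf.fderiv_right (by norm_num)
  exact h1.clm_apply contDiff_const

theorem partialDeriv_comm {f : Space d → ℝ} (hf : ContDiff ℝ 2 f) (i j : Fin d) (x : Space d) :
    partialDeriv i (partialDeriv j f) x = partialDeriv j (partialDeriv i f) x := by
  have h1 : DifferentiableAt ℝ (fderiv ℝ f) x :=
    ((hf.fderiv_right (m := 1) (by norm_num)).differentiable one_ne_zero) x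
  have h2 : ∀ v w : Space d, fderiv ℝ (fun y => fderiv ℝ f y v) x w =
      fderiv ℝ (fderiv ℝ f) x w v := by
    intro v w
    rw [fderiv_clm_apply h1 (differentiableAt_const v)]
    simp
  have h3 : IsSymmSndFDerivAt ℝ f x := hf.contDiffAt.isSymmSndFDerivAt (by simp)
  change fderiv ℝ (fun y => fderiv ℝ f y _) x _ = fderiv ℝ (fun y => fderiv ℝ f y _) x _
  rw [h2, h2]
  exact h3 _ _

/-- The gradient of a harmonic function on the plane vanishes as soon as it is square integrable,
because `∂₁w - i ∂₂w` is entire. -/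
theorem partialDeriv_eq_zero_of_harmonic {w : Space 2 → ℝ} (hw : ContDiff ℝ 2 w)
    (h2 : ∀ i, MemLp (partialDeriv i w) 2 volume)
    (hharm : ∀ x, partialDeriv 0 (partialDeriv 0 w) x + partialDeriv 1 (partialDeriv 1 w) x = 0)
    (x : Space 2) : partialDeriv 0 w x = 0 := by
  set J := Complex.orthonormalBasisOneI.repr with hJ
  have hJ1 : J 1 = EuclideanSpace.single 0 1 := by
    have := Complex.orthonormalBasisOneI.repr_self 0
    simpa using this
  have hJI : J Complex.I = EuclideanSpace.single 1 1 := by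
    have := Complex.orthonormalBasisOneI.repr_self 1
    simpa using this
  have hmp : MeasurePreserving J volume volume := J.measurePreserving
  set f : ℂ → ℂ := fun z => ((partialDeriv 0 w (J z) : ℝ) : ℂ) -
    ((partialDeriv 1 w (J z) : ℝ) : ℂ) * Complex.I with hf
  have hdu : ∀ i y, HasFDerivAt (partialDeriv i w) (fderiv ℝ (partialDeriv i w) y) y := fun i y =>
    ((contDiff_partialDeriv hw i).differentiable one_ne_zero y).hasFDerivAt
  have hJd : ∀ z, HasFDerivAt (fun z => J z) (J : ℂ →L[ℝ] Space 2) z := fun z =>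
    (J : ℂ →L[ℝ] Space 2).hasFDerivAt
  have hfd : ∀ z, HasFDerivAt f (Complex.ofRealCLM.comp ((fderiv ℝ (partialDeriv 0 w) (J z)).comp
      (J : ℂ →L[ℝ] Space 2)) - (Complex.ofRealCLM.comp ((fderiv ℝ (partialDeriv 1 w) (J z)).comp
      (J : ℂ →L[ℝ] Space 2))).smulRight Complex.I) z := by
    intro z
    have h3 : ∀ i, HasFDerivAt (fun z => ((partialDeriv i w (J z) : ℝ) : ℂ))
        (Complex.ofRealCLM.comp ((fderiv ℝ (partialDeriv i w) (J z)).comp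
          (J : ℂ →L[ℝ] Space 2))) z := fun i =>
      Complex.ofRealCLM.hasFDerivAt.comp z ((hdu i (J z)).comp z (hJd z))
    refine ((h3 0).sub ((h3 1).mul_const Complex.I)).congr_fderiv ?_
    ext v
    simp [mul_comm]
  have hdiff : Differentiable ℂ f := fun z => by
    refine differentiableAt_complex_iff_differentiableAt_real.2 ⟨(hfd z).differentiableAt, ?_⟩
    rw [(hfd z).fderiv]
    have e1 := hharm (J z)
    have e2 := partialDeriv_comm hw 0 1 (J z)
    change fderiv ℝ (partialDeriv 0 w) (J z) (EuclideanSpace.single 0 1) +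
      fderiv ℝ (partialDeriv 1 w) (J z) (EuclideanSpace.single 1 1) = 0 at e1
    change fderiv ℝ (partialDeriv 1 w) (J z) (EuclideanSpace.single 0 1) =
      fderiv ℝ (partialDeriv 0 w) (J z) (EuclideanSpace.single 1 1) at e2
    simp only [_root_.sub_apply, ContinuousLinearMap.comp_apply,
      ContinuousLinearMap.smulRight_apply, Complex.ofRealCLM_apply]
    have e3 : (J : ℂ →L[ℝ] Space 2) 1 = EuclideanSpace.single 0 1 := hJ1
    have e4 : (J : ℂ →L[ℝ] Space 2) Complex.I = EuclideanSpace.single 1 1 := hJI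
    rw [e3, e4]
    apply Complex.ext <;> simp <;> linarith
  have hL2 : MemLp f 2 volume := by
    have h4 : ∀ i, MemLp (fun z => ((partialDeriv i w (J z) : ℝ) : ℂ)) 2 volume := fun i =>
      ((h2 i).comp_measurePreserving hmp).ofReal
    exact (h4 0).sub ((h4 1).mul_const Complex.I)
  have h5 := eq_zero_of_differentiable_of_memLp hdiff hL2 (J.symm x)
  have h6 := congrArg Complex.re h5
  simpa [hf] using h6

/-! ### The Davey-Stewartson system -/

theorem integrableOn_inv_norm :
    IntegrableOn (fun ξ : Space 2 => ‖ξ‖⁻¹) (Metric.ball 0 1) volume := by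
  rw [integrableOn_fun_norm_addHaar volume (f := fun y : ℝ => y⁻¹)]
  have : IntegrableOn (fun _ : ℝ => (1 : ℝ)) (Ioo 0 1) volume := by simp
  refine this.congr ?_
  filter_upwards [ae_restrict_mem measurableSet_Ioo] with y hy
  have := hy.1.ne'
  simp [this]

theorem integrable_inv_norm_mul {h : Space 2 → ℂ} (hh : FastDecay h) {B : ℝ}
    (hB : ∀ᵐ ξ, ‖h ξ‖ ≤ B) : Integrable (fun ξ => ‖ξ‖⁻¹ * ‖h ξ‖) volume := by
  have h1 : Integrable ((Metric.ball (0 : Space 2) 1).indicator fun ξ => B * ‖ξ‖⁻¹) volume :=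
    IntegrableOn.integrable_indicator (integrableOn_inv_norm.const_mul B) measurableSet_ball
  refine (h1.add hh.integrable.norm).mono' ?_ ?_
  · exact (measurable_norm.inv).aestronglyMeasurable.mul hh.aesm.norm
  · filter_upwards [hB] with ξ hξ
    rw [Real.norm_of_nonneg (by positivity), Pi.add_apply]
    by_cases hb : ξ ∈ Metric.ball (0 : Space 2) 1
    · rw [indicator_of_mem hb, mul_comm B]
      have : ‖ξ‖⁻¹ * ‖h ξ‖ ≤ ‖ξ‖⁻¹ * B := by gcongr
      linarith [norm_nonneg (h ξ)]
    · rw [indicator_of_notMem hb, zero_add]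
      rw [mem_ball_zero_iff, not_lt] at hb
      exact mul_le_of_le_one_left (norm_nonneg _) (inv_le_one_of_one_le₀ hb)

theorem norm_sq_two (ξ : Space 2) : ‖ξ‖ ^ 2 = ξ 0 ^ 2 + ξ 1 ^ 2 := by
  simp [EuclideanSpace.norm_sq_eq, Fin.sum_univ_two]

theorem measurable_coord (i : Fin d) : Measurable (fun ξ => ξ i : Space d → ℝ) :=
  Continuous.measurable (by fun_prop)

/-- The Poisson equation `Δχ = lam ∂₁ρ` on the plane with `ρ = 𝓕⁻ h`, solved by the Fourier
transform. The transform of `χ` has the singularity `|ξ|⁻¹`, which is integrable in two dimensions.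
-/
theorem exists_poisson {h : Space 2 → ℂ} (hh : FastDecay h) (hreal : conjReflect h = h) {B : ℝ}
    (hB : ∀ᵐ ξ, ‖h ξ‖ ≤ B) (lam : ℝ) : ∃ χ : Space 2 → ℝ, ContDiff ℝ 2 χ ∧
      (∀ i, MemLp (partialDeriv i χ) 2 volume) ∧
      (∀ x, ((partialDeriv 0 (partialDeriv 0 χ) x + partialDeriv 1 (partialDeriv 1 χ) x : ℝ) : ℂ) =
        lam * partialDeriv 0 (𝓕⁻ h) x) ∧
      ∀ x, ((partialDeriv 0 χ x : ℝ) : ℂ) =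
        𝓕⁻ (fun ξ => ((lam * ξ 0 ^ 2 / ‖ξ‖ ^ 2 : ℝ) : ℂ) * h ξ) x := by
  set q : Space 2 → ℂ := fun ξ =>
      ((-(lam * ξ 0 / (2 * Real.pi * ‖ξ‖ ^ 2)) : ℝ) : ℂ) * Complex.I with hq
  set k : Space 2 → ℂ := fun ξ => q ξ * h ξ with hk
  have hpi := Real.pi_pos
  have hqm : Measurable q := by
    refine (Complex.measurable_ofReal.comp ?_).mul_const _
    have h0 : Measurable (fun ξ => lam * ξ 0 : Space 2 → ℝ) := (measurable_coord 0).const_mul lam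
    exact (Measurable.div (G := ℝ) h0 ((measurable_norm.pow_const 2).const_mul (2 * Real.pi))).neg
  have hqn : ∀ ξ, ‖q ξ‖ ≤ |lam| / (2 * Real.pi) * ‖ξ‖⁻¹ := by
    intro ξ
    rw [hq, norm_mul, Complex.norm_I, mul_one, Complex.norm_real, norm_neg, Real.norm_eq_abs,
      abs_div, abs_mul, abs_of_nonneg (by positivity : 0 ≤ 2 * Real.pi * ‖ξ‖ ^ 2)]
    rcases eq_or_ne ξ 0 with rfl | hξ
    · simp
    · have h0 : 0 < ‖ξ‖ := norm_pos_iff.2 hξ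
      have h1 := norm_apply_le ξ 0
      calc |lam| * |ξ 0| / (2 * Real.pi * ‖ξ‖ ^ 2) ≤ |lam| * ‖ξ‖ / (2 * Real.pi * ‖ξ‖ ^ 2) := by
            gcongr
        _ = _ := by field_simp
  have hkm : AEStronglyMeasurable k volume := hqm.aestronglyMeasurable.mul hh.aesm
  have hkint : Integrable k volume := by
    refine ((integrable_inv_norm_mul hh hB).const_mul (|lam| / (2 * Real.pi))).mono' hkm
      (Eventually.of_forall fun ξ => ?_)
    rw [hk, norm_mul, ← mul_assoc]
    gcongr
    exact hqn ξ
  have hkpow : ∀ n : ℕ, Integrable (fun ξ => ‖ξ‖ ^ (n + 1) * ‖k ξ‖) volume := by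
    intro n
    refine ((hh.integrable_pow n).const_mul (|lam| / (2 * Real.pi))).mono'
      ((Continuous.aestronglyMeasurable (by fun_prop)).mul hkm.norm)
      (Eventually.of_forall fun ξ => ?_)
    rw [Real.norm_of_nonneg (by positivity), hk, norm_mul]
    calc ‖ξ‖ ^ (n + 1) * (‖q ξ‖ * ‖h ξ‖)
        ≤ ‖ξ‖ ^ (n + 1) * (|lam| / (2 * Real.pi) * ‖ξ‖⁻¹ * ‖h ξ‖) := by gcongr; exact hqn ξ
      _ = |lam| / (2 * Real.pi) * (‖ξ‖ ^ n * ‖h ξ‖) * (‖ξ‖ * ‖ξ‖⁻¹) := by ring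
      _ ≤ |lam| / (2 * Real.pi) * (‖ξ‖ ^ n * ‖h ξ‖) * 1 := by
          gcongr; exact mul_inv_le_one
      _ = _ := mul_one _
  have hsmooth : ContDiff ℝ 2 (𝓕⁻ k) := by
    have h1 : ContDiff ℝ (2 : ℕ∞) (𝓕 k) := Real.contDiff_fourier (N := 2) fun n _ => by
      rcases n with _ | n
      · simpa using hkint.norm
      · exact hkpow n
    have e : (𝓕⁻ k) = fun x => 𝓕 k (-x) := funext fun x => Real.fourierInv_eq_fourier_neg k x
    rw [e]
    exact h1.comp contDiff_neg
  have hkreal : conjReflect k = k := by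
    funext ξ
    have h1 := congrFun hreal ξ
    simp only [conjReflect] at h1
    simp only [hk, hq, conjReflect, map_mul, h1, Complex.conj_ofReal, Complex.conj_I, norm_neg,
      PiLp.neg_apply]
    push_cast
    ring
  set χ : Space 2 → ℝ := fun x => (𝓕⁻ k x).re with hχ
  have hχe : (fun x => (χ x : ℂ)) = 𝓕⁻ k := by
    funext x
    have h1 := fourierInv_conjReflect k x
    rw [hkreal] at h1
    exact Complex.conj_eq_iff_re.1 h1.symm
  have hχs : ContDiff ℝ 2 χ := Complex.reCLM.contDiff.comp hsmooth
  have hD : ∀ i x, ((partialDeriv i χ x : ℝ) : ℂ) =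
      𝓕⁻ (fun ξ => (2 * Real.pi * ξ i * Complex.I) * k ξ) x := fun i x => by
    rw [← partialDeriv_ofReal (hχs.differentiable two_ne_zero x), hχe,
      partialDeriv_fourierInv hkint (by simpa using hkpow 0)]
  have hG : ∀ i, FastDecay (fun ξ => (2 * Real.pi * ξ i * Complex.I) * k ξ) := by
    intro i
    have := hh.mul_bdd (m := fun ξ => (2 * Real.pi * ξ i * Complex.I) * q ξ) (C := |lam|) (n := 0)
      ?_ fun ξ => ?_
    · refine this.congr (Eventually.of_forall fun ξ => ?_)
      simp only [hk]; ring
    · exact ((((Complex.measurable_ofReal.comp (measurable_coord i)).const_mul _).mul_const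
        _).mul hqm).aestronglyMeasurable
    · rw [pow_zero, mul_one, norm_mul, norm_mul, norm_mul, norm_mul, Complex.norm_I,
        Complex.norm_real, Complex.norm_real, Real.norm_of_nonneg hpi.le, Real.norm_eq_abs]
      have h1 := norm_apply_le ξ i
      calc ‖(2 : ℂ)‖ * Real.pi * |ξ i| * 1 * ‖q ξ‖
          ≤ 2 * Real.pi * ‖ξ‖ * 1 * (|lam| / (2 * Real.pi) * ‖ξ‖⁻¹) := by
            gcongr
            · simp
            · exact hqn ξ
        _ = |lam| * (‖ξ‖ * ‖ξ‖⁻¹) := by field_simp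
        _ ≤ |lam| * 1 := by gcongr; exact mul_inv_le_one
        _ = |lam| := mul_one _
  have hDfun : ∀ i, (fun x => ((partialDeriv i χ x : ℝ) : ℂ)) =
      𝓕⁻ (fun ξ => (2 * Real.pi * ξ i * Complex.I) * k ξ) := fun i => funext (hD i)
  refine ⟨χ, hχs, fun i => ?_, fun x => ?_, fun x => ?_⟩
  · have h1 := memLp_fourierInv (hG i).integrable (hG i).memLp_two
    rw [← hDfun] at h1
    exact h1.re
  · have hDD : ∀ i, ((partialDeriv i (partialDeriv i χ) x : ℝ) : ℂ) =
        𝓕⁻ (fun ξ => ((2 * Real.pi * Complex.I) * ξ i) *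
          ((2 * Real.pi * ξ i * Complex.I) * k ξ)) x := fun i => by
      rw [← partialDeriv_ofReal ((contDiff_partialDeriv hχs i).differentiable one_ne_zero x),
        hDfun, (hG i).partialDeriv_fourierInv]
    push_cast
    rw [hDD, hDD, hh.partialDeriv_fourierInv, ← fourierInv_const_mul_apply,
      ← fourierInv_add_apply ((hG 0).mul_coord _ 0).integrable ((hG 1).mul_coord _ 1).integrable]
    refine congrArg (fun h : Space 2 → ℂ => 𝓕⁻ h x) (funext fun ξ => ?_)
    rcases eq_or_ne ξ 0 with rfl | hξ
    · simp
    · have h0 : ‖ξ‖ ≠ 0 := norm_ne_zero_iff.2 hξ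
      have h1 : (‖ξ‖ : ℂ) ≠ 0 := by exact_mod_cast h0
      have h2 : (Real.pi : ℂ) ≠ 0 := by exact_mod_cast hpi.ne'
      have h3 : (‖ξ‖ : ℂ) ^ 2 = (ξ 0 : ℂ) ^ 2 + (ξ 1 : ℂ) ^ 2 := by exact_mod_cast norm_sq_two ξ
      simp only [hk, hq]
      push_cast
      field_simp
      rw [Complex.I_sq, h3]
      ring
  · rw [hD]
    refine congrArg (fun h : Space 2 → ℂ => 𝓕⁻ h x) (funext fun ξ => ?_)
    rcases eq_or_ne ξ 0 with rfl | hξ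
    · simp
    · have h0 : ‖ξ‖ ≠ 0 := norm_ne_zero_iff.2 hξ
      have h1 : (‖ξ‖ : ℂ) ≠ 0 := by exact_mod_cast h0
      have h2 : (Real.pi : ℂ) ≠ 0 := by exact_mod_cast hpi.ne'
      simp only [hk, hq]
      push_cast
      field_simp
      rw [Complex.I_sq]
      ring

/-- The symbol of the potential of the Davey-Stewartson system. -/
noncomputable def dsMultiplier (lam μ : ℝ) (ξ : Space 2) : ℝ := μ + lam * ξ 0 ^ 2 / ‖ξ‖ ^ 2

theorem isMultiplier_ds (lam μ : ℝ) : IsMultiplier (dsMultiplier lam μ) (|μ| + |lam|) := by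
  refine ⟨?_, fun ξ => ?_, fun ξ => by simp [dsMultiplier]⟩
  · have h0 : Measurable (fun ξ => lam * ξ 0 ^ 2 : Space 2 → ℝ) :=
      ((measurable_coord 0).pow_const 2).const_mul lam
    exact (Measurable.div (G := ℝ) h0 (measurable_norm.pow_const 2)).const_add μ
  · refine (abs_add_le _ _).trans (add_le_add le_rfl ?_)
    rw [mul_div_assoc, abs_mul, abs_of_nonneg (by positivity : 0 ≤ ξ 0 ^ 2 / ‖ξ‖ ^ 2)]
    refine mul_le_of_le_one_right (abs_nonneg _) (div_le_one_of_le₀ ?_ (by positivity))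
    rw [← sq_abs]
    exact pow_le_pow_left₀ (abs_nonneg _) (norm_apply_le ξ 0) 2

theorem dsMultiplier_smul (lam μ : ℝ) (r : ℝ) (hr : 0 < r) (ξ : Space 2) :
    dsMultiplier lam μ (r • ξ) = dsMultiplier lam μ ξ := by
  simp only [dsMultiplier, PiLp.smul_apply, smul_eq_mul, norm_smul, Real.norm_of_nonneg hr.le,
    mul_pow]
  rw [mul_left_comm, mul_div_mul_left _ _ (by positivity)]

theorem continuousAt_dsMultiplier (lam μ : ℝ) {ξ : Space 2} (hξ : ξ ≠ 0) :
    ContinuousAt (dsMultiplier lam μ) ξ := by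
  have h0 : ‖ξ‖ ^ 2 ≠ 0 := pow_ne_zero 2 (norm_ne_zero_iff.2 hξ)
  unfold dsMultiplier
  refine continuousAt_const.add (ContinuousAt.div ?_ ?_ h0) <;>
    exact Continuous.continuousAt (by fun_prop)

/-- The operator `η ∂₁² + ∂₂²` and its symbol. -/
theorem hasSymbol_ds {η : ℝ} (hη : |η| = 1) : HasSymbol
    (fun (f : Space 2 → ℂ) x => (η : ℂ) * partialDeriv 0 (partialDeriv 0 f) x +
      partialDeriv 1 (partialDeriv 1 f) x)
    (fun ξ => 2 * Real.pi ^ 2 * (η * ξ 0 ^ 2 + ξ 1 ^ 2)) := by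
  refine ⟨by fun_prop, ⟨2 * Real.pi ^ 2, fun ξ => ?_⟩, fun g hg x => ?_⟩
  · rw [abs_mul, abs_of_pos (by positivity)]
    gcongr
    calc |η * ξ 0 ^ 2 + ξ 1 ^ 2| ≤ |η * ξ 0 ^ 2| + |ξ 1 ^ 2| := abs_add_le _ _
      _ = ‖ξ‖ ^ 2 := by rw [abs_mul, hη, abs_sq, abs_sq, one_mul, norm_sq_two]
      _ ≤ _ := by gcongr; linarith
  · rw [hg.partialDeriv_partialDeriv_fourierInv, hg.partialDeriv_partialDeriv_fourierInv,
      ← fourierInv_const_mul_apply, ← fourierInv_add_apply, ← fourierInv_const_mul_apply]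
    · refine congrArg (fun h : Space 2 → ℂ => 𝓕⁻ h x) (funext fun ξ => ?_)
      push_cast; ring
    · exact (hg.mul_coord_sq _ 0).integrable.const_mul _
    · exact (hg.mul_coord_sq _ 1).integrable

/-- The coordinate directions are resonant also for the hyperbolic operator. -/
theorem isResonant_ds {η : ℝ} (hη : |η| = 1) :
    IsResonant (fun ξ : Space 2 => 2 * Real.pi ^ 2 * (η * ξ 0 ^ 2 + ξ 1 ^ 2))
      (EuclideanSpace.single 0 1) (EuclideanSpace.single 1 1) (4 * Real.pi ^ 2) := by
  refine ⟨by simp, by simp, by simp [EuclideanSpace.inner_single_left], fun ξ ζ => ?_,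
      fun r s => ?_⟩
  · have h : ∀ i, |(ξ + ζ) i ^ 2 - ξ i ^ 2| ≤ ‖ζ‖ * (2 * ‖ξ‖ + ‖ζ‖) := fun i => by
      have e : (ξ + ζ) i ^ 2 - ξ i ^ 2 = ζ i * (2 * ξ i + ζ i) := by
        rw [PiLp.add_apply]; ring
      rw [e, abs_mul]
      have h1 := norm_apply_le ζ i
      have h2 := norm_apply_le ξ i
      gcongr
      refine (abs_add_le _ _).trans ?_
      rw [abs_mul, abs_two]
      linarith
    have e : 2 * Real.pi ^ 2 * (η * (ξ + ζ) 0 ^ 2 + (ξ + ζ) 1 ^ 2) -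
        2 * Real.pi ^ 2 * (η * ξ 0 ^ 2 + ξ 1 ^ 2) = 2 * Real.pi ^ 2 *
        (η * ((ξ + ζ) 0 ^ 2 - ξ 0 ^ 2) + ((ξ + ζ) 1 ^ 2 - ξ 1 ^ 2)) := by ring
    rw [e, abs_mul, abs_of_pos (by positivity)]
    have h3 := abs_add_le (η * ((ξ + ζ) 0 ^ 2 - ξ 0 ^ 2)) ((ξ + ζ) 1 ^ 2 - ξ 1 ^ 2)
    rw [abs_mul, hη, one_mul] at h3
    calc _ ≤ 2 * Real.pi ^ 2 * (2 * (‖ζ‖ * (2 * ‖ξ‖ + ‖ζ‖))) := by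
          gcongr
          linarith [h 0, h 1]
      _ = _ := by ring
  · simp
    ring

theorem FastDecay.ae_norm_autoConv_le {g : Space d → ℂ} (hg : FastDecay g) :
    ∃ B : ℝ, ∀ᵐ ξ, ‖NormInflation.autoConv g ξ‖ ≤ B := by
  refine ⟨∫ y, ‖((‖𝓕⁻ g y‖ ^ 2 : ℝ) : ℂ)‖, ?_⟩
  filter_upwards [hg.fourier_norm_sq] with ξ hξ
  rw [← hξ]
  exact VectorFourier.norm_fourierIntegral_le_integral_norm _ _ _ _ _

theorem FastDecay.fourierInv_autoConv_eq {g : Space d → ℂ} (hg : FastDecay g) :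
    𝓕⁻ (NormInflation.autoConv g) = fun x => ((‖𝓕⁻ g x‖ ^ 2 : ℝ) : ℂ) :=
  funext fun x => hg.fourierInv_autoConv x

theorem FastDecay.differentiable_norm_sq {g : Space d → ℂ} (hg : FastDecay g) :
    Differentiable ℝ fun x => ‖𝓕⁻ g x‖ ^ 2 :=
  ((contDiff_fourierInv hg).norm_sq ℝ).differentiable (by simp)

/-- The mean field of the Davey-Stewartson system at a fixed time. -/
theorem exists_ds_field {g : Space 2 → ℂ} (hg : FastDecay g) (lam μ : ℝ) :
    ∃ χ : Space 2 → ℝ, ContDiff ℝ 2 χ ∧ (∀ i, MemLp (partialDeriv i χ) 2 volume) ∧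
      (∀ x, partialDeriv 0 (partialDeriv 0 χ) x + partialDeriv 1 (partialDeriv 1 χ) x =
        lam * partialDeriv 0 (fun y => ‖𝓕⁻ g y‖ ^ 2) x) ∧
      ∀ x, partialDeriv 0 χ x + μ * ‖𝓕⁻ g x‖ ^ 2 = meanField (dsMultiplier lam μ) (𝓕⁻ g) x := by
  obtain ⟨B, hB⟩ := hg.ae_norm_autoConv_le
  obtain ⟨χ, h1, h2, h3, h4⟩ := exists_poisson hg.autoConv (conjReflect_autoConv g) hB lam
  refine ⟨χ, h1, h2, fun x => ?_, fun x => ?_⟩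
  · have h5 := h3 x
    rw [hg.fourierInv_autoConv_eq, partialDeriv_ofReal (hg.differentiable_norm_sq x)] at h5
    exact_mod_cast h5
  · have h6 := (isMultiplier_ds lam μ).meanField_eq hg x
    have h7 : 𝓕⁻ (fun ξ => (dsMultiplier lam μ ξ : ℂ) * autoConv g ξ) x =
        ((partialDeriv 0 χ x : ℝ) : ℂ) + (μ : ℂ) * ((‖𝓕⁻ g x‖ ^ 2 : ℝ) : ℂ) := by
      have hb : FastDecay fun ξ : Space 2 => ((lam * ξ 0 ^ 2 / ‖ξ‖ ^ 2 : ℝ) : ℂ) *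
          autoConv g ξ := by
        have := (isMultiplier_ds lam 0).fastDecay hg.autoConv
        simpa [dsMultiplier] using this
      rw [h4, ← hg.fourierInv_autoConv, ← fourierInv_const_mul_apply,
        ← fourierInv_add_apply hb.integrable (hg.autoConv.integrable.const_mul _)]
      refine congrArg (fun h : Space 2 → ℂ => 𝓕⁻ h x) (funext fun ξ => ?_)
      rw [dsMultiplier]
      push_cast; ring
    rw [h7] at h6
    exact_mod_cast h6.symm

/-- The condition `∇χ ∈ L²` determines `∂₁χ`, so the Davey-Stewartson system is a Schrödinger
equation with a nonlocal cubic nonlinearity. -/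
theorem isDSSolution_iff {η lam μ T : ℝ} {φ : Space 2 → ℂ} {ψ : ℝ → Space 2 → ℂ} :
    IsDSSolution η lam μ T φ ψ ↔ SolvesSchrodinger
      (fun f x => (η : ℂ) * partialDeriv 0 (partialDeriv 0 f) x +
        partialDeriv 1 (partialDeriv 1 f) x)
      (fun t => meanField (dsMultiplier lam μ) (ψ t)) T φ ψ := by
  constructor
  · rintro ⟨χ, h1, h2, h3, h4⟩
    refine h4.congr fun t ht x => ?_
    obtain ⟨g, hg⟩ := h4.exists_fourier
    obtain ⟨hg1, hg2⟩ := hg t ht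
    obtain ⟨χ', k1, k2, k3, k4⟩ := exists_ds_field hg1 lam μ
    rw [hg2, ← k4]
    have hd : ∀ {f : Space 2 → ℝ}, ContDiff ℝ 2 f → Differentiable ℝ f := fun h =>
      h.differentiable two_ne_zero
    have hd' : ∀ {f : Space 2 → ℝ} i, ContDiff ℝ 2 f → Differentiable ℝ (partialDeriv i f) :=
      fun i h => (contDiff_partialDeriv h i).differentiable one_ne_zero
    have e : ∀ i, partialDeriv i (fun y => χ t y - χ' y) =
        fun y => partialDeriv i (χ t) y - partialDeriv i χ' y := fun i => funext fun y =>
      partialDeriv_sub (hd (h1 t ht) y) (hd k1 y) i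
    have h5 := partialDeriv_eq_zero_of_harmonic (w := fun y => χ t y - χ' y) ((h1 t ht).sub k1)
      (fun i => by rw [e]; exact (h2 t ht i).sub (k2 i)) (fun y => by
        rw [e, e, partialDeriv_sub (hd' 0 (h1 t ht) y) (hd' 0 k1 y),
          partialDeriv_sub (hd' 1 (h1 t ht) y) (hd' 1 k1 y)]
        have e1 := h3 t ht y
        have e2 := k3 y
        rw [hg2] at e1
        linarith) x
    rw [e] at h5
    linarith
  · intro h
    obtain ⟨g, hg⟩ := h.exists_fourier
    have hex : ∀ t, ∃ χ : Space 2 → ℝ, t ∈ Icc 0 T →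
        ContDiff ℝ 2 χ ∧ (∀ i, MemLp (partialDeriv i χ) 2 volume) ∧
        (∀ x, partialDeriv 0 (partialDeriv 0 χ) x + partialDeriv 1 (partialDeriv 1 χ) x =
          lam * partialDeriv 0 (fun y => ‖ψ t y‖ ^ 2) x) ∧
        ∀ x, partialDeriv 0 χ x + μ * ‖ψ t x‖ ^ 2 = meanField (dsMultiplier lam μ) (ψ t) x := by
      intro t
      by_cases ht : t ∈ Icc 0 T
      · obtain ⟨χ, hχ⟩ := exists_ds_field (hg t ht).1 lam μ
        exact ⟨χ, fun _ => by rw [(hg t ht).2]; exact hχ⟩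
      · exact ⟨0, fun h => absurd h ht⟩
    choose χ hχ using hex
    exact ⟨χ, fun t ht => (hχ t ht).1, fun t ht => (hχ t ht).2.1, fun t ht => (hχ t ht).2.2.1,
      h.congr fun t ht x => ((hχ t ht).2.2.2 x).symm⟩

theorem hasNormInflation_ds {η lam μ : ℝ} (hη : η = 1 ∨ η = -1) (h : lam + 2 * μ ≠ 0) :
    HasNormInflation 2 (-1 / 2) (IsDSSolution η lam μ) := by
  have hη1 : |η| = 1 := by rcases hη with rfl | rfl <;> simp
  refine hasNormInflation_cubic le_rfl (isMultiplier_ds lam μ) (hasSymbol_ds hη1)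
    (isResonant_ds hη1) (dsMultiplier_smul lam μ) (continuousAt_dsMultiplier lam μ (by simp))
    (continuousAt_dsMultiplier lam μ (by simp)) ?_ fun T _ φ ψ => isDSSolution_iff
  have e : dsMultiplier lam μ (EuclideanSpace.single 0 1) +
      dsMultiplier lam μ (EuclideanSpace.single 1 1) = lam + 2 * μ := by
    simp [dsMultiplier]; ring
  rwa [e]

/-! ### The principal value of the dipolar kernel -/

/-- The quadratic harmonic `|y|² - 3 (n · y)²`, the angular part of the dipolar kernel. -/
noncomputable def dipoleForm (n y : Space 3) : ℝ := ‖y‖ ^ 2 - 3 * ⟪n, y⟫ ^ 2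

theorem continuous_dipoleForm (n : Space 3) : Continuous (dipoleForm n) := by
  unfold dipoleForm; fun_prop

theorem abs_dipoleForm_le {n : Space 3} (hn : ‖n‖ = 1) (y : Space 3) :
    |dipoleForm n y| ≤ 2 * ‖y‖ ^ 2 := by
  have h1 : ⟪n, y⟫ ^ 2 ≤ ‖y‖ ^ 2 := by
    have := abs_real_inner_le_norm n y
    rw [hn, one_mul] at this
    rw [← sq_abs ⟪n, y⟫]
    gcongr
  rw [dipoleForm, abs_le]
  constructor <;> nlinarith [sq_nonneg ⟪n, y⟫, sq_nonneg ‖y‖]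

theorem dipoleKernel_eq (n y : Space 3) :
    dipoleKernel n y = dipoleForm n y * (‖y‖ ^ 5)⁻¹ := by
  rcases eq_or_ne y 0 with rfl | hy
  · simp [dipoleKernel]
  · have : ‖y‖ ≠ 0 := norm_ne_zero_iff.2 hy
    rw [dipoleKernel, dipoleForm]
    field_simp

theorem measurable_dipoleKernel (n : Space 3) : Measurable (dipoleKernel n) := by
  have : dipoleKernel n = fun y => dipoleForm n y * (‖y‖ ^ 5)⁻¹ := funext (dipoleKernel_eq n)
  rw [this]
  exact (continuous_dipoleForm n).measurable.mul (measurable_norm.pow_const 5).inv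

theorem abs_dipoleKernel_le {n : Space 3} (hn : ‖n‖ = 1) (y : Space 3) :
    |dipoleKernel n y| ≤ 2 * (‖y‖ ^ 3)⁻¹ := by
  rcases eq_or_ne y 0 with rfl | hy
  · simp [dipoleKernel]
  · have : 0 < ‖y‖ := norm_pos_iff.2 hy
    rw [dipoleKernel_eq, abs_mul, abs_of_pos (by positivity : 0 < (‖y‖ ^ 5)⁻¹)]
    calc _ ≤ 2 * ‖y‖ ^ 2 * (‖y‖ ^ 5)⁻¹ := by gcongr; exact abs_dipoleForm_le hn y
      _ = _ := by field_simp

theorem integral_inner_sq_mul_radial {u v : Space d} (h : ‖u‖ = ‖v‖) (R : ℝ → ℝ) :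
    ∫ y : Space d, ⟪u, y⟫ ^ 2 * R ‖y‖ = ∫ y : Space d, ⟪v, y⟫ ^ 2 * R ‖y‖ := by
  set A : Space d ≃ₗᵢ[ℝ] Space d := (ℝ ∙ (u - v))ᗮ.reflection
  have hA : A u = v := Submodule.reflection_sub h
  rw [← A.measurePreserving.integral_comp A.toHomeomorph.measurableEmbedding
    (fun y => ⟪v, y⟫ ^ 2 * R ‖y‖)]
  simp only [← hA, A.inner_map_map, A.norm_map]

/-- Radial multiples of the harmonic `|y|² - 3 (n · y)²` have mean zero: rotations exchange the
directions, and the squares of three orthogonal components add up to `|y|²`. -/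
theorem integral_dipoleForm_mul_radial {n : Space 3} (hn : ‖n‖ = 1) {R : ℝ → ℝ}
    (hR : Measurable R) (hint : Integrable (fun y : Space 3 => ‖y‖ ^ 2 * R ‖y‖) volume) :
    ∫ y : Space 3, dipoleForm n y * R ‖y‖ = 0 := by
  have hu : ∀ u : Space 3, ‖u‖ = 1 → Integrable (fun y : Space 3 => ⟪u, y⟫ ^ 2 * R ‖y‖) volume := by
    intro u hu
    refine hint.norm.mono' ?_ (Eventually.of_forall fun y => ?_)
    · exact (Continuous.aestronglyMeasurable (by fun_prop)).mul
        (hR.comp measurable_norm).aestronglyMeasurable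
    · rw [norm_mul, norm_mul, norm_pow, norm_pow, norm_norm]
      have := abs_real_inner_le_norm u y
      rw [hu, one_mul] at this
      gcongr
      exact this
  have hs : ∀ y : Space 3, ‖y‖ ^ 2 = ∑ i, ⟪(EuclideanSpace.single i (1 : ℝ) : Space 3), y⟫ ^ 2 :=
    fun y => by simp [EuclideanSpace.norm_sq_eq, EuclideanSpace.inner_single_left]
  have h1 : ∫ y : Space 3, ‖y‖ ^ 2 * R ‖y‖ = 3 * ∫ y : Space 3, ⟪n, y⟫ ^ 2 * R ‖y‖ := by
    simp only [hs, Finset.sum_mul]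
    rw [integral_finsetSum _ fun i _ => hu _ (by simp)]
    rw [Finset.sum_congr rfl fun i _ => integral_inner_sq_mul_radial (v := n) (by simp [hn]) R]
    simp
  have e : (fun y : Space 3 => dipoleForm n y * R ‖y‖) =
      fun y => ‖y‖ ^ 2 * R ‖y‖ - 3 * (⟪n, y⟫ ^ 2 * R ‖y‖) := by
    funext y; rw [dipoleForm]; ring
  rw [e, integral_sub hint ((hu n hn).const_mul 3), integral_const_mul, h1, sub_self]

theorem integrableOn_inv_norm_sq :
    IntegrableOn (fun y : Space 3 => (‖y‖ ^ 2)⁻¹) (Metric.ball 0 1) volume := by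
  rw [integrableOn_fun_norm_addHaar volume (f := fun y : ℝ => (y ^ 2)⁻¹)]
  have : IntegrableOn (fun _ : ℝ => (1 : ℝ)) (Ioo 0 1) volume := by simp
  refine this.congr ?_
  filter_upwards [ae_restrict_mem measurableSet_Ioo] with y hy
  have := hy.1.ne'
  simp [this]

/-- Regularizations `K(y) θ(|y|)` of the dipolar kernel by radial cut-offs tending to `1` all give
the same limit, the absolutely convergent integral of `K(y) (f(x-y) - f(x) 1_{|y|<1})`: the
kernel has mean zero on spheres. -/
theorem tendsto_integral_dipoleKernel {ι : Type*} {l : Filter ι} [l.IsCountablyGenerated]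
    {n : Space 3} (hn : ‖n‖ = 1) {f : Space 3 → ℝ} (hf : Integrable f volume)
    (hf1 : ContDiff ℝ 1 f) {θ : ι → ℝ → ℝ} (hm : ∀ᶠ i in l, Measurable (θ i))
    (hθ : ∀ᶠ i in l, ∀ ρ, 0 ≤ ρ → |θ i ρ| ≤ 1)
    (h0 : ∀ᶠ i in l, ∃ C, ∀ ρ, 0 ≤ ρ → ρ < 1 → |θ i ρ| ≤ C * ρ ^ 3)
    (hlim : ∀ ρ, 0 < ρ → Tendsto (fun i => θ i ρ) l (𝓝 1)) (x : Space 3) :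
    Tendsto (fun i => ∫ y, dipoleKernel n y * θ i ‖y‖ * f (x - y)) l
      (𝓝 (∫ y, dipoleKernel n y *
        (f (x - y) - (Metric.ball (0 : Space 3) 1).indicator (fun _ => f x) y))) := by
  set F : Space 3 → ℝ :=
    fun y => f (x - y) - (Metric.ball (0 : Space 3) 1).indicator (fun _ => f x) y with hF
  have hFm : Measurable F := by
    have := hf1.continuous
    exact Measurable.sub (Continuous.measurable (by fun_prop))
      (measurable_const.indicator measurableSet_ball)
  have hfx : Integrable (fun y => f (x - y)) volume := hf.comp_sub_left x
  obtain ⟨L, hL⟩ := hf1.contDiffOn.exists_lipschitzOnWith one_ne_zero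
    (convex_closedBall x 1) (isCompact_closedBall x 1)
  set D : Space 3 → ℝ := fun y =>
    (Metric.ball (0 : Space 3) 1).indicator (fun y => 2 * L * (‖y‖ ^ 2)⁻¹) y + 2 * ‖f (x - y)‖
    with hD
  have hDint : Integrable D volume :=
    (IntegrableOn.integrable_indicator (integrableOn_inv_norm_sq.const_mul (2 * (L : ℝ)))
      measurableSet_ball).add (hfx.norm.const_mul 2)
  have hKF : ∀ y, |dipoleKernel n y| * |F y| ≤ D y := by
    intro y
    have hk := abs_dipoleKernel_le hn y
    by_cases hy : y ∈ Metric.ball (0 : Space 3) 1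
    · rw [hD, hF]
      simp only [indicator_of_mem hy]
      have h1 := hL.dist_le_mul (x - y) (by
        rw [Metric.mem_closedBall, dist_eq_norm]
        simpa using (mem_ball_zero_iff.1 hy).le) x (by simp)
      rw [dist_eq_norm, dist_eq_norm, sub_sub_cancel_left, norm_neg, Real.norm_eq_abs] at h1
      rcases eq_or_ne y 0 with rfl | h0
      · simp
      have hp : 0 < ‖y‖ := norm_pos_iff.2 h0
      calc |dipoleKernel n y| * |f (x - y) - f x| ≤ 2 * (‖y‖ ^ 3)⁻¹ * (L * ‖y‖) := by gcongr
        _ = 2 * L * (‖y‖ ^ 2)⁻¹ := by field_simp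
        _ ≤ _ := by linarith [norm_nonneg (f (x - y))]
    · rw [hD, hF]
      simp only [indicator_of_notMem hy, sub_zero, zero_add]
      rw [mem_ball_zero_iff, not_lt] at hy
      rw [Real.norm_eq_abs]
      gcongr
      refine hk.trans (mul_le_of_le_one_right zero_le_two (inv_le_one_of_one_le₀ (one_le_pow₀ hy)))
  have hmain : Tendsto (fun i => ∫ y, dipoleKernel n y * θ i ‖y‖ * F y) l
      (𝓝 (∫ y, dipoleKernel n y * F y)) := by
    refine tendsto_integral_filter_of_dominated_convergence D ?_ ?_ hDint
      (Eventually.of_forall fun y => ?_)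
    · filter_upwards [hm] with i hi
      exact (((measurable_dipoleKernel n).mul (hi.comp measurable_norm)).mul
        hFm).aestronglyMeasurable
    · filter_upwards [hθ] with i hi
      refine Eventually.of_forall fun y => ?_
      rw [norm_mul, norm_mul, Real.norm_eq_abs, Real.norm_eq_abs, Real.norm_eq_abs]
      refine le_trans ?_ (hKF y)
      gcongr
      exact mul_le_of_le_one_right (abs_nonneg _) (hi _ (norm_nonneg y))
    · rcases eq_or_ne y 0 with rfl | h0
      · simp [dipoleKernel, tendsto_const_nhds]
      · simpa using ((hlim ‖y‖ (norm_pos_iff.2 h0)).const_mul (dipoleKernel n y)).mul_const (F y)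
  refine hmain.congr' ?_
  filter_upwards [hm, hθ, h0] with i him hi ⟨C, hC⟩
  have hkb : ∀ y, |dipoleKernel n y * θ i ‖y‖| ≤ 2 * max C 1 := by
    intro y
    rcases eq_or_ne y 0 with rfl | h0
    · simp [dipoleKernel]
    have hp : 0 < ‖y‖ := norm_pos_iff.2 h0
    have h2 : |θ i ‖y‖| ≤ max C 1 * ‖y‖ ^ 3 := by
      rcases lt_or_ge ‖y‖ 1 with h | h
      · exact (hC _ hp.le h).trans (by gcongr; exact le_max_left _ _)
      · exact (hi _ hp.le).trans (one_le_mul_of_one_le_of_one_le (le_max_right _ _) (one_le_pow₀ h))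
    rw [abs_mul]
    calc _ ≤ 2 * (‖y‖ ^ 3)⁻¹ * (max C 1 * ‖y‖ ^ 3) := by
          gcongr; exact abs_dipoleKernel_le hn y
      _ = _ := by field_simp
  have hkm : Measurable fun y : Space 3 => dipoleKernel n y * θ i ‖y‖ :=
    (measurable_dipoleKernel n).mul (him.comp measurable_norm)
  have hint1 : Integrable (fun y => dipoleKernel n y * θ i ‖y‖ * f (x - y)) volume :=
    hfx.bdd_mul hkm.aestronglyMeasurable (Eventually.of_forall hkb)
  have hball : Integrable ((Metric.ball (0 : Space 3) 1).indicator fun _ => f x) volume :=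
    IntegrableOn.integrable_indicator (by simp [integrableOn_const_iff])
      measurableSet_ball
  have hint2 : Integrable (fun y => dipoleKernel n y * θ i ‖y‖ *
      (Metric.ball (0 : Space 3) 1).indicator (fun _ => f x) y) volume :=
    hball.bdd_mul hkm.aestronglyMeasurable (Eventually.of_forall hkb)
  have hz : ∫ y, dipoleKernel n y * θ i ‖y‖ *
      (Metric.ball (0 : Space 3) 1).indicator (fun _ => f x) y = 0 := by
    set R : ℝ → ℝ := fun ρ => (ρ ^ 5)⁻¹ * θ i ρ * (Iio 1).indicator (fun _ => 1) ρ with hR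
    have hRm : Measurable R :=
      ((measurable_id.pow_const 5).inv.mul him).mul (measurable_const.indicator measurableSet_Iio)
    have e : ∀ y : Space 3, dipoleKernel n y * θ i ‖y‖ *
        (Metric.ball (0 : Space 3) 1).indicator (fun _ => f x) y =
        f x * (dipoleForm n y * R ‖y‖) := fun y => by
      rw [dipoleKernel_eq, hR]
      by_cases hy : ‖y‖ < 1
      · rw [indicator_of_mem (mem_ball_zero_iff.2 hy)]
        simp only [indicator_of_mem (mem_Iio.2 hy)]
        ring
      · rw [indicator_of_notMem (by simpa using hy)]
        simp only [indicator_of_notMem (by simpa using hy : ‖y‖ ∉ Iio (1 : ℝ))]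
        ring
    simp only [e]
    rw [integral_const_mul, integral_dipoleForm_mul_radial hn hRm, mul_zero]
    have hb1 : Integrable ((Metric.ball (0 : Space 3) 1).indicator fun _ => max C 1) volume :=
      IntegrableOn.integrable_indicator (by simp [integrableOn_const_iff])
        measurableSet_ball
    refine hb1.mono' ((measurable_norm.pow_const 2).mul
      (hRm.comp measurable_norm)).aestronglyMeasurable (Eventually.of_forall fun y => ?_)
    rw [hR]
    by_cases hy : ‖y‖ < 1
    · rw [indicator_of_mem (mem_ball_zero_iff.2 hy)]
      simp only [indicator_of_mem (mem_Iio.2 hy)]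
      rcases eq_or_ne y 0 with rfl | h0
      · simp
      have hp : 0 < ‖y‖ := norm_pos_iff.2 h0
      rw [norm_mul, norm_mul, norm_mul, norm_one, mul_one, Real.norm_of_nonneg (by positivity),
        Real.norm_of_nonneg (by positivity), Real.norm_eq_abs]
      calc ‖y‖ ^ 2 * ((‖y‖ ^ 5)⁻¹ * |θ i ‖y‖|) ≤ ‖y‖ ^ 2 * ((‖y‖ ^ 5)⁻¹ * (C * ‖y‖ ^ 3)) := by
            gcongr; exact hC _ hp.le hy
        _ = C := by field_simp
        _ ≤ _ := le_max_left _ _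
    · rw [indicator_of_notMem (by simpa using hy)]
      simp only [indicator_of_notMem (by simpa using hy : ‖y‖ ∉ Iio (1 : ℝ))]
      simp
  have e2 : ∀ y, dipoleKernel n y * θ i ‖y‖ * F y = dipoleKernel n y * θ i ‖y‖ * f (x - y) -
      dipoleKernel n y * θ i ‖y‖ * (Metric.ball (0 : Space 3) 1).indicator (fun _ => f x) y :=
    fun y => by rw [hF]; ring
  simp only [e2]
  rw [integral_sub hint1 hint2, hz, sub_zero]

/-- The principal value, as an absolutely convergent integral. -/
theorem tendsto_truncated_dipole {n : Space 3} (hn : ‖n‖ = 1) {f : Space 3 → ℝ}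
    (hf : Integrable f volume) (hf1 : ContDiff ℝ 1 f) (x : Space 3) :
    Tendsto (fun r : ℝ => ∫ y in {y : Space 3 | r < ‖y‖}, dipoleKernel n y * f (x - y)) (𝓝[>] 0)
      (𝓝 (∫ y, dipoleKernel n y *
        (f (x - y) - (Metric.ball (0 : Space 3) 1).indicator (fun _ => f x) y))) := by
  have h := tendsto_integral_dipoleKernel (l := 𝓝[>] (0 : ℝ)) hn hf hf1
    (θ := fun r => (Ioi r).indicator fun _ => 1)
    (Eventually.of_forall fun r => measurable_const.indicator measurableSet_Ioi)
    (Eventually.of_forall fun r ρ _ => by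
      by_cases h : ρ ∈ Ioi r
      · simp [indicator_of_mem h]
      · simp [indicator_of_notMem h]) ?_ (fun ρ hρ => ?_) x
  · refine h.congr fun r => ?_
    rw [← integral_indicator (measurableSet_lt measurable_const measurable_norm)]
    refine integral_congr_ae (Eventually.of_forall fun y => ?_)
    by_cases h : r < ‖y‖
    · simp [indicator, h]
    · simp [indicator, h]
  · filter_upwards [self_mem_nhdsWithin] with r hr
    have hr : 0 < r := hr
    refine ⟨(r ^ 3)⁻¹, fun ρ h0 _ => ?_⟩
    by_cases h : ρ ∈ Ioi r
    · simp only [indicator_of_mem h, abs_one]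
      rw [inv_mul_eq_div, one_le_div (by positivity)]
      exact pow_le_pow_left₀ hr.le (le_of_lt h) 3
    · simp only [indicator_of_notMem h, abs_zero]
      positivity
  · refine tendsto_const_nhds.congr' ?_
    filter_upwards [Ioo_mem_nhdsGT hρ] with r hr
    exact (indicator_of_mem (mem_Ioi.2 hr.2) (fun _ => (1 : ℝ))).symm

/-! ### Fourier transforms of Gaussians and of their second derivatives -/

/-- The convolution of `𝓕⁻ Q` and `f` has the Fourier transform `Q 𝓕 f`. -/
theorem integral_fourierInv_mul {Q f : Space d → ℂ} (hQ : Integrable Q) (hf : Integrable f)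
    (x : Space d) : ∫ y, 𝓕⁻ Q y * f (x - y) = 𝓕⁻ (fun ξ => Q ξ * 𝓕 f ξ) x := by
  have hx : Integrable (fun y => f (x - y)) := hf.comp_sub_left x
  have e1 : ∀ y, 𝓕⁻ Q y = 𝓕 (fun ξ => Q (-ξ)) y := fun y => by
    rw [Real.fourierInv_eq_fourier_comp_neg]
  have h := VectorFourier.integral_fourierIntegral_smul_eq_flip (μ := volume) (ν := volume)
    (L := innerₗ (Space d)) Real.continuous_fourierChar continuous_inner hQ.comp_neg hx
  have h2 : ∫ y, 𝓕⁻ Q y * f (x - y) = ∫ ξ, Q (-ξ) * 𝓕 (fun y => f (x - y)) ξ := by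
    simp only [e1]
    simpa using! h
  rw [h2, ← integral_neg_eq_self, Real.fourierInv_eq']
  refine integral_congr_ae (Eventually.of_forall fun ξ => ?_)
  simp only [neg_neg, smul_eq_mul]
  rw [mul_left_comm]
  congr 1
  rw [Real.fourier_eq', Real.fourier_eq', ← integral_const_mul,
    ← integral_sub_left_eq_self _ volume x]
  refine integral_congr_ae (Eventually.of_forall fun y => ?_)
  simp only [smul_eq_mul, sub_sub_cancel]
  rw [← mul_assoc, ← Complex.exp_add]
  congr 2
  rw [inner_sub_left, inner_neg_right, inner_neg_right, real_inner_comm x ξ]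
  push_cast
  ring

theorem fastDecay_gaussian {b : ℝ} (hb : 0 < b) :
    FastDecay (fun ξ : Space d => ((Real.exp (-(b * ‖ξ‖ ^ 2)) : ℝ) : ℂ)) := by
  refine FastDecay.of_bound (Continuous.aestronglyMeasurable (by fun_prop)) fun k =>
    ⟨Real.exp (k ^ 2 / (4 * b)), fun ξ => ?_⟩
  rw [Complex.norm_real, Real.norm_of_nonneg (Real.exp_pos _).le]
  have h1 : (1 + ‖ξ‖) ^ k ≤ Real.exp (k * ‖ξ‖) := by
    rw [Real.exp_nat_mul]
    gcongr
    rw [add_comm]; exact Real.add_one_le_exp _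
  calc (1 + ‖ξ‖) ^ k * Real.exp (-(b * ‖ξ‖ ^ 2))
      ≤ Real.exp (k * ‖ξ‖) * Real.exp (-(b * ‖ξ‖ ^ 2)) := by gcongr
    _ = Real.exp (k * ‖ξ‖ + -(b * ‖ξ‖ ^ 2)) := (Real.exp_add _ _).symm
    _ ≤ _ := by
      refine Real.exp_le_exp.2 ?_
      rw [le_div_iff₀ (by positivity)]
      nlinarith [sq_nonneg (2 * b * ‖ξ‖ - k)]

theorem fourierInv_gaussian {s : ℝ} (hs : 0 < s) :
    𝓕⁻ (fun ξ : Space 3 => ((Real.exp (-(Real.pi ^ 2 / s * ‖ξ‖ ^ 2)) : ℝ) : ℂ)) =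
      fun y => (((s / Real.pi) ^ (3 / 2 : ℝ) * Real.exp (-(s * ‖y‖ ^ 2)) : ℝ) : ℂ) := by
  funext y
  have hpi := Real.pi_pos
  have hb : 0 < ((Real.pi ^ 2 / s : ℝ) : ℂ).re := by rw [Complex.ofReal_re]; positivity
  have h := fourier_gaussian_innerProductSpace hb (-y)
  rw [Real.fourierInv_eq_fourier_neg]
  have e : (fun ξ : Space 3 => ((Real.exp (-(Real.pi ^ 2 / s * ‖ξ‖ ^ 2)) : ℝ) : ℂ)) =
      fun ξ => Complex.exp (-((Real.pi ^ 2 / s : ℝ) : ℂ) * ‖ξ‖ ^ 2) := by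
    funext ξ; push_cast; ring_nf
  rw [e, h, Complex.ofReal_mul, Complex.ofReal_cpow (by positivity)]
  have hpc : (Real.pi : ℂ) ≠ 0 := by exact_mod_cast hpi.ne'
  have hsc : (s : ℂ) ≠ 0 := by exact_mod_cast hs.ne'
  congr 1
  · congr 1
    · push_cast; field_simp
    · simp
  · push_cast
    congr 1
    rw [norm_neg]
    field_simp

theorem partialDeriv_gaussian (c s : ℝ) (j : Fin d) :
    partialDeriv j (fun y : Space d => c * Real.exp (-(s * ‖y‖ ^ 2))) =
      fun y => -(2 * s * c) * (y j * Real.exp (-(s * ‖y‖ ^ 2))) := by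
  funext y
  have h1 : HasFDerivAt (fun y : Space d => c * Real.exp (-(s * ‖y‖ ^ 2))) _ y :=
    (((hasStrictFDerivAt_norm_sq y).hasFDerivAt.const_mul s).neg.exp).const_mul c
  rw [partialDeriv, h1.fderiv]
  simp [inner_single_right]
  ring

theorem partialDeriv_coord_gaussian (c s : ℝ) (i j : Fin d) (y : Space d) :
    partialDeriv i (fun y : Space d => c * (y j * Real.exp (-(s * ‖y‖ ^ 2)))) y =
      c * ((if i = j then 1 else 0) - 2 * s * (y i * y j)) * Real.exp (-(s * ‖y‖ ^ 2)) := by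
  have h1 := ((hasStrictFDerivAt_norm_sq y).hasFDerivAt.const_mul s).neg.exp
  have h2 : HasFDerivAt (fun y : Space d => y j) (EuclideanSpace.proj j : Space d →L[ℝ] ℝ) y :=
    (EuclideanSpace.proj j : Space d →L[ℝ] ℝ).hasFDerivAt
  have h3 : HasFDerivAt (fun y : Space d => c * (y j * Real.exp (-(s * ‖y‖ ^ 2)))) _ y :=
    (h2.mul h1).const_mul c
  rw [partialDeriv, h3.fderiv]
  simp [inner_single_right, eq_comm (a := j)]
  split_ifs <;> ring

/-- The dipolar quadratic form times a Gaussian, as an inverse Fourier transform.  It is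
a second derivative of a Gaussian, the zero-order terms of which cancel as the form is harmonic. -/
theorem fourierInv_dipoleForm_gaussian {n : Space 3} (hn : ‖n‖ = 1) {s : ℝ} (hs : 0 < s)
    (y : Space 3) :
    𝓕⁻ (fun ξ : Space 3 => ((-(Real.pi ^ 2 / s ^ 2 * dipoleForm n ξ) *
      Real.exp (-(Real.pi ^ 2 / s * ‖ξ‖ ^ 2)) : ℝ) : ℂ)) y =
      (((s / Real.pi) ^ (3 / 2 : ℝ) * (dipoleForm n y * Real.exp (-(s * ‖y‖ ^ 2))) : ℝ) : ℂ) := by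
  have hpi := Real.pi_pos
  obtain ⟨c, hc⟩ : ∃ c, c = (s / Real.pi) ^ (3 / 2 : ℝ) := ⟨_, rfl⟩
  have hG := fastDecay_gaussian (d := 3) (b := Real.pi ^ 2 / s) (by positivity)
  have hI := fourierInv_gaussian hs
  rw [← hc] at hI ⊢
  obtain ⟨G, hGe⟩ : ∃ G : Space 3 → ℝ, G = fun ξ => Real.exp (-(Real.pi ^ 2 / s * ‖ξ‖ ^ 2)) :=
    ⟨_, rfl⟩
  have hG' : FastDecay (fun ξ => (G ξ : ℂ)) := by rw [hGe]; exact hG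
  have hI' : 𝓕⁻ (fun ξ => (G ξ : ℂ)) = fun y => ((c * Real.exp (-(s * ‖y‖ ^ 2)) : ℝ) : ℂ) := by
    rw [hGe]; exact hI
  obtain ⟨δ, hδ⟩ : ∃ δ : Fin 3 → Fin 3 → ℝ, δ = fun i j => if i = j then 1 else 0 := ⟨_, rfl⟩
  have hD : ∀ i j, 𝓕⁻ (fun ξ => ((2 * Real.pi * Complex.I) * ξ i) *
      (((2 * Real.pi * Complex.I) * ξ j) * (G ξ : ℂ))) y =
      ((-(2 * s * c) * (δ i j - 2 * s * (y i * y j)) * Real.exp (-(s * ‖y‖ ^ 2)) : ℝ) : ℂ) := by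
    intro i j
    rw [← (hG'.mul_coord _ j).partialDeriv_fourierInv i, ← hG'.partialDeriv_fourierInv j, hI']
    have e : partialDeriv j (fun y : Space 3 => ((c * Real.exp (-(s * ‖y‖ ^ 2)) : ℝ) : ℂ)) =
        fun y => ((-(2 * s * c) * (y j * Real.exp (-(s * ‖y‖ ^ 2))) : ℝ) : ℂ) := by
      funext y
      rw [partialDeriv_ofReal, partialDeriv_gaussian]
      have h := ((hasStrictFDerivAt_norm_sq y).hasFDerivAt.const_mul s).neg.exp.differentiableAt
      exact h.const_mul c
    rw [e, partialDeriv_ofReal, partialDeriv_coord_gaussian, hδ]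
    exact ((((EuclideanSpace.proj j : Space 3 →L[ℝ] ℝ).differentiableAt).mul
      ((hasStrictFDerivAt_norm_sq y).hasFDerivAt.const_mul s).neg.exp.differentiableAt).const_mul _)
  have hn3 : n 0 ^ 2 + n 1 ^ 2 + n 2 ^ 2 = 1 := by
    have := EuclideanSpace.norm_sq_eq n
    rw [hn] at this
    simpa [Fin.sum_univ_three] using this.symm
  have hform : ∀ z : Space 3, dipoleForm n z = ∑ p : Fin 3 × Fin 3,
      (δ p.1 p.2 - 3 * (n p.1 * n p.2)) * (z p.1 * z p.2) := by
    intro z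
    rw [hδ, dipoleForm, EuclideanSpace.norm_sq_eq, PiLp.inner_apply]
    simp [Fintype.sum_prod_type, Fin.sum_univ_three]
    ring
  have key : 𝓕⁻ (fun ξ => ∑ p : Fin 3 × Fin 3,
      (((δ p.1 p.2 - 3 * (n p.1 * n p.2)) / (4 * s ^ 2) : ℝ) : ℂ) *
      (((2 * Real.pi * Complex.I) * ξ p.1) * (((2 * Real.pi * Complex.I) * ξ p.2) * (G ξ : ℂ)))) y =
      ((c * (dipoleForm n y * Real.exp (-(s * ‖y‖ ^ 2))) : ℝ) : ℂ) := by
    rw [fourierInv_finset_sum _ fun p _ =>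
      (((hG'.mul_coord _ p.2).mul_coord _ p.1).integrable.const_mul _)]
    simp only [fourierInv_const_mul_apply, hD]
    rw [hform]
    simp only [← Complex.ofReal_mul]
    rw [← Complex.ofReal_sum]
    refine congrArg Complex.ofReal ?_
    rw [Finset.sum_mul, Finset.mul_sum]
    have h0 : ∑ p : Fin 3 × Fin 3, (δ p.1 p.2 - 3 * (n p.1 * n p.2)) * δ p.1 p.2 = 0 := by
      simp [hδ, Fintype.sum_prod_type, Fin.sum_univ_three]
      linarith
    rw [← sub_eq_zero, ← Finset.sum_sub_distrib]
    have h1 := congrArg (fun t => -(2 * s * c) / (4 * s ^ 2) * Real.exp (-(s * ‖y‖ ^ 2)) * t) h0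
    simp only [mul_zero, Finset.mul_sum] at h1
    refine (Finset.sum_congr rfl fun p _ => ?_).trans h1
    field_simp
    ring
  rw [← key]
  refine congrArg (fun h : Space 3 → ℂ => 𝓕⁻ h y) (funext fun ξ => ?_)
  have hE : Real.exp (-(Real.pi ^ 2 / s * ‖ξ‖ ^ 2)) = G ξ := by rw [hGe]
  rw [hform, hE]
  push_cast
  rw [Finset.mul_sum, ← Finset.sum_neg_distrib, Finset.sum_mul]
  refine Finset.sum_congr rfl fun p _ => ?_
  have hsc : (s : ℂ) ≠ 0 := by exact_mod_cast hs.ne'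
  field_simp
  rw [Complex.I_sq]
  ring

/-! ### The dipolar kernel as a superposition of Gaussians -/

theorem integral_setIntegral_swap {u : ℝ → Space d → ℝ} (hu : Measurable (Function.uncurry u))
    {a b C : ℝ} (hC : ∀ s ∈ Ioc a b, ∀ y, |u s y| ≤ C) {w : Space d → ℂ} (hw : Integrable w) :
    ∫ y, ((∫ s in Ioc a b, u s y : ℝ) : ℂ) * w y =
      ∫ s in Ioc a b, ∫ y, (u s y : ℂ) * w y := by
  have hint : Integrable (Function.uncurry fun s y => (u s y : ℂ) * w y)
      ((volume.restrict (Ioc a b)).prod volume) := by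
    have h1 : Integrable (fun p : ℝ × Space d => (1 : ℂ) * w p.2)
        ((volume.restrict (Ioc a b)).prod volume) :=
      Integrable.mul_prod (f := fun _ : ℝ => (1 : ℂ)) (integrable_const _) hw
    have h2 := h1.norm.const_mul C
    refine h2.mono' ?_ ?_
    · exact (Complex.measurable_ofReal.comp hu).aestronglyMeasurable.mul
        (hw.aestronglyMeasurable.comp_snd)
    · have h3 : ∀ᵐ p : ℝ × Space d ∂((volume.restrict (Ioc a b)).prod volume), p.1 ∈ Ioc a b :=
        Measure.quasiMeasurePreserving_fst.ae (ae_restrict_mem measurableSet_Ioc)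
      filter_upwards [h3] with p hp
      simp only [Function.uncurry, norm_mul, one_mul, Complex.norm_real, Real.norm_eq_abs]
      gcongr
      exact hC _ hp _
  rw [integral_integral_swap hint]
  refine integral_congr_ae (Eventually.of_forall fun y => ?_)
  simp only
  rw [integral_mul_const, integral_complex_ofReal]

/-- The part of `ρ⁻⁵ = Γ(5/2)⁻¹ ∫₀^∞ s^{3/2} e^{-ρ²s} ds` due to the scales `a < s ≤ b`, relative to
`ρ⁻⁵`.  Multiplied by this cut-off, the dipolar kernel is a superposition of the Gaussians whose
Fourier transforms are known. -/
noncomputable def heatCutoff (a b ρ : ℝ) : ℝ :=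
  ρ ^ 5 * ((Real.Gamma (5 / 2))⁻¹ * ∫ s in Ioc a b, s ^ (3 / 2 : ℝ) * Real.exp (-(s * ρ ^ 2)))

theorem measurable_heatCutoff (a b : ℝ) : Measurable (heatCutoff a b) := by
  have : StronglyMeasurable (Function.uncurry fun (ρ s : ℝ) =>
      s ^ (3 / 2 : ℝ) * Real.exp (-(s * ρ ^ 2))) := by
    refine Measurable.stronglyMeasurable ?_
    simp only [Function.uncurry_def]
    fun_prop
  have h := (this.integral_prod_right (ν := volume.restrict (Ioc a b))).measurable
  exact (measurable_id.pow_const 5).mul (h.const_mul _)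

theorem gamma_five_halves_pos : 0 < Real.Gamma (5 / 2) := Real.Gamma_pos_of_pos (by norm_num)

theorem gamma_five_halves : Real.Gamma (5 / 2) = 3 / 4 * Real.pi ^ (1 / 2 : ℝ) := by
  have h1 := Real.Gamma_add_one (s := 3 / 2) (by norm_num)
  have h2 := Real.Gamma_add_one (s := 1 / 2) (by norm_num)
  rw [Real.Gamma_one_half_eq] at h2
  norm_num at h1 h2
  rw [h1, h2, Real.sqrt_eq_rpow]
  norm_num
  ring

theorem setIntegral_rpow_mul_exp {ρ : ℝ} (hρ : 0 < ρ) :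
    IntegrableOn (fun s => s ^ (3 / 2 : ℝ) * Real.exp (-(s * ρ ^ 2))) (Ioi 0) volume ∧
    ∫ s in Ioi 0, s ^ (3 / 2 : ℝ) * Real.exp (-(s * ρ ^ 2)) =
      (ρ ^ 5)⁻¹ * Real.Gamma (5 / 2) := by
  have h := Real.integral_rpow_mul_exp_neg_mul_Ioi (a := 5 / 2) (r := ρ ^ 2) (by norm_num)
    (by positivity)
  have e : ((1 : ℝ) / ρ ^ 2) ^ (5 / 2 : ℝ) = (ρ ^ 5)⁻¹ := by
    rw [one_div, Real.inv_rpow (by positivity), ← Real.rpow_natCast ρ 2, ← Real.rpow_mul hρ.le,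
      ← Real.rpow_natCast ρ 5]
    norm_num
  have e2 : ∀ s : ℝ, s ^ ((5 / 2 : ℝ) - 1) * Real.exp (-(ρ ^ 2 * s)) =
      s ^ (3 / 2 : ℝ) * Real.exp (-(s * ρ ^ 2)) := fun s => by
    rw [mul_comm s (ρ ^ 2)]; norm_num
  simp only [e2, e] at h
  refine ⟨?_, h⟩
  refine Integrable.of_integral_ne_zero ?_
  rw [h]
  have := gamma_five_halves_pos
  positivity

theorem heatCutoff_nonneg {a b ρ : ℝ} (ha : 0 ≤ a) (hρ : 0 ≤ ρ) : 0 ≤ heatCutoff a b ρ := by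
  refine mul_nonneg (by positivity) (mul_nonneg (inv_nonneg.2 gamma_five_halves_pos.le) ?_)
  refine setIntegral_nonneg measurableSet_Ioc fun s hs => ?_
  have : 0 ≤ s := ha.trans hs.1.le
  positivity

theorem heatCutoff_le_one {a b ρ : ℝ} (ha : 0 ≤ a) (hρ : 0 ≤ ρ) : heatCutoff a b ρ ≤ 1 := by
  rcases hρ.eq_or_lt with rfl | hρ
  · simp [heatCutoff]
  obtain ⟨h1, h2⟩ := setIntegral_rpow_mul_exp hρ
  have hG := gamma_five_halves_pos
  have h3 : ∫ s in Ioc a b, s ^ (3 / 2 : ℝ) * Real.exp (-(s * ρ ^ 2)) ≤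
      (ρ ^ 5)⁻¹ * Real.Gamma (5 / 2) := by
    rw [← h2]
    refine setIntegral_mono_set h1 ?_ (Eventually.of_forall fun s hs => ha.trans_lt hs.1)
    filter_upwards [ae_restrict_mem measurableSet_Ioi] with s hs
    have : 0 < s := hs
    simp only [Pi.zero_apply]; positivity
  rw [heatCutoff]
  calc _ ≤ ρ ^ 5 * ((Real.Gamma (5 / 2))⁻¹ * ((ρ ^ 5)⁻¹ * Real.Gamma (5 / 2))) := by gcongr
    _ = 1 := by field_simp

theorem heatCutoff_le {a b ρ : ℝ} (ha : 0 ≤ a) (hρ : 0 ≤ ρ) (hρ1 : ρ < 1) :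
    heatCutoff a b ρ ≤
      ((Real.Gamma (5 / 2))⁻¹ * ∫ s in Ioc a b, s ^ (3 / 2 : ℝ)) * ρ ^ 3 := by
  have hG := gamma_five_halves_pos
  have hi : IntegrableOn (fun s : ℝ => s ^ (3 / 2 : ℝ)) (Ioc a b) volume :=
    ((Real.continuous_rpow_const (by norm_num)).continuousOn.integrableOn_Icc).mono_set
      Ioc_subset_Icc_self
  have h0 : ∀ s ∈ Ioc a b, 0 ≤ s ^ (3 / 2 : ℝ) := fun s hs =>
    Real.rpow_nonneg (ha.trans hs.1.le) _
  have h1 : ∫ s in Ioc a b, s ^ (3 / 2 : ℝ) * Real.exp (-(s * ρ ^ 2)) ≤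
      ∫ s in Ioc a b, s ^ (3 / 2 : ℝ) := by
    refine integral_mono_of_nonneg ?_ hi ?_
    · filter_upwards [ae_restrict_mem measurableSet_Ioc] with s hs
      have := h0 s hs
      simp only [Pi.zero_apply]; positivity
    · filter_upwards [ae_restrict_mem measurableSet_Ioc] with s hs
      refine mul_le_of_le_one_right (h0 s hs) (Real.exp_le_one_iff.2 ?_)
      have : 0 ≤ s := ha.trans hs.1.le
      have : 0 ≤ s * ρ ^ 2 := by positivity
      linarith
  have h2 : 0 ≤ ∫ s in Ioc a b, s ^ (3 / 2 : ℝ) := setIntegral_nonneg measurableSet_Ioc h0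
  have h3 : ρ ^ 5 ≤ ρ ^ 3 := pow_le_pow_of_le_one hρ hρ1.le (by norm_num)
  rw [heatCutoff, mul_comm]
  gcongr

theorem tendsto_heatCutoff {ρ : ℝ} (hρ : 0 < ρ) :
    Tendsto (fun k : ℕ => heatCutoff ((k : ℝ) + 1)⁻¹ (k + 1) ρ) atTop (𝓝 1) := by
  obtain ⟨h1, h2⟩ := setIntegral_rpow_mul_exp hρ
  have hU : (⋃ k : ℕ, Ioc ((k : ℝ) + 1)⁻¹ (k + 1)) = Ioi 0 := by
    ext s
    simp only [mem_iUnion, mem_Ioc, mem_Ioi]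
    constructor
    · rintro ⟨k, hk, _⟩
      exact lt_trans (by positivity) hk
    · intro hs
      obtain ⟨k, hk⟩ := exists_nat_gt (max s s⁻¹)
      have k1 := (le_max_left s s⁻¹).trans_lt hk
      have k2 := (le_max_right s s⁻¹).trans_lt hk
      exact ⟨k, inv_lt_of_inv_lt₀ hs (by linarith), by linarith⟩
  have hmono : Monotone fun k : ℕ => Ioc ((k : ℝ) + 1)⁻¹ (k + 1) := by
    intro i j hij
    have : (i : ℝ) ≤ j := by exact_mod_cast hij
    refine Ioc_subset_Ioc ?_ (by linarith)
    gcongr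
  have h := tendsto_setIntegral_of_monotone (μ := volume)
    (f := fun s => s ^ (3 / 2 : ℝ) * Real.exp (-(s * ρ ^ 2)))
    (fun k : ℕ => measurableSet_Ioc) hmono (by rw [hU]; exact h1)
  rw [hU, h2] at h
  have h3 := (h.const_mul (Real.Gamma (5 / 2))⁻¹).const_mul (ρ ^ 5)
  have hG := gamma_five_halves_pos
  have e : ρ ^ 5 * ((Real.Gamma (5 / 2))⁻¹ * ((ρ ^ 5)⁻¹ * Real.Gamma (5 / 2))) = 1 := by
    field_simp
  rwa [e] at h3

theorem setIntegral_inv_sq_mul_exp {a b c : ℝ} (ha : 0 < a) (hab : a ≤ b) (hc : 0 < c) :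
    ∫ s in Ioc a b, (s ^ 2)⁻¹ * Real.exp (-(c / s)) =
      (Real.exp (-(c / b)) - Real.exp (-(c / a))) / c := by
  rw [← intervalIntegral.integral_of_le hab]
  have hpos : ∀ s ∈ uIcc a b, 0 < s := fun s hs => by
    rw [uIcc_of_le hab] at hs; exact ha.trans_le hs.1
  rw [intervalIntegral.integral_eq_sub_of_hasDerivAt (f := fun s => Real.exp (-(c / s)) / c)]
  · ring
  · intro s hs
    have h0 := (hpos s hs).ne'
    have h1 := (((hasDerivAt_inv h0).const_mul c).neg.exp).div_const c
    refine h1.congr_deriv ?_ |>.congr_of_eventuallyEq ?_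
    · simp only [Pi.neg_apply]
      rw [div_eq_mul_inv c s]
      field_simp
    · exact Eventually.of_forall fun s => by simp [div_eq_mul_inv]
  · refine ContinuousOn.intervalIntegrable ?_
    have : ∀ s ∈ uIcc a b, s ^ 2 ≠ 0 := fun s hs => pow_ne_zero 2 (hpos s hs).ne'
    have h2 : ∀ s ∈ uIcc a b, s ≠ 0 := fun s hs => (hpos s hs).ne'
    fun_prop (disch := assumption)

/-! ### The dipolar Gross-Pitaevskii equation -/

/-- The Fourier symbol `(4π/3) (3 (n · ξ)² / |ξ|² - 1)` of the convolution with the dipolar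
kernel, with value `0` at `ξ = 0`, where the quotient is `0 / 0`. -/
noncomputable def dipoleSymbol (n ξ : Space 3) : ℝ :=
  -(4 * Real.pi / 3) * (dipoleForm n ξ / ‖ξ‖ ^ 2)

theorem measurable_dipoleSymbol (n : Space 3) : Measurable (dipoleSymbol n) := by
  have h0 : Measurable (fun ξ => dipoleForm n ξ : Space 3 → ℝ) :=
    (continuous_dipoleForm n).measurable
  exact (Measurable.div (G := ℝ) h0 (measurable_norm.pow_const 2)).const_mul _

theorem abs_dipoleSymbol_le {n : Space 3} (hn : ‖n‖ = 1) (ξ : Space 3) :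
    |dipoleSymbol n ξ| ≤ 8 * Real.pi / 3 := by
  have hpi := Real.pi_pos
  rw [dipoleSymbol, abs_mul, abs_neg, abs_of_pos (by positivity : 0 < 4 * Real.pi / 3), abs_div,
    abs_of_nonneg (by positivity : 0 ≤ ‖ξ‖ ^ 2)]
  have h1 : |dipoleForm n ξ| / ‖ξ‖ ^ 2 ≤ 2 :=
    div_le_of_le_mul₀ (by positivity) zero_le_two (abs_dipoleForm_le hn ξ)
  calc 4 * Real.pi / 3 * (|dipoleForm n ξ| / ‖ξ‖ ^ 2) ≤ 4 * Real.pi / 3 * 2 := by gcongr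
    _ = _ := by ring

theorem integral_heat_dipole {n : Space 3} (hn : ‖n‖ = 1) {g : Space 3 → ℂ} (hg : FastDecay g)
    {s : ℝ} (hs : 0 < s) (x : Space 3) :
    ∫ y, ((s ^ (3 / 2 : ℝ) * (dipoleForm n y * Real.exp (-(s * ‖y‖ ^ 2))) : ℝ) : ℂ) *
        ((‖𝓕⁻ g (x - y)‖ ^ 2 : ℝ) : ℂ) =
      ∫ ξ, (((s ^ 2)⁻¹ * Real.exp (-(Real.pi ^ 2 * ‖ξ‖ ^ 2 / s)) : ℝ) : ℂ) *
        (Complex.exp ((2 * Real.pi * ⟪ξ, x⟫ : ℝ) * Complex.I) *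
          (((-(Real.pi ^ (3 / 2 : ℝ) * Real.pi ^ 2) * dipoleForm n ξ : ℝ) : ℂ) *
              autoConv g ξ)) := by
  have hpi := Real.pi_pos
  have hQ : FastDecay (fun ξ : Space 3 => ((-(Real.pi ^ 2 / s ^ 2 * dipoleForm n ξ) *
      Real.exp (-(Real.pi ^ 2 / s * ‖ξ‖ ^ 2)) : ℝ) : ℂ)) := by
    have h1 := (fastDecay_gaussian (d := 3) (b := Real.pi ^ 2 / s) (by positivity)).mul_bdd
      (m := fun ξ => ((-(Real.pi ^ 2 / s ^ 2 * dipoleForm n ξ) : ℝ) : ℂ))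
      (C := Real.pi ^ 2 / s ^ 2 * 2) (n := 2)
      (Continuous.aestronglyMeasurable (by have := continuous_dipoleForm n; fun_prop)) fun ξ => by
        rw [Complex.norm_real, norm_neg, norm_mul, Real.norm_of_nonneg (by positivity), mul_assoc]
        gcongr
        refine (abs_dipoleForm_le hn ξ).trans ?_
        gcongr
        linarith
    refine h1.congr (Eventually.of_forall fun ξ => ?_)
    push_cast; rfl
  have hf : Integrable (fun y => ((‖𝓕⁻ g y‖ ^ 2 : ℝ) : ℂ)) volume := by
    have h2 := memLp_fourierInv hg.integrable hg.memLp_two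
    exact (h2.integrable_norm_pow two_ne_zero).ofReal
  have h := integral_fourierInv_mul hQ.integrable hf x
  have hl : ∀ y, ((s ^ (3 / 2 : ℝ) * (dipoleForm n y * Real.exp (-(s * ‖y‖ ^ 2))) : ℝ) : ℂ) *
      ((‖𝓕⁻ g (x - y)‖ ^ 2 : ℝ) : ℂ) = ((Real.pi ^ (3 / 2 : ℝ) : ℝ) : ℂ) *
      (𝓕⁻ (fun ξ : Space 3 => ((-(Real.pi ^ 2 / s ^ 2 * dipoleForm n ξ) *
        Real.exp (-(Real.pi ^ 2 / s * ‖ξ‖ ^ 2)) : ℝ) : ℂ)) y *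
        ((‖𝓕⁻ g (x - y)‖ ^ 2 : ℝ) : ℂ)) := fun y => by
    have hp : 0 < Real.pi ^ (3 / 2 : ℝ) := by positivity
    rw [fourierInv_dipoleForm_gaussian hn hs, ← Complex.ofReal_mul, ← Complex.ofReal_mul,
      ← Complex.ofReal_mul, Real.div_rpow hs.le hpi.le]
    refine congrArg Complex.ofReal ?_
    field_simp
  simp only [hl]
  rw [integral_const_mul, h, Real.fourierInv_eq', ← integral_const_mul]
  refine integral_congr_ae ?_
  filter_upwards [hg.fourier_norm_sq] with ξ hξ
  rw [hξ, smul_eq_mul]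
  have e : Real.exp (-(Real.pi ^ 2 / s * ‖ξ‖ ^ 2)) = Real.exp (-(Real.pi ^ 2 * ‖ξ‖ ^ 2 / s)) := by
    congr 1; ring
  rw [e]
  push_cast
  have hsc : (s : ℂ) ≠ 0 := by exact_mod_cast hs.ne'
  field_simp

theorem measurable_heat : Measurable (Function.uncurry fun (s : ℝ) (ξ : Space d) =>
    (s ^ 2)⁻¹ * Real.exp (-(Real.pi ^ 2 * ‖ξ‖ ^ 2 / s))) := by
  simp only [Function.uncurry_def, div_eq_mul_inv]
  fun_prop

/-- The dipolar kernel restricted to the scales `(a, b]` acts as a Fourier multiplier, whose symbol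
tends to the dipolar symbol as `a → 0` and `b → ∞`. -/
theorem integral_dipoleKernel_heatCutoff {n : Space 3} (hn : ‖n‖ = 1) {g : Space 3 → ℂ}
    (hg : FastDecay g) {a b : ℝ} (ha : 0 < a) (hab : a ≤ b) (x : Space 3) :
    ((∫ y, dipoleKernel n y * heatCutoff a b ‖y‖ * ‖𝓕⁻ g (x - y)‖ ^ 2 : ℝ) : ℂ) =
      ∫ ξ, ((Real.exp (-(Real.pi ^ 2 * ‖ξ‖ ^ 2 / b)) -
        Real.exp (-(Real.pi ^ 2 * ‖ξ‖ ^ 2 / a)) : ℝ) : ℂ) *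
        (Complex.exp ((2 * Real.pi * ⟪ξ, x⟫ : ℝ) * Complex.I) *
          ((dipoleSymbol n ξ : ℂ) * autoConv g ξ)) := by
  have hpi := Real.pi_pos
  have hG := gamma_five_halves_pos
  have hf : Integrable (fun y => ((‖𝓕⁻ g y‖ ^ 2 : ℝ) : ℂ)) volume := by
    have h2 := memLp_fourierInv hg.integrable hg.memLp_two
    exact (h2.integrable_norm_pow two_ne_zero).ofReal
  have hdm := (continuous_dipoleForm n).measurable
  have h1 := integral_setIntegral_swap
    (u := fun s y => s ^ (3 / 2 : ℝ) * (dipoleForm n y * Real.exp (-(s * ‖y‖ ^ 2))))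
    (by
      simp only [Function.uncurry_def]
      fun_prop) (a := a) (b := b) (C := b ^ (3 / 2 : ℝ) * (2 / a))
    (fun s hs y => by
      have hs0 : 0 < s := ha.trans hs.1
      rw [abs_mul, abs_mul, abs_of_nonneg (by positivity), Real.abs_exp]
      have e1 : s ^ (3 / 2 : ℝ) ≤ b ^ (3 / 2 : ℝ) :=
        Real.rpow_le_rpow hs0.le hs.2 (by norm_num)
      have e0 : 0 ≤ b ^ (3 / 2 : ℝ) := Real.rpow_nonneg (ha.le.trans hab) _
      have e2 : |dipoleForm n y| * Real.exp (-(s * ‖y‖ ^ 2)) ≤ 2 / a := by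
        have e3 : s * ‖y‖ ^ 2 ≤ Real.exp (s * ‖y‖ ^ 2) := by
          linarith [Real.add_one_le_exp (s * ‖y‖ ^ 2)]
        have e4 : ‖y‖ ^ 2 * Real.exp (-(s * ‖y‖ ^ 2)) ≤ 1 / s := by
          rw [le_div_iff₀ hs0, Real.exp_neg, ← div_eq_mul_inv, div_mul_eq_mul_div,
            div_le_one (Real.exp_pos _)]
          linarith
        calc _ ≤ 2 * ‖y‖ ^ 2 * Real.exp (-(s * ‖y‖ ^ 2)) := by
              gcongr; exact abs_dipoleForm_le hn y
          _ = 2 * (‖y‖ ^ 2 * Real.exp (-(s * ‖y‖ ^ 2))) := by ring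
          _ ≤ 2 * (1 / a) := by
              gcongr
              refine e4.trans ?_
              gcongr
              exact hs.1.le
          _ = _ := by ring
      gcongr) (hf.comp_sub_left x)
  have hw : Integrable (fun ξ => Complex.exp ((2 * Real.pi * ⟪ξ, x⟫ : ℝ) * Complex.I) *
      (((-(Real.pi ^ (3 / 2 : ℝ) * Real.pi ^ 2) * dipoleForm n ξ : ℝ) : ℂ) * autoConv g ξ))
      volume := by
    have h2 : FastDecay fun ξ => ((-(Real.pi ^ (3 / 2 : ℝ) * Real.pi ^ 2) *
        dipoleForm n ξ : ℝ) : ℂ) *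
        autoConv g ξ := by
      refine hg.autoConv.mul_bdd (C := Real.pi ^ (3 / 2 : ℝ) * Real.pi ^ 2 * 2) (n := 2)
        (Continuous.aestronglyMeasurable (by have := continuous_dipoleForm n; fun_prop)) fun ξ => ?_
      rw [Complex.norm_real, norm_mul, norm_neg, Real.norm_of_nonneg (by positivity),
        mul_assoc (Real.pi ^ (3 / 2 : ℝ) * Real.pi ^ 2)]
      refine mul_le_mul_of_nonneg_left ((abs_dipoleForm_le hn ξ).trans ?_) (by positivity)
      gcongr
      linarith
    refine h2.integrable.bdd_mul (c := 1) (Continuous.aestronglyMeasurable (by fun_prop))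
      (Eventually.of_forall fun ξ => ?_)
    rw [Complex.norm_exp_ofReal_mul_I]
  have h2 := integral_setIntegral_swap (measurable_heat (d := 3)) (a := a) (b := b)
    (C := (a ^ 2)⁻¹) (fun s hs ξ => by
      have hs0 : 0 < s := ha.trans hs.1
      rw [abs_mul, abs_of_nonneg (by positivity), Real.abs_exp]
      refine (mul_le_of_le_one_right (by positivity) (Real.exp_le_one_iff.2 ?_)).trans ?_
      · rw [neg_nonpos]; positivity
      · have := hs.1.le
        gcongr) hw
  have h3 : ∫ s in Ioc a b, ∫ y, ((s ^ (3 / 2 : ℝ) *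
      (dipoleForm n y * Real.exp (-(s * ‖y‖ ^ 2))) : ℝ) : ℂ) *
        ((‖𝓕⁻ g (x - y)‖ ^ 2 : ℝ) : ℂ) = ∫ s in Ioc a b,
      ∫ ξ, (((s ^ 2)⁻¹ * Real.exp (-(Real.pi ^ 2 * ‖ξ‖ ^ 2 / s)) : ℝ) : ℂ) *
        (Complex.exp ((2 * Real.pi * ⟪ξ, x⟫ : ℝ) * Complex.I) *
          (((-(Real.pi ^ (3 / 2 : ℝ) * Real.pi ^ 2) * dipoleForm n ξ : ℝ) : ℂ) * autoConv g ξ)) :=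
    setIntegral_congr_fun measurableSet_Ioc fun s hs => integral_heat_dipole hn hg (ha.trans hs.1) x
  rw [← h1, ← h2] at h3
  have h4 := congrArg (fun z => (((Real.Gamma (5 / 2))⁻¹ : ℝ) : ℂ) * z) h3
  simp only [← integral_const_mul] at h4
  rw [← integral_complex_ofReal]
  refine Eq.trans ?_ (h4.trans ?_)
  · refine integral_congr_ae (Eventually.of_forall fun y => ?_)
    simp only
    rw [← mul_assoc, ← Complex.ofReal_mul, ← Complex.ofReal_mul]
    refine congrArg Complex.ofReal ?_
    congr 1
    have e : ∀ s : ℝ, s ^ (3 / 2 : ℝ) * (dipoleForm n y * Real.exp (-(s * ‖y‖ ^ 2))) =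
        dipoleForm n y * (s ^ (3 / 2 : ℝ) * Real.exp (-(s * ‖y‖ ^ 2))) := fun s => by ring
    simp only [e]
    rw [integral_const_mul, dipoleKernel_eq, heatCutoff]
    rcases eq_or_ne y 0 with rfl | h0
    · simp [dipoleForm]
    · have := norm_ne_zero_iff.2 h0
      field_simp
  · refine integral_congr_ae (Eventually.of_forall fun ξ => ?_)
    simp only
    rcases eq_or_ne ξ 0 with rfl | h0
    · simp [dipoleForm, dipoleSymbol]
    have hp : 0 < ‖ξ‖ := norm_pos_iff.2 h0
    rw [setIntegral_inv_sq_mul_exp ha hab (by positivity), dipoleSymbol, gamma_five_halves]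
    have e : Real.pi ^ (3 / 2 : ℝ) = Real.pi ^ (1 / 2 : ℝ) * Real.pi := by
      rw [← Real.rpow_add_one hpi.ne']; norm_num
    rw [e]
    have hq : 0 < Real.pi ^ (1 / 2 : ℝ) := by positivity
    have hqc : ((Real.pi ^ (1 / 2 : ℝ) : ℝ) : ℂ) ≠ 0 := by exact_mod_cast hq.ne'
    have hpc : (Real.pi : ℂ) ≠ 0 := by exact_mod_cast hpi.ne'
    have hnc : (‖ξ‖ : ℂ) ≠ 0 := by exact_mod_cast hp.ne'
    push_cast
    field_simp
    try ring

theorem tendsto_exp_sub_exp {c : ℝ} (hc : 0 < c) :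
    Tendsto (fun k : ℕ => Real.exp (-(c / ((k : ℝ) + 1))) - Real.exp (-(c / ((k : ℝ) + 1)⁻¹)))
      atTop (𝓝 1) := by
  have hk : Tendsto (fun k : ℕ => (k : ℝ) + 1) atTop atTop :=
    tendsto_atTop_add_const_right _ _ tendsto_natCast_atTop_atTop
  have h1 : Tendsto (fun k : ℕ => Real.exp (-(c / ((k : ℝ) + 1)))) atTop (𝓝 (Real.exp (-0))) :=
    (Real.continuous_exp.tendsto _).comp (hk.const_div_atTop c).neg
  have h2 : Tendsto (fun k : ℕ => Real.exp (-(c / ((k : ℝ) + 1)⁻¹))) atTop (𝓝 0) := by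
    refine Real.tendsto_exp_neg_atTop_nhds_zero.comp ?_
    simp only [div_inv_eq_mul]
    exact hk.const_mul_atTop hc
  simpa using h1.sub h2

/-- The principal value convolution with the dipolar kernel is a Fourier multiplier: the truncation
of the kernel near the origin and its restriction to a range of Gaussian scales have the same limit.
-/
theorem isDipoleConvolution_of_fastDecay {n : Space 3} (hn : ‖n‖ = 1) {g : Space 3 → ℂ}
    (hg : FastDecay g) {w : Space 3 → ℝ}
    (hw : ∀ x, (w x : ℂ) = 𝓕⁻ (fun ξ => (dipoleSymbol n ξ : ℂ) * autoConv g ξ) x) :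
    IsDipoleConvolution n (fun y => ‖𝓕⁻ g y‖ ^ 2) w := by
  intro x
  have hpi := Real.pi_pos
  have hfi : Integrable (fun y => ‖𝓕⁻ g y‖ ^ 2) volume :=
    (memLp_fourierInv hg.integrable hg.memLp_two).integrable_norm_pow two_ne_zero
  have hfc : ContDiff ℝ 1 (fun y => ‖𝓕⁻ g y‖ ^ 2) :=
    ((contDiff_fourierInv hg).norm_sq ℝ).of_le (by norm_cast)
  have h1 := tendsto_truncated_dipole hn hfi hfc x
  have h2 := tendsto_integral_dipoleKernel (l := atTop) hn hfi hfc
    (θ := fun k : ℕ => heatCutoff ((k : ℝ) + 1)⁻¹ (k + 1))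
    (Eventually.of_forall fun k => measurable_heatCutoff _ _)
    (Eventually.of_forall fun k ρ hρ => by
      rw [abs_of_nonneg (heatCutoff_nonneg (by positivity) hρ)]
      exact heatCutoff_le_one (by positivity) hρ)
    (Eventually.of_forall fun k => ⟨_, fun ρ hρ hρ1 => by
      rw [abs_of_nonneg (heatCutoff_nonneg (by positivity) hρ)]
      exact heatCutoff_le (by positivity) hρ hρ1⟩)
    (fun ρ hρ => tendsto_heatCutoff hρ) x
  have h3 : Tendsto (fun k : ℕ => ((∫ y, dipoleKernel n y *
      heatCutoff ((k : ℝ) + 1)⁻¹ (k + 1) ‖y‖ * ‖𝓕⁻ g (x - y)‖ ^ 2 : ℝ) : ℂ)) atTop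
      (𝓝 (w x)) := by
    have hab : ∀ k : ℕ, ((k : ℝ) + 1)⁻¹ ≤ (k : ℝ) + 1 := fun k => by
      have h1 : (1 : ℝ) ≤ (k : ℝ) + 1 := by linarith [Nat.cast_nonneg (α := ℝ) k]
      exact (inv_le_one_of_one_le₀ h1).trans h1
    simp only [fun k : ℕ => integral_dipoleKernel_heatCutoff hn hg
      (by positivity : (0 : ℝ) < ((k : ℝ) + 1)⁻¹) (hab k) x]
    rw [hw, Real.fourierInv_eq']
    have hm : FastDecay fun ξ => (dipoleSymbol n ξ : ℂ) * autoConv g ξ :=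
      hg.autoConv.mul_bdd (C := 8 * Real.pi / 3) (n := 0)
        (Complex.measurable_ofReal.comp (measurable_dipoleSymbol n)).aestronglyMeasurable
        fun ξ => by simpa using abs_dipoleSymbol_le hn ξ
    refine tendsto_integral_of_dominated_convergence
      (fun ξ => ‖(dipoleSymbol n ξ : ℂ) * autoConv g ξ‖) (fun k => ?_) hm.integrable.norm
      (fun k => Eventually.of_forall fun ξ => ?_) (Eventually.of_forall fun ξ => ?_)
    · refine (Continuous.aestronglyMeasurable (by fun_prop)).mul
        ((Continuous.aestronglyMeasurable (by fun_prop)).mul hm.aesm)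
    · rw [norm_mul, norm_mul, Complex.norm_exp_ofReal_mul_I, one_mul, Complex.norm_real]
      refine mul_le_of_le_one_left (norm_nonneg _) ?_
      have e1 : Real.exp (-(Real.pi ^ 2 * ‖ξ‖ ^ 2 / ((k : ℝ) + 1))) ≤ 1 :=
        Real.exp_le_one_iff.2 (by rw [neg_nonpos]; positivity)
      have e2 : Real.exp (-(Real.pi ^ 2 * ‖ξ‖ ^ 2 / ((k : ℝ) + 1)⁻¹)) ≤ 1 :=
        Real.exp_le_one_iff.2 (by rw [neg_nonpos]; positivity)
      rw [Real.norm_eq_abs, abs_le]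
      constructor <;> linarith [Real.exp_pos (-(Real.pi ^ 2 * ‖ξ‖ ^ 2 / ((k : ℝ) + 1))),
        Real.exp_pos (-(Real.pi ^ 2 * ‖ξ‖ ^ 2 / ((k : ℝ) + 1)⁻¹))]
    · rcases eq_or_ne ξ 0 with rfl | h0
      · simp [dipoleSymbol, dipoleForm]
      have hp : 0 < ‖ξ‖ := norm_pos_iff.2 h0
      have h4 := tendsto_exp_sub_exp (c := Real.pi ^ 2 * ‖ξ‖ ^ 2) (by positivity)
      have h5 := (Complex.continuous_ofReal.tendsto _).comp h4
      have h6 := h5.mul_const (Complex.exp ((2 * Real.pi * ⟪ξ, x⟫ : ℝ) * Complex.I) *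
          ((dipoleSymbol n ξ : ℂ) * autoConv g ξ))
      simpa only [Complex.ofReal_one, one_mul, smul_eq_mul, Function.comp_def] using h6
  have h4 := (Complex.continuous_re.tendsto _).comp h3
  simp only [Function.comp_def, Complex.ofReal_re] at h4
  rw [tendsto_nhds_unique h2 h4] at h1
  exact h1

/-- The symbol of the potential of the dipolar Gross-Pitaevskii equation. -/
noncomputable def dgpMultiplier (n : Space 3) (lam μ : ℝ) (ξ : Space 3) : ℝ :=
  μ + lam * dipoleSymbol n ξ

theorem dipoleForm_neg (n ξ : Space 3) : dipoleForm n (-ξ) = dipoleForm n ξ := by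
  simp [dipoleForm]

theorem isMultiplier_dgp {n : Space 3} (hn : ‖n‖ = 1) (lam μ : ℝ) :
    IsMultiplier (dgpMultiplier n lam μ) (|μ| + |lam| * (8 * Real.pi / 3)) := by
  refine ⟨((measurable_dipoleSymbol n).const_mul lam).const_add μ, fun ξ => ?_, fun ξ => by
    simp [dgpMultiplier, dipoleSymbol, dipoleForm_neg]⟩
  refine (abs_add_le _ _).trans ?_
  rw [abs_mul]
  gcongr
  exact abs_dipoleSymbol_le hn ξ

theorem dgpMultiplier_smul (n : Space 3) (lam μ : ℝ) (r : ℝ) (hr : 0 < r) (ξ : Space 3) :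
    dgpMultiplier n lam μ (r • ξ) = dgpMultiplier n lam μ ξ := by
  have e : dipoleForm n (r • ξ) = r ^ 2 * dipoleForm n ξ := by
    rw [dipoleForm, dipoleForm, norm_smul, inner_smul_right, Real.norm_of_nonneg hr.le]
    ring
  rw [dgpMultiplier, dgpMultiplier, dipoleSymbol, dipoleSymbol, e, norm_smul,
    Real.norm_of_nonneg hr.le, mul_pow, mul_div_mul_left _ _ (by positivity)]

theorem continuousAt_dgpMultiplier (n : Space 3) (lam μ : ℝ) {ξ : Space 3} (hξ : ξ ≠ 0) :
    ContinuousAt (dgpMultiplier n lam μ) ξ := by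
  have h0 : ‖ξ‖ ^ 2 ≠ 0 := pow_ne_zero 2 (norm_ne_zero_iff.2 hξ)
  have h1 : ContinuousAt (fun ξ => dipoleForm n ξ / ‖ξ‖ ^ 2) ξ :=
    (continuous_dipoleForm n).continuousAt.div (Continuous.continuousAt (by fun_prop)) h0
  exact continuousAt_const.add (continuousAt_const.mul (continuousAt_const.mul h1))

theorem meanField_dgpMultiplier {n : Space 3} (hn : ‖n‖ = 1) {g : Space 3 → ℂ} (hg : FastDecay g)
    (lam μ : ℝ) {w : Space 3 → ℝ} (hw : IsDipoleConvolution n (fun y => ‖𝓕⁻ g y‖ ^ 2) w)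
    (x : Space 3) : meanField (dgpMultiplier n lam μ) (𝓕⁻ g) x = μ * ‖𝓕⁻ g x‖ ^ 2 + lam * w x := by
  have hm := isMultiplier_dgp hn 1 0
  have e0 : dgpMultiplier n 1 0 = dipoleSymbol n := by funext ξ; simp [dgpMultiplier]
  rw [e0] at hm
  have h1 := isDipoleConvolution_of_fastDecay hn hg (hm.meanField_eq hg)
  have h2 : w x = meanField (dipoleSymbol n) (𝓕⁻ g) x := tendsto_nhds_unique (hw x) (h1 x)
  have h3 := (isMultiplier_dgp hn lam μ).meanField_eq hg x
  have h4 : 𝓕⁻ (fun ξ => (dgpMultiplier n lam μ ξ : ℂ) * autoConv g ξ) x =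
      (μ : ℂ) * ((‖𝓕⁻ g x‖ ^ 2 : ℝ) : ℂ) + (lam : ℂ) * (w x : ℂ) := by
    rw [h2, hm.meanField_eq hg, ← hg.fourierInv_autoConv, ← fourierInv_const_mul_apply,
      ← fourierInv_const_mul_apply, ← fourierInv_add_apply (hg.autoConv.integrable.const_mul _)
        ((hm.fastDecay hg.autoConv).integrable.const_mul _)]
    refine congrArg (fun h : Space 3 → ℂ => 𝓕⁻ h x) (funext fun ξ => ?_)
    rw [dgpMultiplier]
    push_cast; ring
  rw [h4] at h3
  exact_mod_cast h3

/-- The dipolar Gross-Pitaevskii equation is a Schrödinger equation with a nonlocal cubic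
nonlinearity. Principal values are limits, hence unique. -/
theorem isDGPSolution_iff {n : Space 3} (hn : ‖n‖ = 1) {lam μ T : ℝ} {φ : Space 3 → ℂ}
    {ψ : ℝ → Space 3 → ℂ} : IsDGPSolution n lam μ T φ ψ ↔ SolvesSchrodinger (fun f => Δ f)
      (fun t => meanField (dgpMultiplier n lam μ) (ψ t)) T φ ψ := by
  constructor
  · rintro ⟨W, hW, h⟩
    obtain ⟨g, hg⟩ := h.exists_fourier
    refine h.congr fun t ht x => ?_
    have hWt := hW t ht
    rw [(hg t ht).2] at hWt ⊢
    exact (meanField_dgpMultiplier hn (hg t ht).1 lam μ hWt x).symm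
  · intro h
    obtain ⟨g, hg⟩ := h.exists_fourier
    have hm := isMultiplier_dgp hn 1 0
    have e0 : dgpMultiplier n 1 0 = dipoleSymbol n := by funext ξ; simp [dgpMultiplier]
    rw [e0] at hm
    have hW : ∀ t ∈ Icc 0 T, IsDipoleConvolution n (fun y => ‖ψ t y‖ ^ 2)
        (meanField (dipoleSymbol n) (ψ t)) := fun t ht => by
      rw [(hg t ht).2]
      exact isDipoleConvolution_of_fastDecay hn (hg t ht).1 (hm.meanField_eq (hg t ht).1)
    refine ⟨fun t => meanField (dipoleSymbol n) (ψ t), hW, h.congr fun t ht x => ?_⟩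
    have hWt := hW t ht
    simp only
    rw [(hg t ht).2] at hWt ⊢
    exact meanField_dgpMultiplier hn (hg t ht).1 lam μ hWt x

theorem exists_orthonormal_triple {n : Space 3} (hn : ‖n‖ = 1) : ∃ e f : Space 3,
    ‖e‖ = 1 ∧ ‖f‖ = 1 ∧ ⟪n, e⟫ = 0 ∧ ⟪n, f⟫ = 0 ∧ ⟪e, f⟫ = 0 := by
  obtain ⟨b, hb⟩ : ∃ b : Fin 3 → Space 3, b = fun i => EuclideanSpace.single i (1 : ℝ) := ⟨_, rfl⟩
  have h1 : ‖b 0‖ = ‖n‖ := by simp [hb, hn]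
  obtain ⟨A, hA⟩ : ∃ A : Space 3 ≃ₗᵢ[ℝ] Space 3, A (b 0) = n :=
    ⟨(ℝ ∙ (b 0 - n))ᗮ.reflection, Submodule.reflection_sub h1⟩
  refine ⟨A (b 1), A (b 2), ?_, ?_, ?_, ?_, ?_⟩
  · simp [hb]
  · simp [hb]
  · rw [← hA, A.inner_map_map]; simp [hb, EuclideanSpace.inner_single_left]
  · rw [← hA, A.inner_map_map]; simp [hb, EuclideanSpace.inner_single_left]
  · rw [A.inner_map_map]; simp [hb, EuclideanSpace.inner_single_left]

theorem dgpMultiplier_of_norm_one {n e : Space 3} (he : ‖e‖ = 1) (lam μ : ℝ) :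
    dgpMultiplier n lam μ e = μ - lam * (4 * Real.pi / 3) * (1 - 3 * ⟪n, e⟫ ^ 2) := by
  rw [dgpMultiplier, dipoleSymbol, dipoleForm, he]
  ring

/-- Two directions orthogonal to the dipole axis have the symbols `μ - 4π lam / 3`; the axis itself
has the symbol `μ + 8π lam / 3`.  The sums over the two kinds of orthonormal pairs do not both
vanish. -/
theorem hasNormInflation_dgp {n : Space 3} {lam μ : ℝ} (hn : ‖n‖ = 1) (h : (lam, μ) ≠ (0, 0)) :
    HasNormInflation 3 (-1 / 2) (IsDGPSolution n lam μ) := by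
  obtain ⟨e, f, he, hf, hne, hnf, hef⟩ := exists_orthonormal_triple hn
  have key : ∀ e f : Space 3, ‖e‖ = 1 → ‖f‖ = 1 → ⟪e, f⟫ = 0 →
      dgpMultiplier n lam μ e + dgpMultiplier n lam μ f ≠ 0 →
      HasNormInflation 3 (-1 / 2) (IsDGPSolution n lam μ) := fun e f he hf hef hm =>
    hasNormInflation_cubic (by norm_num) (isMultiplier_dgp hn lam μ) hasSymbol_laplacian
      (isResonant_norm_sq he hf hef) (dgpMultiplier_smul n lam μ)
      (continuousAt_dgpMultiplier n lam μ (by rw [neg_ne_zero, ← norm_ne_zero_iff]; simp [he]))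
      (continuousAt_dgpMultiplier n lam μ (by rw [neg_ne_zero, ← norm_ne_zero_iff]; simp [hf]))
      hm fun T _ φ ψ => isDGPSolution_iff hn
  by_cases h1 : dgpMultiplier n lam μ e + dgpMultiplier n lam μ f = 0
  · -- otherwise a pair of directions containing the dipole axis works
    refine key n e hn he hne fun h2 => h ?_
    rw [dgpMultiplier_of_norm_one he, dgpMultiplier_of_norm_one hf, hne, hnf] at h1
    rw [dgpMultiplier_of_norm_one hn, dgpMultiplier_of_norm_one he, hne,
      real_inner_self_eq_norm_sq, hn] at h2
    have h3 : lam * Real.pi = 0 := by linarith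
    have h4 : lam = 0 := (mul_eq_zero.1 h3).resolve_right Real.pi_ne_zero
    rw [h4] at h1 ⊢
    have h5 : μ = 0 := by linarith
    rw [h5]
  · exact key e f he hf hef h1

end NormInflation

theorem theorem1p3 :
    (∀ (d ν : ℕ) (μ : ℝ), 2 ≤ d → 1 ≤ ν → μ ≠ 0 →
      NormInflation.HasNormInflation d (-1 / (2 * (ν : ℝ)))
        (NormInflation.IsNLSSolution ν μ)) ∧
    (∀ η lam μ : ℝ, (η = 1 ∨ η = -1) → lam + 2 * μ ≠ 0 →
      NormInflation.HasNormInflation 2 (-1 / 2) (NormInflation.IsDSSolution η lam μ)) ∧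
    (∀ (n : EuclideanSpace ℝ (Fin 3)) (lam μ : ℝ), ‖n‖ = 1 → (lam, μ) ≠ (0, 0) →
      NormInflation.HasNormInflation 3 (-1 / 2) (NormInflation.IsDGPSolution n lam μ)) :=
  ⟨fun _ _ _ hd hν hμ => NormInflation.hasNormInflation_nls hd hν hμ,
    fun _ _ _ hη h => NormInflation.hasNormInflation_ds hη h,
    fun _ _ _ hn h => NormInflation.hasNormInflation_dgp hn h⟩
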